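/- **Setting.** Let $s\in[\tfrac34,1)$, $0<T\le\infty$, and $\Lambda=(-\Delta)^{1/2}$ on $\mathbb R^3$. Put $\|f\|_{L^2_{uloc}}=\sup_{x_0\in\mathbb R^3}\|f\|_{L^2(B_1(x_0))}$; $L^2_{uloc}$ is the space of vector fields on $\mathbb R^3$ with finite norm, and $E^2=\{f\in L^2_{uloc}:\lim_{|x_0|\to\infty}\|f\|_{L^2(B_1(x_0))}=0\}$. For $0<T'<\infty$, $L^{2,2}_{uloc}(T')$ is the space of fields $v$ on $(0,T')\times\mathbb R^3$ with $\sup_{x_0}\|v\|_{L^2((0,T')\times B_1(x_0))}<\infty$, and $G^{2,2}(T')$ is the subspace of those with $\lim_{|x_0|\to\infty}\|v\|_{L^2((0,T')\times B_1(x_0))}=0$. A *local Leray solution* on $(0,T)\times\mathbb R^3$ starting from a divergence-free $u_0\in L^2_{uloc}$ is a vector field $u$ for which there is a scalar function $P\in L^1_{loc}((0,T)\times\mathbb R^3)$ such that: 1. $u\in L^\infty([0,T'];L^2_{uloc})$ and $\Lambda^su\in L^{2,2}_{uloc}(T')$ for every $0<T'<T$, where $\Lambda^su$ is understood in the sense of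 distributions; 2. $\partial_tu+\Lambda^{2s}u+\operatorname{div}(u\otimes u)+\nabla P=0$, $\operatorname{div}u=0$ and $\nabla P=-\nabla\frac{\operatorname{div}\operatorname{div}}{\Delta}(u\otimes u)$ in the sense of distributions on $(0,T)\times\mathbb R^3$; 3. $\lim_{t\to0+}\|u(t)-u_0\|_{L^2(K)}=0$ for every compact $K\subset\mathbb R^3$ (as an essential limit in $t$); 4. for all nonnegative $\psi\in\mathcal D((0,T)\times\mathbb R^3)$ and nonnegative $\tilde\psi\in\mathcal D(\mathbb R^3)$ with $\tilde\psi\psi=\psi$, with all integrals taken over $(0,T)\times\mathbb R^3$, $$2\iint\psi|\Lambda^su|^2\le\iint|u|^2\partial_t\psi-2\iint[\tilde\psi,\Lambda^s]\Lambda^su\cdot u\psi-2\iint[\Lambda^s,\psi]u\cdot(\tilde\psi\Lambda^su)+\iint|u|^2u\cdot\nabla\psi+2\iint P\,u\cdot\nabla\psi .$$ Here, for $\chi\in\mathcal D(\mathbb R^3)$, $[\Lambda^s,\chi]w(x)=C_s\int_{\mathbb R^3}\frac{\chi(x)-\chi(y)}{|x-y|^{3+s}}w(y)\,dy$ and $[\chi,\Lambda^s]=-[\Lambda^s,\chi]$,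 where $C_s=\big(\int_{\mathbb R^3}\frac{1-\cos\zeta_1}{|\zeta|^{3+s}}d\zeta\big)^{-1}$. **Theorem.** Let $u_0\in E^2$ with $\operatorname{div}u_0=0$, and let $u$ be a local Leray solution on $(0,T)\times\mathbb R^3$ starting from $u_0$. Then $u\in L^\infty([0,T'];E^2)$ and $\Lambda^su\in G^{2,2}(T')$ for every $0<T'<T$. Moreover, after redefinition on a null set of times, $u(t)\in L^2_{uloc}$ for every $t\in[0,T)$, $u(0)=u_0$, the map $t\mapsto u(t)$ is continuous from $[0,T)$ to $\mathcal D'(\mathbb R^3)$, and $$\lim_{t'\to t+}\|u(t')-u(t)\|_{L^2_{uloc}}=0\qquad\text{for }t=0\text{ and for almost every }t\in(0,T).$$ -/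

import Mathlib

open MeasureTheory Set Filter Topology
open scoped ENNReal NNReal FourierTransform ContDiff

namespace FracNS

noncomputable section

/-- Euclidean three-space. -/
abbrev E3 : Type := EuclideanSpace ℝ (Fin 3)

/-! ### Uniformly local spaces -/

/-- The norm of `L²_uloc(ℝ³)`: the supremum over `x₀` of the `L²` norm on the unit ball `B₁(x₀)`,
with values in `[0, ∞]`. -/
def ulocNorm (f : E3 → E3) : ℝ≥0∞ :=
  ⨆ x₀ : E3, eLpNorm f 2 (volume.restrict (Metric.ball x₀ 1))

/-- `f ∈ L²_uloc(ℝ³)`. -/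
def MemL2uloc (f : E3 → E3) : Prop :=
  AEStronglyMeasurable f volume ∧ ulocNorm f < ⊤

/-- `f ∈ E²(ℝ³)`: `f ∈ L²_uloc` and `‖f‖_{L²(B₁(x₀))} → 0` as `|x₀| → ∞`. -/
def MemE2 (f : E3 → E3) : Prop :=
  MemL2uloc f ∧
    Tendsto (fun x₀ : E3 => eLpNorm f 2 (volume.restrict (Metric.ball x₀ 1))) (cocompact E3) (𝓝 0)

/-- `u ∈ L^∞([0,T']; L²_uloc)`. -/
def MemLinftyL2uloc (T' : ℝ) (u : ℝ → E3 → E3) : Prop :=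
  AEStronglyMeasurable (fun z : ℝ × E3 => u z.1 z.2) (volume.restrict (Ioo 0 T' ×ˢ univ)) ∧
    ∃ M : ℝ≥0, ∀ᵐ t : ℝ, t ∈ Ioo 0 T' → MemL2uloc (u t) ∧ ulocNorm (u t) ≤ M

/-- `u ∈ L^∞([0,T']; E²)`. -/
def MemLinftyE2 (T' : ℝ) (u : ℝ → E3 → E3) : Prop :=
  MemLinftyL2uloc T' u ∧ ∀ᵐ t : ℝ, t ∈ Ioo 0 T' → MemE2 (u t)

/-- The norm of `v` in `L²([0,T']; L²(B₁(x₀)))`. -/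
def cylNorm (T' : ℝ) (v : ℝ → E3 → E3) (x₀ : E3) : ℝ≥0∞ :=
  eLpNorm (fun z : ℝ × E3 => v z.1 z.2) 2 (volume.restrict (Ioo 0 T' ×ˢ Metric.ball x₀ 1))

/-- `v ∈ L^{2,2}_uloc(T')`. -/
def MemL22uloc (T' : ℝ) (v : ℝ → E3 → E3) : Prop :=
  AEStronglyMeasurable (fun z : ℝ × E3 => v z.1 z.2) (volume.restrict (Ioo 0 T' ×ˢ univ)) ∧
    (⨆ x₀ : E3, cylNorm T' v x₀) < ⊤

/-- `v ∈ G^{2,2}(T')`. -/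
def MemG22 (T' : ℝ) (v : ℝ → E3 → E3) : Prop :=
  MemL22uloc T' v ∧ Tendsto (cylNorm T' v) (cocompact E3) (𝓝 0)

/-! ### Space-time domain and test functions -/

/-- The time interval `(0,T)`, where `T = ∞` is allowed. -/
def timeIoo (T : EReal) : Set ℝ := {t | 0 < t ∧ (t : EReal) < T}

/-- The space-time domain `(0,T) × ℝ³`; points are written `(t, x)`. -/
def slab (T : EReal) : Set (ℝ × E3) := timeIoo T ×ˢ univ

/-- `φ ∈ 𝒟(Ω)`: `φ` is smooth and its support is a compact subset of `Ω`. -/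
def IsTest {X F : Type*} [NormedAddCommGroup X] [NormedSpace ℝ X]
    [NormedAddCommGroup F] [NormedSpace ℝ F] (Ω : Set X) (φ : X → F) : Prop :=
  ContDiff ℝ ∞ φ ∧ HasCompactSupport φ ∧ tsupport φ ⊆ Ω

/-- The time derivative `∂ₜφ (t, x)`. -/
def dt {F : Type*} [NormedAddCommGroup F] [NormedSpace ℝ F] (φ : ℝ × E3 → F) (z : ℝ × E3) : F :=
  deriv (fun τ => φ (τ, z.2)) z.1

/-- The spatial gradient `∇φ (t, x)` of a scalar function. -/
def spGrad (φ : ℝ × E3 → ℝ) (z : ℝ × E3) : E3 :=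
  gradient (fun y => φ (z.1, y)) z.2

/-- The spatial derivative of a vector field `φ` in the direction `a`: `(a · ∇)φ (t, x)`. -/
def spDeriv (φ : ℝ × E3 → E3) (z : ℝ × E3) (a : E3) : E3 :=
  fderiv ℝ (fun y => φ (z.1, y)) z.2 a

/-- The spatial divergence `div φ (t, x)` of a vector field. -/
def spDiv (φ : ℝ × E3 → E3) (z : ℝ × E3) : ℝ :=
  ∑ i : Fin 3, spDeriv φ z (EuclideanSpace.single i 1) i

/-! ### Fourier multipliers acting on test functions -/

/-- The Fourier multiplier with real even symbol `m`, applied to a real test function `g`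
(Mathlib's `𝓕` has the kernel `exp (-2πi x·ξ)`). -/
def fourierMul (m : E3 → ℝ) (g : E3 → ℝ) (x : E3) : ℝ :=
  (𝓕⁻ (fun ξ : E3 => (m ξ : ℂ) * 𝓕 (fun y : E3 => (g y : ℂ)) ξ) x).re

/-- `Λ^σ g = (-Δ)^{σ/2} g` for a test function `g`. With the kernel `exp (-2πi x·ξ)` the symbol
of `-Δ` is `(2π|ξ|)²`. -/
def lam (σ : ℝ) (g : E3 → ℝ) : E3 → ℝ :=
  fourierMul (fun ξ => (2 * Real.pi * ‖ξ‖) ^ σ) g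

/-- `Λ^σ φ (t, x)` for a space-time test vector field, taken in `x` and component by component. -/
def lamVec (σ : ℝ) (φ : ℝ × E3 → E3) (z : ℝ × E3) : E3 :=
  WithLp.toLp 2 (fun i => lam σ (fun y => φ (z.1, y) i) z.2)

/-- `∂ᵢ∂ⱼ Δ⁻¹ g` for a test function `g`: the multiplier `ξᵢ ξⱼ / |ξ|²`. -/
def rieszPair (i j : Fin 3) (g : E3 → ℝ) : E3 → ℝ :=
  fourierMul (fun ξ => ξ i * ξ j / ‖ξ‖ ^ 2) g

/-- `v = Λ^σ u` on `(0,T) × ℝ³` in the sense of distributions, `v` being a locally integrable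
function. -/
def IsLam (σ : ℝ) (T : EReal) (u v : ℝ → E3 → E3) : Prop :=
  LocallyIntegrableOn (fun z : ℝ × E3 => v z.1 z.2) (slab T) ∧
    ∀ φ : ℝ × E3 → E3, IsTest (slab T) φ →
      ∫ z in slab T, inner ℝ (v z.1 z.2) (φ z) = ∫ z in slab T, inner ℝ (u z.1 z.2) (lamVec σ φ z)

/-! ### The commutator `[Λ^s, χ]` -/

/-- The constant in `Λ^s f(x) = C_s p.v. ∫ (f(x) - f(y)) / |x-y|^{3+s} dy`, `0 < s < 2`, namely
`C_s = (∫ (1 - cos ζ₁) / |ζ|^{3+s} dζ)⁻¹`. -/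
def lamConst (s : ℝ) : ℝ :=
  (∫ ζ : E3, (1 - Real.cos (ζ 0)) / ‖ζ‖ ^ (3 + s))⁻¹

/-- The commutator `[Λ^s, χ] w = Λ^s (χ w) - χ Λ^s w` for `0 < s < 1` and a smooth compactly
supported `χ`, written as the absolutely convergent integral
`C_s ∫ (χ(x) - χ(y)) w(y) / |x-y|^{3+s} dy`. -/
def lamComm (s : ℝ) (χ : E3 → ℝ) (w : E3 → E3) (x : E3) : E3 :=
  lamConst s • ∫ y : E3, ((χ x - χ y) / ‖x - y‖ ^ (3 + s)) • w y

/-! ### The fractional Navier-Stokes equations -/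

/-- `div w = 0` on `ℝ³` in the sense of distributions. -/
def IsSolenoidal (w : E3 → E3) : Prop :=
  ∀ φ : E3 → ℝ, IsTest univ φ → ∫ x, inner ℝ (w x) (gradient φ x) = 0

/-- `div u = 0` on `(0,T) × ℝ³` in the sense of distributions. -/
def IsSolenoidalOn (T : EReal) (u : ℝ → E3 → E3) : Prop :=
  ∀ φ : ℝ × E3 → ℝ, IsTest (slab T) φ → ∫ z in slab T, inner ℝ (u z.1 z.2) (spGrad φ z) = 0

/-- `∂ₜu + Λ^{2s}u + div (u ⊗ u) + ∇P = 0` on `(0,T) × ℝ³` in the sense of distributions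
(`u · ∇u = div (u ⊗ u)` as `div u = 0`). -/
def IsMomentumEq (s : ℝ) (T : EReal) (u : ℝ → E3 → E3) (P : ℝ → E3 → ℝ) : Prop :=
  ∀ φ : ℝ × E3 → E3, IsTest (slab T) φ →
    ∫ z in slab T,
      (inner ℝ (u z.1 z.2) (dt φ z) - inner ℝ (u z.1 z.2) (lamVec (2 * s) φ z)
        + inner ℝ (u z.1 z.2) (spDeriv φ z (u z.1 z.2)) + P z.1 z.2 * spDiv φ z) = 0

/-- `∇P = -∇ (div div / Δ) (u ⊗ u)` on `(0,T) × ℝ³` in the sense of distributions. The operator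
`∇ Δ⁻¹ ∂ᵢ∂ⱼ` acts on `uᵢuⱼ` by duality: for a test field `φ` the function `∂ᵢ∂ⱼΔ⁻¹ div φ` is
smooth and `O(|x|⁻⁴)` at infinity, so it is integrable against `uᵢuⱼ ∈ L¹_uloc`. -/
def IsPressure (T : EReal) (u : ℝ → E3 → E3) (P : ℝ → E3 → ℝ) : Prop :=
  ∀ φ : ℝ × E3 → E3, IsTest (slab T) φ →
    ∫ z in slab T, P z.1 z.2 * spDiv φ z =
      - ∫ z in slab T, ∑ i : Fin 3, ∑ j : Fin 3,
          u z.1 z.2 i * u z.1 z.2 j * rieszPair i j (fun y => spDiv φ (z.1, y)) z.2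

/-- The local energy inequality, with `v` in the role of `Λ^s u`:
`2∬ψ|v|² ≤ ∬|u|²∂ₜψ - 2∬[ψ',Λ^s]v · uψ - 2∬[Λ^s,ψ]u · ψ'v + ∬|u|² u·∇ψ + 2∬P u·∇ψ`
for all nonnegative `ψ ∈ 𝒟((0,T) × ℝ³)` and `ψ' ∈ 𝒟(ℝ³)` with `ψ'ψ = ψ`. -/
def IsSuitable (s : ℝ) (T : EReal) (u v : ℝ → E3 → E3) (P : ℝ → E3 → ℝ) : Prop :=
  ∀ (ψ : ℝ × E3 → ℝ) (ψ' : E3 → ℝ), IsTest (slab T) ψ → (∀ z, 0 ≤ ψ z) →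
    IsTest univ ψ' → (∀ x, 0 ≤ ψ' x) → (∀ t x, ψ' x * ψ (t, x) = ψ (t, x)) →
    2 * (∫ z in slab T, ψ z * ‖v z.1 z.2‖ ^ 2) ≤
      (∫ z in slab T, ‖u z.1 z.2‖ ^ 2 * dt ψ z)
      - 2 * (∫ z in slab T, inner ℝ (-(lamComm s ψ' (v z.1) z.2)) (ψ z • u z.1 z.2))
      - 2 * (∫ z in slab T,
          inner ℝ (lamComm s (fun y => ψ (z.1, y)) (u z.1) z.2) (ψ' z.2 • v z.1 z.2))
      + (∫ z in slab T, ‖u z.1 z.2‖ ^ 2 * inner ℝ (u z.1 z.2) (spGrad ψ z))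
      + 2 * (∫ z in slab T, P z.1 z.2 * inner ℝ (u z.1 z.2) (spGrad ψ z))

/-- The conditions on a local Leray solution `u` on `(0,T) × ℝ³` starting from `u₀`, with
`v = Λ^s u` and with pressure `P`. As `u` is a class of functions modulo null sets, the limit at
`t = 0` is an essential limit. -/
structure IsLocalLerayWith (s : ℝ) (T : EReal) (u₀ : E3 → E3) (u v : ℝ → E3 → E3)
    (P : ℝ → E3 → ℝ) : Prop where
  bounded : ∀ T' : ℝ, 0 < T' → (T' : EReal) < T → MemLinftyL2uloc T' u
  isLam : IsLam s T u v
  lam_bounded : ∀ T' : ℝ, 0 < T' → (T' : EReal) < T → MemL22uloc T' v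
  locInt_pressure : LocallyIntegrableOn (fun z : ℝ × E3 => P z.1 z.2) (slab T)
  solenoidal : IsSolenoidalOn T u
  momentum : IsMomentumEq s T u P
  pressure : IsPressure T u P
  initial : ∀ K : Set E3, IsCompact K →
    Tendsto (fun t : ℝ => eLpNorm (u t - u₀) 2 (volume.restrict K)) (𝓝[>] 0 ⊓ ae volume) (𝓝 0)
  suitable : IsSuitable s T u v P

/-- `u` is a local Leray solution of the fractional Navier-Stokes equations on `(0,T) × ℝ³`
starting from `u₀`. -/
def IsLocalLeray (s : ℝ) (T : EReal) (u₀ : E3 → E3) (u : ℝ → E3 → E3) : Prop :=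
  ∃ (v : ℝ → E3 → E3) (P : ℝ → E3 → ℝ), IsLocalLerayWith s T u₀ u v P

/-- `w` is a representative of `u` on `(0,T)` (`w(t) = u(t)` almost everywhere, for almost every
`t`) with `w(t) ∈ L²_uloc` for every `t ∈ [0,T)`, with `w(0) = u₀`, and continuous from `[0,T)`
to the space of distributions on `ℝ³`. -/
structure IsContRep (T : EReal) (u₀ : E3 → E3) (u w : ℝ → E3 → E3) : Prop where
  ae_eq : ∀ᵐ t : ℝ, t ∈ timeIoo T → w t =ᵐ[volume] u t
  mem : ∀ t : ℝ, 0 ≤ t → (t : EReal) < T → MemL2uloc (w t)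
  initial : w 0 = u₀
  cont : ∀ φ : E3 → E3, IsTest univ φ →
    ContinuousOn (fun t : ℝ => ∫ x, inner ℝ (w t x) (φ x)) {t : ℝ | 0 ≤ t ∧ (t : EReal) < T}

end

end FracNS

/-!
The proof rests on a uniform decay estimate for the energy of a local Leray solution at spatial
infinity, and on the weak continuity in time of the solution. The four claims follow from these two
facts.

*The energy inequality on balls.* Let `φ` be a cutoff of the ball `B_ρ(o)`. Testing the local
energy inequality with `θ(t) φ(x)` and letting `θ` tend to an indicator, multiplied by `e^{-lt}`,
bounds `∫ φ |u(t)|²` and the dissipation of `v = Λ^s u` by the initial energy `∫ φ |u₀|²` and by the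
time integral of the error terms (`IsLocalLerayWith.energy_test`, `exists_times_of_weak_ineq_exp`,
`IsLocalLerayWith.energy_from_zero`). These are estimated on a fixed time slice, for almost every
time, the equations having been disintegrated in time along a countable dense set of test functions
(`ae_forall_test`, `IsLocalLerayWith.ae_isSlice`):

- The commutator kernels `|φ(x) - φ(y)| |x - y|^{-3-s}` are integrable and decay like
  `|x|^{-3-s}`. The tails are measured by the weight `wt x = (1 + |x|)^{-15/4}`, which is integrable
  and, as `s ≥ 3/4`, dominates every kernel that occurs (`exists_comm_bound`).
- The cubic term is controlled through the critical embedding `Ḣ^{3/4} ⊂ L⁴`, localized with the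
  help of the commutators (`exists_sobolev_homogeneous`, `exists_local_sobolev`,
  `exists_cubic_bound`): `∫_B |u|³ ≤ ‖u‖_{L²(B)} ‖u‖²_{L⁴(B)}`.
- The pressure equals, up to a constant on the ball, the double Riesz transform of the part of
  `u ⊗ u` near the ball plus a function that depends on the distant part with the kernel of order
  `|x|^{-4}` (`exists_riesz_transpose`, `exists_riesz_far`, `ae_eq_const_of_weak_gradient`,
  `exists_pressure_bound`). The constant is harmless as `div u = 0`.

In each of these terms the dissipation carries a small factor, namely `C/ρ` from `|∇φ| ≤ C/ρ`, or a
free parameter `η` (`rhsBound`).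

*Decay.* Let `D o` be the integral over `B_ρ(o)`, and over time with the factor `e^{-lt}`, of
`2|v|² + l|u|²`. For `ρ` large, `η` small and then `l` large the inequality becomes
`D ≤ e₀ + W ∗ D` with a kernel `W` of mass at most `1/2`, while `e₀ → 0` at infinity since
`u₀ ∈ E²`. As `D` is bounded, the upper limit of `D` at infinity is at most half of itself, so `D`
vanishes at infinity (`tendsto_zero_of_le_lintegral`, `IsLocalLerayWith.exists_decay`). This gives
`u ∈ L^∞ E²` and `Λ^s u ∈ G^{2,2}`, and bounds the energy near infinity uniformly in time.

*Weak continuity.* By the momentum equation the pairings of `u(t)` with a test function have an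
integrable derivative (`IsLocalLerayWith.weak_deriv`). Together with the uniform bound on the
weighted energy this yields a representative `w` that is weakly continuous in the weighted
`L²` space, with `w 0 = u₀` (`exists_weak_extension`, `IsLocalLerayWith.exists_isWeaklyContinuous`).

*Strong continuity from the right.* The energy inequality between almost all times says that the
cut-off energies of `w` are upper semicontinuous from the right, at `t = 0` and at almost every `t`
(`IsLocalLerayWith.isRightUpper`). Weak convergence and convergence of the norms give
strong convergence on each ball (`IsWeaklyContinuous.exists_cutEnergy_sub_le`). Outside a large ball
the uniform decay makes `w(t') - w(t)` small, whence convergence in the norm of `L²_uloc`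
(`tendsto_ulocNorm_sub`).
-/

namespace FracNS

open Metric (mem_ball ball closedBall mem_closedBall closedBall_subset_closedBall)
open ENNReal (half_pos add_halves ofReal rpow_natCast rpow_mul ofReal_mul ofReal_pow
  ofReal_le_ofReal ofReal_le_ofReal_iff ofReal_ne_top ofReal_one ofReal_add ofReal_toReal
  toReal_nonneg mul_lt_top pow_lt_top_iff ofReal_lt_top pow_lt_top pow_le_pow_left_iff toReal_mono
  mul_ne_top inv_lt_top add_lt_top sum_lt_top div_lt_top ofReal_ofNat ofNat_ne_top
  tendsto_nhds_zero ofReal_div_of_pos one_lt_top)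
open Real (norm_of_nonneg rpow_two mul_rpow norm_eq_abs dist_eq fourier_eq rpow_neg fourierChar
  continuous_fourierChar fourierInv_eq rpow_add rpow_le_rpow_of_nonpos
  exp exp_pos enorm_of_nonneg)
open Complex (norm_real abs_re_le_norm measurable_ofReal)
open EuclideanSpace (single)
open scoped Real

variable {α F : Type*} [MeasurableSpace α] [NormedAddCommGroup F] {μ : Measure α}
  {σ ρ a R s r t b C A T' : ℝ} {o z x y c : E3} {g m η κ : E3 → ℝ} {f u u₀ : E3 → E3} {Ω : Set E3}
  {I : Set ℝ} {θ : ℝ → ℝ} {w : ℝ → E3 → E3} {T : EReal}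
  {P : ℝ → E3 → ℝ} {M ε : ℝ≥0∞}

lemma lintegral_ofReal_mul (a : ℝ) (f : α → ℝ≥0∞) :
    ∫⁻ x, ofReal a * f x ∂μ = ofReal a * ∫⁻ x, f x ∂μ := lintegral_const_mul' _ _ ofReal_ne_top

/-! ### Fourier multipliers on test functions -/

/-- The complex-valued Fourier multiplier operator with real symbol `m`; `fourierMul m` is its real
part. -/
noncomputable def mulC (m : E3 → ℝ) (g : E3 → ℝ) (x : E3) : ℂ :=
  𝓕⁻ (fun ξ : E3 => (m ξ : ℂ) * 𝓕 (fun y : E3 => (g y : ℂ)) ξ) x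

lemma fourierMul_eq_re (m g : E3 → ℝ) (x : E3) : fourierMul m g x = (mulC m g x).re := rfl

lemma IsTest.ofReal_contDiff (hg : IsTest Ω g) :
    ContDiff ℝ ∞ (fun y : E3 => (g y : ℂ)) := Complex.ofRealCLM.contDiff.comp hg.1

lemma IsTest.ofReal_hasCompactSupport (hg : IsTest Ω g) :
    HasCompactSupport (fun y : E3 => (g y : ℂ)) := hg.2.1.comp_left (g := fun r : ℝ => (r : ℂ)) rfl

/-- A real test function as a complex-valued Schwartz function. -/
noncomputable def IsTest.schwartz {Ω : Set E3} {g : E3 → ℝ} (hg : IsTest Ω g) :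
    SchwartzMap E3 ℂ :=
  hg.ofReal_hasCompactSupport.toSchwartzMap hg.ofReal_contDiff

/-- The Fourier transform of a real function. -/
noncomputable def ftR (g : E3 → ℝ) : E3 → ℂ := 𝓕 (fun y : E3 => (g y : ℂ))

lemma IsTest.fourier_schwartz (hg : IsTest Ω g) : ((𝓕 hg.schwartz : SchwartzMap E3 ℂ) : E3 → ℂ) =
    ftR g := by
  rw [SchwartzMap.fourier_coe]
  rfl

lemma IsTest.continuous_ftR (hg : IsTest Ω g) : Continuous (ftR g) := by
  rw [← hg.fourier_schwartz]
  exact (𝓕 hg.schwartz).continuous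

lemma IsTest.integrable_pow_mul_ftR (hg : IsTest Ω g) (k : ℕ) :
    Integrable (fun ξ => ‖ξ‖ ^ k * ‖ftR g ξ‖) := by
  rw [← hg.fourier_schwartz]
  exact (𝓕 hg.schwartz).integrable_pow_mul volume k

lemma IsTest.integrable_rpow_mul_ftR (hg : IsTest Ω g) (h0 : 0 ≤ σ) (h2 : σ ≤ 2) :
    Integrable (fun ξ => ‖ξ‖ ^ σ * ‖ftR g ξ‖) := by
  refine ((hg.integrable_pow_mul_ftR 0).add (hg.integrable_pow_mul_ftR 2)).mono' ?_
    (ae_of_all _ fun ξ => ?_)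
  · exact ((continuous_norm.rpow_const (fun _ => Or.inr h0)).mul
      hg.continuous_ftR.norm).aestronglyMeasurable
  · rw [norm_of_nonneg (by positivity)]
    simp only [Pi.add_apply]
    rw [← add_mul]
    refine mul_le_mul_of_nonneg_right ?_ (norm_nonneg _)
    rcases le_total ‖ξ‖ 1 with h1 | h1
    · have := Real.rpow_le_one (norm_nonneg ξ) h1 h0
      nlinarith [sq_nonneg ‖ξ‖]
    · have := Real.rpow_le_rpow_of_exponent_le h1 h2
      rw [rpow_two] at this
      linarith

/-- A symbol that is smooth off the origin and positively homogeneous of degree `σ`. -/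
structure IsHomSymbol (σ : ℝ) (m : E3 → ℝ) : Prop where
  smooth : ContDiffOn ℝ ∞ m {0}ᶜ
  zero : m 0 = 0
  hom : ∀ t : ℝ, 0 < t → ∀ ξ, m (t • ξ) = t ^ σ * m ξ

lemma IsHomSymbol.exists_bound (hm : IsHomSymbol σ m) : ∃ C, 0 ≤ C ∧ ∀ ξ, |m ξ| ≤ C * ‖ξ‖ ^ σ := by
  have hc : ContinuousOn m (Metric.sphere 0 1) :=
    hm.smooth.continuousOn.mono (by
      intro x hx h
      simp only [mem_singleton_iff] at h
      simp [h] at hx)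
  obtain ⟨C, hC⟩ := (isCompact_sphere (0 : E3) 1).exists_bound_of_continuousOn hc
  refine ⟨max C 0, le_max_right _ _, fun ξ => ?_⟩
  by_cases h : ξ = 0
  · subst h
    rw [hm.zero, abs_zero]
    positivity
  · have hn : 0 < ‖ξ‖ := norm_pos_iff.2 h
    have : ξ = ‖ξ‖ • (‖ξ‖⁻¹ • ξ) := by rw [smul_smul, mul_inv_cancel₀ hn.ne', one_smul]
    rw [this, hm.hom _ hn, ← this, abs_mul, abs_of_nonneg (by positivity), mul_comm]
    refine mul_le_mul_of_nonneg_right ((hC _ ?_).trans (le_max_left _ _)) (by positivity)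
    simp [norm_smul, hn.ne']

lemma IsHomSymbol.measurable (hm : IsHomSymbol σ m) : Measurable m := by
  convert (hm.smooth.continuousOn.measurable_piecewise (g := fun _ => (0 : ℝ))
    continuous_const.continuousOn (measurableSet_singleton (0 : E3)).compl) using 1
  ext x
  by_cases hx : x = 0
  · simp [hx, hm.zero]
  · simp [hx]

lemma isHomSymbol_lam (σ : ℝ) (hσ : 0 < σ) : IsHomSymbol σ (fun ξ => (2 * π * ‖ξ‖) ^ σ) where
  smooth := fun ξ hξ => by
    refine ContDiffAt.contDiffWithinAt (ContDiffAt.rpow_const_of_ne ?_ ?_)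
    · exact contDiffAt_const.mul (contDiffAt_norm ℝ hξ)
    · positivity
  zero := by simp [Real.zero_rpow hσ.ne']
  hom t ht ξ := by
    rw [norm_smul, norm_of_nonneg ht.le, ← mul_rpow ht.le (by positivity)]
    ring_nf

lemma isHomSymbol_riesz (i j : Fin 3) : IsHomSymbol 0 (fun ξ => ξ i * ξ j / ‖ξ‖ ^ 2) where
  smooth := fun ξ hξ => by
    refine ContDiffAt.contDiffWithinAt (ContDiffAt.div ?_ ?_ ?_)
    · exact ((EuclideanSpace.proj (𝕜 := ℝ) i).contDiff.mul
        (EuclideanSpace.proj (𝕜 := ℝ) j).contDiff).contDiffAt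
    · exact (contDiffAt_norm ℝ hξ).pow 2
    · positivity
  zero := by simp
  hom t ht ξ := by
    rw [norm_smul, norm_of_nonneg ht.le, Real.rpow_zero, one_mul]
    simp only [PiLp.smul_apply, smul_eq_mul]
    by_cases h : ξ = 0
    · simp [h]
    · have := norm_pos_iff.2 h
      field_simp

lemma IsHomSymbol.integrable_mul_ftR (hm : IsHomSymbol σ m) (h0 : 0 ≤ σ) (h2 : σ ≤ 2)
    (hg : IsTest Ω g) : Integrable (fun ξ => (m ξ : ℂ) * ftR g ξ) := by
  obtain ⟨C, hC, hb⟩ := hm.exists_bound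
  refine ((hg.integrable_rpow_mul_ftR h0 h2).const_mul C).mono' ?_ (ae_of_all _ fun ξ => ?_)
  · exact (measurable_ofReal.comp hm.measurable).aestronglyMeasurable.mul
      hg.continuous_ftR.aestronglyMeasurable
  · rw [norm_mul, norm_real, norm_eq_abs, ← mul_assoc]
    exact mul_le_mul_of_nonneg_right (hb ξ) (norm_nonneg _)

/-- A smooth bump function on the half line, supported in `(1, 2)`, which cuts symbols into dyadic
pieces. -/
noncomputable def dyadicBump : ContDiffBump (3 / 2 : ℝ) where
  rIn := 1 / 4
  rOut := 1 / 2
  rIn_pos := by norm_num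
  rIn_lt_rOut := by norm_num

lemma dyadicBump_eq_zero (ht : t ≤ 1 ∨ 2 ≤ t) : dyadicBump t = 0 := by
  apply dyadicBump.zero_of_le_dist
  rw [dist_eq]
  change 1 / 2 ≤ _
  rcases ht with h | h
  · rw [abs_of_nonpos (by linarith)]; linarith
  · rw [abs_of_nonneg (by linarith)]; linarith

/-- The localized symbol `m(ξ) χ(|ξ|)`. -/
noncomputable def cutSymbol (m : E3 → ℝ) (ξ : E3) : ℂ := ((m ξ * dyadicBump ‖ξ‖ : ℝ) : ℂ)

lemma cutSymbol_eq_zero (m : E3 → ℝ) {ξ : E3} (h : ‖ξ‖ ≤ 1 ∨ 2 ≤ ‖ξ‖) : cutSymbol m ξ = 0 := by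
  simp [cutSymbol, dyadicBump_eq_zero h]

lemma cutSymbol_hasCompactSupport (m : E3 → ℝ) : HasCompactSupport (cutSymbol m) := by
  refine HasCompactSupport.intro (isCompact_closedBall (0 : E3) 2) fun x hx => cutSymbol_eq_zero m
    (Or.inr ?_)
  simp at hx
  exact hx.le

lemma IsHomSymbol.contDiff_cutSymbol (hm : IsHomSymbol σ m) : ContDiff ℝ ∞ (cutSymbol m) := by
  rw [contDiff_iff_contDiffAt]
  intro ξ
  by_cases h : ξ = 0
  · subst h
    refine (contDiffAt_const (c := (0 : ℂ))).congr_of_eventuallyEq ?_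
    filter_upwards [Metric.ball_mem_nhds (0 : E3) one_pos] with ξ hξ
    refine cutSymbol_eq_zero m (Or.inl ?_)
    simp at hξ
    exact hξ.le
  · exact Complex.ofRealCLM.contDiff.contDiffAt.comp ξ
      (ContDiffAt.mul ((hm.smooth ξ h).contDiffAt (isOpen_compl_singleton.mem_nhds h))
      (dyadicBump.contDiff.contDiffAt.comp ξ (contDiffAt_norm ℝ h)))

/-- The inverse Fourier transform of the localized symbol, as a Schwartz function. -/
noncomputable def IsHomSymbol.piece {σ : ℝ} {m : E3 → ℝ} (hm : IsHomSymbol σ m) :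
    SchwartzMap E3 ℂ :=
  𝓕⁻ ((cutSymbol_hasCompactSupport m).toSchwartzMap hm.contDiff_cutSymbol)

lemma IsHomSymbol.piece_apply (hm : IsHomSymbol σ m) (x : E3) :
    hm.piece x = 𝓕⁻ (cutSymbol m) x := by
  rw [IsHomSymbol.piece, SchwartzMap.fourierInv_coe]
  rfl

lemma IsHomSymbol.integrable_cutSymbol (hm : IsHomSymbol σ m) : Integrable (cutSymbol m) :=
  hm.contDiff_cutSymbol.continuous.integrable_of_hasCompactSupport (cutSymbol_hasCompactSupport m)

lemma IsHomSymbol.integral_piece (hm : IsHomSymbol σ m) : ∫ x, hm.piece x = 0 := by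
  have h1 : 𝓕 hm.piece = (cutSymbol_hasCompactSupport m).toSchwartzMap hm.contDiff_cutSymbol := by
    rw [IsHomSymbol.piece, FourierTransform.fourier_fourierInv_eq]
  have h2 : 𝓕 hm.piece 0 = cutSymbol m 0 := by rw [h1]; rfl
  rw [SchwartzMap.fourier_coe, fourier_eq] at h2
  simpa [cutSymbol_eq_zero m (ξ := 0) (by simp)] using h2

/-- The normalizing constant `∫₀^∞ χ(t) dt/t`. -/
noncomputable def dyadicConst : ℝ := ∫ t in Ioi (0 : ℝ), dyadicBump t / t

lemma integrableOn_dyadic : IntegrableOn (fun t : ℝ => dyadicBump t / t) (Ioi 0) := by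
  have : Continuous (fun t : ℝ => dyadicBump t / max t 1) :=
    dyadicBump.continuous.div (by fun_prop) (fun t => by positivity)
  have hi : Integrable (fun t : ℝ => dyadicBump t / max t 1) := by
    refine this.integrable_of_hasCompactSupport (HasCompactSupport.intro
      (isCompact_Icc (a := (1 : ℝ)) (b := 2)) fun x hx => ?_)
    rw [dyadicBump_eq_zero, zero_div]
    rw [mem_Icc, not_and_or, not_le, not_le] at hx
    exact hx.imp le_of_lt le_of_lt
  refine hi.integrableOn.congr_fun (fun t ht => ?_) measurableSet_Ioi
  rcases le_total t 1 with h | h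
  · simp [dyadicBump_eq_zero (Or.inl h)]
  · simp [max_eq_left h]

lemma dyadicConst_pos : 0 < dyadicConst := by
  rw [dyadicConst, setIntegral_pos_iff_support_of_nonneg_ae _ integrableOn_dyadic]
  · refine lt_of_lt_of_le ?_ (measure_mono (s := Ioo (1 : ℝ) 2) ?_)
    · simp
    · intro t ht
      refine ⟨?_, by simpa using lt_trans one_pos ht.1⟩
      have : 0 < dyadicBump t := dyadicBump.pos_of_mem_ball (by
        rw [mem_ball, dist_eq, abs_lt]
        change -(1 / 2) < _ ∧ _ < 1 / 2
        constructor <;> linarith [ht.1, ht.2])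
      exact (div_pos this (lt_trans one_pos ht.1)).ne'
  · filter_upwards [ae_restrict_mem measurableSet_Ioi] with t ht using div_nonneg dyadicBump.nonneg
      (le_of_lt ht)

lemma integral_dyadic_scale (ha : 0 < a) : ∫ t in Ioi (0 : ℝ), dyadicBump (t * a) / t =
    dyadicConst := by
  have h := integral_comp_mul_right_Ioi (fun t => dyadicBump t / t) 0 ha
  rw [zero_mul, smul_eq_mul] at h
  rw [dyadicConst, eq_comm, ← mul_right_inj' (inv_ne_zero ha.ne'), ← h, ← integral_const_mul]
  exact setIntegral_congr_fun measurableSet_Ioi fun t ht => by field_simp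

lemma integrableOn_dyadic_scale (ha : 0 < a) :
    IntegrableOn (fun t : ℝ => dyadicBump (t * a) / t) (Ioi 0) := by
  have h := (integrableOn_Ioi_comp_mul_right_iff (fun t => dyadicBump t / t) 0 ha).2
    (by simpa using integrableOn_dyadic)
  exact IntegrableOn.congr_fun (h.mul_const a) (fun t ht => by field_simp) measurableSet_Ioi

lemma IsHomSymbol.cutSymbol_smul (hm : IsHomSymbol σ m) (ht : 0 < t) (ξ : E3) :
    cutSymbol m (t • ξ) = ((t ^ σ * m ξ * dyadicBump (t * ‖ξ‖) : ℝ) : ℂ) := by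
  rw [cutSymbol, hm.hom t ht, norm_smul, norm_of_nonneg ht.le]

lemma IsHomSymbol.cutSymbol_smul' (hm : IsHomSymbol σ m) (ht : 0 < t) (ξ : E3) :
    ((t ^ (-σ - 1) : ℝ) : ℂ) * cutSymbol m (t • ξ) = ((m ξ * (dyadicBump (t * ‖ξ‖) / t) : ℝ) :
    ℂ) := by
  rw [hm.cutSymbol_smul ht, ← Complex.ofReal_mul, Real.rpow_sub ht, rpow_neg ht.le, Real.rpow_one]
  congr 1
  field_simp

/-- A homogeneous symbol is the superposition of the dilates of its localization. -/
lemma IsHomSymbol.integral_cutSymbol (hm : IsHomSymbol σ m) (ξ : E3) :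
    ∫ t in Ioi (0 : ℝ), ((t ^ (-σ - 1) : ℝ) : ℂ) * cutSymbol m (t • ξ) =
    ((m ξ * dyadicConst : ℝ) : ℂ) := by
  rw [setIntegral_congr_fun measurableSet_Ioi (fun t ht => hm.cutSymbol_smul' ht ξ),
    integral_complex_ofReal, integral_const_mul]
  by_cases h : ξ = 0
  · simp [h, hm.zero]
  · rw [integral_dyadic_scale (norm_pos_iff.2 h)]

/-- The Fourier multiplier with symbol `m(tξ)χ(t|ξ|)` is a convolution with a dilated Schwartz
function. -/
lemma IsHomSymbol.integral_cutSymbol_mul_ftR (hm : IsHomSymbol σ m) (hg : IsTest Ω g) (ht : 0 < t)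
    (x : E3) : ∫ ξ, fourierChar (inner ℝ ξ x) • (cutSymbol m (t • ξ) * ftR g ξ) =
    ((t ^ (-3 : ℝ) : ℝ) : ℂ) * ∫ y, hm.piece (t⁻¹ • (x - y)) * (g y : ℂ) := by
  have hcut := (integrable_comp_smul_iff volume (cutSymbol m) ht.ne').2 hm.integrable_cutSymbol
  have hF : Integrable (fun ξ : E3 => fourierChar (inner ℝ ξ x) • cutSymbol m (t • ξ)) := by
    rw [← integrable_norm_iff]
    · simpa using hcut.norm
    · exact (continuous_fourierChar.comp (by fun_prop)).aestronglyMeasurable.smul hcut.1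
  have key := VectorFourier.integral_fourierIntegral_smul_eq_flip (μ := volume) (L := innerₗ E3)
    continuous_fourierChar (by simpa using continuous_inner)
    (hg.ofReal_contDiff.continuous.integrable_of_hasCompactSupport hg.ofReal_hasCompactSupport) hF
  have hflip : (innerₗ E3).flip = innerₗ E3 := by ext a b; simp
  rw [hflip] at key
  have hl : ∀ ξ, VectorFourier.fourierIntegral fourierChar volume (innerₗ E3) (fun y : E3 =>
    (g y : ℂ)) ξ = ftR g ξ := fun ξ => rfl
  have hr : ∀ y, VectorFourier.fourierIntegral fourierChar volume (innerₗ E3)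
    (fun ξ : E3 => fourierChar (inner ℝ ξ x) • cutSymbol m (t • ξ)) y =
      ((t ^ (-3 : ℝ) : ℝ)) * hm.piece (t⁻¹ • (x - y)) := fun y => by
    rw [hm.piece_apply, fourierInv_eq]
    have h4 : ((t ^ (-3 : ℝ))) = ((|(t ^ Module.finrank ℝ E3)⁻¹|)) := by
      rw [finrank_euclideanSpace, Fintype.card_fin, abs_of_pos (by positivity), rpow_neg ht.le]
      norm_cast
    rw [h4, ← Complex.real_smul, ← Measure.integral_comp_smul volume (fun ξ : E3 =>
      fourierChar (inner ℝ ξ (t⁻¹ • (x - y))) • cutSymbol m ξ) t, VectorFourier.fourierIntegral]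
    congr 1
    ext ξ
    rw [smul_smul, ← AddChar.map_add_eq_mul]
    congr 2
    rw [inner_smul_left, inner_smul_right]
    simp only [innerₗ_apply_apply, conj_trivial]
    rw [← mul_assoc, mul_inv_cancel₀ ht.ne', one_mul, inner_sub_right]
    ring
  simp only [hl, hr, smul_eq_mul] at key
  calc _ = ∫ ξ, ftR g ξ * fourierChar (inner ℝ ξ x) • cutSymbol m (t • ξ) := by
        congr 1; ext ξ
        rw [mul_smul_comm, mul_comm (ftR g ξ)]
    _ = _ := by
      rw [key, ← integral_const_mul]
      congr 1; ext y; ring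

/-- A homogeneous multiplier as a superposition of convolutions with dilated Schwartz functions. -/
lemma IsHomSymbol.mulC_eq (hm : IsHomSymbol σ m) (h0 : 0 ≤ σ) (h2 : σ ≤ 2) (hg : IsTest Ω g)
    (x : E3) : mulC m g x = (dyadicConst⁻¹ : ℂ) * ∫ t in Ioi (0 : ℝ), ((t ^ (-σ - 4) : ℝ) : ℂ) *
    ∫ y, hm.piece (t⁻¹ • (x - y)) * (g y : ℂ) := by
  have hc0 : (dyadicConst : ℂ) ≠ 0 := by exact_mod_cast dyadicConst_pos.ne'
  -- The double integral over `ξ` and `t` converges absolutely.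
  have hmeas : AEStronglyMeasurable (Function.uncurry fun ξ t =>
    fourierChar (inner ℝ ξ x) • (((t ^ (-σ - 1) : ℝ)) * cutSymbol m (t • ξ) * ftR g ξ))
    ((volume : Measure E3).prod (volume.restrict (Ioi (0 : ℝ)))) := by
    exact (continuous_fourierChar.comp (f := fun p : E3 × ℝ => inner ℝ p.1 x)
      (by fun_prop)).aestronglyMeasurable.smul
      (((measurable_ofReal.comp (measurable_snd.pow_const _)).mul
      (hm.contDiff_cutSymbol.continuous.measurable.comp (by fun_prop))).mul
      (hg.continuous_ftR.measurable.comp measurable_fst)).aestronglyMeasurable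
  have hnorm : ∀ ξ : E3, ∀ t : ℝ, 0 < t → ‖fourierChar (inner ℝ ξ x) •
    (((t ^ (-σ - 1) : ℝ)) * cutSymbol m (t • ξ) * ftR g ξ)‖ =
    |m ξ| * ‖ftR g ξ‖ * (dyadicBump (t * ‖ξ‖) / t) := fun ξ t ht => by
    rw [Circle.norm_smul, norm_mul, hm.cutSymbol_smul' ht, norm_real, norm_mul,
      norm_eq_abs, norm_of_nonneg (div_nonneg dyadicBump.nonneg ht.le)]
    ring
  have hint : Integrable (Function.uncurry fun ξ t =>
    fourierChar (inner ℝ ξ x) • (((t ^ (-σ - 1) : ℝ)) * cutSymbol m (t • ξ) * ftR g ξ))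
    ((volume : Measure E3).prod (volume.restrict (Ioi (0 : ℝ)))) := by
    rw [integrable_prod_iff hmeas]
    constructor
    · have h0ae : ∀ᵐ ξ : E3, ξ ≠ 0 := by simp [ae_iff, measure_singleton]
      filter_upwards [h0ae, hmeas.prodMk_left] with ξ hξ hmξ
      rw [← integrable_norm_iff hmξ]
      exact IntegrableOn.congr_fun ((integrableOn_dyadic_scale (norm_pos_iff.2 hξ)).const_mul _)
        (fun t ht => (hnorm ξ t ht).symm) measurableSet_Ioi
    · refine ((hm.integrable_mul_ftR h0 h2 hg).norm.mul_const dyadicConst).congr ?_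
      have h0ae : ∀ᵐ ξ : E3, ξ ≠ 0 := by simp [ae_iff, measure_singleton]
      filter_upwards [h0ae] with ξ hξ
      have := setIntegral_congr_fun (μ := volume) measurableSet_Ioi (fun t ht => hnorm ξ t ht)
      simp only [Function.uncurry_apply_pair] at this ⊢
      rw [this, integral_const_mul, integral_dyadic_scale (norm_pos_iff.2 hξ), norm_mul,
        norm_real, norm_eq_abs]
  rw [mulC, fourierInv_eq]
  have hL : ∀ ξ : E3, ∫ t in Ioi (0 : ℝ), fourierChar (inner ℝ ξ x) •
    (((t ^ (-σ - 1) : ℝ)) * cutSymbol m (t • ξ) * ftR g ξ) =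
    dyadicConst * fourierChar (inner ℝ ξ x) • ((m ξ) * ftR g ξ) := fun ξ => by
    simp only [Circle.smul_def]
    rw [integral_smul, integral_mul_const, hm.integral_cutSymbol ξ]
    push_cast
    ring
  have hR : ∀ t ∈ Ioi (0 : ℝ), ∫ ξ, fourierChar (inner ℝ ξ x) •
    (((t ^ (-σ - 1) : ℝ)) * cutSymbol m (t • ξ) * ftR g ξ) =
    ((t ^ (-σ - 4) : ℝ)) * ∫ y, hm.piece (t⁻¹ • (x - y)) * (g y) := fun t ht => by
    have e1 : ∀ ξ : E3, fourierChar (inner ℝ ξ x) •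
      (((t ^ (-σ - 1) : ℝ)) * cutSymbol m (t • ξ) * ftR g ξ) =
      ((t ^ (-σ - 1) : ℝ)) *
        fourierChar (inner ℝ ξ x) • (cutSymbol m (t • ξ) * ftR g ξ) := fun ξ => by
      simp only [Circle.smul_def, smul_eq_mul]; ring
    simp only [e1]
    rw [integral_const_mul, hm.integral_cutSymbol_mul_ftR hg ht, ← mul_assoc,
      ← Complex.ofReal_mul, ← rpow_add ht]
    ring_nf
  rw [← setIntegral_congr_fun measurableSet_Ioi hR, ← integral_integral_swap hint]
  simp only [hL]
  rw [integral_const_mul, ← mul_assoc, inv_mul_cancel₀ hc0, one_mul]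
  rfl

/-- The majorant `min(1, t⁸)` of a Schwartz function of `1/t`. -/
lemma integrableOn_rpow_mul_min (ha : 1 < a) (ha' : a < 9) :
    IntegrableOn (fun t : ℝ => t ^ (-a) * min 1 (t ^ 8)) (Ioi 0) := by
  rw [← Ioc_union_Ioi_eq_Ioi zero_le_one]
  refine IntegrableOn.union ?_ ?_
  · have h : IntegrableOn (fun t : ℝ => t ^ (8 - a)) (Ioc 0 1) := by
      rw [← intervalIntegrable_iff_integrableOn_Ioc_of_le zero_le_one]
      exact intervalIntegral.intervalIntegrable_rpow' (by linarith)
    refine h.congr_fun (fun t ht => ?_) measurableSet_Ioc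
    simp only
    rw [min_eq_right (pow_le_one₀ ht.1.le ht.2), sub_eq_neg_add, rpow_add ht.1]
    norm_cast
  · exact (integrableOn_Ioi_rpow_of_lt (a := -a) (by linarith) one_pos).congr_fun
      (fun t ht => by rw [min_eq_left (one_le_pow₀ ht.le), mul_one]) measurableSet_Ioi

lemma integral_rpow_mul_min_scale (ha : 1 < a) (ha' : a < 9) (hR : 0 < R) :
    IntegrableOn (fun t : ℝ => t ^ (-a) * min 1 ((t / R) ^ 8))
    (Ioi 0) ∧ ∫ t in Ioi (0 : ℝ), t ^ (-a) * min 1 ((t / R) ^ 8) = R ^ (1 - a) * ∫ t in Ioi (0 : ℝ),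
    t ^ (-a) * min 1 (t ^ 8) := by
  have hR' := inv_pos.2 hR
  have e : ∀ t ∈ Ioi (0 : ℝ), R ^ (-a) * ((t * R⁻¹) ^ (-a) * min 1 ((t * R⁻¹) ^ 8)) =
    t ^ (-a) * min 1 ((t / R) ^ 8) := fun t ht => by
    rw [mul_rpow ht.le hR'.le, Real.inv_rpow hR.le, rpow_neg hR.le, inv_inv, div_eq_mul_inv]
    field_simp
  constructor
  · have h := (integrableOn_Ioi_comp_mul_right_iff (fun t => t ^ (-a) * min 1 (t ^ 8)) 0 hR').2
      (by simpa using integrableOn_rpow_mul_min ha ha')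
    exact IntegrableOn.congr_fun (h.const_mul (R ^ (-a))) e measurableSet_Ioi
  · have h := integral_comp_mul_right_Ioi (fun t => t ^ (-a) * min 1 (t ^ 8)) 0 hR'
    rw [zero_mul, smul_eq_mul, inv_inv] at h
    rw [← setIntegral_congr_fun measurableSet_Ioi e, integral_const_mul, h, ← mul_assoc]
    congr 1
    rw [sub_eq_neg_add, rpow_add hR, Real.rpow_one]

/-- A Schwartz function is dominated by `min(1, |x|⁻⁸)`. -/
lemma exists_schwartz_bound [NormedSpace ℝ F] (K : SchwartzMap E3 F) :
    ∃ C, 0 ≤ C ∧ ∀ t R : ℝ, 0 < t → 0 < R → ∀ z : E3, R ≤ ‖z‖ → ‖K (t⁻¹ • z)‖ ≤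
    C * min 1 ((t / R) ^ 8) := by
  obtain ⟨C0, hC0⟩ := K.decay 0 0
  obtain ⟨C8, hC8⟩ := K.decay 8 0
  simp only [pow_zero, one_mul, norm_iteratedFDeriv_zero] at hC0 hC8
  refine ⟨max C0 C8, hC0.1.le.trans (le_max_left _ _), fun t R ht hR z hz => ?_⟩
  rw [mul_min_of_nonneg _ _ (hC0.1.le.trans (le_max_left _ _)), mul_one]
  refine le_min ((hC0.2 _).trans (le_max_left _ _)) ?_
  have h := hC8.2 (t⁻¹ • z)
  rw [norm_smul, norm_inv, norm_of_nonneg ht.le] at h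
  have h1 : (R / t) ^ 8 * ‖K (t⁻¹ • z)‖ ≤ max C0 C8 := by
    refine le_trans (mul_le_mul_of_nonneg_right (pow_le_pow_left₀ (by positivity) ?_ 8)
      (norm_nonneg _)) (h.trans (le_max_right _ _))
    rw [inv_mul_eq_div]
    gcongr
  have h2 : (t / R) ^ 8 * (R / t) ^ 8 = 1 := by rw [← mul_pow]; field_simp
  calc _ = (t / R) ^ 8 * ((R / t) ^ 8 * ‖K (t⁻¹ • z)‖) := by rw [← mul_assoc, h2, one_mul]
    _ ≤ (t / R) ^ 8 * max C0 C8 := by gcongr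
    _ = _ := mul_comm _ _

/-- The convolution kernel of a homogeneous multiplier, off the origin. -/
noncomputable def IsHomSymbol.kernel {σ : ℝ} {m : E3 → ℝ} (hm : IsHomSymbol σ m) (z : E3) : ℂ :=
  (dyadicConst⁻¹ : ℂ) * ∫ t in Ioi (0 : ℝ), ((t ^ (-σ - 4) : ℝ) : ℂ) * hm.piece (t⁻¹ • z)

lemma aestronglyMeasurable_dilate [NormedSpace ℝ F] {Y : Type*} [MeasurableSpace Y]
    [TopologicalSpace Y] [BorelSpace Y] (K : SchwartzMap E3 F) {f : Y → E3} (hf : Measurable f)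
    (μ : Measure (Y × ℝ)) : AEStronglyMeasurable (fun p : Y × ℝ => K (p.2⁻¹ • f p.1)) μ :=
      K.continuous.comp_aestronglyMeasurable
      ((measurable_snd.inv.smul (hf.comp measurable_fst)).aestronglyMeasurable)

/-- The double integral defining a singular integral operator against a function `h` with
`|x - y|^{-3-σ} h(y)` integrable. -/
lemma IsHomSymbol.kernel_fubini (hm : IsHomSymbol σ m) (h0 : 0 ≤ σ) (h2 : σ ≤ 2) {h : E3 → ℝ}
    (hmeas : Measurable h) (x : E3) (hi : Integrable (fun y => ‖x - y‖ ^ (-σ - 3) * |h y|)) :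
    Integrable (fun y => hm.kernel (x - y) * (h y : ℂ)) ∧ (dyadicConst⁻¹ : ℂ) * ∫ t in Ioi (0 : ℝ),
    ((t ^ (-σ - 4) : ℝ) : ℂ) * ∫ y, hm.piece (t⁻¹ • (x - y)) * (h y : ℂ) = ∫ y, hm.kernel (x - y) *
    (h y : ℂ) := by
  obtain ⟨C, hC, hK⟩ := exists_schwartz_bound hm.piece
  have hm1 : AEStronglyMeasurable (Function.uncurry fun y t =>
      ((t ^ (-σ - 4) : ℝ) : ℂ) * hm.piece (t⁻¹ • (x - y)) * (h y : ℂ))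
      ((volume : Measure E3).prod (volume.restrict (Ioi (0 : ℝ)))) := by
    have a1 : Measurable (fun p : E3 × ℝ => ((p.2 ^ (-σ - 4) : ℝ) : ℂ)) :=
      measurable_ofReal.comp (measurable_snd.pow_const _)
    exact (a1.aestronglyMeasurable.mul (aestronglyMeasurable_dilate hm.piece (by fun_prop) _)).mul
      (measurable_ofReal.comp (hmeas.comp measurable_fst)).aestronglyMeasurable
  have hne : ∀ᵐ y : E3, x - y ≠ 0 := by
    have : ∀ᵐ y : E3, y ≠ x := by simp [ae_iff]
    filter_upwards [this] with y hy using sub_ne_zero.2 hy.symm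
  have hb : ∀ y : E3, x - y ≠ 0 → ∀ t ∈ Ioi (0 : ℝ),
    ‖((t ^ (-σ - 4) : ℝ)) * hm.piece (t⁻¹ • (x - y)) * (h y : ℂ)‖ ≤
      C * |h y| * (t ^ (-(σ + 4)) * min 1 ((t / ‖x - y‖) ^ 8)) := fun y hy t (ht : 0 < t) => by
    rw [norm_mul, norm_mul, norm_real, norm_real, norm_eq_abs, norm_eq_abs,
      abs_of_pos (Real.rpow_pos_of_pos ht _), show -σ - 4 = -(σ + 4) by ring]
    have := hK t _ ht (norm_pos_iff.2 hy) (x - y) le_rfl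
    calc _ ≤ t ^ (-(σ + 4)) * (C * min 1 ((t / ‖x - y‖) ^ 8)) * |h y| := by gcongr
      _ = _ := by ring
  have hint : Integrable (Function.uncurry fun (y : E3) (t : ℝ) =>
      ((t ^ (-σ - 4) : ℝ)) * hm.piece (t⁻¹ • (x - y)) * (h y : ℂ))
      ((volume : Measure E3).prod (volume.restrict (Ioi (0 : ℝ)))) := by
    rw [integrable_prod_iff hm1]
    constructor
    · filter_upwards [hne, hm1.prodMk_left] with y hy hmy
      refine (((integral_rpow_mul_min_scale (a := σ + 4) (by linarith) (by linarith)
        (norm_pos_iff.2 hy)).1).const_mul (C * |h y|)).mono' hmy ?_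
      filter_upwards [ae_restrict_mem measurableSet_Ioi] with t ht using hb y hy t ht
    · refine (hi.const_mul (C * ∫ t in Ioi (0 : ℝ), t ^ (-(σ + 4)) * min 1 (t ^ 8))).mono'
        hm1.norm.integral_prod_right' ?_
      filter_upwards [hne, hm1.prodMk_left] with y hy hmy
      have hs := integral_rpow_mul_min_scale (a := σ + 4) (by linarith) (by linarith)
        (norm_pos_iff.2 hy)
      rw [norm_of_nonneg (integral_nonneg fun t => norm_nonneg _)]
      calc _ ≤ ∫ t in Ioi (0 : ℝ), C * |h y| * (t ^ (-(σ + 4)) * min 1 ((t / ‖x - y‖) ^ 8)) := by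
            refine integral_mono_of_nonneg (ae_of_all _ fun t => norm_nonneg _)
              (hs.1.const_mul _) ?_
            filter_upwards [ae_restrict_mem measurableSet_Ioi] with t ht using hb y hy t ht
        _ = _ := by
          rw [integral_const_mul, hs.2, show 1 - (σ + 4) = -σ - 3 by ring]
          ring
  have hy : ∀ y : E3, ∫ t in Ioi (0 : ℝ),
    ((t ^ (-σ - 4) : ℝ)) * hm.piece (t⁻¹ • (x - y)) * (h y) =
    dyadicConst * (hm.kernel (x - y) * (h y)) := fun y => by
    rw [integral_mul_const, IsHomSymbol.kernel, ← mul_assoc, ← mul_assoc, mul_inv_cancel₀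
      (by exact_mod_cast dyadicConst_pos.ne'), one_mul]
  have hc0 : (dyadicConst : ℂ) ≠ 0 := by exact_mod_cast dyadicConst_pos.ne'
  constructor
  · refine (hint.integral_prod_left.const_mul dyadicConst⁻¹).congr (ae_of_all _ fun y => ?_)
    simp only [Function.uncurry_apply_pair]
    rw [hy, ← mul_assoc, inv_mul_cancel₀ hc0, one_mul]
  · have hsw := integral_integral_swap hint
    simp only [hy] at hsw
    rw [integral_const_mul] at hsw
    rw [eq_comm, ← mul_right_inj' hc0, hsw, ← mul_assoc, mul_inv_cancel₀ hc0, one_mul]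
    congr 1
    ext t
    rw [← integral_const_mul]
    congr 1
    ext y
    ring

lemma IsHomSymbol.exists_kernel_bound (hm : IsHomSymbol σ m) (h0 : 0 ≤ σ) (h2 : σ ≤ 2) :
    ∃ C, 0 ≤ C ∧ ∀ z, z ≠ 0 → ‖hm.kernel z‖ ≤ C * ‖z‖ ^ (-σ - 3) := by
  obtain ⟨C, hC, hK⟩ := exists_schwartz_bound hm.piece
  refine ⟨dyadicConst⁻¹ * (C * ∫ t in Ioi (0 : ℝ), t ^ (-(σ + 4)) * min 1 (t ^ 8)), ?_,
    fun z hz => ?_⟩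
  · have := dyadicConst_pos
    have h3 : 0 ≤ ∫ t in Ioi (0 : ℝ), t ^ (-(σ + 4)) * min 1 (t ^ 8) :=
      setIntegral_nonneg measurableSet_Ioi fun t (ht : 0 < t) => by positivity
    positivity
  · have hs := integral_rpow_mul_min_scale (a := σ + 4) (by linarith) (by linarith)
      (norm_pos_iff.2 hz)
    rw [IsHomSymbol.kernel, norm_mul, norm_inv, norm_real,
      norm_of_nonneg dyadicConst_pos.le, mul_assoc]
    refine mul_le_mul_of_nonneg_left ?_ (inv_nonneg.2 dyadicConst_pos.le)
    calc _ ≤ ∫ t in Ioi (0 : ℝ), C * (t ^ (-(σ + 4)) * min 1 ((t / ‖z‖) ^ 8)) := by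
          refine norm_integral_le_of_norm_le (hs.1.const_mul C) ?_
          filter_upwards [ae_restrict_mem measurableSet_Ioi] with t ht
          have ht : 0 < t := ht
          rw [norm_mul, norm_real, norm_of_nonneg (Real.rpow_nonneg ht.le _),
            show -σ - 4 = -(σ + 4) by ring]
          have := hK t _ ht (norm_pos_iff.2 hz) z le_rfl
          calc _ ≤ t ^ (-(σ + 4)) * (C * min 1 ((t / ‖z‖) ^ 8)) := by gcongr
            _ = _ := by ring
      _ = _ := by
        rw [integral_const_mul, hs.2, show 1 - (σ + 4) = -σ - 3 by ring]
        ring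

lemma IsHomSymbol.measurable_kernel (hm : IsHomSymbol σ m) : Measurable hm.kernel := by
  have h : StronglyMeasurable (Function.uncurry fun z t =>
    ((t ^ (-σ - 4) : ℝ)) * hm.piece (t⁻¹ • z)) := by
    apply Measurable.stronglyMeasurable
    exact (measurable_ofReal.comp (measurable_snd.pow_const _)).mul
      (hm.piece.continuous.measurable.comp (measurable_snd.inv.smul measurable_fst))
  exact (h.integral_prod_right).measurable.const_mul _

lemma IsTest.measurable (hg : IsTest Ω g) : Measurable g := hg.1.continuous.measurable

/-- Off the support of `g`, a homogeneous multiplier acts by its kernel. -/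
lemma IsHomSymbol.mulC_eq_kernel (hm : IsHomSymbol σ m) (h0 : 0 ≤ σ) (h2 : σ ≤ 2) (hg : IsTest Ω g)
    (hR : 0 < R) (hx : ∀ y, g y ≠ 0 → R ≤ ‖x - y‖) :
    mulC m g x = ∫ y, hm.kernel (x - y) * (g y : ℂ) := by
  rw [hm.mulC_eq h0 h2 hg x]
  refine (hm.kernel_fubini h0 h2 hg.measurable x
    (((hg.1.continuous.integrable_of_hasCompactSupport hg.2.1).norm.const_mul (R ^ (-σ - 3))).mono'
    ?_ (ae_of_all _ fun y => ?_))).2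
  · exact (((measurable_const.sub measurable_id).norm.pow_const _).mul
      hg.measurable.norm).aestronglyMeasurable
  · rw [norm_of_nonneg (by positivity)]
    by_cases h : g y = 0
    · simp [h]
    · exact mul_le_mul_of_nonneg_right (rpow_le_rpow_of_nonpos hR (hx y h) (by linarith))
        (abs_nonneg _)

/-- The decay of a homogeneous multiplier off the support. -/
lemma IsHomSymbol.exists_offDiag_bound (hm : IsHomSymbol σ m) (h0 : 0 ≤ σ) (h2 : σ ≤ 2) :
    ∃ C, 0 ≤ C ∧ ∀ (Ω : Set E3) (g : E3 → ℝ), IsTest Ω g → ∀ (x : E3) (R : ℝ), 0 < R →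
    (∀ y, g y ≠ 0 → R ≤ ‖x - y‖) → ‖mulC m g x‖ ≤ C * R ^ (-σ - 3) * ∫ y, |g y| := by
  obtain ⟨C, hC, hK⟩ := hm.exists_kernel_bound h0 h2
  refine ⟨C, hC, fun Ω g hg x R hR hx => ?_⟩
  rw [hm.mulC_eq_kernel h0 h2 hg hR hx, ← integral_const_mul]
  refine norm_integral_le_of_norm_le ((hg.1.continuous.integrable_of_hasCompactSupport
    hg.2.1).norm.const_mul _) (ae_of_all _ fun y => ?_)
  rw [norm_mul, norm_real]
  by_cases h : g y = 0
  · simp [h]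
  · exact mul_le_mul_of_nonneg_right ((hK _ (norm_pos_iff.1 (hR.trans_le (hx y h)))).trans
      (mul_le_mul_of_nonneg_left (rpow_le_rpow_of_nonpos hR (hx y h) (by linarith)) hC))
      (norm_nonneg _)

/-- The improved decay of a homogeneous multiplier applied to a function of mean zero. -/
lemma IsHomSymbol.exists_meanZero_bound (hm : IsHomSymbol σ m) (h0 : 0 ≤ σ) (h2 : σ ≤ 2) :
    ∃ C, 0 ≤ C ∧ ∀ (Ω : Set E3) (g : E3 → ℝ), IsTest Ω g → ∫ y, g y = 0 → ∀ (x c : E3) (r : ℝ), 0 <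
    r → (∀ y, g y ≠ 0 → ‖y - c‖ ≤ r) → 2 * r ≤ ‖x - c‖ → ‖mulC m g x‖ ≤ C * r * ‖x - c‖ ^ (-σ - 4) *
    ∫ y, |g y| := by
  obtain ⟨C, hC, hK⟩ := exists_schwartz_bound (SchwartzMap.fderivCLM ℝ E3 ℂ hm.piece)
  have h3 : 0 ≤ ∫ t in Ioi (0 : ℝ), t ^ (-(σ + 5)) * min 1 (t ^ 8) := setIntegral_nonneg
    measurableSet_Ioi fun t (ht : 0 < t) => by positivity
  refine ⟨dyadicConst⁻¹ * (C * 2 ^ (σ + 4) * ∫ t in Ioi (0 : ℝ), t ^ (-(σ + 5)) * min 1 (t ^ 8)),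
    ?_, fun Ω g hg hg0 x c r hr hsupp hx => ?_⟩
  · have := dyadicConst_pos
    positivity
  have hgi : Integrable g := hg.1.continuous.integrable_of_hasCompactSupport hg.2.1
  have hgc : Integrable (fun y => (g y : ℂ)) := hgi.ofReal
  set R := ‖x - c‖ with hRdef
  have hR : 0 < R := by linarith
  have hpb : ∃ B, ∀ z, ‖hm.piece z‖ ≤ B := by
    obtain ⟨B, hB⟩ := hm.piece.decay 0 0
    exact ⟨B, fun z => by simpa using hB.2 z⟩
  obtain ⟨B, hB⟩ := hpb
  have hinner : ∀ t : ℝ, 0 < t → ‖∫ y, hm.piece (t⁻¹ • (x - y)) * (g y)‖ ≤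
    C * r * t⁻¹ * min 1 ((t / (R / 2)) ^ 8) * ∫ y, |g y| := fun t ht => by
    have e1 : ∫ y, hm.piece (t⁻¹ • (x - y)) * (g y) =
      ∫ y, (hm.piece (t⁻¹ • (x - y)) - hm.piece (t⁻¹ • (x - c))) * (g y) := by
      have i1 : Integrable (fun y => hm.piece (t⁻¹ • (x - y)) * (g y)) := hgc.bdd_mul
        (hm.piece.continuous.comp (by fun_prop)).aestronglyMeasurable (ae_of_all _ fun y => hB _)
      simp only [sub_mul]
      rw [integral_sub i1 (hgc.const_mul _), integral_const_mul, integral_complex_ofReal, hg0]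
      simp
    rw [e1, ← integral_const_mul]
    refine norm_integral_le_of_norm_le (hgi.norm.const_mul _) (ae_of_all _ fun y => ?_)
    rw [norm_mul, norm_real]
    by_cases h : g y = 0
    · simp [h]
    refine mul_le_mul_of_nonneg_right ?_ (norm_nonneg _)
    have hseg := (convex_segment (𝕜 := ℝ) (t⁻¹ • (x - c))
      (t⁻¹ • (x - y))).norm_image_sub_le_of_norm_fderiv_le (C := C * min 1 ((t / (R / 2)) ^ 8))
      (fun z _ => hm.piece.differentiableAt) (fun z hz => ?_)
      (left_mem_segment ℝ _ _) (right_mem_segment ℝ _ _)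
    · refine hseg.trans ?_
      rw [← smul_sub, norm_smul, norm_inv, norm_of_nonneg ht.le,
        show x - y - (x - c) = -(y - c) by abel, norm_neg]
      have := hsupp y h
      calc _ ≤ C * min 1 ((t / (R / 2)) ^ 8) * (t⁻¹ * r) := by gcongr
        _ = _ := by ring
    · obtain ⟨a, b, ha, hb, hab, rfl⟩ := hz
      have e2 : a • t⁻¹ • (x - c) + b • t⁻¹ • (x - y) = t⁻¹ • ((x - c) - b • (y - c)) := by
        have : a = 1 - b := by linarith
        subst this
        module
      rw [e2]
      refine hK t (R / 2) ht (by linarith) _ ?_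
      have h4 := norm_sub_norm_le (x - c) (b • (y - c))
      rw [norm_smul, norm_of_nonneg hb] at h4
      have h5 : b * ‖y - c‖ ≤ 1 * r :=
        mul_le_mul (by linarith) (hsupp y h) (norm_nonneg _) zero_le_one
      linarith
  have hs := integral_rpow_mul_min_scale (a := σ + 5) (by linarith) (by linarith) (R := R / 2)
    (by linarith)
  rw [hm.mulC_eq h0 h2 hg x, norm_mul, norm_inv, norm_real, norm_of_nonneg
    dyadicConst_pos.le]
  simp only [mul_assoc]
  refine mul_le_mul_of_nonneg_left ?_ (inv_nonneg.2 dyadicConst_pos.le)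
  calc _ ≤ ∫ t in Ioi (0 : ℝ), (C * r * ∫ y, |g y|) *
        (t ^ (-(σ + 5)) * min 1 ((t / (R / 2)) ^ 8)) := by
        refine norm_integral_le_of_norm_le (hs.1.const_mul _) ?_
        filter_upwards [ae_restrict_mem measurableSet_Ioi] with t ht
        have ht : 0 < t := ht
        rw [norm_mul, norm_real, norm_of_nonneg (Real.rpow_nonneg ht.le _)]
        refine (mul_le_mul_of_nonneg_left (hinner t ht) (Real.rpow_nonneg ht.le _)).trans_eq ?_
        rw [show -(σ + 5) = (-σ - 4) - 1 by ring, Real.rpow_sub ht (-σ - 4) 1, Real.rpow_one]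
        ring
    _ = _ := by
      rw [integral_const_mul, hs.2, show 1 - (σ + 5) = -σ - 4 by ring,
        Real.div_rpow hR.le zero_le_two, show -σ - 4 = -(σ + 4) by ring,
        rpow_neg zero_le_two, div_inv_eq_mul]
      ring

lemma integrableOn_norm_rpow_ball (ha : -3 < a) (R : ℝ) :
    IntegrableOn (fun z : E3 => ‖z‖ ^ a) (ball 0 R) := by
  rw [integrableOn_fun_norm_addHaar volume (f := fun r : ℝ => r ^ a)]
  rcases le_or_gt R 0 with hR | hR
  · simp [Ioo_eq_empty (not_lt.2 hR)]
  · refine ((intervalIntegral.integrableOn_Ioo_rpow_iff hR).2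
      (show -1 < a + 2 by linarith)).congr_fun (fun y hy => ?_) measurableSet_Ioo
    simp only [finrank_euclideanSpace, Fintype.card_fin]
    rw [rpow_add hy.1, mul_comm]
    norm_cast

/-- The integrable kernel `min(1,|z|) |z|^{-3-σ}` which dominates commutators of order `σ < 1`. -/
noncomputable def commKernel (σ : ℝ) (z : E3) : ℝ := min 1 ‖z‖ * ‖z‖ ^ (-σ - 3)

lemma commKernel_nonneg (σ : ℝ) (z : E3) : 0 ≤ commKernel σ z := by unfold commKernel; positivity

lemma measurable_commKernel (σ : ℝ) : Measurable (commKernel σ) :=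
  (measurable_const.min measurable_norm).mul (measurable_norm.pow_const _)

lemma rpow_norm_le_of_one_le (hσ : -3 ≤ σ) (hz : 1 ≤ ‖z‖) :
    ‖z‖ ^ (-σ - 3) ≤ 2 ^ (σ + 3) * (1 + ‖z‖) ^ (-(σ + 3)) := by
  have : ((1 + ‖z‖) / 2) ^ (-(σ + 3)) = 2 ^ (σ + 3) * (1 + ‖z‖) ^ (-(σ + 3)) := by
    rw [Real.div_rpow (by positivity) zero_le_two, rpow_neg zero_le_two, div_inv_eq_mul, mul_comm]
  rw [← this, show -σ - 3 = -(σ + 3) by ring]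
  exact rpow_le_rpow_of_nonpos (by positivity) (by linarith) (by linarith)

lemma integrable_commKernel (h0 : 0 < σ) (h1 : σ < 1) : Integrable (commKernel σ) := by
  rw [← integrableOn_univ, ← union_compl_self (ball (0 : E3) 1)]
  refine IntegrableOn.union ?_ ?_
  · refine Integrable.mono' (integrableOn_norm_rpow_ball (a := -σ - 2) (by linarith) 1)
      (measurable_commKernel σ).aestronglyMeasurable (ae_of_all _ fun z => ?_)
    rw [norm_of_nonneg (commKernel_nonneg σ z), commKernel]
    by_cases hz : z = 0
    · subst hz
      simp only [norm_zero, min_eq_right zero_le_one, zero_mul]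
      positivity
    · rw [show -σ - 2 = 1 + (-σ - 3) by ring, rpow_add (norm_pos_iff.2 hz), Real.rpow_one]
      gcongr
      exact min_le_right _ _
  · have hJ : Integrable (fun z : E3 => (2 : ℝ) ^ (σ + 3) * (1 + ‖z‖) ^ (-(σ + 3))) :=
      (integrable_one_add_norm (by simp; linarith)).const_mul _
    refine hJ.integrableOn.mono' (measurable_commKernel σ).aestronglyMeasurable ?_
    filter_upwards [ae_restrict_mem measurableSet_ball.compl] with z hz
    rw [norm_of_nonneg (commKernel_nonneg σ z), commKernel, min_eq_left (by simpa using hz),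
      one_mul]
    exact rpow_norm_le_of_one_le (by linarith) (by simpa using hz)

/-- A function that is bounded and Lipschitz, in quantitative form. -/
def BddLip (L : ℝ) (g : E3 → ℝ) : Prop := ∀ x y, |g x - g y| ≤ L * min 1 ‖x - y‖

lemma BddLip.of_bounds (hd : Differentiable ℝ g) {B : ℝ} (hA : ∀ x, |g x| ≤ A)
    (hB : ∀ x, ‖fderiv ℝ g x‖ ≤ B) : BddLip (2 * A + B) g := fun x y => by
  have hA0 := (abs_nonneg _).trans (hA x)
  have hB0 := (norm_nonneg _).trans (hB x)
  have h1 : |g x - g y| ≤ B * ‖x - y‖ := Convex.norm_image_sub_le_of_norm_fderiv_le (fun z _ =>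
    hd z) (fun z _ => hB z) convex_univ (mem_univ y) (mem_univ x)
  have h2 : |g x - g y| ≤ 2 * A := (abs_sub _ _).trans (by linarith [hA x, hA y])
  rcases le_total 1 ‖x - y‖ with h | h
  · rw [min_eq_left h]; linarith
  · rw [min_eq_right h]; nlinarith [norm_nonneg (x - y)]

lemma IsTest.exists_bounds (hg : IsTest Ω g) : ∃ A B : ℝ, (∀ x, |g x| ≤ A) ∧ ∀ x, ‖fderiv ℝ g x‖ ≤
    B := by
  obtain ⟨A, hA⟩ := hg.2.1.exists_bound_of_continuous hg.1.continuous
  obtain ⟨B, hB⟩ := (hg.2.1.fderiv (𝕜 := ℝ)).exists_bound_of_continuous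
    (hg.1.continuous_fderiv (by simp))
  exact ⟨A, B, hA, hB⟩

lemma IsTest.differentiable (hg : IsTest Ω g) : Differentiable ℝ g := hg.1.differentiable (by simp)

lemma IsTest.exists_bddLip (hg : IsTest Ω g) : ∃ L, 0 ≤ L ∧ BddLip L g := by
  obtain ⟨A, B, hA, hB⟩ := hg.exists_bounds
  exact ⟨2 * A + B, by linarith [(abs_nonneg _).trans (hA 0), (norm_nonneg _).trans (hB 0)],
    BddLip.of_bounds hg.differentiable hA hB⟩

/-- A homogeneous multiplier of order `σ ∈ (0, 1)` as a singular integral of first differences. -/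
lemma IsHomSymbol.mulC_eq_diff (hm : IsHomSymbol σ m) (h0 : 0 < σ) (h1 : σ < 1) (hg : IsTest Ω g)
    (x : E3) : Integrable (fun y => hm.kernel (x - y) * ((g y - g x : ℝ) : ℂ)) ∧ mulC m g x =
    ∫ y, hm.kernel (x - y) * ((g y - g x : ℝ) : ℂ) := by
  obtain ⟨L, hL, hLip⟩ := hg.exists_bddLip
  have hgc : Integrable (fun y => (g y : ℂ)) :=
    (hg.1.continuous.integrable_of_hasCompactSupport hg.2.1).ofReal
  have hi : Integrable (fun y => ‖x - y‖ ^ (-σ - 3) * |g y - g x|) := by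
    refine (((integrable_commKernel h0 h1).comp_sub_left x).const_mul L).mono' ?_
      (ae_of_all _ fun y => ?_)
    · exact (((measurable_const.sub measurable_id).norm.pow_const _).mul
        (hg.measurable.sub_const _).norm).aestronglyMeasurable
    · rw [norm_of_nonneg (by positivity), commKernel, abs_sub_comm]
      calc _ ≤ ‖x - y‖ ^ (-σ - 3) * (L * min 1 ‖x - y‖) := by gcongr; exact hLip x y
        _ = _ := by ring
  have hk := hm.kernel_fubini h0.le (by linarith) (hg.measurable.sub_const (g x)) x hi
  refine ⟨hk.1, ?_⟩
  rw [← hk.2, hm.mulC_eq h0.le (by linarith) hg x]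
  congr 1
  refine setIntegral_congr_fun measurableSet_Ioi fun t ht => ?_
  congr 1
  have i1 := ((integrable_comp_smul_iff volume hm.piece (inv_ne_zero ht.ne')).2
    hm.piece.integrable).comp_sub_left x
  obtain ⟨B, hB⟩ := hm.piece.decay 0 0
  have i2 : Integrable (fun y => hm.piece (t⁻¹ • (x - y)) * (g y)) := hgc.bdd_mul
    (hm.piece.continuous.comp (by fun_prop)).aestronglyMeasurable (ae_of_all _ fun y =>
    by simpa using hB.2 (t⁻¹ • (x - y)))
  have e : ∫ y, hm.piece (t⁻¹ • (x - y)) = 0 := by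
    rw [integral_sub_left_eq_self (fun z => hm.piece (t⁻¹ • z)) volume x,
      Measure.integral_comp_smul, hm.integral_piece, smul_zero]
  simp only [Complex.ofReal_sub, mul_sub]
  rw [integral_sub i2 (i1.mul_const _), integral_mul_const, e, zero_mul, sub_zero]

/-- On `L¹ ∩ L²` the `L²` Fourier transform is given by the Fourier integral. -/
lemma fourier_toLp_ae_eq {f : E3 → ℂ} (h1 : Integrable f) (h2 : MemLp f 2) :
    (𝓕 (h2.toLp f) : Lp ℂ 2 (volume : Measure E3)) =ᵐ[volume] 𝓕 f := by
  have hc : Continuous (𝓕 f) := VectorFourier.fourierIntegral_continuous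
    continuous_fourierChar (by simpa using continuous_inner) h1
  have hL : LocallyIntegrable (𝓕 (h2.toLp f) : Lp ℂ 2 (volume : Measure E3)) :=
    (Lp.memLp _).locallyIntegrable (by norm_num)
  refine ae_eq_of_integral_contDiff_smul_eq hL hc.locallyIntegrable fun g hg hgs => ?_
  have hT : IsTest univ g := ⟨hg, hgs, subset_univ _⟩
  have e1 := Lp.toTemperedDistribution_apply (𝓕 (h2.toLp f)) hT.schwartz
  rw [← Lp.fourier_toTemperedDistribution_eq, TemperedDistribution.fourier_apply,
    Lp.toTemperedDistribution_apply] at e1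
  have e2 := VectorFourier.integral_fourierIntegral_smul_eq_flip (μ := volume) (L := innerₗ E3)
    continuous_fourierChar (by simpa using continuous_inner) hT.schwartz.integrable h1
  have hflip : (innerₗ E3).flip = innerₗ E3 := by ext a b; simp
  rw [hflip] at e2
  have e3 : ∫ x, g x • (𝓕 (h2.toLp f)) x = ∫ x, hT.schwartz x • (𝓕 (h2.toLp f)) x := rfl
  rw [e3, ← e1]
  have e4 : ∫ x, (𝓕 hT.schwartz) x • (h2.toLp f) x =
    ∫ x, (𝓕 hT.schwartz) x • f x := by
    refine integral_congr_ae ?_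
    filter_upwards [h2.coeFn_toLp] with x hx
    rw [hx]
  rwa [e4, SchwartzMap.fourier_coe]

/-- Plancherel's identity on `L¹ ∩ L²`. -/
lemma eLpNorm_fourier {f : E3 → ℂ} (h1 : Integrable f) (h2 : MemLp f 2) :
    eLpNorm (𝓕 f) 2 volume = eLpNorm f 2 volume := by
  rw [← eLpNorm_congr_ae (fourier_toLp_ae_eq h1 h2), ← eLpNorm_congr_ae h2.coeFn_toLp]
  have := Lp.norm_fourier_eq (h2.toLp f)
  rw [Lp.norm_def, Lp.norm_def] at this
  exact (ENNReal.toReal_eq_toReal_iff' (Lp.eLpNorm_ne_top _) (Lp.eLpNorm_ne_top _)).1 this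

lemma eLpNorm_fourierInv {f : E3 → ℂ} (h1 : Integrable f) (h2 : MemLp f 2) :
    eLpNorm (𝓕⁻ f) 2 volume = eLpNorm f 2 volume := by
  have hc : Continuous (𝓕 f) := VectorFourier.fourierIntegral_continuous
    continuous_fourierChar (by simpa using continuous_inner) h1
  rw [← eLpNorm_fourier h1 h2,
    (by ext x; rw [Real.fourierInv_eq_fourier_neg]; rfl : 𝓕⁻ f = (𝓕 f) ∘ (fun x => -x))]
  exact eLpNorm_comp_measurePreserving hc.aestronglyMeasurable
    (Measure.measurePreserving_neg volume)

lemma IsTest.memLp_ftR (hg : IsTest Ω g) : MemLp (ftR g) 2 := by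
  rw [← hg.fourier_schwartz]
  exact (𝓕 hg.schwartz).memLp 2

lemma IsTest.integrable_ftR (hg : IsTest Ω g) : Integrable (ftR g) := by
  rw [← hg.fourier_schwartz]
  exact (𝓕 hg.schwartz).integrable

lemma IsTest.eLpNorm_ftR (hg : IsTest Ω g) : eLpNorm (ftR g) 2 volume = eLpNorm g 2 volume := by
  have h := eLpNorm_fourier hg.schwartz.integrable (hg.schwartz.memLp 2)
  change eLpNorm (ftR g) 2 volume = _ at h
  rw [h]
  exact eLpNorm_congr_norm_ae (ae_of_all _ fun x => norm_real (g x))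

lemma IsTest.fourierInv_ftR (hg : IsTest Ω g) (x : E3) : 𝓕⁻ (ftR g) x = (g x : ℂ) :=
  congrFun (hg.ofReal_contDiff.continuous.fourierInv_fourier_eq hg.schwartz.integrable
  hg.integrable_ftR) x

/-- A multiplier with bounded symbol is bounded on `L²`. -/
lemma eLpNorm_mulC_le (hm : Measurable m) (hC : ∀ ξ, |m ξ| ≤ C) (hg : IsTest Ω g) :
    eLpNorm (mulC m g) 2 volume ≤ ofReal C * eLpNorm g 2 volume := by
  have hmm : AEStronglyMeasurable (fun ξ => (m ξ : ℂ)) volume :=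
    (measurable_ofReal.comp hm).aestronglyMeasurable
  have hb : ∀ ξ, ‖(m ξ : ℂ)‖ ≤ C := fun ξ => by simpa using hC ξ
  have h1 : Integrable (fun ξ => (m ξ) * ftR g ξ) := hg.integrable_ftR.bdd_mul hmm (ae_of_all _ hb)
  have h2 : MemLp (fun ξ => (m ξ : ℂ) * ftR g ξ) 2 :=
    hg.memLp_ftR.of_le_mul (c := C) (hmm.mul hg.continuous_ftR.aestronglyMeasurable)
      (ae_of_all _ fun ξ => by
        rw [norm_mul]; exact mul_le_mul_of_nonneg_right (hb ξ) (norm_nonneg _))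
  have : mulC m g = 𝓕⁻ (fun ξ => (m ξ) * ftR g ξ) := rfl
  rw [this, eLpNorm_fourierInv h1 h2, ← hg.eLpNorm_ftR]
  exact eLpNorm_le_mul_eLpNorm_of_ae_le_mul (ae_of_all _ fun ξ => by
    rw [norm_mul]; exact mul_le_mul_of_nonneg_right (hb ξ) (norm_nonneg _)) 2

/-- The Cauchy-Schwarz inequality for lower Lebesgue integrals. -/
lemma lintegral_mul_sq_le {f g : α → ℝ≥0∞} (hf : AEMeasurable f μ) (hg : AEMeasurable g μ) :
    (∫⁻ a, f a * g a ∂μ) ^ 2 ≤ (∫⁻ a, f a ^ 2 ∂μ) * ∫⁻ a, g a ^ 2 ∂μ := by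
  have h := ENNReal.lintegral_mul_le_Lp_mul_Lq μ Real.HolderConjugate.two_two hf hg
  simp only [Pi.mul_apply, ENNReal.rpow_two] at h
  calc _ ≤ ((∫⁻ a, f a ^ 2 ∂μ) ^ (1 / 2 : ℝ) * (∫⁻ a, g a ^ 2 ∂μ) ^ (1 / 2 : ℝ)) ^ 2 := by gcongr
    _ = _ := by
      rw [mul_pow, ← rpow_natCast, ← rpow_natCast, ← rpow_mul, ← rpow_mul]
      norm_num

lemma eLpNorm_two_sq (f : α → F) (μ : Measure α) : eLpNorm f 2 μ ^ 2 = ∫⁻ x, ‖f x‖ₑ ^ 2 ∂μ := by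
  simpa using eLpNorm_nnreal_pow_eq_lintegral two_ne_zero

lemma lintegral_norm_rpow_ball (hA : 0 < A) :
    ∫⁻ ξ in ball (0 : E3) A, ofReal (‖ξ‖ ^ (-(3 / 2) : ℝ)) =
    ofReal ((∫ ξ in ball (0 : E3) 1, ‖ξ‖ ^ (-(3 / 2) : ℝ)) * A ^ (3 / 2 : ℝ)) := by
  rw [← ofReal_integral_eq_lintegral_ofReal (integrableOn_norm_rpow_ball (by norm_num) A)
    (ae_of_all _ fun ξ => by positivity)]
  congr 1
  have h := Measure.setIntegral_comp_smul_of_pos volume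
    (fun ξ : E3 => ‖ξ‖ ^ (-(3 / 2) : ℝ)) (ball 0 1) hA
  rw [smul_ball hA.ne', smul_zero, mul_one, norm_of_nonneg hA.le, finrank_euclideanSpace,
    Fintype.card_fin, smul_eq_mul, eq_inv_mul_iff_mul_eq₀ (by positivity)] at h
  rw [← h]
  simp only [norm_smul, norm_of_nonneg hA.le]
  have : ∀ ξ : E3, (A * ‖ξ‖) ^ (-(3 / 2) : ℝ) = A ^ (-(3 / 2) : ℝ) * ‖ξ‖ ^ (-(3 / 2) : ℝ) :=
    fun ξ => mul_rpow hA.le (norm_nonneg _)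
  simp only [this]
  rw [integral_const_mul, ← mul_assoc, mul_comm]
  congr 1
  rw [← Real.rpow_natCast, ← rpow_add hA]
  norm_num

/-- The critical Sobolev inequality `Ḣ^{3/4} ⊂ L⁴`, by splitting into frequencies below and above
a threshold that depends on the level of `g`. -/
lemma exists_sobolev_homogeneous : ∃ C : ℝ, 0 < C ∧ ∀ (Ω : Set E3) (g : E3 → ℝ), IsTest Ω g →
    ∀ N : ℝ, 0 < N → ∫⁻ ξ, ofReal (‖ξ‖ ^ (3 / 2 : ℝ)) * ‖ftR g ξ‖ₑ ^ 2 ≤ ofReal N →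
    ∫⁻ x, ‖g x‖ₑ ^ 4 ≤ ofReal (C * N ^ 2) := by
  set κ := ∫ ξ in ball (0 : E3) 1, ‖ξ‖ ^ (-(3 / 2) : ℝ) with hκ
  have hκ0 : 0 ≤ κ := integral_nonneg fun ξ => by positivity
  refine ⟨64 * (κ + 1), by positivity, fun Ω g hg N hN hI => ?_⟩
  set c := 4 * (κ + 1) * N with hc
  have hc0 : 0 < c := by positivity
  have hmF := hg.continuous_ftR.measurable
  -- Chebyshev's inequality for the high frequencies of `g`, the low ones being at most `l / 2`
  have hdist : ∀ l : ℝ, 0 < l → volume {x | l < ‖g x‖} ≤ ofReal (4 / l ^ 2) *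
    ∫⁻ ξ, {ξ : E3 | l ^ 2 ≤ c * ‖ξ‖ ^ (3 / 2 : ℝ)}.indicator (fun ξ => ‖ftR g ξ‖ₑ ^ 2) ξ := by
    intro l hl
    set A := (l ^ 2 / c) ^ (2 / 3 : ℝ) with hA
    have hA0 : 0 < A := by positivity
    have hA' : A ^ (3 / 2 : ℝ) = l ^ 2 / c := by
      rw [hA, ← Real.rpow_mul (by positivity)]
      norm_num
    have hset : {ξ : E3 | l ^ 2 ≤ c * ‖ξ‖ ^ (3 / 2 : ℝ)} = (ball (0 : E3) A)ᶜ := by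
      ext ξ
      simp only [mem_ofPred_eq, mem_compl_iff, mem_ball, dist_zero_right, not_lt]
      rw [← div_le_iff₀' hc0, ← hA', Real.rpow_le_rpow_iff hA0.le (norm_nonneg _) (by norm_num)]
    set S := ball (0 : E3) A
    have hSm : MeasurableSet S := measurableSet_ball
    set gl := 𝓕⁻ (S.indicator (ftR g)) with hgl
    set gh := 𝓕⁻ (Sᶜ.indicator (ftR g)) with hgh
    have hlow : ∀ x, ‖gl x‖ ≤ l / 2 := fun x => by
      have h1 : ‖gl x‖ₑ ≤ ∫⁻ ξ in S, ‖ftR g ξ‖ₑ := by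
        rw [hgl, fourierInv_eq]
        refine (enorm_integral_le_lintegral_enorm _).trans ?_
        rw [← lintegral_indicator hSm]
        refine lintegral_mono fun ξ => ?_
        rw [← ofReal_norm, Circle.norm_smul, ofReal_norm]
        by_cases h : ξ ∈ S <;> simp [h]
      have h2 : ‖gl x‖ₑ ^ 2 ≤ ofReal ((l / 2) ^ 2) := by
        have e : ∫⁻ ξ in S, ‖ftR g ξ‖ₑ = ∫⁻ ξ in S, ofReal (‖ξ‖ ^ (-(3 / 4) : ℝ)) *
          (ofReal (‖ξ‖ ^ (3 / 4 : ℝ)) * ‖ftR g ξ‖ₑ) := by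
          refine lintegral_congr_ae ?_
          filter_upwards [ae_restrict_of_ae
            (by simp [ae_iff, measure_singleton] : ∀ᵐ ξ : E3, ξ ≠ 0)] with ξ hξ
          rw [← mul_assoc, ← ofReal_mul (by positivity), ← rpow_add (norm_pos_iff.2 hξ)]
          simp
        have m1 : ∀ a : ℝ, Measurable (fun ξ : E3 => ofReal (‖ξ‖ ^ a)) :=
          fun a => (measurable_norm.pow_const a).ennreal_ofReal
        have hcs := lintegral_mul_sq_le (μ := volume.restrict S)
          (m1 (-(3 / 4))).aemeasurable ((m1 (3 / 4)).mul hmF.enorm).aemeasurable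
        have e1 : ∀ (a : ℝ) (ξ : E3), ofReal (‖ξ‖ ^ a) ^ 2 =
          ofReal (‖ξ‖ ^ (a * 2)) := fun a ξ => by
          rw [← ofReal_pow (by positivity), ← Real.rpow_natCast, ← Real.rpow_mul (norm_nonneg _)]
          norm_num
        simp only [Pi.mul_apply, mul_pow, e1] at hcs
        calc _ ≤ (∫⁻ ξ in S, ‖ftR g ξ‖ₑ) ^ 2 := by gcongr
          _ ≤ (∫⁻ ξ in S, ofReal (‖ξ‖ ^ (-(3 / 4) * 2 : ℝ))) *
            ∫⁻ ξ in S, ofReal (‖ξ‖ ^ (3 / 4 * 2 : ℝ)) * ‖ftR g ξ‖ₑ ^ 2 := by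
            rw [e]; exact hcs
          _ ≤ ofReal (κ * A ^ (3 / 2 : ℝ)) * ofReal N := by
            have e2 := lintegral_norm_rpow_ball hA0
            rw [← hκ] at e2
            simp only [show (-(3 / 4) * 2 : ℝ) = -(3 / 2) by norm_num,
              show (3 / 4 * 2 : ℝ) = 3 / 2 by norm_num]
            rw [e2]
            gcongr
            exact (setLIntegral_le_lintegral _ _).trans hI
          _ ≤ _ := by
            rw [← ofReal_mul (by positivity), hA']
            apply ofReal_le_ofReal
            rw [hc, div_pow, show κ * (l ^ 2 / (4 * (κ + 1) * N)) * N = (κ / (κ + 1)) *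
              (l ^ 2 / 2 ^ 2) by
              field_simp; ring]
            have : κ / (κ + 1) ≤ 1 := (div_le_one (by positivity)).2 (by linarith)
            nlinarith [sq_nonneg l]
      rw [← ofReal_norm, ← ofReal_pow (norm_nonneg _), ofReal_le_ofReal_iff (by positivity)] at h2
      exact le_of_sq_le_sq h2 (by positivity)
    have hsplit : ∀ x, (g x) = gl x + gh x := fun x => by
      have hi1 := hg.integrable_ftR.indicator hSm
      rw [← hg.fourierInv_ftR x, hgl, hgh, fourierInv_eq, fourierInv_eq,
        fourierInv_eq, ← integral_add]
      · congr 1; ext ξ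
        rw [← smul_add, indicator_self_add_compl_apply]
      · simpa [inner_neg_right] using (Real.fourierIntegral_convergent_iff (-x)).2 hi1
      · simpa using (Real.fourierIntegral_convergent_iff (-x)).2
          (hg.integrable_ftR.indicator hSm.compl)
    have hsub : {x | l < ‖g x‖} ⊆ {x | ofReal (l / 2) ^ 2 ≤ ‖gh x‖ₑ ^ 2} := fun x hx => by
      simp only [mem_ofPred_eq] at hx ⊢
      gcongr
      rw [← ofReal_norm]
      apply ofReal_le_ofReal
      have h3 : ‖(g x : ℂ)‖ ≤ ‖gl x‖ + ‖gh x‖ := by rw [hsplit x]; exact norm_add_le _ _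
      rw [norm_real] at h3
      linarith [hlow x]
    have hgh_meas : Measurable gh := by
      have : Continuous gh := by
        have hc := VectorFourier.fourierIntegral_continuous (L := innerₗ E3) continuous_fourierChar
          (by simpa using continuous_inner) (hg.integrable_ftR.indicator hSm.compl)
        have e : gh = (𝓕 (Sᶜ.indicator (ftR g))) ∘ (fun x => -x) := by
          ext x; rw [hgh, Real.fourierInv_eq_fourier_neg]; rfl
        rw [e]
        exact Continuous.comp hc continuous_neg
      exact this.measurable
    have hpl : ∫⁻ x, ‖gh x‖ₑ ^ 2 = ∫⁻ ξ, Sᶜ.indicator (fun ξ => ‖ftR g ξ‖ₑ ^ 2) ξ := by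
      rw [← eLpNorm_two_sq, hgh, eLpNorm_fourierInv (hg.integrable_ftR.indicator hSm.compl)
        (hg.memLp_ftR.indicator hSm.compl), eLpNorm_two_sq]
      congr 1; ext ξ
      by_cases h : ξ ∈ Sᶜ
      · rw [indicator_of_mem h, indicator_of_mem h]
      · rw [indicator_of_notMem h, indicator_of_notMem h]; simp
    rw [hset, ← hpl]
    refine (measure_mono hsub).trans
      ((meas_ge_le_lintegral_div (hgh_meas.enorm.pow_const 2).aemeasurable ?_ ?_).trans ?_)
    · simpa using hl
    · finiteness
    · rw [ENNReal.div_eq_inv_mul, ← ofReal_pow (by positivity),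
        ← ENNReal.ofReal_inv_of_pos (by positivity)]
      gcongr
      rw [div_pow, inv_div]
      norm_num
  have hlc := lintegral_rpow_eq_lintegral_meas_lt_mul (μ := volume) (ae_of_all _ fun x =>
    norm_nonneg _) hg.measurable.norm.aemeasurable (p := 4) (by norm_num)
  have e0 : ∫⁻ x, ‖g x‖ₑ ^ 4 = ∫⁻ x, ofReal (‖g x‖ ^ (4 : ℝ)) := by
    refine lintegral_congr fun x => ?_
    rw [← ofReal_norm, ← ofReal_pow (norm_nonneg _), ← Real.rpow_natCast]
    norm_num
  rw [e0, hlc]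
  have hset_meas : MeasurableSet {p : ℝ × E3 | p.1 ^ 2 ≤ c * ‖p.2‖ ^ (3 / 2 : ℝ)} :=
    measurableSet_le (measurable_fst.pow_const 2)
      ((measurable_snd.norm.pow_const _).const_mul c)
  calc _ ≤ ofReal 4 * ∫⁻ l in Ioi (0 : ℝ), ∫⁻ ξ, ofReal (4 * l) *
        {p : ℝ × E3 | p.1 ^ 2 ≤ c * ‖p.2‖ ^ (3 / 2 : ℝ)}.indicator
          (fun p => ‖ftR g p.2‖ₑ ^ 2) (l, ξ) := by
        gcongr 1
        refine setLIntegral_mono' measurableSet_Ioi fun l hl =>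
          (mul_le_mul_left (hdist l hl) _).trans ?_
        rw [lintegral_ofReal_mul, mul_right_comm,
          ← ofReal_mul (by positivity)]
        have : 4 / l ^ 2 * l ^ ((4 : ℝ) - 1) = 4 * l := by
          rw [show ((4 : ℝ) - 1) = ((3 : ℕ)) by norm_num, Real.rpow_natCast]
          field_simp
        rw [this]
        exact le_of_eq rfl
    _ = ofReal 4 * ∫⁻ ξ, ∫⁻ l in Ioi (0 : ℝ), ofReal (4 * l) *
      {p : ℝ × E3 | p.1 ^ 2 ≤ c * ‖p.2‖ ^ (3 / 2 : ℝ)}.indicator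
        (fun p => ‖ftR g p.2‖ₑ ^ 2) (l, ξ) := by
      congr 1
      apply lintegral_lintegral_swap
      apply Measurable.aemeasurable
      exact Measurable.mul (by fun_prop) (((hmF.comp measurable_snd).enorm.pow_const 2).indicator
        hset_meas)
    _ ≤ ofReal 4 * ∫⁻ ξ, ofReal (4 * c) *
      (ofReal (‖ξ‖ ^ (3 / 2 : ℝ)) * ‖ftR g ξ‖ₑ ^ 2) := by
        gcongr with ξ
        set b := c * ‖ξ‖ ^ (3 / 2 : ℝ) with hb
        calc _ ≤ ∫⁻ l in Ioi (0 : ℝ), (Ioc 0 (√b)).indicator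
              (fun _ => ofReal (4 * √b) * ‖ftR g ξ‖ₑ ^ 2) l := by
              refine setLIntegral_mono' measurableSet_Ioi fun l (hl : 0 < l) => ?_
              by_cases h : l ^ 2 ≤ b
              · have h4 := Real.le_sqrt_of_sq_le h
                rw [indicator_of_mem (show l ∈ Ioc 0 (√b) from ⟨hl, h4⟩)]
                have h5 : (l, ξ) ∈ {p : ℝ × E3 | p.1 ^ 2 ≤ c * ‖p.2‖ ^ (3 / 2 : ℝ)} := h
                rw [indicator_of_mem h5]
                gcongr
              · have h5 : (l, ξ) ∉ {p : ℝ × E3 | p.1 ^ 2 ≤ c * ‖p.2‖ ^ (3 / 2 : ℝ)} := h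
                rw [indicator_of_notMem h5, mul_zero]
                exact zero_le
          _ ≤ _ := by
            refine (setLIntegral_le_lintegral _ _).trans ?_
            rw [lintegral_indicator_const measurableSet_Ioc, Real.volume_Ioc, sub_zero,
              mul_right_comm, ← ofReal_mul (by positivity), ← mul_assoc, ← ofReal_mul
              (by positivity), mul_assoc 4, Real.mul_self_sqrt (by positivity), hb, mul_assoc 4]
    _ ≤ ofReal 4 * (ofReal (4 * c) * ofReal N) := by
      rw [lintegral_ofReal_mul]
      gcongr
    _ = _ := by
      rw [← ofReal_mul (by positivity), ← ofReal_mul (by positivity), hc]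
      congr 1; ring

/-- The symbol of `Λ^σ`. -/
noncomputable def lamSym (σ : ℝ) (ξ : E3) : ℝ := (2 * π * ‖ξ‖) ^ σ

lemma isHomSymbol_lamSym (hσ : 0 < σ) : IsHomSymbol σ (lamSym σ) := isHomSymbol_lam σ hσ

lemma lam_eq_re (σ : ℝ) (g : E3 → ℝ) (x : E3) : lam σ g x = (mulC (lamSym σ) g x).re := rfl

/-- Plancherel's identity for `Λ^σ g`. -/
lemma lintegral_mulC_lamSym (h0 : 0 < σ) (h1 : σ ≤ 1) (hg : IsTest Ω g) :
    ∫⁻ x, ‖mulC (lamSym σ) g x‖ₑ ^ 2 = ∫⁻ ξ, ofReal (lamSym σ ξ ^ 2) * ‖ftR g ξ‖ₑ ^ 2 := by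
  have hm := isHomSymbol_lamSym h0
  have i1 := hm.integrable_mul_ftR h0.le (by linarith) hg
  obtain ⟨B, hB⟩ : ∃ B, ∀ ξ, ‖ftR g ξ‖ ≤ B := by
    obtain ⟨B, hB⟩ := (𝓕 hg.schwartz).decay 0 0
    rw [← hg.fourier_schwartz]
    exact ⟨B, fun z => by simpa using hB.2 z⟩
  obtain ⟨C, hC, hCb⟩ := hm.exists_bound
  have i2 : MemLp (fun ξ => (lamSym σ ξ) * ftR g ξ) 2 := by
    rw [memLp_two_iff_integrable_sq_norm i1.1]
    refine ((hg.integrable_rpow_mul_ftR (σ := 2 * σ) (by linarith) (by linarith)).const_mul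
      (C ^ 2 * B)).mono' (i1.1.norm.pow 2) (ae_of_all _ fun ξ => ?_)
    rw [norm_mul, norm_real, norm_of_nonneg (by positivity), mul_pow,
      norm_eq_abs, sq_abs]
    have h5 : (lamSym σ ξ) ^ 2 ≤ C ^ 2 * ‖ξ‖ ^ (2 * σ) := by
      rw [← sq_abs, mul_comm 2 σ, Real.rpow_mul (norm_nonneg _), rpow_two, ← mul_pow]
      gcongr
      exact hCb ξ
    calc _ ≤ (C ^ 2 * ‖ξ‖ ^ (2 * σ)) * (B * ‖ftR g ξ‖) := by
          rw [sq ‖ftR g ξ‖]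
          gcongr
          exact hB ξ
      _ = _ := by ring
  rw [← eLpNorm_two_sq]
  have : mulC (lamSym σ) g = 𝓕⁻ (fun ξ => (lamSym σ ξ) * ftR g ξ) := rfl
  rw [this, eLpNorm_fourierInv i1 i2, eLpNorm_two_sq]
  refine lintegral_congr fun ξ => ?_
  rw [enorm_mul, mul_pow]
  congr 1
  rw [← ofReal_norm, norm_real, ← ofReal_pow (norm_nonneg _), norm_eq_abs, sq_abs]

/-- The Sobolev inequality `‖g‖_{L⁴}² ≤ C (‖g‖_{L²}² + ‖Λ^s g‖_{L²}²)` for `s ≥ 3/4`. -/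
lemma exists_sobolev (hs : 3 / 4 ≤ s) (hs1 : s ≤ 1) :
    ∃ C : ℝ, 0 < C ∧ ∀ (Ω : Set E3) (g : E3 → ℝ), IsTest Ω g → ∫⁻ x, ‖g x‖ₑ ^ 4 ≤
    ofReal C * ((∫⁻ x, ‖g x‖ₑ ^ 2) + ∫⁻ x, ‖mulC (lamSym s) g x‖ₑ ^ 2) ^ 2 := by
  obtain ⟨C, hC, hS⟩ := exists_sobolev_homogeneous
  refine ⟨C, hC, fun Ω g hg => ?_⟩
  set I := (∫⁻ x, ‖g x‖ₑ ^ 2) + ∫⁻ x, ‖mulC (lamSym s) g x‖ₑ ^ 2 with hI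
  have hle : ∫⁻ ξ, ofReal (‖ξ‖ ^ (3 / 2 : ℝ)) * ‖ftR g ξ‖ₑ ^ 2 ≤ I := by
    rw [hI, lintegral_mulC_lamSym (by linarith) hs1 hg, ← eLpNorm_two_sq, ← hg.eLpNorm_ftR,
      eLpNorm_two_sq, ← lintegral_add_left (hg.continuous_ftR.measurable.enorm.pow_const 2)]
    refine lintegral_mono fun ξ => ?_
    rw [← one_add_mul]
    gcongr
    rw [← ofReal_one, ← ofReal_add zero_le_one (by positivity)]
    apply ofReal_le_ofReal
    rcases le_total ‖ξ‖ 1 with h | h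
    · have := Real.rpow_le_one (norm_nonneg ξ) h (show (0 : ℝ) ≤ 3 / 2 by norm_num)
      nlinarith [sq_nonneg (lamSym s ξ)]
    · have e : lamSym s ξ ^ 2 = (2 * π * ‖ξ‖) ^ (2 * s) := by
        rw [lamSym, mul_comm 2 s, Real.rpow_mul (by positivity), rpow_two]
      have h1 : ‖ξ‖ ^ (3 / 2 : ℝ) ≤ ‖ξ‖ ^ (2 * s) :=
        Real.rpow_le_rpow_of_exponent_le h (by linarith)
      have h2 : ‖ξ‖ ^ (2 * s) ≤ (2 * π * ‖ξ‖) ^ (2 * s) := Real.rpow_le_rpow (norm_nonneg _)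
        (by nlinarith [Real.pi_gt_three]) (by linarith)
      linarith
  rcases eq_or_ne I ⊤ with hT | hT
  · rw [hT]
    simp [hC]
  rcases eq_or_ne I 0 with h0 | h0
  · have : ∫⁻ x, ‖g x‖ₑ ^ 2 = 0 := by
      rw [hI] at h0
      exact (add_eq_zero.1 h0).1
    rw [lintegral_eq_zero_iff (hg.measurable.enorm.pow_const 2)] at this
    have h4 : ∫⁻ x, ‖g x‖ₑ ^ 4 = 0 := by
      rw [lintegral_eq_zero_iff (hg.measurable.enorm.pow_const 4)]
      filter_upwards [this] with x hx
      simpa using hx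
    rw [h4]
    exact zero_le
  · have := hS Ω g hg I.toReal (ENNReal.toReal_pos h0 hT) (by rwa [ofReal_toReal hT])
    rwa [ofReal_mul hC.le, ofReal_pow toReal_nonneg, ofReal_toReal hT] at this

/-- A weighted form of the Cauchy-Schwarz inequality. -/
lemma lintegral_weight_mul_sq_le {K g : α → ℝ≥0∞} (hK : AEMeasurable K μ) (hg : AEMeasurable g μ) :
    (∫⁻ a, K a * g a ∂μ) ^ 2 ≤ (∫⁻ a, K a ∂μ) * ∫⁻ a, K a * g a ^ 2 ∂μ := by
  have hh : ∀ a, K a = K a ^ (1 / 2 : ℝ) * K a ^ (1 / 2 : ℝ) := fun a => by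
    rw [← ENNReal.rpow_add_of_nonneg _ _ (by norm_num) (by norm_num)]; norm_num
  calc _ = (∫⁻ a, K a ^ (1 / 2 : ℝ) * (K a ^ (1 / 2 : ℝ) * g a) ∂μ) ^ 2 := by
        congr 1; refine lintegral_congr fun a => ?_
        rw [← mul_assoc, ← hh]
    _ ≤ _ := lintegral_mul_sq_le (hK.pow_const (1 / 2 : ℝ)) ((hK.pow_const (1 / 2 : ℝ)).mul hg)
    _ = _ := by
      congr 1
      · exact lintegral_congr fun a => by rw [sq, ← hh]
      · exact lintegral_congr fun a => by rw [mul_pow, sq (K a ^ (1 / 2 : ℝ)), ← hh]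

/-! ### The weight -/

/-- An integrable weight on `ℝ³` that dominates the tails of all kernels. -/
noncomputable def wt (z : E3) : ℝ := (1 + ‖z‖) ^ (-(15 / 4) : ℝ)

/-- The weight with values in `[0, ∞]`. -/
noncomputable def wtE (z : E3) : ℝ≥0∞ := ofReal (wt z)

lemma wt_pos (z : E3) : 0 < wt z := by unfold wt; positivity

lemma wt_le_one (z : E3) : wt z ≤ 1 :=
  Real.rpow_le_one_of_one_le_of_nonpos (by linarith [norm_nonneg z]) (by norm_num)

lemma continuous_wt : Continuous wt :=
  (continuous_const.add continuous_norm).rpow_const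
    fun z => Or.inl (by change (1 : ℝ) + ‖z‖ ≠ 0; positivity)

lemma measurable_wtE : Measurable wtE := continuous_wt.measurable.ennreal_ofReal

lemma integrable_wt : Integrable wt := integrable_one_add_norm (by simp; norm_num)

lemma lintegral_wtE_lt_top : ∫⁻ z, wtE z < ⊤ := by
  have h := integrable_wt.2
  rw [hasFiniteIntegral_iff_enorm] at h
  refine lt_of_le_of_lt (lintegral_mono fun z => ?_) h
  rw [wtE, ← ofReal_norm, norm_of_nonneg (wt_pos z).le]

/-- The weight is slowly varying. -/
lemma wt_le_mul {a b : E3} (hR : ‖a - b‖ ≤ R) : wt a ≤ (1 + R) ^ (15 / 4 : ℝ) * wt b := by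
  have hR0 := (norm_nonneg _).trans hR
  have h1 : 1 + ‖b‖ ≤ (1 + R) * (1 + ‖a‖) := by
    have := norm_sub_norm_le b a
    rw [norm_sub_rev] at this
    nlinarith [norm_nonneg a]
  have h3 : ((1 + R) * (1 + ‖a‖)) ^ (-(15 / 4) : ℝ) ≤ wt b :=
    rpow_le_rpow_of_nonpos (by have := norm_nonneg b; positivity) h1 (by norm_num)
  rw [mul_rpow (by positivity) (by have := norm_nonneg a; positivity)] at h3
  calc _ = (1 + R) ^ (15 / 4 : ℝ) * ((1 + R) ^ (-(15 / 4) : ℝ) * wt a) := by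
        rw [← mul_assoc, ← rpow_add (by positivity)]; norm_num
    _ ≤ _ := by gcongr; exact h3

lemma wtE_le_mul {a b : E3} (hR : ‖a - b‖ ≤ R) :
    wtE a ≤ ofReal ((1 + R) ^ (15 / 4 : ℝ)) * wtE b := by
  have hR0 := (norm_nonneg _).trans hR
  rw [wtE, wtE, ← ofReal_mul (by positivity)]
  exact ofReal_le_ofReal (wt_le_mul hR)

lemma one_le_mul_wtE {a : E3} (hR : ‖a‖ ≤ R) : 1 ≤ ofReal ((1 + R) ^ (15 / 4 : ℝ)) * wtE a := by
  simpa [wtE, wt] using wtE_le_mul (a := 0) (by simpa using hR)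

/-- The weighted `L²` energy `∫ wt(x - z) |f(x)|² dx`. -/
noncomputable def wtEnergy {F : Type*} [NormedAddCommGroup F] (f : E3 → F) (z : E3) : ℝ≥0∞ :=
  ∫⁻ x, wtE (x - z) * ‖f x‖ₑ ^ 2

lemma wtEnergy_le_mul (f : E3 → F) {z' : E3} (hR : ‖z - z'‖ ≤ R) :
    wtEnergy f z ≤ ofReal ((1 + R) ^ (15 / 4 : ℝ)) * wtEnergy f z' := by
  rw [wtEnergy, wtEnergy, ← lintegral_ofReal_mul]
  refine lintegral_mono fun x => ?_
  rw [← mul_assoc]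
  gcongr
  exact wtE_le_mul (by rwa [show x - z - (x - z') = -(z - z') by abel, norm_neg])

lemma wtEnergy_lt_top {f : E3 → F} (h : wtEnergy f z < ⊤) (z' : E3) : wtEnergy f z' < ⊤ :=
  lt_of_le_of_lt (wtEnergy_le_mul f le_rfl) (by finiteness)

lemma setLIntegral_closedBall_le_wtEnergy (f : E3 → F) (z : E3) (R : ℝ) :
    ∫⁻ x in closedBall z R, ‖f x‖ₑ ^ 2 ≤ ofReal ((1 + R) ^ (15 / 4 : ℝ)) * wtEnergy f z := by
  rw [wtEnergy, ← lintegral_ofReal_mul]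
  refine le_trans (setLIntegral_mono' measurableSet_closedBall fun x hx => ?_)
    (setLIntegral_le_lintegral (closedBall z R) _)
  rw [← mul_assoc]
  have := one_le_mul_wtE (by simpa [dist_eq_norm] using hx)
  calc _ = 1 * ‖f x‖ₑ ^ 2 := (one_mul _).symm
    _ ≤ _ := by gcongr

/-- The commutator kernel with values in `[0, ∞]`. -/
noncomputable def commKernelE (σ : ℝ) (z : E3) : ℝ≥0∞ := ofReal (commKernel σ z)

lemma measurable_commKernelE (σ : ℝ) : Measurable (commKernelE σ) :=
  (measurable_commKernel σ).ennreal_ofReal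

lemma commKernel_neg (σ : ℝ) (z : E3) : commKernel σ (-z) = commKernel σ z := by simp [commKernel]

lemma lintegral_commKernelE_lt_top (h0 : 0 < σ) (h1 : σ < 1) : ∫⁻ z, commKernelE σ z < ⊤ := by
  have h := (integrable_commKernel h0 h1).2
  rw [hasFiniteIntegral_iff_enorm] at h
  refine lt_of_le_of_lt (lintegral_mono fun z => ?_) h
  rw [commKernelE, ← ofReal_norm, norm_of_nonneg (commKernel_nonneg σ z)]

lemma commKernelE_le_wtE (h0 : 3 / 4 ≤ σ) (hz : 1 ≤ ‖z‖) :
    commKernelE σ z ≤ ofReal (2 ^ (σ + 3)) * wtE z := by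
  rw [commKernelE, wtE, ← ofReal_mul (by positivity)]
  apply ofReal_le_ofReal
  rw [commKernel, min_eq_left hz, one_mul]
  refine (rpow_norm_le_of_one_le (by linarith) hz).trans ?_
  gcongr
  exact Real.rpow_le_rpow_of_exponent_le (by linarith) (by linarith)

/-- The part of the commutator kernel in which one of the two points lies in the ball `B_R(z)`. -/
noncomputable def commKernelOn (σ : ℝ) (z : E3) (R : ℝ) (x y : E3) : ℝ≥0∞ :=
  commKernelE σ (x - y) * {p : E3 × E3 | p.1 ∈ closedBall z R ∨
    p.2 ∈ closedBall z R}.indicator 1 (x, y)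

lemma measurable_commKernelOn (σ : ℝ) (z : E3) (R : ℝ) :
    Measurable (fun p : E3 × E3 => commKernelOn σ z R p.1 p.2) :=
      ((measurable_commKernelE σ).comp (measurable_fst.sub measurable_snd)).mul
      (measurable_one.indicator ((measurable_fst measurableSet_closedBall).union
      (measurable_snd measurableSet_closedBall)))

lemma commKernelOn_le (σ : ℝ) (z : E3) (R : ℝ) (x y : E3) :
    commKernelOn σ z R x y ≤ commKernelE σ (x - y) :=
  mul_le_of_le_one_right' (indicator_le_self' (fun _ _ => zero_le) _)

lemma commKernelOn_of_mem (h : x ∈ closedBall z R ∨ y ∈ closedBall z R) :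
    commKernelOn σ z R x y = commKernelE σ (x - y) := by
  have h' : (x, y) ∈ {p : E3 × E3 | p.1 ∈ closedBall z R ∨ p.2 ∈ closedBall z R} := h
  rw [commKernelOn, indicator_of_mem h', Pi.one_apply, mul_one]

lemma commKernelOn_of_notMem (hx : x ∉ closedBall z R) (hy : y ∉ closedBall z R) :
    commKernelOn σ z R x y = 0 := by
  rw [commKernelOn, indicator_of_notMem (fun h => h.elim hx hy), mul_zero]

lemma exists_lintegral_commKernelOn_le (h0 : 3 / 4 ≤ σ) (h1 : σ < 1) (R : ℝ) :
    ∃ C : ℝ≥0∞, C < ⊤ ∧ ∀ z x : E3, ∫⁻ y, commKernelOn σ z R x y ≤ C * wtE (x - z) := by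
  have hIt := lintegral_commKernelE_lt_top (by linarith) h1
  have hVt : volume (closedBall (0 : E3) R) < ⊤ := measure_closedBall_lt_top
  refine ⟨(∫⁻ z, commKernelE σ z) * ofReal ((1 + (R + 1)) ^ (15 / 4 : ℝ)) +
    ofReal (2 ^ (σ + 3)) * ofReal ((1 + (R + 1)) ^ (15 / 4 : ℝ)) *
    volume (closedBall (0 : E3) R), by finiteness, fun z x => ?_⟩
  rw [add_mul]
  by_cases hx : ‖x - z‖ ≤ R + 1
  · refine le_trans ?_ le_self_add
    calc _ ≤ ∫⁻ y, commKernelE σ (x - y) := lintegral_mono fun y => commKernelOn_le σ z R x y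
      _ = ∫⁻ y, commKernelE σ y := lintegral_sub_left_eq_self (fun y => commKernelE σ y) x
      _ = (∫⁻ y, commKernelE σ y) * 1 := (mul_one _).symm
      _ ≤ _ := by rw [mul_assoc]; gcongr; exact one_le_mul_wtE hx
  · push Not at hx
    refine le_trans ?_ le_add_self
    calc _ ≤ ∫⁻ y, (closedBall z R).indicator (fun _ => ofReal (2 ^ (σ + 3)) *
      ofReal ((1 + (R + 1)) ^ (15 / 4 : ℝ)) * wtE (x - z)) y := by
          refine lintegral_mono fun y => ?_
          by_cases hy : y ∈ closedBall z R
          · rw [indicator_of_mem hy]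
            refine (commKernelOn_le σ z R x y).trans ?_
            rw [mem_closedBall, dist_eq_norm] at hy
            have h3 : 1 ≤ ‖x - y‖ := by
              have := norm_sub_norm_le (x - z) (y - z)
              rw [sub_sub_sub_cancel_right] at this
              linarith
            refine (commKernelE_le_wtE h0 h3).trans ?_
            rw [mul_assoc]
            gcongr
            refine wtE_le_mul ?_
            rw [show x - y - (x - z) = -(y - z) by abel, norm_neg]
            linarith
          · rw [commKernelOn_of_notMem (by rw [mem_closedBall, dist_eq_norm]; linarith) hy]
            exact zero_le
      _ = _ := by
        rw [lintegral_indicator_const measurableSet_closedBall, Measure.addHaar_closedBall_center]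
        ring

/-- The commutator of an operator of order `σ < 1` with a cutoff supported in a ball is bounded from
weighted `L²` to `L²`. -/
lemma exists_comm_bound (h0 : 3 / 4 ≤ σ) (h1 : σ < 1) (R : ℝ) :
    ∃ C : ℝ≥0∞, C < ⊤ ∧ ∀ (f : E3 → ℝ≥0∞) (z : E3), AEMeasurable f →
    ∫⁻ y, (∫⁻ x, commKernelOn σ z R x y * f x) ^ 2 ≤ C * ∫⁻ x, wtE (x - z) * f x ^ 2 := by
  have hIt := lintegral_commKernelE_lt_top (by linarith) h1
  obtain ⟨C, hC, hcol⟩ := exists_lintegral_commKernelOn_le h0 h1 R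
  set I := ∫⁻ z, commKernelE σ z
  refine ⟨I * C, mul_lt_top hIt hC, fun f z hf => ?_⟩
  have hKm := measurable_commKernelOn σ z R
  have hKm1 : ∀ y, Measurable (fun x : E3 => commKernelOn σ z R x y) := fun y => Measurable.comp
    (g := fun p : E3 × E3 => commKernelOn σ z R p.1 p.2) (f := fun x : E3 => (x, y)) hKm
    measurable_prodMk_right
  have hKm2 : ∀ x, Measurable (fun y : E3 => commKernelOn σ z R x y) := fun x => Measurable.comp
    (g := fun p : E3 × E3 => commKernelOn σ z R p.1 p.2) (f := fun y : E3 => (x, y)) hKm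
    measurable_prodMk_left
  have step1 : ∫⁻ y, (∫⁻ x, commKernelOn σ z R x y * f x) ^ 2 ≤
    ∫⁻ y, I * ∫⁻ x, commKernelOn σ z R x y * f x ^ 2 := by
    refine lintegral_mono fun y => (lintegral_weight_mul_sq_le (hKm1 y).aemeasurable hf).trans ?_
    gcongr
    calc _ ≤ ∫⁻ x, commKernelE σ (x - y) := lintegral_mono fun x => commKernelOn_le σ z R x y
      _ = I := lintegral_sub_right_eq_self (fun y => commKernelE σ y) y
  have hmm : AEMeasurable (Function.uncurry fun y x => commKernelOn σ z R x y * f x ^ 2)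
    (volume.prod volume) := (hKm.comp measurable_swap).aemeasurable.mul (hf.pow_const 2).comp_snd
  have step2 : ∫⁻ y, I * ∫⁻ x, commKernelOn σ z R x y * f x ^ 2 =
    I * ∫⁻ x, ∫⁻ y, commKernelOn σ z R x y * f x ^ 2 := by
    rw [lintegral_const_mul' _ _ hIt.ne, lintegral_lintegral_swap hmm]
  have step3 : ∫⁻ x, ∫⁻ y, commKernelOn σ z R x y * f x ^ 2 ≤
    C * ∫⁻ x, wtE (x - z) * f x ^ 2 := by
    rw [← lintegral_const_mul' _ _ hC.ne]
    refine lintegral_mono fun x => ?_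
    rw [lintegral_mul_const _ (hKm2 x), ← mul_assoc]
    gcongr
    exact hcol z x
  rw [step2] at step1
  refine step1.trans ?_
  rw [mul_assoc]
  gcongr

/-! ### The fractional Laplacian of order less than one as a singular integral -/

lemma fourierInv_neg_of_even {f : E3 → ℂ} (hf : ∀ ξ, f (-ξ) = f ξ) (x : E3) :
    𝓕⁻ f (-x) = 𝓕⁻ f x := by
  rw [fourierInv_eq, fourierInv_eq, ← integral_neg_eq_self]
  simp only [hf, inner_neg_neg]

lemma conj_fourierInv {f : E3 → ℂ} (hf : ∀ ξ, (starRingEnd ℂ) (f ξ) = f ξ) (x : E3) :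
    (starRingEnd ℂ) (𝓕⁻ f x) = 𝓕⁻ f (-x) := by
  rw [Real.fourierInv_eq', Real.fourierInv_eq', ← integral_conj]
  congr 1
  ext ξ
  simp only [smul_eq_mul, map_mul, hf]
  rw [← Complex.exp_conj]
  congr 2
  simp only [map_mul, Complex.conj_I, Complex.conj_ofReal, inner_neg_right]
  push_cast
  ring

/-- The fractional Laplacian `Λ^σ`, `0 < σ < 1`, as a singular integral of first differences with
an even real kernel. -/
lemma exists_lam_kernel (h0 : 0 < σ) (h1 : σ < 1) : ∃ κ : E3 → ℝ, Measurable κ ∧ (∀ z, κ (-z) =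
    κ z) ∧ (∃ C, 0 ≤ C ∧ ∀ z, z ≠ 0 → |κ z| ≤ C * ‖z‖ ^ (-σ - 3)) ∧ ∀ (Ω : Set E3) (g : E3 → ℝ),
    IsTest Ω g → ∀ x, Integrable (fun y => κ (x - y) * (g y - g x)) ∧ mulC (lamSym σ) g x =
    ((∫ y, κ (x - y) * (g y - g x) : ℝ) : ℂ) := by
  have hm := isHomSymbol_lamSym h0
  have hev : ∀ ξ, cutSymbol (lamSym σ) (-ξ) = cutSymbol (lamSym σ) ξ := by
    intro ξ; simp [cutSymbol, lamSym]
  have hpe : ∀ z, hm.piece (-z) = hm.piece z := by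
    intro z; rw [hm.piece_apply, hm.piece_apply, fourierInv_neg_of_even hev]
  have hpr : ∀ z, (starRingEnd ℂ) (hm.piece z) = hm.piece z := fun z => by
    rw [hm.piece_apply, conj_fourierInv (f := fun ξ => (cutSymbol (lamSym σ) ξ))
      (fun ξ => Complex.conj_ofReal _), fourierInv_neg_of_even hev]
  have hke : ∀ z, hm.kernel (-z) = hm.kernel z := by
    intro z; simp only [IsHomSymbol.kernel, smul_neg, hpe]
  have hkr : ∀ z, ((hm.kernel z).re) = hm.kernel z := fun z => by
    rw [← Complex.conj_eq_iff_re, IsHomSymbol.kernel, map_mul, ← integral_conj]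
    simp only [map_mul, hpr, Complex.conj_ofReal, map_inv₀]
  refine ⟨fun z => (hm.kernel z).re, Complex.measurable_re.comp hm.measurable_kernel,
    fun z => by simp only [hke], ?_, fun Ω g hg x => ?_⟩
  · obtain ⟨C, hC, hb⟩ := hm.exists_kernel_bound h0.le (by linarith)
    exact ⟨C, hC, fun z hz => (abs_re_le_norm _).trans (hb z hz)⟩
  · obtain ⟨hi, he⟩ := hm.mulC_eq_diff h0 h1 hg x
    have e : ∀ y, hm.kernel (x - y) * ((g y - g x : ℝ)) =
      (((hm.kernel (x - y)).re * (g y - g x) : ℝ)) := fun y => by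
      rw [← hkr (x - y)]
      push_cast
      simp
    simp only [e] at hi he
    refine ⟨?_, ?_⟩
    · simpa using hi.re
    · rw [he, integral_complex_ofReal]

lemma IsTest.exists_radius [NormedSpace ℝ F] {g : E3 → F} (hg : IsTest Ω g) :
    ∃ R, 0 < R ∧ ∀ y, g y ≠ 0 → ‖y‖ ≤ R := by
  obtain ⟨R, hR, hsub⟩ := hg.2.1.isBounded.subset_closedBall_lt 0 0
  exact ⟨R, hR, fun y hy => by simpa using hsub (subset_tsupport g hy)⟩

lemma norm_mulC_le_integral (m g : E3 → ℝ) (x : E3) :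
    ‖mulC m g x‖ ≤ ∫ ξ, ‖(m ξ : ℂ) * ftR g ξ‖ := by
  rw [mulC, fourierInv_eq]
  refine (norm_integral_le_integral_norm _).trans (le_of_eq ?_)
  congr 1; ext ξ
  rw [Circle.norm_smul]; rfl

/-- The tails of homogeneous multipliers of order at least `3/4` are dominated by the weight, with
a constant that is uniform over the test functions supported in a ball. -/
lemma IsHomSymbol.exists_decay_le (hm : IsHomSymbol σ m) (h0 : 3 / 4 ≤ σ) (h2 : σ ≤ 2)
    (hR : 0 < R) : ∃ C, 0 ≤ C ∧ ∀ (Ω : Set E3) (g : E3 → ℝ), IsTest Ω g → (∀ y, g y ≠ 0 → ‖y‖ ≤ R) →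
    ∀ x, ‖mulC m g x‖ ≤ C * ((∫ ξ, ‖(m ξ : ℂ) * ftR g ξ‖) + ∫ y, |g y|) * wt x := by
  obtain ⟨C, hC, hb⟩ := hm.exists_offDiag_bound (by linarith) h2
  refine ⟨(1 + (R + 1)) ^ (15 / 4 : ℝ) + (1 + R + 1) ^ (15 / 4 : ℝ) * (C * 2 ^ (σ + 3)),
    by positivity, fun Ω g hg hsupp x => ?_⟩
  set B := ∫ ξ, ‖(m ξ) * ftR g ξ‖
  have hwp := wt_pos x
  suffices hsuff : ‖mulC m g x‖ ≤ B * (1 + (R + 1)) ^ (15 / 4 : ℝ) * wt x +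
      (1 + R + 1) ^ (15 / 4 : ℝ) * (C * 2 ^ (σ + 3) * ∫ y, |g y|) * wt x by
    refine hsuff.trans ?_
    rw [← add_mul]
    gcongr
    have e1 : 0 ≤ (1 + (R + 1)) ^ (15 / 4 : ℝ) * ∫ y, |g y| := by positivity
    have e2 : 0 ≤ (1 + R + 1) ^ (15 / 4 : ℝ) * (C * 2 ^ (σ + 3)) * B := by positivity
    linarith
  by_cases hx : ‖x‖ ≤ R + 1
  · refine le_trans ?_ (le_add_of_nonneg_right (by positivity))
    have h1 := wt_le_mul (a := 0) (by simpa using hx)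
    rw [(by simp [wt] : wt 0 = 1)] at h1
    calc _ ≤ B * 1 := by rw [mul_one]; exact norm_mulC_le_integral m g x
      _ ≤ _ := by rw [mul_assoc]; gcongr
  · push Not at hx
    refine le_trans ?_ (le_add_of_nonneg_left (by positivity))
    have h3 := hb Ω g hg x (‖x‖ - R) (by linarith) (fun y hy => by
      have := norm_sub_norm_le x y
      linarith [hsupp y hy])
    refine h3.trans ?_
    have h4 : (‖x‖ - R) ^ (-σ - 3) ≤ 2 ^ (σ + 3) * (1 + (‖x‖ - R)) ^ (-(15 / 4) : ℝ) := by
      have h5 : ((1 + (‖x‖ - R)) / 2) ^ (-(σ + 3)) =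
        2 ^ (σ + 3) * (1 + (‖x‖ - R)) ^ (-(σ + 3)) := by
        rw [Real.div_rpow (by linarith) zero_le_two, rpow_neg zero_le_two, div_inv_eq_mul,
          mul_comm]
      calc _ ≤ ((1 + (‖x‖ - R)) / 2) ^ (-(σ + 3)) := by
            rw [show -σ - 3 = -(σ + 3) by ring]
            exact rpow_le_rpow_of_nonpos (by linarith) (by linarith) (by linarith)
        _ ≤ _ := by
          rw [h5]
          gcongr <;> linarith
    have h6 : (1 + (‖x‖ - R)) ^ (-(15 / 4) : ℝ) ≤ (1 + R + 1) ^ (15 / 4 : ℝ) * wt x := by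
      have h7 : (1 + ‖x‖) / (1 + R + 1) ≤ 1 + (‖x‖ - R) := by
        rw [div_le_iff₀ (by linarith)]
        nlinarith
      calc _ ≤ ((1 + ‖x‖) / (1 + R + 1)) ^ (-(15 / 4) : ℝ) :=
        rpow_le_rpow_of_nonpos (by positivity) h7 (by norm_num)
        _ = _ := by
            rw [Real.div_rpow (by positivity) (by positivity), rpow_neg (x := 1 + R + 1)
              (by positivity), div_inv_eq_mul, mul_comm, wt]
    calc _ ≤ C * (2 ^ (σ + 3) * ((1 + R + 1) ^ (15 / 4 : ℝ) * wt x)) * ∫ y, |g y| := by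
          gcongr
          exact h4.trans (by gcongr)
      _ = _ := by ring

lemma IsHomSymbol.exists_decay (hm : IsHomSymbol σ m) (h0 : 3 / 4 ≤ σ) (h2 : σ ≤ 2)
    (hg : IsTest Ω g) : ∃ C, 0 ≤ C ∧ ∀ x, ‖mulC m g x‖ ≤ C * wt x := by
  obtain ⟨R, hR, hsupp⟩ := hg.exists_radius
  obtain ⟨C, hC, hb⟩ := hm.exists_decay_le h0 h2 hR
  exact ⟨C * ((∫ ξ, ‖(m ξ) * ftR g ξ‖) + ∫ y, |g y|), (by positivity), hb Ω g hg hsupp⟩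

/-- The tails of a homogeneous multiplier applied to a function of mean zero are dominated by the
weight, with a constant that is uniform over the test functions supported in a ball. -/
lemma IsHomSymbol.exists_decay_of_meanZero_le (hm : IsHomSymbol σ m) (h0 : 0 ≤ σ) (h2 : σ ≤ 2)
    (hR : 0 < R) : ∃ C, 0 ≤ C ∧ ∀ (Ω : Set E3) (g : E3 → ℝ), IsTest Ω g → ∫ y, g y = 0 →
    (∀ y, g y ≠ 0 → ‖y‖ ≤ R) → ∀ x, ‖mulC m g x‖ ≤ C * ((∫ ξ, ‖(m ξ : ℂ) * ftR g ξ‖) + ∫ y, |g y|) *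
    wt x := by
  obtain ⟨C, hC, hb⟩ := hm.exists_meanZero_bound h0 h2
  refine ⟨(1 + (2 * R + 1)) ^ (15 / 4 : ℝ) + C * R * 2 ^ (15 / 4 : ℝ), by positivity,
    fun Ω g hg hg0 hsupp x => ?_⟩
  set B := ∫ ξ, ‖(m ξ) * ftR g ξ‖
  have hwp := wt_pos x
  suffices hsuff : ‖mulC m g x‖ ≤ B * (1 + (2 * R + 1)) ^ (15 / 4 : ℝ) * wt x +
    C * R * (2 ^ (15 / 4 : ℝ) * ∫ y, |g y|) * wt x by
    refine hsuff.trans ?_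
    rw [← add_mul]
    gcongr
    have e1 : 0 ≤ (1 + (2 * R + 1)) ^ (15 / 4 : ℝ) * ∫ y, |g y| := by positivity
    have e2 : 0 ≤ C * R * 2 ^ (15 / 4 : ℝ) * B := by positivity
    linarith
  by_cases hx : ‖x‖ ≤ 2 * R + 1
  · refine le_trans ?_ (le_add_of_nonneg_right (by positivity))
    have h1 := wt_le_mul (a := 0) (by simpa using hx)
    rw [(by simp [wt] : wt 0 = 1)] at h1
    calc _ ≤ B * 1 := by rw [mul_one]; exact norm_mulC_le_integral m g x
      _ ≤ _ := by rw [mul_assoc]; gcongr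
  · push Not at hx
    refine le_trans ?_ (le_add_of_nonneg_left (by positivity))
    have h3 := hb Ω g hg hg0 x 0 R hR (fun y hy => by simpa using hsupp y hy)
      (by simp only [sub_zero]; linarith)
    refine h3.trans ?_
    rw [sub_zero]
    have h4 : ‖x‖ ^ (-σ - 4) ≤ 2 ^ (15 / 4 : ℝ) * wt x := by
      calc _ ≤ ‖x‖ ^ (-(15 / 4) : ℝ) := Real.rpow_le_rpow_of_exponent_le (by linarith) (by linarith)
        _ ≤ ((1 + ‖x‖) / 2) ^ (-(15 / 4) : ℝ) :=
          rpow_le_rpow_of_nonpos (by positivity) (by linarith) (by norm_num)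
        _ = _ := by
          rw [Real.div_rpow (by positivity) zero_le_two, rpow_neg zero_le_two,
            div_inv_eq_mul, mul_comm, wt]
    calc _ ≤ C * R * (2 ^ (15 / 4 : ℝ) * wt x) * ∫ y, |g y| := by gcongr
      _ = _ := by ring

/-- The commutator identity `ζ Λ^σ h = Λ^σ (ζ h) + ∫ κ(x - y) (ζ(x) - ζ(y)) h(y) dy`. -/
lemma lam_commutator (hκ : ∀ (Ω : Set E3) (g : E3 → ℝ), IsTest Ω g →
    ∀ x, Integrable (fun y => κ (x - y) * (g y - g x)) ∧ mulC (lamSym σ) g x =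
    ((∫ y, κ (x - y) * (g y - g x) : ℝ) : ℂ)) {ζ h : E3 → ℝ} (hζh :
    IsTest univ (fun x => ζ x * h x)) (hh : IsTest univ h) (x :
    E3) : Integrable (fun y => κ (x - y) * (ζ x - ζ y) * h y) ∧ ζ x * lam σ h x =
    lam σ (fun x => ζ x * h x) x + ∫ y, κ (x - y) * (ζ x - ζ y) * h y := by
  obtain ⟨i1, e1⟩ := hκ _ _ hh x
  obtain ⟨i2, e2⟩ := hκ _ _ hζh x
  simp only [(fun y => by ring : ∀ y, κ (x - y) * (ζ x - ζ y) * h y = ζ x *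
    (κ (x - y) * (h y - h x)) - κ (x - y) * (ζ y * h y - ζ x * h x))]
  refine ⟨(i1.const_mul _).sub i2, ?_⟩
  rw [integral_sub (i1.const_mul _) i2, integral_const_mul, lam_eq_re, lam_eq_re, e1, e2,
    Complex.ofReal_re, Complex.ofReal_re]
  ring

/-! ### Mollification -/

/-- A standard mollifier on `ℝ³` supported in the unit ball. -/
structure IsMollifier (η : E3 → ℝ) : Prop where
  isTest : IsTest univ η
  nonneg : ∀ z, 0 ≤ η z
  integral_eq : ∫ z, η z = 1
  support : ∀ z, η z ≠ 0 → ‖z‖ ≤ 1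

/-- The mollification `η * F`. -/
noncomputable def mollify (η F : E3 → ℝ) (x : E3) : ℝ := ∫ y, η (x - y) * F y

lemma mollify_eq_convolution (η F : E3 → ℝ) :
    mollify η F = convolution η F (ContinuousLinearMap.lsmul ℝ ℝ) volume := by
  ext x
  rw [convolution_lsmul_swap]
  simp [mollify]

/-- A sequence of mollifiers concentrating at the origin. -/
lemma exists_mollifier_seq : ∃ η : ℕ → E3 → ℝ, (∀ n, IsMollifier (η n)) ∧ (∀ n z, η n z ≠ 0 → ‖z‖ ≤
    1 / ((n : ℝ) + 1)) ∧ ∀ F : E3 → ℝ, LocallyIntegrable F → ∀ᵐ x, Tendsto (fun n => mollify (η n) F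
    x) atTop (𝓝 (F x)) := by
  have hp : ∀ n : ℕ, (0 : ℝ) < 1 / (n + 1) := fun n => Nat.one_div_pos_of_nat
  let φ : ℕ → ContDiffBump (0 : E3) := fun n =>
    ⟨1 / ((n : ℝ) + 1) / 2, 1 / (n + 1), half_pos (hp n), half_lt_self (hp n)⟩
  have hs := fun n z hz => by
    have : z ∈ Function.support ((φ n).normed volume) := hz
    rw [ContDiffBump.support_normed_eq] at this
    exact (mem_ball_zero_iff.1 this).le
  refine ⟨fun n => (φ n).normed volume, fun n => ⟨⟨(φ n).contDiff_normed,
    (φ n).hasCompactSupport_normed, subset_univ _⟩, (φ n).nonneg_normed, (φ n).integral_normed,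
    fun z hz => (hs n z hz).trans ?_⟩, hs, fun F hF => ?_⟩
  · rw [div_le_one (by positivity)]; linarith
  · simp only [mollify_eq_convolution]
    refine ContDiffBump.ae_convolution_tendsto_right_of_locallyIntegrable (K := 2)
      tendsto_one_div_add_atTop_nhds_zero_nat (.of_forall fun n => ?_) hF
    change 1 / ((n : ℝ) + 1) ≤ 2 * (1 / (n + 1) / 2)
    linarith

lemma mollify_contDiff {F : E3 → ℝ} (hη : IsMollifier η) (hF : LocallyIntegrable F) :
    ContDiff ℝ ∞ (mollify η F) := by
  rw [mollify_eq_convolution]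
  exact HasCompactSupport.contDiff_convolution_left _ hη.isTest.2.1 hη.isTest.1 hF

lemma mollify_isTest {F : E3 → ℝ} (hη : IsMollifier η) (hF : LocallyIntegrable F)
    (hs : HasCompactSupport F) : IsTest univ (mollify η F) := by
  refine ⟨mollify_contDiff hη hF, ?_, subset_univ _⟩
  rw [mollify_eq_convolution]
  exact HasCompactSupport.convolution _ hη.isTest.2.1 hs

lemma mollify_support {F : E3 → ℝ} {δ : ℝ} (hη : ∀ z, η z ≠ 0 → ‖z‖ ≤ δ)
    (hF : ∀ y, F y ≠ 0 → ‖y - c‖ ≤ r) (hx : mollify η F x ≠ 0) : ‖x - c‖ ≤ r + δ := by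
  by_contra hcon
  apply hx
  rw [mollify]
  apply integral_eq_zero_of_ae
  refine .of_forall fun y => ?_
  by_contra hy
  have h3 := hη _ (left_ne_zero_of_mul hy)
  have h4 := hF _ (right_ne_zero_of_mul hy)
  have := norm_sub_le_norm_sub_add_norm_sub x y c
  linarith

lemma IsMollifier.lintegral (hη : IsMollifier η) : ∫⁻ z, ofReal (η z) = 1 := by
  rw [← ofReal_integral_eq_lintegral_ofReal (hη.isTest.1.continuous.integrable_of_hasCompactSupport
    hη.isTest.2.1) (.of_forall hη.nonneg), hη.integral_eq, ofReal_one]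

lemma enorm_mollify_le (hη : IsMollifier η) (F : E3 → ℝ) (x : E3) :
    ‖mollify η F x‖ₑ ≤ ∫⁻ y, ofReal (η (x - y)) * ‖F y‖ₑ := by
  refine (enorm_integral_le_lintegral_enorm _).trans (le_of_eq (lintegral_congr fun y => ?_))
  rw [enorm_mul, enorm_of_nonneg (hη.nonneg _)]

lemma lintegral_mollify_le (hη : IsMollifier η) {F : E3 → ℝ} (hF : AEStronglyMeasurable F) :
    ∫⁻ x, ‖mollify η F x‖ₑ ^ 2 ≤ ∫⁻ x, ‖F x‖ₑ ^ 2 := by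
  have hm := hη.isTest.1.continuous.measurable.ennreal_ofReal
  calc _ ≤ ∫⁻ x, ∫⁻ y, ofReal (η (x - y)) * ‖F y‖ₑ ^ 2 := by
        refine lintegral_mono fun x => ?_
        calc _ ≤ (∫⁻ y, ofReal (η (x - y)) * ‖F y‖ₑ) ^ 2 := by gcongr; exact enorm_mollify_le hη F x
          _ ≤ (∫⁻ y, ofReal (η (x - y))) * ∫⁻ y, ofReal (η (x - y)) * ‖F y‖ₑ ^ 2 :=
            lintegral_weight_mul_sq_le (hm.comp (measurable_const.sub measurable_id)).aemeasurable
            hF.enorm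
          _ = _ := by rw [lintegral_sub_left_eq_self (fun y => ofReal (η y)), hη.lintegral, one_mul]
    _ = ∫⁻ y, ∫⁻ x, ofReal (η (x - y)) * ‖F y‖ₑ ^ 2 := by
        exact lintegral_lintegral_swap
          ((hm.comp (measurable_fst.sub measurable_snd)).aemeasurable.mul
          (hF.enorm.pow_const 2).comp_snd)
    _ = _ := by
      refine lintegral_congr fun y => ?_
      have hmy : Measurable fun x => ofReal (η (x - y)) :=
        hm.comp (measurable_id.sub measurable_const)
      rw [lintegral_mul_const _ hmy,
        lintegral_sub_right_eq_self (fun y => ofReal (η y)), hη.lintegral, one_mul]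

lemma abs_kernel_mul_le {L : ℝ} (hC : 0 ≤ C) (hκC : ∀ z, z ≠ 0 → |κ z| ≤ C * ‖z‖ ^ (-σ - 3))
    (hg : BddLip L g) {a : E3} (ha : x - y = a) : |κ a * (g x - g y)| ≤ C * L * commKernel σ a := by
  by_cases hz : a = 0
  · simp [sub_eq_zero.1 (ha.trans hz), hz, commKernel]
  · have h4 := hg x y
    rw [ha] at h4
    rw [abs_mul, show C * L * commKernel σ a = C * ‖a‖ ^ (-σ - 3) * (L * min 1 ‖a‖) by
      simp only [commKernel]; ring]
    exact mul_le_mul (hκC _ hz) h4 (abs_nonneg _) (by positivity)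

/-- If `Λ^σ F = k` weakly then `Λ^σ (η * F) = η * k` for a mollifier `η`. -/
lemma mulC_mollify (h0 : 0 < σ) (h1 : σ < 1) (hκm : Measurable κ) (hκe : ∀ z, κ (-z) = κ z)
    (hκb : ∃ C, 0 ≤ C ∧ ∀ z, z ≠ 0 → |κ z| ≤ C * ‖z‖ ^ (-σ - 3))
    (hκ : ∀ (Ω : Set E3) (g : E3 → ℝ), IsTest Ω g → ∀ x, Integrable (fun y => κ (x - y) *
    (g y - g x)) ∧ mulC (lamSym σ) g x = ((∫ y, κ (x - y) * (g y - g x) : ℝ) :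
    ℂ)) {F k : E3 → ℝ} (hF : Integrable F) (hFs : HasCompactSupport F) (hw : ∀ h, IsTest univ h →
    ∫ x, F x * lam σ h x = ∫ x, k x * h x) (hη : IsMollifier η) (x :
    E3) : mulC (lamSym σ) (mollify η F) x = ((mollify η k x : ℝ) : ℂ) := by
  rw [(hκ univ _ (mollify_isTest hη hF.locallyIntegrable hFs) x).2]
  congr 1
  have hηc := hη.isTest.1.continuous
  obtain ⟨L, hL, hLip⟩ := hη.isTest.exists_bddLip
  obtain ⟨C, hC, hκC⟩ := hκb
  have hi : ∀ x, Integrable fun y => η (x - y) * F y := fun x => by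
    obtain ⟨B, hB⟩ := hηc.bounded_above_of_compact_support hη.isTest.2.1
    exact hF.bdd_mul (hηc.comp (continuous_const.sub continuous_id)).aestronglyMeasurable
      (.of_forall fun y => hB _)
  -- the reflected translate of the mollifier as a test function
  have hr : IsTest univ (fun y => η (x - y)) := ⟨hη.isTest.1.comp (contDiff_const.sub contDiff_id),
    hη.isTest.2.1.comp_homeomorph (Homeomorph.subLeft x), subset_univ _⟩
  have e1 : ∀ a, lam σ (fun y => η (x - y)) a = ∫ y, κ (x - y) * (η (y - a) - η (x - a)) := fun a =>
    by
    rw [lam_eq_re, (hκ univ _ hr a).2, Complex.ofReal_re,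
      ← integral_sub_left_eq_self (fun y => κ (x - y) * (η (y - a) - η (x - a))) volume (x + a)]
    refine integral_congr_ae (.of_forall fun y => ?_)
    simp only
    rw [← hκe (a - y)]
    congr 2
    · abel
    · congr 1; abel
  have hint : Integrable (fun p : E3 × E3 => κ (x - p.1) * (η (p.1 - p.2) - η (x - p.2)) * F p.2)
    (volume.prod volume) := by
    have hb : Integrable (fun p : E3 × E3 => C * L * (commKernel σ (x - p.1)) * ‖F p.2‖)
      (volume.prod volume) := by
      exact Integrable.mul_prod (((integrable_commKernel h0 h1).comp_sub_left x).const_mul _)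
        hF.norm
    refine hb.mono' ?_ ?_
    · exact AEStronglyMeasurable.mul (Measurable.aestronglyMeasurable
        ((hκm.comp (measurable_const.sub measurable_fst)).mul
        ((hηc.measurable.comp (measurable_fst.sub measurable_snd)).sub
        (hηc.measurable.comp (measurable_const.sub measurable_snd)))))
        hF.aestronglyMeasurable.comp_snd
    · refine .of_forall fun p => ?_
      rw [norm_mul]
      refine mul_le_mul_of_nonneg_right ?_ (norm_nonneg _)
      have h4 := abs_kernel_mul_le hC hκC hLip (a := x - p.1) (x := x - p.2) (y := p.1 - p.2)
        (by abel)
      rwa [norm_eq_abs, abs_mul, abs_sub_comm, ← abs_mul]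
  calc _ = ∫ y, ∫ a, κ (x - y) * (η (y - a) - η (x - a)) * F a := by
        refine integral_congr_ae (.of_forall fun y => ?_)
        simp only
        rw [mollify, mollify, ← integral_sub (hi y) (hi x), ← integral_const_mul]
        refine integral_congr_ae (.of_forall fun a => ?_)
        simp only; ring
    _ = ∫ a, ∫ y, κ (x - y) * (η (y - a) - η (x - a)) * F a := integral_integral_swap hint
    _ = ∫ a, F a * lam σ (fun y => η (x - y)) a := by
      refine integral_congr_ae (.of_forall fun a => ?_)
      simp only
      rw [integral_mul_const, e1, mul_comm]
    _ = _ := by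
      rw [hw _ hr, mollify]
      refine integral_congr_ae (.of_forall fun a => ?_)
      simp only; ring

/-! ### Local fractional Sobolev inequality -/

lemma ennreal_add_sq_le (a b : ℝ≥0∞) : (a + b) ^ 2 ≤ 2 * (a ^ 2 + b ^ 2) := by
  by_cases ha : a = ⊤
  · simp [ha]
  by_cases hb : b = ⊤
  · simp [hb]
  lift a to ℝ≥0 using ha
  lift b to ℝ≥0 using hb
  exact_mod_cast (add_sq_le : (a + b) ^ 2 ≤ 2 * (a ^ 2 + b ^ 2))

lemma lintegral_wtE_sub (z : E3) : ∫⁻ x, wtE (x - z) = ∫⁻ x, wtE x :=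
  lintegral_sub_right_eq_self (wtE) z

lemma lintegral_wtE_mul_sq_le {f : E3 → F} (hf : AEStronglyMeasurable f) (z : E3) :
    (∫⁻ x, wtE (x - z) * ‖f x‖ₑ) ^ 2 ≤ (∫⁻ x, wtE x) * wtEnergy f z := by
  rw [← lintegral_wtE_sub z]
  exact lintegral_weight_mul_sq_le
    (measurable_wtE.comp (measurable_id.sub measurable_const)).aemeasurable hf.enorm

lemma lintegral_wtE_mul_lt_top {f : E3 → F} (hf : AEStronglyMeasurable f) (h : wtEnergy f z < ⊤) :
    ∫⁻ x, wtE (x - z) * ‖f x‖ₑ < ⊤ := (pow_lt_top_iff.1 ((lintegral_wtE_mul_sq_le hf z).trans_lt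
      (mul_lt_top lintegral_wtE_lt_top h))).resolve_right two_ne_zero

lemma integrable_mul_of_le_wt {f : E3 → ℝ} (hf : AEStronglyMeasurable f)
    (hg : AEStronglyMeasurable g) (h : wtEnergy f z < ⊤) (hC : ∀ x, |g x| ≤ C * wt x) :
    Integrable (fun x => f x * g x) := by
  refine ⟨hf.mul hg, ?_⟩
  rw [hasFiniteIntegral_iff_enorm]
  have h0 := lintegral_wtE_mul_lt_top hf (wtEnergy_lt_top h 0)
  refine lt_of_le_of_lt ?_ (mul_lt_top (ofReal_lt_top (r := C)) h0)
  rw [← lintegral_ofReal_mul]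
  refine lintegral_mono fun x => ?_
  rw [enorm_mul, sub_zero, wtE, ← mul_assoc, ← ofReal_mul (nonneg_of_mul_nonneg_left
    ((abs_nonneg _).trans (hC x)) (wt_pos x)), mul_comm]
  gcongr
  rw [← ofReal_norm]
  exact ofReal_le_ofReal (hC x)

lemma memLp_restrict_of_wtEnergy {f : E3 → F} (hf : AEStronglyMeasurable f) (h : wtEnergy f z < ⊤)
    (c : E3) (r : ℝ) : MemLp f 2 (volume.restrict (closedBall c r)) := by
  refine ⟨hf.restrict, ?_⟩
  have h1 : eLpNorm f 2 (volume.restrict (closedBall c r)) ^ 2 < ⊤ := by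
    rw [eLpNorm_two_sq]
    exact (setLIntegral_closedBall_le_wtEnergy f c r).trans_lt
      (mul_lt_top ofReal_lt_top (wtEnergy_lt_top h c))
  exact (pow_lt_top_iff.1 h1).resolve_right two_ne_zero

lemma locallyIntegrable_of_wtEnergy {f : E3 → F} (hf : AEStronglyMeasurable f)
    (h : wtEnergy f z < ⊤) : LocallyIntegrable f := fun x => by
  refine ⟨closedBall x 1, Metric.closedBall_mem_nhds x one_pos, ?_⟩
  have : IsFiniteMeasure (volume.restrict (closedBall x 1)) :=
    isFiniteMeasure_restrict.2 measure_closedBall_lt_top.ne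
  exact (memLp_restrict_of_wtEnergy hf h x 1).integrable (by norm_num)

lemma lam_decay (h0 : 3 / 4 ≤ σ) (h2 : σ ≤ 2) (hg : IsTest univ g) :
    ∃ C, ∀ x, |lam σ g x| ≤ C * wt x := by
  obtain ⟨C, -, hb⟩ := (isHomSymbol_lamSym (by linarith)).exists_decay h0 h2 hg
  refine ⟨C, fun x => ?_⟩
  rw [lam_eq_re]
  exact (abs_re_le_norm _).trans (hb x)

/-- The bump function equal to `1` on `B_r(z)` and supported in `B_{2r}(z)`. -/
noncomputable def ballBump (r : ℝ) (z x : E3) : ℝ :=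
  (⟨2, 4, by norm_num, by norm_num⟩ : ContDiffBump (0 : E3)) ((2 / r) • (x - z))

lemma ballBump_nonneg (r : ℝ) (z x : E3) : 0 ≤ ballBump r z x := ContDiffBump.nonneg _

lemma ballBump_le_one (r : ℝ) (z x : E3) : ballBump r z x ≤ 1 := ContDiffBump.le_one _

lemma ballBump_eq_one (hr : 0 < r) (hx : ‖x - z‖ ≤ r) : ballBump r z x = 1 := by
  refine ContDiffBump.one_of_mem_closedBall _ ?_
  rw [mem_closedBall_zero_iff, norm_smul, norm_of_nonneg (by positivity)]
  calc _ ≤ 2 / r * r := by gcongr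
    _ = 2 := by field_simp

lemma ballBump_eq_zero (hr : 0 < r) (hx : 2 * r ≤ ‖x - z‖) : ballBump r z x = 0 := by
  refine ContDiffBump.zero_of_le_dist _ ?_
  rw [dist_zero_right, norm_smul, norm_of_nonneg (by positivity)]
  calc _ = 2 / r * (2 * r) := by field_simp; norm_num
    _ ≤ 2 / r * ‖x - z‖ := by gcongr

lemma norm_le_of_ballBump_ne_zero (hr : 0 < r) (hx : ballBump r z x ≠ 0) : ‖x - z‖ ≤ 2 * r := by
  by_contra h
  exact hx (ballBump_eq_zero hr (not_le.1 h).le)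

lemma ballBump_isTest (hr : 0 < r) (z : E3) : IsTest univ (ballBump r z) := by
  refine ⟨?_, ?_, subset_univ _⟩
  · exact (ContDiffBump.contDiff _).comp ((contDiff_id.sub contDiff_const).const_smul (2 / r))
  · refine HasCompactSupport.of_support_subset_isCompact
      (isCompact_closedBall z (2 * r)) fun x hx => ?_
    rw [mem_closedBall, dist_eq_norm]
    exact norm_le_of_ballBump_ne_zero hr hx

lemma exists_ballBump_bddLip (hr : 0 < r) : ∃ L, 0 ≤ L ∧ ∀ z, BddLip L (ballBump r z) := by
  obtain ⟨L, hL, hb⟩ := (ballBump_isTest hr 0).exists_bddLip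
  exact ⟨L, hL, fun z x y => by simpa [ballBump] using hb (x - z) (y - z)⟩

/-- The kernel of a commutator with a cutoff supported in a ball. -/
lemma enorm_kernel_mul_le {L : ℝ} {ζ : E3 → ℝ} (hC : 0 ≤ C) (hκC : ∀ z, z ≠ 0 → |κ z| ≤
    C * ‖z‖ ^ (-σ - 3)) (hL : 0 ≤ L) (hζ : BddLip L ζ) (hs : ∀ x, ζ x ≠ 0 → ‖x - z‖ ≤ R) (x y :
    E3) : ‖κ (x - y) * (ζ x - ζ y)‖ₑ ≤ ofReal (C * L) * commKernelOn σ z R x y := by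
  by_cases h : x ∈ closedBall z R ∨ y ∈ closedBall z R
  · rw [commKernelOn_of_mem h, commKernelE, ← ofReal_mul (by positivity), ← ofReal_norm]
    exact ofReal_le_ofReal (abs_kernel_mul_le hC hκC hζ rfl)
  · simp only [mem_closedBall, dist_eq_norm] at h
    push Not at h
    have hy : ζ y = 0 := by by_contra hy; exact absurd (hs y hy) (not_le.2 h.2)
    simp [(by by_contra hx; exact absurd (hs x hx) (not_le.2 h.1) : ζ x = 0), hy]

lemma lintegral_comm_mul_lt_top (h0 : 3 / 4 ≤ σ) (h1 : σ < 1) {f h : E3 → ℝ} (R : ℝ)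
    (hf : AEStronglyMeasurable f) (hfw : wtEnergy f z < ⊤) (hh : IsTest univ h) :
    ∫⁻ y, ‖h y‖ₑ * ∫⁻ x, commKernelOn σ z R x y * ‖f x‖ₑ < ⊤ := by
  obtain ⟨C, hC, hb⟩ := exists_comm_bound h0 h1 R
  have h3 : ∫⁻ y, ‖h y‖ₑ ^ 2 < ⊤ := by
    rw [← eLpNorm_two_sq]
    exact pow_lt_top ((hh.1.continuous.memLp_of_hasCompactSupport hh.2.1)).2
  exact (pow_lt_top_iff.1 ((lintegral_mul_sq_le hh.1.continuous.enorm.measurable.aemeasurable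
    (AEMeasurable.lintegral_prod_right'
    (((measurable_commKernelOn σ z R).comp measurable_swap).aemeasurable.mul
    hf.enorm.comp_snd))).trans_lt
    (mul_lt_top h3 ((hb _ z hf.enorm).trans_lt (mul_lt_top hC hfw))))).resolve_right two_ne_zero

/-- Local fractional Sobolev inequality on unit scale, with constants independent of the center. -/
lemma exists_local_sobolev (h0 : 3 / 4 ≤ s) (h1 : s < 1) :
    ∃ C : ℝ≥0∞, C < ⊤ ∧ ∀ (z : E3) (f v : E3 → ℝ), AEStronglyMeasurable f → AEStronglyMeasurable v →
    wtEnergy f z < ⊤ → wtEnergy v z < ⊤ → (∀ h, IsTest univ h → ∫ x, v x * h x =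
    ∫ x, f x * lam s h x) → ∫⁻ x in closedBall z 2, ‖f x‖ₑ ^ 4 ≤
    C * ((∫⁻ x in closedBall z 4, ‖v x‖ₑ ^ 2) + wtEnergy f z) ^ 2 := by
  have hs0 : 0 < s := by linarith
  obtain ⟨κ, hκm, hκe, ⟨Cκ, hCκ, hκC⟩, hκ⟩ := exists_lam_kernel hs0 h1
  obtain ⟨L, hL, hLip⟩ := exists_ballBump_bddLip (r := 2) two_pos
  obtain ⟨C1, hC1, hcomm⟩ := exists_comm_bound h0 h1 4
  obtain ⟨CS, hCS, hsob⟩ := exists_sobolev h0 h1.le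
  obtain ⟨η, hη, -, hηlim⟩ := exists_mollifier_seq
  set A : ℝ≥0∞ := ofReal ((1 + 4) ^ (15 / 4 : ℝ)) with hA
  set B := ofReal (Cκ * L) with hB
  refine ⟨ofReal CS * (A + 2 + 2 * (B ^ 2 * C1)) ^ 2, by finiteness, ?_⟩
  intro z f v hf hv hfw hvw hlam
  set ζ := ballBump 2 z with hζ
  have hζt : IsTest univ ζ := ballBump_isTest two_pos z
  have hζs : ∀ x, ζ x ≠ 0 → ‖x - z‖ ≤ 4 := fun x hx => by
    have := norm_le_of_ballBump_ne_zero two_pos hx; linarith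
  have hζm : Measurable ζ := hζt.1.continuous.measurable
  have hloc := locallyIntegrable_of_wtEnergy hf hfw
  have hlocv := locallyIntegrable_of_wtEnergy hv hvw
  set F := fun x => ζ x * f x with hF
  have hFi : Integrable F := hloc.integrable_smul_left_of_hasCompactSupport
    hζt.1.continuous hζt.2.1
  have hFs : HasCompactSupport F := hζt.2.1.mul_right
  set G := fun y => ∫ x, κ (x - y) * (ζ x - ζ y) * f x with hG
  have hGb : ∀ y, ‖G y‖ₑ ≤ B * ∫⁻ x, commKernelOn s z 4 x y * ‖f x‖ₑ := fun y => by
    rw [← lintegral_ofReal_mul]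
    refine (enorm_integral_le_lintegral_enorm _).trans (lintegral_mono fun x => ?_)
    rw [enorm_mul, ← mul_assoc]
    gcongr
    exact enorm_kernel_mul_le hCκ hκC hL (hLip z) hζs x y
  have hG2 : ∫⁻ y, ‖G y‖ₑ ^ 2 ≤ B ^ 2 * C1 * wtEnergy f z := by
    calc _ ≤ ∫⁻ y, B ^ 2 * (∫⁻ x, commKernelOn s z 4 x y * ‖f x‖ₑ) ^ 2 := by
          refine lintegral_mono fun y => ?_
          rw [← mul_pow]; gcongr; exact hGb y
      _ = B ^ 2 * ∫⁻ y, (∫⁻ x, commKernelOn s z 4 x y * ‖f x‖ₑ) ^ 2 :=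
          lintegral_const_mul' _ _ (by finiteness)
      _ ≤ _ := by rw [mul_assoc]; gcongr; exact hcomm _ z hf.enorm
  have hKm :=
    (hκm.comp (measurable_fst.sub measurable_snd)).mul
      ((hζm.comp measurable_fst).sub (hζm.comp measurable_snd))
  have hGm : AEStronglyMeasurable G := AEStronglyMeasurable.integral_prod_right'
    ((hKm.comp measurable_swap).aestronglyMeasurable.mul hf.comp_snd)
  set k := fun y => ζ y * v y + G y with hk
  have hkm : AEStronglyMeasurable k := (hζm.aestronglyMeasurable.mul hv).add hGm
  have hw : ∀ h, IsTest univ h → ∫ x, F x * lam s h x = ∫ x, k x * h x := by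
    intro h hh
    have hζh : IsTest univ (fun x => ζ x * h x) :=
      ⟨hζt.1.mul hh.1, hζt.2.1.mul_right, subset_univ _⟩
    have hprod : Integrable (fun p : E3 × E3 => f p.1 * (κ (p.1 - p.2) * (ζ p.1 - ζ p.2) * h p.2))
        (volume.prod volume) := by
      refine ⟨hf.comp_fst.mul ((hKm.mul
        (hh.1.continuous.measurable.comp measurable_snd)).aestronglyMeasurable), ?_⟩
      rw [hasFiniteIntegral_iff_enorm]
      have hmE : AEMeasurable (fun p : E3 × E3 =>
          ‖f p.1 * (κ (p.1 - p.2) * (ζ p.1 - ζ p.2) * h p.2)‖ₑ) (volume.prod volume) :=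
        (hf.comp_fst.mul ((hKm.mul
          (hh.1.continuous.measurable.comp measurable_snd)).aestronglyMeasurable)).enorm
      rw [lintegral_prod_symm _ hmE]
      refine lt_of_le_of_lt ?_ (mul_lt_top (ofReal_lt_top (r := Cκ * L))
        (lintegral_comm_mul_lt_top h0 h1 4 hf hfw hh))
      rw [← lintegral_ofReal_mul]
      refine lintegral_mono fun y => ?_
      simp only
      rw [← lintegral_const_mul' _ _ enorm_ne_top, ← lintegral_ofReal_mul]
      refine lintegral_mono fun x => ?_
      simp only [enorm_mul (f x), enorm_mul _ (h y)]
      have := enorm_kernel_mul_le hCκ hκC hL (hLip z) hζs x y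
      calc _ ≤ ‖f x‖ₑ * ((ofReal (Cκ * L) * commKernelOn s z 4 x y) * ‖h y‖ₑ) := by
            gcongr
        _ = _ := by ring
    obtain ⟨Cd, hCd⟩ := lam_decay h0 (by linarith) hζh
    have i1 : Integrable (fun x => f x * lam s (fun x => ζ x * h x) x) := by
      refine integrable_mul_of_le_wt hf ?_ hfw hCd
      rw [show lam s (fun x => ζ x * h x) = fun x => ∫ y, κ (x - y) * ((ζ y * h y) - (ζ x * h x)) by
        ext x; rw [lam_eq_re, (hκ _ _ hζh x).2, Complex.ofReal_re]]
      refine AEStronglyMeasurable.integral_prod_right'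
        (f := fun p : E3 × E3 => κ (p.1 - p.2) * ((ζ p.2 * h p.2) - (ζ p.1 * h p.1))) ?_
      have hm := hζh.1.continuous.measurable
      exact ((hκm.comp (measurable_fst.sub measurable_snd)).mul
        ((hm.comp measurable_snd).sub (hm.comp measurable_fst))).aestronglyMeasurable
    have i2 : Integrable (fun x => f x * ∫ y, κ (x - y) * (ζ x - ζ y) * h y) := by
      have := hprod.integral_prod_left
      simpa only [integral_const_mul] using this
    have i3 : Integrable (fun y => G y * h y) := by
      have := hprod.integral_prod_right
      refine this.congr (.of_forall fun y => ?_)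
      simp only
      rw [← integral_mul_const]
      congr 1; ext x; ring
    have i4 : Integrable (fun y => v y * (ζ y * h y)) := by
      refine (hlocv.integrable_smul_left_of_hasCompactSupport (hζh.1.continuous) hζh.2.1).congr
        (.of_forall fun y => ?_)
      simp only [smul_eq_mul]; ring
    calc _ = ∫ x, (f x * lam s (fun x => ζ x * h x) x +
          f x * ∫ y, κ (x - y) * (ζ x - ζ y) * h y) := by
          refine integral_congr_ae (.of_forall fun x => ?_)
          simp only
          rw [← mul_add, ← (lam_commutator hκ hζh hh x).2]; ring
      _ = (∫ y, v y * (ζ y * h y)) + ∫ x, f x * ∫ y, κ (x - y) * (ζ x - ζ y) * h y := by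
        rw [integral_add i1 i2, hlam _ hζh]
      _ = (∫ y, v y * (ζ y * h y)) + ∫ y, G y * h y := by
        congr 1
        calc _ = ∫ x, ∫ y, f x * (κ (x - y) * (ζ x - ζ y) * h y) := by
              simp only [integral_const_mul]
          _ = ∫ y, ∫ x, f x * (κ (x - y) * (ζ x - ζ y) * h y) := integral_integral_swap hprod
          _ = _ := by
            refine integral_congr_ae (.of_forall fun y => ?_)
            simp only
            rw [← integral_mul_const]
            congr 1; ext x; ring
      _ = _ := by
        rw [← integral_add i4 i3]
        refine integral_congr_ae (.of_forall fun y => ?_)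
        simp only; ring
  set X := (∫⁻ x in closedBall z 4, ‖v x‖ₑ ^ 2)
  have hζ1 : ∀ (g : E3 → ℝ), ∫⁻ x, ‖ζ x * g x‖ₑ ^ 2 ≤
      ∫⁻ x in closedBall z 4, ‖g x‖ₑ ^ 2 := by
    intro g
    rw [← lintegral_indicator measurableSet_closedBall]
    refine lintegral_mono fun x => ?_
    by_cases hx : x ∈ closedBall z 4
    · rw [indicator_of_mem hx, enorm_mul]
      gcongr
      calc ‖ζ x‖ₑ * ‖g x‖ₑ ≤ 1 * ‖g x‖ₑ := by
            gcongr
            rw [enorm_of_nonneg (ballBump_nonneg _ _ _), ← ofReal_one]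
            exact ofReal_le_ofReal (ballBump_le_one _ _ _)
        _ = _ := one_mul _
    · have : ζ x = 0 := by
        by_contra hc
        exact hx (by rw [mem_closedBall, dist_eq_norm]; exact hζs x hc)
      simp [this]
  have hk2 : ∫⁻ x, ‖k x‖ₑ ^ 2 ≤ 2 * X + 2 * (B ^ 2 * C1 * wtEnergy f z) := by
    calc _ ≤ ∫⁻ x, (2 * ‖ζ x * v x‖ₑ ^ 2 + 2 * ‖G x‖ₑ ^ 2) := by
          refine lintegral_mono fun x => ?_
          calc _ ≤ (‖ζ x * v x‖ₑ + ‖G x‖ₑ) ^ 2 := by gcongr; exact enorm_add_le _ _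
            _ ≤ 2 * (‖ζ x * v x‖ₑ ^ 2 + ‖G x‖ₑ ^ 2) := ennreal_add_sq_le _ _
            _ = _ := by ring
      _ = 2 * (∫⁻ x, ‖ζ x * v x‖ₑ ^ 2) + 2 * ∫⁻ x, ‖G x‖ₑ ^ 2 := by
        rw [lintegral_add_right' _ ((hGm.enorm.pow_const 2).const_mul 2),
          lintegral_const_mul' _ _ (by finiteness), lintegral_const_mul' _ _ (by finiteness)]
      _ ≤ _ := by
        gcongr
        exact hζ1 v
  have hn : ∀ n, ∫⁻ x, ‖mollify (η n) F x‖ₑ ^ 4 ≤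
    ofReal CS * ((A + 2 + 2 * (B ^ 2 * C1)) * (X + wtEnergy f z)) ^ 2 := fun n => by
    have hs := hsob univ _ (mollify_isTest (hη n) hFi.locallyIntegrable hFs)
    refine hs.trans ?_
    gcongr
    have e1 : ∫⁻ x, ‖mulC (lamSym s) (mollify (η n) F) x‖ₑ ^ 2 ≤ ∫⁻ x, ‖k x‖ₑ ^ 2 := by
      refine le_trans (le_of_eq (lintegral_congr fun x => ?_)) (lintegral_mollify_le (hη n) hkm)
      rw [mulC_mollify hs0 h1 hκm hκe ⟨Cκ, hCκ, hκC⟩ hκ hFi hFs hw (hη n) x]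
      simp [enorm_eq_nnnorm]
    calc _ ≤ A * wtEnergy f z + (2 * X + 2 * (B ^ 2 * C1 * wtEnergy f z)) :=
      add_le_add ((lintegral_mollify_le (hη n) hFi.1).trans
        ((hζ1 f).trans (setLIntegral_closedBall_le_wtEnergy f z 4))) (e1.trans hk2)
      _ ≤ A * wtEnergy f z + (2 * X + 2 * (B ^ 2 * C1 * wtEnergy f z)) +
        (A * X + 2 * wtEnergy f z + 2 * (B ^ 2 * C1) * X) := le_self_add
      _ = _ := by ring
  calc _ ≤ ∫⁻ x, ‖F x‖ₑ ^ 4 := by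
        refine le_trans (le_of_eq (setLIntegral_congr_fun measurableSet_closedBall fun x hx => ?_))
          (setLIntegral_le_lintegral (closedBall z 2) _)
        simp only [hF]
        rw [hζ, ballBump_eq_one two_pos (by simpa [dist_eq_norm] using hx), one_mul]
    _ ≤ ∫⁻ x, liminf (fun n => ‖mollify (η n) F x‖ₑ ^ 4) atTop := by
      refine lintegral_mono_ae ?_
      filter_upwards [hηlim F hFi.locallyIntegrable] with x hx using
        (((ENNReal.continuous_pow 4).tendsto _).comp ((continuous_enorm.tendsto _).comp
        hx)).liminf_eq.ge
    _ ≤ liminf (fun n => ∫⁻ x, ‖mollify (η n) F x‖ₑ ^ 4) atTop := lintegral_liminf_le fun n =>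
      (mollify_contDiff (hη n) hFi.locallyIntegrable).continuous.enorm.measurable.pow_const 4
    _ ≤ ofReal CS * ((A + 2 + 2 * (B ^ 2 * C1)) * (X + wtEnergy f z)) ^ 2 := by
      refine liminf_le_of_le (by isBoundedDefault) fun b hb => ?_
      obtain ⟨n, hn'⟩ := hb.exists
      exact hn'.trans (hn n)
    _ = _ := by rw [mul_pow]; ring

/-! ### Representation of bounded functionals and weak convergence of mollifications -/

/-- A functional that is bounded by the `L²` norm of a linear image is represented by an `L²`
function. -/
lemma exists_memLp_of_bound {V : Type*} [InnerProductSpace ℝ F] [CompleteSpace F] [AddCommGroup V]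
    [Module ℝ V] (J : V →ₗ[ℝ] (α → F)) (hJ : ∀ g, MemLp (J g) 2 μ) (ℓ : V →ₗ[ℝ] ℝ) (hC : 0 ≤ C)
    (hb : ∀ g, |ℓ g| ≤ C * (eLpNorm (J g) 2 μ).toReal) : ∃ W : α → F, MemLp W 2 μ ∧ eLpNorm W 2 μ ≤
    ofReal C ∧ ∀ g, ℓ g = ∫ x, inner ℝ (W x) (J g x) ∂μ := by
  let K : V →ₗ[ℝ] Lp F 2 μ :=
    { toFun := fun g => (hJ g).toLp
      map_add' := fun g h => by
        rw [← MemLp.toLp_add]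
        exact MemLp.toLp_congr _ _ (by rw [map_add])
      map_smul' := fun c g => by
        simp only [RingHom.id_apply]
        rw [← MemLp.toLp_const_smul]
        exact MemLp.toLp_congr _ _ (by rw [map_smul]) }
  have hK : ∀ g, ‖K g‖ = (eLpNorm (J g) 2 μ).toReal := fun g => Lp.norm_toLp _ (hJ g)
  have hker : LinearMap.ker K ≤ LinearMap.ker ℓ := fun g hg => by
    rw [LinearMap.mem_ker] at hg ⊢
    have h1 := hb g
    rw [← hK, hg, norm_zero, mul_zero] at h1
    exact abs_eq_zero.1 (le_antisymm h1 (abs_nonneg _))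
  let ℓ' : LinearMap.range K →ₗ[ℝ] ℝ :=
    ((LinearMap.ker K).liftQ ℓ hker).comp K.quotKerEquivRange.symm.toLinearMap
  have hℓ' : ∀ g, ℓ' ⟨K g, LinearMap.mem_range_self K g⟩ = ℓ g := fun g => by
    simp only [ℓ']
    simp
  let ℓc : StrongDual ℝ (LinearMap.range K) := ℓ'.mkContinuous C (by
    rintro ⟨x, g, rfl⟩
    rw [hℓ' g, norm_eq_abs]
    refine (hb g).trans (le_of_eq ?_)
    rw [← hK]; rfl)
  obtain ⟨L, hL, hLn⟩ := exists_extension_norm_eq _ ℓc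
  let W : Lp F 2 μ := (InnerProductSpace.toDual ℝ (Lp F 2 μ)).symm L
  have hWn : ‖W‖ ≤ C := by
    rw [LinearIsometryEquiv.norm_map, hLn]
    exact LinearMap.mkContinuous_norm_le _ hC _
  refine ⟨W, Lp.memLp W, ?_, fun g => ?_⟩
  · rw [← Lp.enorm_def, ← ofReal_norm]
    exact ofReal_le_ofReal hWn
  · rw [← hℓ' g]
    have h1 : L (K g) = ℓ' ⟨K g, LinearMap.mem_range_self K g⟩ :=
      hL ⟨K g, LinearMap.mem_range_self K g⟩
    rw [← h1, ← InnerProductSpace.toDual_symm_apply, L2.inner_def]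
    refine integral_congr_ae ?_
    filter_upwards [(hJ g).coeFn_toLp] with x hx
    change inner ℝ (W x) (((hJ g).toLp (J g)) x) = _
    rw [hx]

lemma integrable_mul_of_memLp {f g : α → ℝ} (hf : MemLp f 2 μ) (hg : MemLp g 2 μ) :
    Integrable (fun x => f x * g x) μ := hf.integrable_mul hg

/-- The Cauchy-Schwarz inequality for integrals. -/
lemma abs_integral_mul_le {f g : α → ℝ} (hf : MemLp f 2 μ) (hg : MemLp g 2 μ) :
    ‖∫ x, f x * g x ∂μ‖ₑ ≤ eLpNorm f 2 μ * eLpNorm g 2 μ := by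
  refine (enorm_integral_le_lintegral_enorm _).trans ?_
  rw [← pow_le_pow_left_iff two_ne_zero, mul_pow, eLpNorm_two_sq, eLpNorm_two_sq]
  simpa only [enorm_mul] using lintegral_mul_sq_le hf.1.enorm hg.1.enorm

lemma eLpNorm_mollify_le {F : E3 → ℝ} (hη : IsMollifier η) (hF : AEStronglyMeasurable F) :
    eLpNorm (mollify η F) 2 volume ≤ eLpNorm F 2 volume := by
  rw [← pow_le_pow_left_iff two_ne_zero, eLpNorm_two_sq, eLpNorm_two_sq]
  exact lintegral_mollify_le hη hF

lemma memLp_mollify {F : E3 → ℝ} (hη : IsMollifier η) (hF : MemLp F 2 volume) :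
    MemLp (mollify η F) 2 volume :=
  ⟨(mollify_contDiff hη (hF.locallyIntegrable (by norm_num))).continuous.aestronglyMeasurable,
    (eLpNorm_mollify_le hη hF.1).trans_lt hF.2⟩

lemma integrable_mollify_kernel {F : E3 → ℝ} (hη : IsMollifier η) (hF : LocallyIntegrable F)
    (x : E3) : Integrable (fun y => η (x - y) * F y) := hF.integrable_smul_left_of_hasCompactSupport
      (hη.isTest.1.continuous.comp (continuous_const.sub continuous_id))
      (hη.isTest.2.1.comp_homeomorph (Homeomorph.subLeft x))

lemma mollify_add {F G : E3 → ℝ} (hη : IsMollifier η) (hF : LocallyIntegrable F)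
    (hG : LocallyIntegrable G) (x : E3) : mollify η (F + G) x = mollify η F x + mollify η G x := by
  rw [mollify, mollify, mollify, ← integral_add (integrable_mollify_kernel hη hF x)
    (integrable_mollify_kernel hη hG x)]
  simp only [Pi.add_apply, mul_add]

lemma abs_mollify_le {F : E3 → ℝ} (hη : IsMollifier η) {B : ℝ} (hB : ∀ y, |F y| ≤ B) (x : E3) :
    |mollify η F x| ≤ B := by
  calc _ ≤ ∫ y, η (x - y) * B := by
        rw [mollify, ← norm_eq_abs]
        refine norm_integral_le_of_norm_le
          (((hη.isTest.1.continuous.integrable_of_hasCompactSupport hη.isTest.2.1).comp_sub_left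
          x).mul_const B) (.of_forall fun y => ?_)
        rw [norm_mul, norm_of_nonneg (hη.nonneg _)]
        exact mul_le_mul_of_nonneg_left (hB y) (hη.nonneg _)
    _ = B := by rw [integral_mul_const, integral_sub_left_eq_self (η), hη.integral_eq, one_mul]

/-- A sequence of mollifiers for which mollification converges almost everywhere. -/
structure IsMollifierSeq (η : ℕ → E3 → ℝ) : Prop where
  isMollifier : ∀ n, IsMollifier (η n)
  support : ∀ n z, η n z ≠ 0 → ‖z‖ ≤ 1 / ((n : ℝ) + 1)
  tendsto_ae : ∀ F : E3 → ℝ, LocallyIntegrable F →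
    ∀ᵐ x, Tendsto (fun n => mollify (η n) F x) atTop (𝓝 (F x))

lemma exists_isMollifierSeq : ∃ η, IsMollifierSeq η := by
  obtain ⟨η, h1, h2, h3⟩ := exists_mollifier_seq
  exact ⟨η, h1, h2, h3⟩

lemma IsMollifierSeq.tendsto_integral {η : ℕ → E3 → ℝ} (hη : IsMollifierSeq η) {W k : E3 → ℝ}
    (hW : MemLp W 2 volume) (hk : MemLp k 2 volume) :
    Tendsto (fun n => ∫ x, W x * mollify (η n) k x) atTop (𝓝 (∫ x, W x * k x)) := by
  rw [Metric.tendsto_atTop]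
  intro ε hε
  set N := (eLpNorm W 2 volume).toReal
  obtain ⟨g, hg1, hg2, hg3⟩ := hk.exist_eLpNorm_sub_le (by norm_num) (by norm_num)
    (by positivity : 0 < ε / (4 * (N + 1)))
  have hgL : MemLp g 2 volume := hg2.continuous.memLp_of_hasCompactSupport hg1
  have hd : MemLp (k - g) 2 volume := hk.sub hgL
  have hgt : IsTest univ g := ⟨hg2, hg1, subset_univ _⟩
  have hlim : Tendsto (fun n => ∫ x, W x * mollify (η n) g x) atTop (𝓝 (∫ x, W x * g x)) := by
    obtain ⟨R, hR, hsupp⟩ := hgt.exists_radius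
    obtain ⟨A, B, hA, -⟩ := hgt.exists_bounds
    have hA0 := (abs_nonneg _).trans (hA 0)
    have hWi : Integrable ((closedBall 0 (R + 1)).indicator fun x => |W x| * A) := by
      refine IntegrableOn.integrable_indicator ?_ measurableSet_closedBall
      exact ((hW.locallyIntegrable (by norm_num)).integrableOn_isCompact
        (isCompact_closedBall _ _)).abs.mul_const A
    refine tendsto_integral_of_dominated_convergence _ (fun n => ?_) hWi (fun n => ?_) ?_
    · exact (integrable_mul_of_memLp hW (memLp_mollify (hη.isMollifier n) hgL)).1
    · refine .of_forall fun x => ?_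
      by_cases hx : x ∈ closedBall 0 (R + 1)
      · rw [indicator_of_mem hx, norm_mul, norm_eq_abs, norm_eq_abs]
        gcongr
        exact abs_mollify_le (hη.isMollifier n) hA x
      · rw [indicator_of_notMem hx]
        have : mollify (η n) g x = 0 := by
          by_contra hc
          apply hx
          simpa using mollify_support (hη.isMollifier n).support (c := 0) (by simpa using hsupp) hc
        simp [this]
    · filter_upwards [hη.tendsto_ae g (hgL.locallyIntegrable (by norm_num))] with x hx using
        hx.const_mul _
  obtain ⟨n₀, hn₀⟩ := (Metric.tendsto_atTop.1 hlim) (ε / 2) (by positivity)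
  refine ⟨n₀, fun n hn => ?_⟩
  have key : ∀ G : E3 → ℝ, MemLp G 2 volume →
    eLpNorm G 2 volume ≤ ofReal (ε / (4 * (N + 1))) →
    |∫ x, W x * G x| ≤ N * (ε / (4 * (N + 1))) := fun G hG hGe => by
    have h1 := (abs_integral_mul_le hW hG).trans (mul_le_mul_right hGe _)
    rw [← ofReal_norm, norm_eq_abs, ← ofReal_toReal hW.2.ne, ← ofReal_mul toReal_nonneg] at h1
    exact (ofReal_le_ofReal_iff (by positivity)).1 h1
  have h1 := key _ hd hg3
  have h2 := key _ (memLp_mollify (hη.isMollifier n) hd)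
    ((eLpNorm_mollify_le (hη.isMollifier n) hd.1).trans hg3)
  have h3 := hn₀ n hn
  rw [dist_eq] at h3 ⊢
  have e1 : ∫ x, W x * mollify (η n) k x =
    (∫ x, W x * mollify (η n) (k - g) x) + ∫ x, W x * mollify (η n) g x := by
    rw [← integral_add (integrable_mul_of_memLp hW (memLp_mollify (hη.isMollifier n) hd))
      (integrable_mul_of_memLp hW (memLp_mollify (hη.isMollifier n) hgL))]
    refine integral_congr_ae (.of_forall fun x => ?_)
    simp only
    rw [← mul_add, ← mollify_add (hη.isMollifier n) (hd.locallyIntegrable (by norm_num))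
      (hgL.locallyIntegrable (by norm_num)), sub_add_cancel]
  have e2 : ∫ x, W x * k x = (∫ x, W x * (k - g) x) + ∫ x, W x * g x := by
    rw [← integral_add (integrable_mul_of_memLp hW hd) (integrable_mul_of_memLp hW hgL)]
    refine integral_congr_ae (.of_forall fun x => ?_)
    simp only [Pi.sub_apply]; ring
  rw [e1, e2]
  have h4 : N * (ε / (4 * (N + 1))) < ε / 4 := by
    rw [mul_div_assoc', div_lt_div_iff₀ (by positivity) (by norm_num)]
    nlinarith
  rw [abs_lt] at *
  rw [abs_le] at h1 h2
  constructor <;> linarith [h1.2]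

/-! ### Zero-order multipliers acting on square-integrable functions -/

/-- Test functions on `ℝ³` as a real vector space. -/
def testSpace : Submodule ℝ (E3 → ℝ) where
  carrier := {g | IsTest univ g}
  add_mem' ha hb := ⟨ha.1.add hb.1, ha.2.1.add hb.2.1, subset_univ _⟩
  zero_mem' := ⟨contDiff_const, HasCompactSupport.zero, subset_univ _⟩
  smul_mem' c _ hg := ⟨hg.1.const_smul c, hg.2.1.smul_left (f := fun _ => c), subset_univ _⟩

lemma integrable_fourierChar_smul {f : E3 → ℂ} (hf : Integrable f) {c : E3 → ℝ}
    (hc : Continuous c) : Integrable fun v => fourierChar (c v) • f v :=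
  hf.norm.mono' (AEStronglyMeasurable.smul (continuous_subtype_val.comp (continuous_fourierChar.comp
    hc)).aestronglyMeasurable hf.1) (.of_forall fun v => by rw [Circle.norm_smul])

lemma ftR_add {h : E3 → ℝ} (hg : IsTest univ g) (hh : IsTest univ h) (ξ : E3) :
    ftR (g + h) ξ = ftR g ξ + ftR h ξ := by
  have h1 : Integrable (fun y => (g y : ℂ)) :=
    (hg.1.continuous.integrable_of_hasCompactSupport hg.2.1).ofReal
  have h2 : Integrable (fun y => (h y : ℂ)) :=
    (hh.1.continuous.integrable_of_hasCompactSupport hh.2.1).ofReal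
  have hc : Continuous fun v : E3 => -(inner ℝ v ξ) := by fun_prop
  rw [ftR, ftR, ftR, fourier_eq, fourier_eq, fourier_eq,
    ← integral_add (integrable_fourierChar_smul h1 hc) (integrable_fourierChar_smul h2 hc)]
  congr 1; ext y
  simp only [Pi.add_apply, Complex.ofReal_add, smul_add]

lemma ftR_smul (c : ℝ) (g : E3 → ℝ) (ξ : E3) : ftR (c • g) ξ = c * ftR g ξ := by
  rw [ftR, ftR, fourier_eq, fourier_eq, ← integral_const_mul]
  congr 1; ext y
  simp only [Pi.smul_apply, smul_eq_mul, Complex.ofReal_mul, Circle.smul_def]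
  ring

lemma mulC_eq_fourierInv (m g : E3 → ℝ) (x : E3) :
    mulC m g x = 𝓕⁻ (fun ξ : E3 => (m ξ : ℂ) * ftR g ξ) x := rfl

lemma IsHomSymbol.mulC_add (hm : IsHomSymbol σ m) (h0 : 0 ≤ σ) (h2 : σ ≤ 2) {h : E3 → ℝ}
    (hg : IsTest univ g) (hh : IsTest univ h) (x : E3) : mulC m (g + h) x = mulC m g x +
    mulC m h x := by
  rw [mulC_eq_fourierInv, mulC_eq_fourierInv, mulC_eq_fourierInv, fourierInv_eq, fourierInv_eq,
    fourierInv_eq, ← integral_add (integrable_fourierChar_smul (hm.integrable_mul_ftR h0 h2 hg)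
    (by fun_prop)) (integrable_fourierChar_smul (hm.integrable_mul_ftR h0 h2 hh) (by fun_prop))]
  congr 1; ext ξ
  rw [ftR_add hg hh, mul_add, smul_add]

lemma mulC_smul (m : E3 → ℝ) (c : ℝ) (g : E3 → ℝ) (x : E3) : mulC m (c • g) x = c * mulC m g x := by
  rw [mulC_eq_fourierInv, mulC_eq_fourierInv, fourierInv_eq, fourierInv_eq, ← integral_const_mul]
  congr 1; ext ξ
  simp only [ftR_smul, Circle.smul_def]
  ring

lemma IsHomSymbol.continuous_mulC (hm : IsHomSymbol σ m) (h0 : 0 ≤ σ) (h2 : σ ≤ 2)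
    (hg : IsTest Ω g) : Continuous (mulC m g) := by
  have hi := hm.integrable_mul_ftR h0 h2 hg
  have : mulC m g = fun x => ∫ v, fourierChar (inner ℝ v x) • ((m v) * ftR g v) := by
    ext x; rw [mulC_eq_fourierInv, fourierInv_eq]
  rw [this]
  refine continuous_of_dominated (fun x => ?_) (fun x => .of_forall fun v =>
    by rw [Circle.norm_smul]) hi.norm (.of_forall fun v => ?_)
  · exact (integrable_fourierChar_smul hi (by fun_prop)).1
  · exact (continuous_fourierChar.comp (by fun_prop)).smul continuous_const

lemma riesz_symbol_abs_le_one (i j : Fin 3) (ξ : E3) : |ξ i * ξ j / ‖ξ‖ ^ 2| ≤ 1 := by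
  by_cases h : ξ = 0
  · simp [h]
  rw [abs_div, abs_mul, abs_of_pos (by positivity : 0 < ‖ξ‖ ^ 2), div_le_one (by positivity), sq]
  have := PiLp.norm_apply_le ξ i
  have := PiLp.norm_apply_le ξ j
  simp only [norm_eq_abs] at *
  gcongr

lemma IsTest.memLp [NormedSpace ℝ F] {g : E3 → F} (hg : IsTest Ω g) (p : ℝ≥0∞) : MemLp g p volume :=
  hg.1.continuous.memLp_of_hasCompactSupport hg.2.1

lemma continuous_rieszPair (i j : Fin 3) (hg : IsTest univ g) : Continuous (rieszPair i j g) :=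
  Complex.continuous_re.comp ((isHomSymbol_riesz i j).continuous_mulC le_rfl zero_le_two hg)

lemma eLpNorm_rieszPair_le (i j : Fin 3) (hg : IsTest univ g) : eLpNorm (rieszPair i j g) 2 volume ≤
    eLpNorm g 2 volume := by
  calc _ ≤ eLpNorm (mulC (fun ξ => ξ i * ξ j / ‖ξ‖ ^ 2) g) 2 volume :=
    eLpNorm_mono fun x => abs_re_le_norm _
    _ ≤ ofReal 1 * eLpNorm g 2 volume :=
      eLpNorm_mulC_le (isHomSymbol_riesz i j).measurable (riesz_symbol_abs_le_one i j) hg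
    _ = _ := by rw [ofReal_one, one_mul]

lemma memLp_rieszPair (i j : Fin 3) (hg : IsTest univ g) : MemLp (rieszPair i j g) 2 volume :=
  ⟨(continuous_rieszPair i j hg).aestronglyMeasurable,
    (eLpNorm_rieszPair_le i j hg).trans_lt (hg.memLp 2).2⟩

lemma rieszPair_add (i j : Fin 3) {h : E3 → ℝ} (hg : IsTest univ g) (hh : IsTest univ h) (x : E3) :
    rieszPair i j (g + h) x = rieszPair i j g x + rieszPair i j h x := by
  rw [rieszPair, fourierMul_eq_re, (isHomSymbol_riesz i j).mulC_add le_rfl zero_le_two hg hh]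
  rfl

lemma rieszPair_smul (i j : Fin 3) (c : ℝ) (g : E3 → ℝ) (x : E3) :
    rieszPair i j (c • g) x = c * rieszPair i j g x := by
  rw [rieszPair, fourierMul_eq_re, mulC_smul, Complex.re_ofReal_mul]
  rfl

/-- The transpose on `L²` of the double Riesz transform. -/
lemma exists_riesz_transpose (i j : Fin 3) {U : E3 → ℝ} (hU : MemLp U 2 volume) :
    ∃ W : E3 → ℝ, MemLp W 2 volume ∧ ∀ g, IsTest univ g → ∫ x, U x * rieszPair i j g x =
    ∫ x, W x * g x := by
  have hi : ∀ g : testSpace, Integrable fun x => U x * rieszPair i j g x := fun g =>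
    integrable_mul_of_memLp hU (memLp_rieszPair i j g.2)
  obtain ⟨W, hW, -, hWe⟩ := exists_memLp_of_bound testSpace.subtype
    (fun g => IsTest.memLp g.2 2)
    { toFun := fun g => ∫ x, U x * rieszPair i j g x
      map_add' := fun g h => by
        rw [← integral_add (hi g) (hi h)]
        congr 1; ext x
        rw [← mul_add, ← rieszPair_add i j g.2 h.2]; rfl
      map_smul' := fun c g => by
        simp only [RingHom.id_apply, smul_eq_mul]
        rw [← integral_const_mul]
        congr 1; ext x
        rw [Submodule.coe_smul, rieszPair_smul]; ring } toReal_nonneg (fun g => by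
      have h3 := toReal_mono (mul_ne_top hU.2.ne (IsTest.memLp g.2 2).2.ne)
        ((abs_integral_mul_le hU (memLp_rieszPair i j g.2)).trans
        (mul_le_mul_right (eLpNorm_rieszPair_le i j g.2) _))
      rw [ENNReal.toReal_mul, toReal_enorm] at h3
      exact h3)
  refine ⟨W, hW, fun g hg => ?_⟩
  have := hWe ⟨g, hg⟩
  simp only [LinearMap.coe_mk, AddHom.coe_mk] at this
  rw [this]
  exact integral_congr_ae (.of_forall fun x => by simp [mul_comm])

lemma lintegral_enorm_mollify_le (hη : IsMollifier η) {F : E3 → ℝ} (hF : AEStronglyMeasurable F) :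
    ∫⁻ x, ‖mollify η F x‖ₑ ≤ ∫⁻ x, ‖F x‖ₑ := by
  have hm := hη.isTest.1.continuous.measurable.ennreal_ofReal
  calc _ ≤ ∫⁻ x, ∫⁻ y, ofReal (η (x - y)) * ‖F y‖ₑ :=
    lintegral_mono fun x => enorm_mollify_le hη F x
    _ = ∫⁻ y, ∫⁻ x, ofReal (η (x - y)) * ‖F y‖ₑ := lintegral_lintegral_swap
      ((hm.comp (measurable_fst.sub measurable_snd)).aemeasurable.mul hF.enorm.comp_snd)
    _ = _ := by
      refine lintegral_congr fun y => ?_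
      have hmy : Measurable fun x => ofReal (η (x - y)) :=
        hm.comp (measurable_id.sub measurable_const)
      rw [lintegral_mul_const _ hmy,
        lintegral_sub_right_eq_self (fun y => ofReal (η y)), hη.lintegral, one_mul]

lemma hasCompactSupport_of_norm_sub_le {k : E3 → F} (hk : ∀ x, k x ≠ 0 → ‖x - c‖ ≤ r) :
    HasCompactSupport k :=
  HasCompactSupport.of_support_subset_isCompact (isCompact_closedBall c r) fun x hx => by
    rw [mem_closedBall, dist_eq_norm]; exact hk x hx

lemma lintegral_enorm_eq_ofReal (hg : Integrable g) : ∫⁻ y, ‖g y‖ₑ = ofReal (∫ y, |g y|) := by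
  rw [ofReal_integral_eq_lintegral_ofReal hg.abs (.of_forall fun y => abs_nonneg _)]
  exact lintegral_congr fun y => by rw [← ofReal_norm, norm_eq_abs]

/-- The transposed Riesz transform paired with a function supported in a small ball: the part of `U`
near the ball enters through its `L²` norm, the remaining part only through its `L¹` norm. -/
lemma exists_riesz_small_ball (i j : Fin 3) :
    ∃ C : ℝ≥0∞, C < ⊤ ∧ ∀ (U W : E3 → ℝ), MemLp U 2 volume → MemLp W 2 volume →
    (∀ g, IsTest univ g → ∫ x, U x * rieszPair i j g x = ∫ x, W x * g x) → ∀ (z : E3) (k : E3 → ℝ),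
    MemLp k 2 volume → (∀ x, k x ≠ 0 → ‖x - z‖ ≤ 1 / 2) → ‖∫ x, W x * k x‖ₑ ≤
    eLpNorm U 2 (volume.restrict (closedBall z 2)) * eLpNorm k 2 volume + C * (∫⁻ x, ‖U x‖ₑ) * ∫⁻ x,
    ‖k x‖ₑ := by
  obtain ⟨η, hη⟩ := exists_isMollifierSeq
  obtain ⟨C, hC, hoff⟩ := (isHomSymbol_riesz i j).exists_offDiag_bound (by norm_num) zero_le_two
  refine ⟨ofReal C, ofReal_lt_top, fun U W hU hW hUW z k hk hks => le_of_tendsto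
    ((continuous_enorm.tendsto _).comp (hη.tendsto_integral hW hk)) ?_⟩
  filter_upwards [eventually_ge_atTop 1] with n hn
  have hηn := hη.isMollifier n
  set g := mollify (η n) k
  have hgt := mollify_isTest hηn (hk.locallyIntegrable (by norm_num))
    (hasCompactSupport_of_norm_sub_le hks)
  have hgs : ∀ x, g x ≠ 0 → ‖x - z‖ ≤ 1 := fun x hx => by
    have h1 := mollify_support (hη.support n) hks hx
    have h2 : 1 / ((n : ℝ) + 1) ≤ 1 / 2 := by
      apply one_div_le_one_div_of_le (by norm_num)
      have : (1 : ℝ) ≤ n := by exact_mod_cast hn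
      linarith
    linarith
  simp only [Function.comp_apply]
  rw [← hUW g hgt]
  refine (enorm_integral_le_lintegral_enorm _).trans ?_
  rw [← lintegral_add_compl _ (measurableSet_closedBall)]
  refine add_le_add ?_ ?_
  · have h1 : (∫⁻ x in closedBall z 2, ‖U x * rieszPair i j g x‖ₑ) ≤
      eLpNorm U 2 (volume.restrict (closedBall z 2)) * eLpNorm (rieszPair i j g) 2 volume := by
      rw [← pow_le_pow_left_iff two_ne_zero, mul_pow, eLpNorm_two_sq, eLpNorm_two_sq]
      simp only [enorm_mul]
      exact (lintegral_mul_sq_le hU.1.enorm.restrict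
        (memLp_rieszPair i j hgt).1.enorm.restrict).trans
          (mul_le_mul_right (setLIntegral_le_lintegral _ _) _)
    refine h1.trans ?_
    gcongr
    exact (eLpNorm_rieszPair_le i j hgt).trans (eLpNorm_mollify_le hηn hk.1)
  · calc _ ≤ ∫⁻ x in (closedBall z 2)ᶜ, ofReal C * (∫⁻ y, ‖k y‖ₑ) * ‖U x‖ₑ := by
          refine setLIntegral_mono' measurableSet_closedBall.compl fun x hx => ?_
          rw [enorm_mul, mul_comm]
          gcongr
          have h1 := hoff univ g hgt x 1 one_pos (fun y hy => by
            have h2 := hgs y hy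
            have h3 : 2 < ‖x - z‖ := by simpa [dist_eq_norm] using hx
            have h4 := norm_sub_norm_le (x - z) (y - z)
            rw [sub_sub_sub_cancel_right] at h4
            linarith)
          rw [Real.one_rpow, mul_one] at h1
          calc _ ≤ ofReal (C * ∫ y, |g y|) := by
                rw [← ofReal_norm]
                exact ofReal_le_ofReal ((abs_re_le_norm _).trans h1)
            _ = ofReal C * ∫⁻ y, ‖g y‖ₑ := by
              rw [ofReal_mul hC, lintegral_enorm_eq_ofReal
                (memLp_one_iff_integrable.1 (hgt.memLp 1))]
            _ ≤ _ := mul_le_mul_right (lintegral_enorm_mollify_le hηn hk.1) _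
      _ ≤ ∫⁻ x, ofReal C * (∫⁻ y, ‖k y‖ₑ) * ‖U x‖ₑ := setLIntegral_le_lintegral _ _
      _ = _ := by rw [lintegral_const_mul'' _ hU.1.enorm]; ring

/-- A decomposition of the pairing into contributions of small balls. -/
lemma exists_riesz_pairing_bound (i j : Fin 3) :
    ∃ C : ℝ≥0∞, C < ⊤ ∧ ∀ (U W : E3 → ℝ), MemLp U 2 volume → MemLp W 2 volume →
    (∀ g, IsTest univ g → ∫ x, U x * rieszPair i j g x = ∫ x, W x * g x) →
    ∀ h : E3 → ℝ, MemLp h 2 volume → ‖∫ x, W x * h x‖ₑ ≤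
    C * ((∫⁻ z, eLpNorm U 2 (volume.restrict (closedBall z 2)) * eLpNorm h 2 (volume.restrict
    (closedBall z (1 / 2)))) + (∫⁻ x, ‖U x‖ₑ) * ∫⁻ x, ‖h x‖ₑ) := by
  obtain ⟨C, hC, hb⟩ := exists_riesz_small_ball i j
  obtain ⟨η, hη⟩ := exists_isMollifierSeq
  obtain ⟨A, hA⟩ := (hη.isMollifier 1).isTest.2.1.exists_bound_of_continuous
    (hη.isMollifier 1).isTest.1.continuous
  set e := η 1 with he
  have hem : IsMollifier e := hη.isMollifier 1
  have hes : ∀ z, e z ≠ 0 → ‖z‖ ≤ 1 / 2 := fun z hz => by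
    have := hη.support 1 z hz; norm_num at this ⊢; exact this
  refine ⟨ofReal A + C, by finiteness, fun U W hU hW hUW h hh => ?_⟩
  have hec : Measurable e := hem.isTest.1.continuous.measurable
  have hfub : Integrable (fun p : E3 × E3 => (W p.1 * h p.1) * e (p.1 - p.2))
      (volume.prod volume) := by
    have hWh := integrable_mul_of_memLp hW hh
    have hm : AEStronglyMeasurable (fun p : E3 × E3 => (W p.1 * h p.1) * e (p.1 - p.2))
        (volume.prod volume) := hWh.1.comp_fst.mul
      (hec.comp (measurable_fst.sub measurable_snd)).aestronglyMeasurable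
    refine ⟨hm, ?_⟩
    rw [hasFiniteIntegral_iff_enorm, lintegral_prod _ hm.enorm]
    refine lt_of_le_of_lt (le_of_eq (lintegral_congr fun x => ?_)) hWh.2
    simp only [enorm_mul (W x * h x)]
    rw [lintegral_const_mul' _ _ enorm_ne_top]
    simp only [enorm_of_nonneg (hem.nonneg _)]
    rw [lintegral_sub_left_eq_self (fun y => ofReal (e y)), hem.lintegral, mul_one]
  have e1 : ∫ x, W x * h x = ∫ z, ∫ x, W x * (h x * e (x - z)) := by
    calc _ = ∫ x, ∫ z, (W x * h x) * e (x - z) := by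
          refine integral_congr_ae (.of_forall fun x => ?_)
          simp only
          rw [integral_const_mul, integral_sub_left_eq_self (fun y => e y), hem.integral_eq,
            mul_one]
      _ = ∫ z, ∫ x, (W x * h x) * e (x - z) := integral_integral_swap hfub
      _ = _ := by simp only [mul_assoc]
  rw [e1]
  refine (enorm_integral_le_lintegral_enorm _).trans ?_
  have hmE : AEMeasurable (fun p : E3 × E3 => ‖h p.2‖ₑ * ofReal (e (p.2 - p.1)))
    (volume.prod volume) := hh.1.enorm.comp_snd.mul
    (hec.comp (measurable_snd.sub measurable_fst)).ennreal_ofReal.aemeasurable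
  have heE : ∀ x, ∫⁻ z, ofReal (e (x - z)) = 1 := fun x => by
    rw [lintegral_sub_left_eq_self (fun y => ofReal (e y)), hem.lintegral]
  calc _ ≤ ∫⁻ z, (ofReal A * (eLpNorm U 2 (volume.restrict (closedBall z 2)) *
    eLpNorm h 2 (volume.restrict (closedBall z (1 / 2)))) +
    C * (∫⁻ x, ‖U x‖ₑ) * ∫⁻ x, ‖h x‖ₑ * ofReal (e (x - z))) := by
        refine lintegral_mono fun z => ?_
        have hez : Measurable fun x => e (x - z) := hec.comp (measurable_id.sub measurable_const)
        have hkA : ∀ x, ‖h x * e (x - z)‖ ≤ A * ‖(closedBall z (1 / 2)).indicator h x‖ := fun x =>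
          by
          by_cases hx : e (x - z) = 0
          · rw [hx, mul_zero, norm_zero]
            exact mul_nonneg ((norm_nonneg _).trans (hA 0)) (norm_nonneg _)
          · rw [indicator_of_mem (by simpa [dist_eq_norm] using hes _ hx), norm_mul, mul_comm]
            gcongr
            exact hA _
        have hk2 : eLpNorm (fun x => h x * e (x - z)) 2 volume ≤
          ofReal A * eLpNorm h 2 (volume.restrict (closedBall z (1 / 2))) := by
          rw [← eLpNorm_indicator_eq_eLpNorm_restrict measurableSet_closedBall]
          exact eLpNorm_le_mul_eLpNorm_of_ae_le_mul (.of_forall hkA) 2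
        have hk : MemLp (fun x => h x * e (x - z)) 2 volume := ⟨hh.1.mul hez.aestronglyMeasurable,
          hk2.trans_lt (mul_lt_top ofReal_lt_top
          ((eLpNorm_mono_measure _ Measure.restrict_le_self).trans_lt hh.2))⟩
        refine (hb U W hU hW hUW z _ hk (fun x hx => hes _ (right_ne_zero_of_mul hx))).trans
          (add_le_add ?_ (le_of_eq ?_))
        · calc _ ≤ eLpNorm U 2 (volume.restrict (closedBall z 2)) * (ofReal A *
            eLpNorm h 2 (volume.restrict (closedBall z (1 / 2)))) := by gcongr
            _ = _ := by ring
        · congr 1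
          exact lintegral_congr fun x => by rw [enorm_mul, enorm_of_nonneg (hem.nonneg _)]
    _ = ofReal A * (∫⁻ z, eLpNorm U 2 (volume.restrict (closedBall z 2)) *
      eLpNorm h 2 (volume.restrict (closedBall z (1 / 2)))) +
      C * ((∫⁻ x, ‖U x‖ₑ) * ∫⁻ x, ‖h x‖ₑ) := by
        have hm2 := hmE.lintegral_prod_right'
        rw [lintegral_add_right' _ (hm2.const_mul _), lintegral_ofReal_mul,
          lintegral_const_mul'' _ hm2, lintegral_lintegral_swap hmE]
        simp only [lintegral_const_mul' _ _ enorm_ne_top, heE, mul_one, mul_assoc]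
    _ ≤ _ := by
      rw [mul_add]
      gcongr
      · exact le_self_add
      · exact le_add_self

lemma rpow_norm_le_wt (hσ : 0 ≤ σ) (hy : 1 ≤ ‖y‖) : ‖y‖ ^ (-σ - 4) ≤ 2 ^ (15 / 4 : ℝ) * wt y := by
  calc _ ≤ ‖y‖ ^ (-(15 / 4) : ℝ) := Real.rpow_le_rpow_of_exponent_le hy (by linarith)
    _ ≤ ((1 + ‖y‖) / 2) ^ (-(15 / 4) : ℝ) :=
      rpow_le_rpow_of_nonpos (by positivity) (by linarith) (by norm_num)
    _ = _ := by
      rw [Real.div_rpow (by positivity) zero_le_two, rpow_neg zero_le_two,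
        div_inv_eq_mul, mul_comm, wt]

lemma integral_mollify {F : E3 → ℝ} (hη : IsMollifier η) (hF : Integrable F) :
    ∫ x, mollify η F x = ∫ x, F x := by
  rw [mollify_eq_convolution, integral_convolution (L := ContinuousLinearMap.lsmul ℝ ℝ)
    (memLp_one_iff_integrable.1 (hη.isTest.memLp 1)) hF, hη.integral_eq]
  simp

lemma lintegral_enorm_sq_le_of_support (hg : AEStronglyMeasurable g) (hs : ∀ y, g y ≠ 0 → ‖y - c‖ ≤
    r) : (∫⁻ y, ‖g y‖ₑ) ^ 2 ≤ volume (closedBall c r) * ∫⁻ y, ‖g y‖ₑ ^ 2 := by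
  calc _ = (∫⁻ y, (closedBall c r).indicator 1 y * ‖g y‖ₑ) ^ 2 := by
        congr 1
        refine lintegral_congr fun y => ?_
        by_cases hy : y ∈ closedBall c r
        · rw [indicator_of_mem hy, Pi.one_apply, one_mul]
        · have : g y = 0 := by by_contra hc; exact hy (by simpa [dist_eq_norm] using hs y hc)
          simp [this]
    _ ≤ _ := lintegral_mul_sq_le (μ := volume) ((measurable_one).indicator
      (measurableSet_closedBall)).aemeasurable hg.enorm
    _ = _ := by
      congr 1
      rw [← lintegral_indicator_one measurableSet_closedBall]
      refine lintegral_congr fun y => ?_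
      by_cases hy : y ∈ closedBall c r <;> simp [hy]

lemma enorm_rieszPair_far_le (i j : Fin 3) (hρ : 1 ≤ ρ) :
    ∃ C : ℝ≥0∞, C < ⊤ ∧ ∀ (o : E3) (g : E3 → ℝ), IsTest univ g → ∫ y, g y = 0 → (∀ y, g y ≠ 0 →
    ‖y - o‖ ≤ 3 * ρ) → ∀ x, x ∉ closedBall o (6 * ρ) → ‖rieszPair i j g x‖ₑ ≤
    C * wtE (x - o) * ∫⁻ y, ‖g y‖ₑ := by
  obtain ⟨C, hC, hb⟩ := (isHomSymbol_riesz i j).exists_meanZero_bound le_rfl zero_le_two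
  refine ⟨ofReal (C * (3 * ρ) * 2 ^ (15 / 4 : ℝ)), ofReal_lt_top, fun o g hg hg0 hgs x hx => ?_⟩
  have hx' : 6 * ρ < ‖x - o‖ := by simpa [dist_eq_norm] using hx
  have h2 := rpow_norm_le_wt le_rfl (by linarith)
  rw [lintegral_enorm_eq_ofReal (memLp_one_iff_integrable.1 (hg.memLp 1)), wtE,
    ← ofReal_mul (by positivity), ← ofReal_mul (by
      have := wt_pos (x - o); positivity), ← ofReal_norm]
  apply ofReal_le_ofReal
  refine ((abs_re_le_norm _).trans (hb univ g hg hg0 x o (3 * ρ) (by linarith) hgs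
    (by linarith))).trans ?_
  calc _ ≤ C * (3 * ρ) * (2 ^ (15 / 4 : ℝ) * wt (x - o)) * ∫ y, |g y| := by gcongr
    _ = _ := by ring

/-- The contribution of distant values to the pairing with a Riesz transform, on functions of mean
zero supported in a fixed ball. -/
lemma exists_riesz_far (i j : Fin 3) (hρ : 1 ≤ ρ) :
    ∃ C : ℝ≥0∞, C < ⊤ ∧ ∀ (a : E3 → ℝ) (o : E3), AEStronglyMeasurable a →
    ∫⁻ x, wtE (x - o) * ‖a x‖ₑ < ⊤ → ∃ Q : E3 → ℝ, MemLp Q 2 volume ∧ (∀ g, IsTest univ g →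
    ∫ y, g y = 0 → (∀ y, g y ≠ 0 → ‖y - o‖ ≤ 3 * ρ) →
    Integrable (fun x => (closedBall o (6 * ρ))ᶜ.indicator a x * rieszPair i j g x) ∧
    ∫ x, (closedBall o (6 * ρ))ᶜ.indicator a x * rieszPair i j g x = ∫ x, Q x * g x) ∧
    ∀ h, MemLp h 2 volume → ∫ y, h y = 0 → (∀ y, h y ≠ 0 → ‖y - o‖ ≤ 2 * ρ) → ‖∫ x, Q x * h x‖ₑ ≤
    C * (∫⁻ x, wtE (x - o) * ‖a x‖ₑ) * ∫⁻ x, ‖h x‖ₑ := by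
  obtain ⟨C, hC, hb⟩ := enorm_rieszPair_far_le i j hρ
  obtain ⟨η, hη⟩ := exists_isMollifierSeq
  refine ⟨C, hC, fun a o ha hA => ?_⟩
  set A := ∫⁻ x, wtE (x - o) * ‖a x‖ₑ with hAdef
  set B := closedBall o (6 * ρ) with hB
  have hwm : AEMeasurable (fun x => wtE (x - o) * ‖a x‖ₑ) :=
    (measurable_wtE.comp (measurable_id.sub measurable_const)).aemeasurable.mul ha.enorm
  have hbound : ∀ g, IsTest univ g → ∫ y, g y = 0 → (∀ y, g y ≠ 0 → ‖y - o‖ ≤ 3 * ρ) →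
      ∫⁻ x, ‖Bᶜ.indicator a x * rieszPair i j g x‖ₑ ≤ C * A * ∫⁻ y, ‖g y‖ₑ := fun g hg hg0 hgs => by
    calc _ ≤ ∫⁻ x, (C * ∫⁻ y, ‖g y‖ₑ) * (wtE (x - o) * ‖a x‖ₑ) := by
          refine lintegral_mono fun x => ?_
          by_cases hx : x ∈ B
          · simp [hx]
          · rw [indicator_of_mem (show x ∈ Bᶜ from hx), enorm_mul]
            calc _ ≤ ‖a x‖ₑ * (C * wtE (x - o) * ∫⁻ y, ‖g y‖ₑ) := by
                  gcongr; exact hb o g hg hg0 hgs x hx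
              _ = _ := by ring
      _ = _ := by rw [lintegral_const_mul'' _ hwm]; ring
  have hfin : ∀ g : E3 → ℝ, IsTest univ g → ∫⁻ y, ‖g y‖ₑ < ⊤ := fun g hg =>
    (memLp_one_iff_integrable.1 (hg.memLp 1)).2
  have hint : ∀ g, IsTest univ g → ∫ y, g y = 0 → (∀ y, g y ≠ 0 → ‖y - o‖ ≤ 3 * ρ) →
    Integrable (fun x => Bᶜ.indicator a x * rieszPair i j g x) := fun g hg hg0 hgs => by
    exact ⟨(ha.indicator measurableSet_closedBall.compl).mul (continuous_rieszPair i j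
      hg).aestronglyMeasurable, (hbound g hg hg0 hgs).trans_lt (mul_lt_top (mul_lt_top hC hA)
      (hfin g hg))⟩
  let V : Submodule ℝ (E3 → ℝ) :=
    { carrier := {g | IsTest univ g ∧ ∫ y, g y = 0 ∧ ∀ y, g y ≠ 0 → ‖y - o‖ ≤ 3 * ρ}
      add_mem' := by
        rintro f g ⟨hf, hf0, hfs⟩ ⟨hg, hg0, hgs⟩
        refine ⟨testSpace.add_mem hf hg, ?_, fun y hy => ?_⟩
        · simp only [Pi.add_apply]
          rw [integral_add (memLp_one_iff_integrable.1 (hf.memLp 1))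
            (memLp_one_iff_integrable.1 (hg.memLp 1)), hf0, hg0, add_zero]
        · by_cases h : f y = 0
          · exact hgs y fun h' => hy (by simp [h, h'])
          · exact hfs y h
      zero_mem' := ⟨testSpace.zero_mem, by simp, by simp⟩
      smul_mem' := by
        rintro c g ⟨hg, hg0, hgs⟩
        refine ⟨testSpace.smul_mem c hg, ?_, fun y hy => hgs y fun h' => hy (by simp [h'])⟩
        simp only [Pi.smul_apply, smul_eq_mul]
        rw [integral_const_mul, hg0, mul_zero] }
  set K := C * A * volume (closedBall o (3 * ρ)) ^ (1 / 2 : ℝ) with hK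
  have hKt : K < ⊤ := by
    refine mul_lt_top (mul_lt_top hC hA) (ENNReal.rpow_lt_top_of_nonneg
      (by norm_num) measure_closedBall_lt_top.ne)
  obtain ⟨Q, hQ, -, hQe⟩ := exists_memLp_of_bound V.subtype
    (fun g => IsTest.memLp g.2.1 2)
    { toFun := fun g => ∫ x, Bᶜ.indicator a x * rieszPair i j g x
      map_add' := fun g h => by
        rw [← integral_add (hint _ g.2.1 g.2.2.1 g.2.2.2) (hint _ h.2.1 h.2.2.1 h.2.2.2)]
        congr 1; ext x
        rw [← mul_add, ← rieszPair_add i j g.2.1 h.2.1]; rfl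
      map_smul' := fun c g => by
        simp only [RingHom.id_apply, smul_eq_mul]
        rw [← integral_const_mul]
        congr 1; ext x
        rw [Submodule.coe_smul, rieszPair_smul]; ring } toReal_nonneg (fun g => by
      have h1 : (∫⁻ y, ‖g.1 y‖ₑ) ≤ volume (closedBall o (3 * ρ)) ^ (1 / 2 : ℝ) *
        eLpNorm g.1 2 volume := by
        rw [← pow_le_pow_left_iff two_ne_zero, mul_pow, eLpNorm_two_sq, ← ENNReal.rpow_mul_natCast,
          show (1 / 2 : ℝ) * (2 : ℕ) = 1 by norm_num, ENNReal.rpow_one]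
        exact lintegral_enorm_sq_le_of_support g.2.1.1.continuous.aestronglyMeasurable g.2.2.2
      have h2 : ‖∫ x, Bᶜ.indicator a x * rieszPair i j g x‖ₑ ≤ K * eLpNorm g.1 2 volume := by
        refine (enorm_integral_le_lintegral_enorm _).trans
          ((hbound _ g.2.1 g.2.2.1 g.2.2.2).trans ?_)
        rw [hK, mul_assoc (C * A)]
        gcongr
      have h3 := toReal_mono (mul_ne_top hKt.ne (IsTest.memLp g.2.1 2).2.ne) h2
      rw [ENNReal.toReal_mul, toReal_enorm] at h3
      exact h3)
  have hQe' : ∀ g, IsTest univ g → ∫ y, g y = 0 → (∀ y, g y ≠ 0 → ‖y - o‖ ≤ 3 * ρ) →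
    ∫ x, Bᶜ.indicator a x * rieszPair i j g x = ∫ x, Q x * g x := fun g hg hg0 hgs => by
    have := hQe ⟨g, hg, hg0, hgs⟩
    simp only [LinearMap.coe_mk, AddHom.coe_mk] at this
    rw [this]
    exact integral_congr_ae (.of_forall fun x => by simp [mul_comm])
  refine ⟨Q, hQ, fun g hg hg0 hgs => ⟨hint g hg hg0 hgs, hQe' g hg hg0 hgs⟩, fun h hh hh0 hhs => ?_⟩
  have hhl := hh.locallyIntegrable (by norm_num)
  have hhi : Integrable h := by
    rw [← integrableOn_iff_integrable_of_support_subset (s := closedBall o (2 * ρ))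
      (fun y hy => by simpa [dist_eq_norm] using hhs y hy)]
    exact hhl.integrableOn_isCompact (isCompact_closedBall _ _)
  refine le_of_tendsto' ((continuous_enorm.tendsto _).comp (hη.tendsto_integral hQ hh)) fun n => ?_
  have hηn := hη.isMollifier n
  have hgt := mollify_isTest hηn hhl (hasCompactSupport_of_norm_sub_le hhs)
  have hgs : ∀ y, mollify (η n) h y ≠ 0 → ‖y - o‖ ≤ 3 * ρ := fun y hy => by
    have := mollify_support hηn.support hhs hy
    linarith
  have hg0 : ∫ y, mollify (η n) h y = 0 := by rw [integral_mollify hηn hhi, hh0]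
  simp only [Function.comp_apply]
  rw [← hQe' _ hgt hg0 hgs]
  exact (enorm_integral_le_lintegral_enorm _).trans ((hbound _ hgt hg0 hgs).trans
    (mul_le_mul_right (lintegral_enorm_mollify_le hηn hh.1) _))

/-! ### Functions with vanishing weak gradient -/

/-- The partial derivative of `g` in the `i`-th coordinate direction. -/
noncomputable def pd (i : Fin 3) (g : E3 → ℝ) (x : E3) : ℝ :=
  fderiv ℝ g x (single i 1)

lemma IsTest.pd (hg : IsTest univ g) (i : Fin 3) : IsTest univ (pd i g) := by
  refine ⟨?_, ?_, subset_univ _⟩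
  · have h : ContDiff ℝ ∞ (fderiv ℝ g) := hg.1.fderiv_right (by simp)
    exact h.clm_apply contDiff_const
  · exact (hg.2.1.fderiv_apply (𝕜 := ℝ) _)

lemma pd_support (hs : ∀ y, g y ≠ 0 → ‖y - c‖ ≤ r) (i : Fin 3) (y : E3) (hy : pd i g y ≠ 0) :
    ‖y - c‖ ≤ r := by
  have h2 : y ∈ tsupport g := by
    by_contra hc
    apply hy
    have : fderiv ℝ g y = 0 := by
      by_contra h
      exact hc (support_fderiv_subset ℝ h)
    simp [FracNS.pd, this]
  simpa [dist_eq_norm] using (closure_minimal (fun y hy => by simpa [dist_eq_norm] using hs y hy)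
    Metric.isClosed_closedBall) h2

lemma integral_pd (hg : IsTest univ g) (i : Fin 3) : ∫ x, pd i g x = 0 := by
  have := integral_mul_fderiv_eq_neg_fderiv_mul_of_integrable (f := fun _ => (1 : ℝ)) (by simp)
    (by simpa using (memLp_one_iff_integrable.1 ((hg.pd i).memLp 1) : Integrable fun x =>
    fderiv ℝ g x _)) (by simpa using memLp_one_iff_integrable.1 (hg.memLp 1)) (by fun_prop)
    (fun x _ => hg.differentiable x)
  simpa [pd] using this

lemma isTest_translate (hη : IsTest univ η) (x : E3) : IsTest univ (fun y => η (x - y)) :=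
  ⟨hη.1.comp (contDiff_const.sub contDiff_id),
    hη.2.1.comp_homeomorph (Homeomorph.subLeft x), subset_univ _⟩

lemma pd_mollify {F : E3 → ℝ} (hη : IsMollifier η) (hF : LocallyIntegrable F) (i : Fin 3) (x : E3) :
    fderiv ℝ (mollify η F) x (single i 1) = - ∫ y, F y * pd i (fun y => η (x - y))
    y := by
  have h := hη.isTest.2.1.hasFDerivAt_convolution_left (ContinuousLinearMap.lsmul ℝ ℝ)
    (hη.isTest.1.of_le (by simp)) hF x
  rw [mollify_eq_convolution, h.fderiv, convolution_eq_swap]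
  have hpd : ∀ y, pd i (fun y => η (x - y)) y =
    - fderiv ℝ η (x - y) (single i 1) := fun y => by
    have h1 : HasFDerivAt (fun y => η (x - y)) ((fderiv ℝ η (x - y)).comp (-ContinuousLinearMap.id ℝ
      E3)) y := (hη.isTest.differentiable _).hasFDerivAt.comp y ((hasFDerivAt_id y).const_sub x)
    rw [pd, h1.fderiv]; simp
  have hc : ConvolutionExistsAt (fderiv ℝ η) F x ((ContinuousLinearMap.lsmul ℝ ℝ).precompL E3)
    volume := (hη.isTest.2.1.fderiv (𝕜 := ℝ)).convolutionExists_left _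
    (hη.isTest.1.continuous_fderiv (by simp)) hF x
  rw [ContinuousLinearMap.integral_apply hc.integrable_swap, ← integral_neg]
  refine integral_congr_ae (.of_forall fun y => ?_)
  simp only [hpd]
  rw [ContinuousLinearMap.precompL_apply]
  simp [mul_comm]

/-- A locally integrable function whose weak gradient vanishes on a ball is constant on a smaller
concentric ball. -/
lemma ae_eq_const_of_weak_gradient {f : E3 → ℝ} (hf : LocallyIntegrable f) (hr : 0 < r)
    (h0 : ∀ g, IsTest univ g → (∀ y, g y ≠ 0 → ‖y - o‖ ≤ r + 1) → ∀ i, ∫ y, f y * pd i g y = 0) :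
    ∃ c : ℝ, ∀ᵐ x, x ∈ ball o r → f x = c := by
  obtain ⟨η, hη⟩ := exists_isMollifierSeq
  have hconst : ∀ n, ∀ x ∈ ball o r, ∀ y ∈ ball o r,
    mollify (η n) f x = mollify (η n) f y := fun n x hx y hy => by
    have hηn := hη.isMollifier n
    refine Metric.isOpen_ball.is_const_of_fderiv_eq_zero (convex_ball o r).isPreconnected
      ((mollify_contDiff hηn hf).differentiable (by simp)).differentiableOn (fun z hz => ?_) hx hy
    rw [mem_ball_iff_norm] at hz
    have hb : ∀ i, fderiv ℝ (mollify (η n) f) z (single i 1) = 0 := fun i => by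
      rw [pd_mollify hηn hf, neg_eq_zero]
      refine h0 _ (isTest_translate hηn.isTest z) (fun y hy => ?_) i
      have h1 := hηn.support _ hy
      have h2 := norm_sub_le_norm_sub_add_norm_sub y z o
      rw [norm_sub_rev y z] at h2
      linarith
    ext v
    have hv : v = ∑ i, v i • single i (1 : ℝ) := by ext j; simp [Pi.single_apply]
    rw [hv]
    simp [hb]
  have hae := hη.tendsto_ae f hf
  obtain ⟨a, ha, hlim⟩ : ∃ a ∈ ball o r,
    Tendsto (fun n => mollify (η n) f a) atTop (𝓝 (f a)) := by
    have : ∃ᵐ x, x ∈ ball o r := by rw [frequently_ae_mem_iff]; exact (Metric.measure_ball_pos _ _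
      hr).ne'
    obtain ⟨a, h1, h2⟩ := (this.and_eventually hae).exists
    exact ⟨a, h1, h2⟩
  refine ⟨f a, ?_⟩
  filter_upwards [hae] with x hx hxb
  refine tendsto_nhds_unique hx (hlim.congr fun n => hconst n _ ha _ hxb)

/-! ### Averages over unit balls -/

lemma measurableSet_dist_lt (r : ℝ) : MeasurableSet {p : E3 × E3 | p.2 ∈ ball p.1 r} :=
  (isOpen_lt (continuous_snd.dist continuous_fst) continuous_const).measurableSet

lemma measurableSet_dist_le (r : ℝ) : MeasurableSet {p : E3 × E3 | p.2 ∈ closedBall p.1 r} :=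
  (isClosed_le (continuous_snd.dist continuous_fst) continuous_const).measurableSet

/-- A weighted integral is controlled by weighted averages over unit balls. -/
lemma lintegral_wtE_mul_le_average : ∃ C : ℝ≥0∞, C < ⊤ ∧ ∀ (f : E3 → ℝ≥0∞) (z : E3), AEMeasurable
    f → ∫⁻ x, wtE (x - z) * f x ≤ C * ∫⁻ y, wtE (y - z) * ∫⁻ x in ball y 1, f x := by
  set b := volume (ball (0 : E3) 1) with hb
  have hb0 : b ≠ 0 := (Metric.measure_ball_pos _ _ one_pos).ne'
  set c := ofReal ((1 + 1) ^ (15 / 4 : ℝ))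
  refine ⟨b⁻¹ * c, mul_lt_top (inv_lt_top.2 (pos_iff_ne_zero.2 hb0))
    ofReal_lt_top, fun f z hf => ?_⟩
  have hm : AEMeasurable (fun p : E3 × E3 =>
      {p : E3 × E3 | p.2 ∈ ball p.1 1}.indicator (fun p => wtE (p.1 - z) * f p.2) p)
      (volume.prod volume) := by
    exact AEMeasurable.indicator
      ((measurable_wtE.comp (measurable_fst.sub measurable_const)).aemeasurable.mul hf.comp_snd)
      (measurableSet_dist_lt 1)
  have e : ∀ y, wtE (y - z) * ∫⁻ x in ball y 1, f x =
    ∫⁻ x, {p : E3 × E3 | p.2 ∈ ball p.1 1}.indicator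
      (fun p => wtE (p.1 - z) * f p.2) (y, x) := fun y => by
    rw [← lintegral_const_mul' (wtE (y - z)) _ ofReal_ne_top,
      ← lintegral_indicator measurableSet_ball]
    rfl
  simp only [e]
  rw [lintegral_lintegral_swap (f := fun y x => {p : E3 × E3 | p.2 ∈ ball p.1 1}.indicator
    (fun p => wtE (p.1 - z) * f p.2) (y, x)) hm, mul_assoc]
  have h1 : ∀ x, b * (wtE (x - z) * f x) ≤ c * ∫⁻ y, {p : E3 × E3 | p.2 ∈ ball p.1 1}.indicator
    (fun p => wtE (p.1 - z) * f p.2) (y, x) := fun x => by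
    calc _ = ∫⁻ _ in ball x 1, wtE (x - z) * f x := by
          rw [setLIntegral_const, hb, Measure.addHaar_ball_center volume x, mul_comm]
      _ ≤ ∫⁻ y in ball x 1, c * (wtE (y - z) * f x) := by
        refine setLIntegral_mono' measurableSet_ball fun y hy => ?_
        rw [← mul_assoc]
        gcongr
        refine wtE_le_mul ?_
        rw [sub_sub_sub_cancel_right, ← dist_eq_norm, dist_comm]
        exact (mem_ball.1 hy).le
      _ = c * ∫⁻ y in ball x 1, wtE (y - z) * f x := lintegral_ofReal_mul _ _
      _ = _ := by
        rw [← lintegral_indicator measurableSet_ball]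
        congr 1
        refine lintegral_congr fun y => ?_
        by_cases hy : y ∈ ball x 1
        · have hy' : (y, x) ∈ {p : E3 × E3 | p.2 ∈ ball p.1 1} := Metric.mem_ball_comm.1 hy
          rw [indicator_of_mem hy, indicator_of_mem hy']
        · rw [indicator_of_notMem hy, indicator_of_notMem
            (fun h => hy (Metric.mem_ball_comm.1 h) : (y, x) ∉ {p : E3 × E3 | p.2 ∈ ball p.1 1})]
  rw [← ENNReal.mul_le_iff_le_inv hb0 measure_ball_lt_top.ne, ← lintegral_const_mul' _ _
    measure_ball_lt_top.ne, ← lintegral_ofReal_mul]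
  exact lintegral_mono h1

/-- A uniformly local function has uniformly bounded weighted energy. -/
lemma exists_wtEnergy_le_ulocNorm :
    ∃ C : ℝ≥0∞, C < ⊤ ∧ ∀ (f : E3 → E3) (z : E3), AEStronglyMeasurable f → wtEnergy f z ≤
    C * ulocNorm f ^ 2 := by
  obtain ⟨C, hC, hb⟩ := lintegral_wtE_mul_le_average
  refine ⟨C * ∫⁻ y, wtE y, mul_lt_top hC lintegral_wtE_lt_top, fun f z hf =>
    (hb _ z (hf.enorm.pow_const 2)).trans ?_⟩
  rw [mul_assoc, ← lintegral_wtE_sub z]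
  gcongr
  have hwm : Measurable fun x : E3 => wtE (x - z) :=
    measurable_wtE.comp (measurable_id.sub measurable_const)
  rw [← lintegral_mul_const'' _ hwm.aemeasurable]
  refine lintegral_mono fun y => ?_
  gcongr
  rw [← eLpNorm_two_sq]
  gcongr
  exact le_iSup (fun y => eLpNorm f 2 (volume.restrict (ball y 1))) y

lemma lintegral_closedBall_lintegral_eq {f : E3 → ℝ≥0∞} (hf : AEMeasurable f) (o : E3) (a b : ℝ) :
    ∫⁻ z in closedBall o a, ∫⁻ x in closedBall z b, f x =
    ∫⁻ x, f x * volume (closedBall x b ∩ closedBall o a) := by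
  have e : ∀ z, ∫⁻ x in closedBall z b, f x =
    ∫⁻ x, {p : E3 × E3 | p.2 ∈ closedBall p.1 b}.indicator (fun p => f p.2) (z, x) := fun z => by
    rw [← lintegral_indicator measurableSet_closedBall]
    rfl
  simp only [e]
  rw [lintegral_lintegral_swap (f := fun z x => {p : E3 × E3 | p.2 ∈ closedBall p.1 b}.indicator
    (fun p => f p.2) (z, x)) (AEMeasurable.indicator hf.comp_snd (measurableSet_dist_le b))]
  refine lintegral_congr fun x => ?_
  rw [← Measure.restrict_apply measurableSet_closedBall,
    ← lintegral_indicator_const measurableSet_closedBall]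
  exact lintegral_congr fun z => by simp [indicator, dist_comm]

/-- Integrating local integrals over the centers. -/
lemma lintegral_closedBall_lintegral_le {f : E3 → ℝ≥0∞} (hf : AEMeasurable f) (o : E3) (a b : ℝ) :
    ∫⁻ z in closedBall o a, ∫⁻ x in closedBall z b, f x ≤ volume (closedBall (0 : E3) b) *
    ∫⁻ x in closedBall o (a + b), f x := by
  rw [lintegral_closedBall_lintegral_eq hf, ← lintegral_const_mul' _ _
    measure_closedBall_lt_top.ne, ← lintegral_indicator measurableSet_closedBall]
  refine lintegral_mono fun x => ?_
  by_cases hx : x ∈ closedBall o (a + b)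
  · rw [indicator_of_mem hx, mul_comm, ← Measure.addHaar_closedBall_center volume x b]
    gcongr
    exact inter_subset_left
  · rw [Disjoint.inter_eq (Metric.closedBall_disjoint_closedBall (not_le.1 (by
      rwa [add_comm]))), measure_empty, mul_zero]
    exact zero_le

/-! ### Time slices -/

/-- The conditions satisfied by almost every time slice of a local Leray solution. -/
structure IsSlice (s : ℝ) (M : ℝ≥0∞) (u v : E3 → E3) (p : E3 → ℝ) : Prop where
  meas_u : AEStronglyMeasurable u
  meas_v : AEStronglyMeasurable v
  bound : ulocNorm u ≤ M
  energy_v : wtEnergy v 0 < ⊤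
  lam_eq : ∀ h, IsTest univ h → ∀ i, ∫ x, v x i * h x = ∫ x, u x i * lam s h x
  div_eq : ∀ g : E3 → ℝ, IsTest univ g → ∫ x, inner ℝ (u x) (gradient g x) = 0
  meas_p : LocallyIntegrable p
  pressure_eq : ∀ g, IsTest univ g → ∀ i, ∫ x, p x * pd i g x =
    - ∫ x, ∑ j, ∑ k, u x j * u x k * rieszPair j k (pd i g) x

lemma enorm_apply_le (w : E3) (i : Fin 3) : ‖w i‖ₑ ≤ ‖w‖ₑ := by
  rw [← ofReal_norm, ← ofReal_norm]
  exact ofReal_le_ofReal (PiLp.norm_apply_le w i)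

lemma exists_enorm_le_apply (w : E3) : ∃ i, ‖w‖ₑ ≤ 3 * ‖w i‖ₑ := by
  obtain ⟨i, -, hi⟩ := Finset.exists_max_image Finset.univ (fun i => |w i|)
    Finset.univ_nonempty
  refine ⟨i, ?_⟩
  have h1 : ‖w‖ ≤ 3 * |w i| := by
    rw [EuclideanSpace.norm_eq]
    refine Real.sqrt_le_iff.2 ⟨by positivity, ?_⟩
    calc _ ≤ ∑ _j : Fin 3, |w i| ^ 2 := by
          refine Finset.sum_le_sum fun j _ => ?_
          rw [norm_eq_abs]
          exact pow_le_pow_left₀ (abs_nonneg _) (hi j (Finset.mem_univ j)) 2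
      _ = 3 * |w i| ^ 2 := by simp
      _ ≤ _ := by nlinarith
  calc _ ≤ ofReal (3 * |w i|) := by rw [← ofReal_norm]; exact ofReal_le_ofReal h1
    _ = _ := by rw [ofReal_mul (by norm_num), ← norm_eq_abs, ofReal_norm]; norm_num

lemma aestronglyMeasurable_apply {w : α → E3} (hw : AEStronglyMeasurable w μ) (i : Fin 3) :
    AEStronglyMeasurable (fun x => w x i) μ :=
  (EuclideanSpace.proj i).continuous.comp_aestronglyMeasurable hw

lemma wtEnergy_apply_le (w : E3 → E3) (i : Fin 3) (z : E3) : wtEnergy (fun x => w x i) z ≤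
    wtEnergy w z := by
  refine lintegral_mono fun x => ?_
  gcongr
  exact enorm_apply_le _ _

/-- The local Sobolev inequality for vector fields. -/
lemma exists_local_sobolev_slice (h0 : 3 / 4 ≤ s) (h1 : s < 1) :
    ∃ C : ℝ≥0∞, C < ⊤ ∧ ∀ (M : ℝ≥0∞) (u v : E3 → E3) (p : E3 → ℝ), IsSlice s M u v p → M < ⊤ →
    ∀ z, ∫⁻ x in closedBall z 2, ‖u x‖ₑ ^ 4 ≤ C * ((∫⁻ x in closedBall z 4, ‖v x‖ₑ ^ 2) +
    wtEnergy u z) ^ 2 := by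
  obtain ⟨C, hC, hb⟩ := exists_local_sobolev h0 h1
  obtain ⟨Cw, hCw, hw⟩ := exists_wtEnergy_le_ulocNorm
  refine ⟨81 * (3 * C), by finiteness, fun M u v p h hM z => ?_⟩
  have hcomp : ∀ i, ∫⁻ x in closedBall z 2, ‖u x i‖ₑ ^ 4 ≤
    C * ((∫⁻ x in closedBall z 4, ‖v x‖ₑ ^ 2) + wtEnergy u z) ^ 2 := fun i => by
    refine (hb z (fun x => u x i) (fun x => v x i) (aestronglyMeasurable_apply h.meas_u i)
      (aestronglyMeasurable_apply h.meas_v i) ((wtEnergy_apply_le u i z).trans_lt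
      ((hw u z h.meas_u).trans_lt (mul_lt_top hCw (pow_lt_top (h.bound.trans_lt hM)))))
      ((wtEnergy_apply_le v i z).trans_lt (wtEnergy_lt_top h.energy_v z)) (fun g hg => h.lam_eq g hg
      i)).trans ?_
    gcongr
    · exact enorm_apply_le _ _
    · exact wtEnergy_apply_le u i z
  calc _ ≤ ∫⁻ x in closedBall z 2, 81 * ∑ i, ‖u x i‖ₑ ^ 4 := by
        refine lintegral_mono fun x => ?_
        obtain ⟨i, hi⟩ := exists_enorm_le_apply (u x)
        calc _ ≤ (3 * ‖u x i‖ₑ) ^ 4 := by gcongr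
          _ = 81 * ‖u x i‖ₑ ^ 4 := by rw [mul_pow]; norm_num
          _ ≤ _ := by
              gcongr
              exact Finset.single_le_sum (f := fun i => ‖u x i‖ₑ ^ 4) (fun _ _ => zero_le)
                (Finset.mem_univ i)
    _ = 81 * ∑ i, ∫⁻ x in closedBall z 2, ‖u x i‖ₑ ^ 4 := by
      rw [lintegral_const_mul' _ _ (by finiteness), lintegral_finsetSum' _ fun i _ =>
        ((aestronglyMeasurable_apply h.meas_u i).enorm.pow_const 4).restrict]
    _ ≤ 81 * ∑ _i : Fin 3, C * ((∫⁻ x in closedBall z 4, ‖v x‖ₑ ^ 2) +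
      wtEnergy u z) ^ 2 := by
        gcongr with i
        exact hcomp i
    _ = _ := by simp only [Finset.sum_const, Finset.card_univ, Fintype.card_fin]; ring

lemma exists_gradient_ballBump_le : ∃ C, 0 < C ∧ ∀ r, 0 < r → ∀ z x, ‖gradient (ballBump r z) x‖ ≤
    C / r := by
  obtain ⟨A, B, -, hB⟩ := (ballBump_isTest one_pos 0).exists_bounds
  refine ⟨B + 1, by linarith [(norm_nonneg _).trans (hB 0)], fun r hr z x => ?_⟩
  have he : ballBump r z = fun x => ballBump 1 0 (r⁻¹ • (x - z)) := by
    ext x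
    simp only [ballBump, sub_zero, smul_smul]
    congr 2
    field_simp
  have hd : HasFDerivAt (ballBump r z) ((fderiv ℝ (ballBump 1 0) (r⁻¹ • (x - z))).comp
    (r⁻¹ • ContinuousLinearMap.id ℝ E3)) x := by
    rw [he]
    exact ((ballBump_isTest one_pos 0).differentiable _).hasFDerivAt.comp x
      (((hasFDerivAt_id x).sub_const z).const_smul r⁻¹)
  rw [gradient, LinearIsometryEquiv.norm_map, hd.fderiv]
  refine (ContinuousLinearMap.opNorm_comp_le _ _).trans ?_
  calc _ ≤ B * ‖r⁻¹ • ContinuousLinearMap.id ℝ E3‖ := by gcongr; exact hB _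
    _ ≤ B * (r⁻¹ * 1) := by
      have := (norm_nonneg _).trans (hB 0)
      gcongr
      rw [norm_smul, norm_of_nonneg (inv_nonneg.2 hr.le)]
      gcongr
      exact ContinuousLinearMap.norm_id_le
    _ ≤ _ := by
      rw [mul_one, div_eq_mul_inv]
      gcongr
      linarith

/-- A local integral is controlled by the integral over the centers of small balls. -/
lemma mul_lintegral_closedBall_le {f : E3 → ℝ≥0∞} (hf : AEMeasurable f) (o : E3) (a b : ℝ) :
    volume (closedBall (0 : E3) b) * ∫⁻ x in closedBall o a, f x ≤ ∫⁻ z in closedBall o (a + b),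
    ∫⁻ x in closedBall z b, f x := by
  rw [lintegral_closedBall_lintegral_eq hf, ← lintegral_const_mul' _ _
    measure_closedBall_lt_top.ne, ← lintegral_indicator measurableSet_closedBall]
  refine lintegral_mono fun x => ?_
  by_cases hx : x ∈ closedBall o a
  · rw [indicator_of_mem hx, mul_comm, inter_eq_left.2 (Metric.closedBall_subset_closedBall' (by
      linarith [mem_closedBall.1 hx])), Measure.addHaar_closedBall_center volume x]
  · rw [indicator_of_notMem hx]; exact zero_le

/-- The local quantity that controls the nonlinear terms near `z`. -/
noncomputable def localEnergy (u v : E3 → E3) (z : E3) : ℝ≥0∞ :=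
  (∫⁻ x in closedBall z 4, ‖v x‖ₑ ^ 2) + wtEnergy u z

lemma exists_lintegral_localEnergy_le (hρ : 2 ≤ ρ) :
    ∃ C : ℝ≥0∞, C < ⊤ ∧ ∀ (u v : E3 → E3) (o : E3), AEStronglyMeasurable v →
    ∫⁻ z in closedBall o (3 * ρ), localEnergy u v z ≤ volume (closedBall (0 : E3) 4) *
    (∫⁻ x in closedBall o (7 * ρ), ‖v x‖ₑ ^ 2) + C * wtEnergy u o := by
  refine ⟨volume (closedBall (0 : E3) (3 * ρ)) * ofReal ((1 + 3 * ρ) ^ (15 / 4 : ℝ)),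
    mul_lt_top measure_closedBall_lt_top ofReal_lt_top, fun u v o hv => ?_⟩
  calc _ ≤ ∫⁻ z in closedBall o (3 * ρ), ((∫⁻ x in closedBall z 4, ‖v x‖ₑ ^ 2) +
        ofReal ((1 + 3 * ρ) ^ (15 / 4 : ℝ)) * wtEnergy u o) := by
        refine setLIntegral_mono' measurableSet_closedBall fun z hz => ?_
        rw [localEnergy]
        gcongr
        exact wtEnergy_le_mul u (by simpa [dist_eq_norm] using hz)
    _ = (∫⁻ z in closedBall o (3 * ρ), ∫⁻ x in closedBall z 4, ‖v x‖ₑ ^ 2) +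
      ofReal ((1 + 3 * ρ) ^ (15 / 4 : ℝ)) * wtEnergy u o *
        volume (closedBall (0 : E3) (3 * ρ)) := by
      rw [lintegral_add_right _ measurable_const, setLIntegral_const,
        Measure.addHaar_closedBall_center volume o]
    _ ≤ _ := by
      refine add_le_add ((lintegral_closedBall_lintegral_le (hv.enorm.pow_const 2) o (3 * ρ)
        4).trans ?_) (le_of_eq (by ring))
      gcongr
      linarith

lemma gradient_ballBump_support (hρ : 0 < ρ) (hx : gradient (ballBump ρ o) x ≠ 0) :
    ‖x - o‖ ≤ 2 * ρ := by
  have h1 : tsupport (ballBump ρ o) ⊆ closedBall o (2 * ρ) :=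
    closure_minimal (fun y hy => by
      simpa [dist_eq_norm] using norm_le_of_ballBump_ne_zero hρ hy) Metric.isClosed_closedBall
  have h2 : x ∈ tsupport (ballBump ρ o) := by
    by_contra hc
    apply hx
    have : fderiv ℝ (ballBump ρ o) x = 0 := by
      by_contra h
      exact hc (support_fderiv_subset ℝ h)
    simp [gradient, this]
  simpa [dist_eq_norm] using h1 h2

lemma continuous_gradient (hg : IsTest univ g) : Continuous (gradient g) :=
  (InnerProductSpace.toDual ℝ E3).symm.continuous.comp (hg.1.continuous_fderiv (by simp))

/-- The flux `u · ∇φ` through the cutoff `φ` on the ball `B_ρ(o)`. -/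
noncomputable def flux (ρ : ℝ) (o : E3) (u : E3 → E3) (x : E3) : ℝ :=
  inner ℝ (u x) (gradient (ballBump ρ o) x)

lemma flux_support (hρ : 0 < ρ) (hx : flux ρ o u x ≠ 0) : ‖x - o‖ ≤ 2 * ρ :=
  gradient_ballBump_support hρ fun h => hx (by rw [flux, h, inner_zero_right])

lemma aestronglyMeasurable_flux (hρ : 0 < ρ) (o : E3) (hu : AEStronglyMeasurable u) :
    AEStronglyMeasurable (flux ρ o u) :=
  hu.inner (continuous_gradient (ballBump_isTest hρ o)).aestronglyMeasurable

lemma exists_enorm_flux_le : ∃ G : ℝ, 0 < G ∧ ∀ ρ, 0 < ρ → ∀ (o : E3) (u : E3 → E3) (x : E3), ‖flux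
    ρ o u x‖ₑ ≤ ofReal (G / ρ) * (closedBall o (2 * ρ)).indicator (fun x => ‖u x‖ₑ) x := by
  obtain ⟨G, hG, hb⟩ := exists_gradient_ballBump_le
  refine ⟨G, hG, fun ρ hρ o u x => ?_⟩
  by_cases hx : flux ρ o u x = 0
  · rw [hx, enorm_zero]; exact zero_le
  · rw [indicator_of_mem (by simpa [dist_eq_norm] using flux_support hρ hx), ← ofReal_norm,
      ← ofReal_norm, ← ofReal_mul (by positivity)]
    apply ofReal_le_ofReal
    refine (norm_inner_le_norm _ _).trans ?_
    rw [mul_comm]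
    gcongr
    exact hb ρ hρ o x

lemma eLpNorm_halfBall_le (hu : ulocNorm u ≤ M) (z : E3) :
    eLpNorm u 2 (volume.restrict (closedBall z (1 / 2))) ≤ M := by
  refine le_trans ?_ ((le_iSup (fun y => eLpNorm u 2 (volume.restrict (ball y 1))) z).trans hu)
  exact eLpNorm_mono_measure _ (Measure.restrict_mono
    (Metric.closedBall_subset_ball (by norm_num)) le_rfl)

lemma eLpNorm_flux_le {G : ℝ} (hρ : 2 ≤ ρ) (hu : ulocNorm u ≤ M) (hG : ∀ x, ‖flux ρ o u x‖ₑ ≤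
    ofReal (G / ρ) * (closedBall o (2 * ρ)).indicator (fun x => ‖u x‖ₑ) x) (z :
    E3) : eLpNorm (flux ρ o u) 2 (volume.restrict (closedBall z (1 / 2))) ≤
    (closedBall o (3 * ρ)).indicator (fun _ => ofReal (G / ρ) * M) z := by
  by_cases hz : z ∈ closedBall o (3 * ρ)
  · rw [indicator_of_mem hz]
    calc _ ≤ ofReal (G / ρ) *
          eLpNorm u 2 (volume.restrict (closedBall z (1 / 2))) := by
          rw [← pow_le_pow_left_iff two_ne_zero, mul_pow, eLpNorm_two_sq, eLpNorm_two_sq,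
            ← lintegral_const_mul' _ _ (by finiteness)]
          refine lintegral_mono fun x => ?_
          rw [← mul_pow]
          gcongr
          refine (hG x).trans ?_
          gcongr
          exact indicator_le_self _ _ _
      _ ≤ _ := by gcongr; exact eLpNorm_halfBall_le hu z
  · rw [indicator_of_notMem hz]
    refine le_of_eq ?_
    rw [eLpNorm_congr_ae, eLpNorm_zero]
    refine (ae_restrict_iff' measurableSet_closedBall).2 (.of_forall fun x hx => ?_)
    have hxm : x ∉ closedBall o (2 * ρ) := fun h => by
      apply hz
      rw [mem_closedBall] at *
      have := dist_triangle z x o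
      rw [dist_comm z x] at this
      linarith
    have := hG x
    rw [indicator_of_notMem hxm, mul_zero, nonpos_iff_eq_zero, enorm_eq_zero] at this
    simpa using this

lemma lintegral_flux_le {G : ℝ} (hG : ∀ x, ‖flux ρ o u x‖ₑ ≤
    ofReal (G / ρ) * (closedBall o (2 * ρ)).indicator (fun x => ‖u x‖ₑ) x) : ∫⁻ x, ‖flux ρ o u
    x‖ₑ ≤ ofReal (G / ρ) * (volume (closedBall (0 : E3) (2 * ρ)) +
    ofReal ((1 + 2 * ρ) ^ (15 / 4 : ℝ)) * wtEnergy u o) := by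
  calc _ ≤ ∫⁻ x, ofReal (G / ρ) *
    (closedBall o (2 * ρ)).indicator (fun x => ‖u x‖ₑ) x := lintegral_mono hG
    _ = ofReal (G / ρ) * ∫⁻ x in closedBall o (2 * ρ), ‖u x‖ₑ := by
      rw [lintegral_ofReal_mul, lintegral_indicator measurableSet_closedBall]
    _ ≤ ofReal (G / ρ) * ∫⁻ x in closedBall o (2 * ρ), (1 + ‖u x‖ₑ ^ 2) := by
      gcongr with x
      rcases le_total ‖u x‖ₑ 1 with h | h
      · exact h.trans le_self_add
      · exact (le_self_pow₀ h two_ne_zero).trans le_add_self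
    _ ≤ _ := by
      gcongr
      rw [lintegral_add_left measurable_const, setLIntegral_const, one_mul,
        Measure.addHaar_closedBall_center volume o]
      gcongr
      exact setLIntegral_closedBall_le_wtEnergy u o (2 * ρ)

lemma IsSlice.wtEnergy_lt_top {v : E3 → E3} {p : E3 → ℝ} (h : IsSlice s M u v p) (hM : M < ⊤)
    (z : E3) : wtEnergy u z < ⊤ := by
  obtain ⟨Cw, hCw, hw⟩ := exists_wtEnergy_le_ulocNorm
  exact (hw u z h.meas_u).trans_lt (mul_lt_top hCw (pow_lt_top (h.bound.trans_lt hM)))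

lemma IsSlice.localEnergy_lt_top {v : E3 → E3} {p : E3 → ℝ} (h : IsSlice s M u v p) (hM : M < ⊤)
    (z : E3) : localEnergy u v z < ⊤ := add_lt_top.2
      ⟨(setLIntegral_closedBall_le_wtEnergy v z 4).trans_lt (mul_lt_top ofReal_lt_top
      (FracNS.wtEnergy_lt_top h.energy_v z)), h.wtEnergy_lt_top hM z⟩

lemma exists_local_sobolev_sq (h0 : 3 / 4 ≤ s) (h1 : s < 1) :
    ∃ C : ℝ≥0∞, C < ⊤ ∧ ∀ (M : ℝ≥0∞) (u v : E3 → E3) (p : E3 → ℝ), IsSlice s M u v p → M < ⊤ →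
    ∀ z, ∫⁻ x in closedBall z 2, ‖u x‖ₑ ^ 4 ≤ (C * localEnergy u v z) ^ 2 := by
  obtain ⟨C, hC, hb⟩ := exists_local_sobolev_slice h0 h1
  refine ⟨C + 1, by finiteness, fun M u v p h hM z => (hb M u v p h hM z).trans ?_⟩
  rw [mul_pow, localEnergy]
  gcongr
  exact le_self_add.trans (le_self_pow₀ le_add_self two_ne_zero)

/-- The cubic term of the local energy inequality. -/
lemma exists_cubic_bound (h0 : 3 / 4 ≤ s) (h1 : s < 1) : ∃ C0 : ℝ, 0 < C0 ∧ ∀ ρ, 2 ≤ ρ →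
    ∀ M : ℝ≥0∞, M < ⊤ → ∃ C1 : ℝ≥0∞, C1 < ⊤ ∧ ∀ (u v : E3 → E3) (p : E3 → ℝ), IsSlice s M u v p →
    ∀ o : E3, ∫⁻ x, ‖u x‖ₑ ^ 2 * ‖flux ρ o u x‖ₑ ≤
    ofReal (C0 / ρ) * M * (∫⁻ x in closedBall o (7 * ρ), ‖v x‖ₑ ^ 2) + C1 * wtEnergy u o := by
  obtain ⟨G, hG, hflux⟩ := exists_enorm_flux_le
  obtain ⟨CS, hCS, hS⟩ := exists_local_sobolev_sq h0 h1
  set b : ℝ≥0∞ := volume (closedBall (0 : E3) (1 / 2))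
  have hb0 : b ≠ 0 := (Metric.measure_closedBall_pos _ _ (by norm_num)).ne'
  have hv4 : volume (closedBall (0 : E3) 4) < ⊤ := measure_closedBall_lt_top
  set A := b⁻¹ * CS * volume (closedBall (0 : E3) 4) with hA
  refine ⟨G * (A.toReal + 1), by positivity, fun ρ hρ M hM => ?_⟩
  have hρ0 : 0 < ρ := by linarith
  obtain ⟨C, hC, hloc⟩ := exists_lintegral_localEnergy_le hρ
  refine ⟨ofReal (G / ρ) * b⁻¹ * CS * M * C, by finiteness, fun u v p h o => ?_⟩
  have hmu := h.meas_u.enorm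
  have hball : ∀ z, ∫⁻ x in closedBall z (1 / 2), ‖u x‖ₑ ^ 2 * ‖u x‖ₑ ≤
    CS * localEnergy u v z * M := fun z => by
    rw [← pow_le_pow_left_iff two_ne_zero]
    refine (lintegral_mul_sq_le (hmu.pow_const 2).restrict hmu.restrict).trans ?_
    rw [mul_pow (CS * _)]
    gcongr
    · refine le_trans ?_ (hS M u v p h hM z)
      simpa only [← pow_mul] using lintegral_mono_set (closedBall_subset_closedBall (by norm_num))
    · rw [← eLpNorm_two_sq]
      gcongr
      exact eLpNorm_halfBall_le h.bound z
  calc _ ≤ ∫⁻ x, ofReal (G / ρ) * (closedBall o (2 * ρ)).indicator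
          (fun x => ‖u x‖ₑ ^ 2 * ‖u x‖ₑ) x := by
        refine lintegral_mono fun x => (mul_le_mul_right (hflux ρ hρ0 o u x) _).trans (le_of_eq ?_)
        by_cases hx : x ∈ closedBall o (2 * ρ)
        · simp only [indicator_of_mem hx]; ring
        · simp only [indicator_of_notMem hx]; ring
    _ = ofReal (G / ρ) *
      ∫⁻ x in closedBall o (2 * ρ), ‖u x‖ₑ ^ 2 * ‖u x‖ₑ := by
        rw [lintegral_ofReal_mul, lintegral_indicator measurableSet_closedBall]
    _ ≤ ofReal (G / ρ) * (b⁻¹ * ∫⁻ z in closedBall o (3 * ρ),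
      CS * localEnergy u v z * M) := by
        gcongr
        rw [← ENNReal.mul_le_iff_le_inv hb0 measure_closedBall_lt_top.ne]
        refine (mul_lintegral_closedBall_le ((hmu.pow_const 2).mul hmu) o (2 * ρ) (1 / 2)).trans ?_
        exact (lintegral_mono_set (closedBall_subset_closedBall
          (by linarith))).trans (lintegral_mono hball)
    _ = ofReal (G / ρ) * b⁻¹ * CS * M *
      ∫⁻ z in closedBall o (3 * ρ), localEnergy u v z := by
        rw [lintegral_mul_const' _ _ hM.ne, lintegral_const_mul' _ _ hCS.ne]
        ring
    _ ≤ _ := by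
      refine (mul_le_mul_right (hloc u v o h.meas_v) _).trans ?_
      rw [mul_add]
      refine add_le_add ?_ (le_of_eq (by ring))
      calc _ = ofReal (G / ρ) * A * M *
        ∫⁻ x in closedBall o (7 * ρ), ‖v x‖ₑ ^ 2 := by rw [hA]; ring
        _ ≤ _ := by
            gcongr
            rw [show G * (A.toReal + 1) / ρ = G / ρ * (A.toReal + 1) by ring,
              ofReal_mul (by positivity)]
            gcongr
            rw [ofReal_add toReal_nonneg zero_le_one,
              ofReal_toReal (by finiteness : A < ⊤).ne]
            exact le_self_add

/-! ### The pressure term -/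

lemma IsSlice.setLIntegral_pow_four_lt_top (h0 : 3 / 4 ≤ s) (h1 : s < 1) {v : E3 → E3} {p : E3 → ℝ}
    (h : IsSlice s M u v p) (hM : M < ⊤) (o : E3) (r : ℝ) :
    ∫⁻ x in closedBall o r, ‖u x‖ₑ ^ 4 < ⊤ := by
  obtain ⟨CS, hCS, hS⟩ := exists_local_sobolev_sq h0 h1
  have hl : LocallyIntegrable (fun x => ‖u x‖ ^ 4) := fun z => by
    refine ⟨closedBall z 2, Metric.closedBall_mem_nhds z two_pos,
      (h.meas_u.norm.pow 4).restrict, ?_⟩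
    rw [hasFiniteIntegral_iff_enorm]
    simp only [enorm_pow, enorm_norm]
    have := h.localEnergy_lt_top hM z
    exact (hS M u v p h hM z).trans_lt (by finiteness)
  have := (hl.integrableOn_isCompact (isCompact_closedBall o r)).2
  rw [hasFiniteIntegral_iff_enorm] at this
  simpa only [enorm_pow, enorm_norm] using this

lemma aestronglyMeasurable_apply_mul (hu : AEStronglyMeasurable u) (j k : Fin 3) :
    AEStronglyMeasurable (fun x => u x j * u x k) :=
  (aestronglyMeasurable_apply hu j).mul (aestronglyMeasurable_apply hu k)

lemma enorm_apply_mul_le (w : E3) (j k : Fin 3) : ‖w j * w k‖ₑ ≤ ‖w‖ₑ ^ 2 := by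
  rw [enorm_mul, sq]
  exact mul_le_mul' (enorm_apply_le w j) (enorm_apply_le w k)

lemma lintegral_wtE_apply_mul_le (u : E3 → E3) (j k : Fin 3) (o : E3) :
    ∫⁻ x, wtE (x - o) * ‖u x j * u x k‖ₑ ≤ wtEnergy u o :=
  lintegral_mono fun x => mul_le_mul_right (enorm_apply_mul_le (u x) j k) _

/-- The local representation of the pressure of a time slice: up to an additive constant it is a
sum of square-integrable functions, given by the transposed Riesz transforms of the near part of
`u ⊗ u` and by functionals that only see its far part. -/
lemma exists_pressure_bound (h0 : 3 / 4 ≤ s) (h1 : s < 1) : ∃ C0 : ℝ, 0 < C0 ∧ ∀ ρ, 2 ≤ ρ →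
    ∀ M : ℝ≥0∞, M < ⊤ → ∃ C1 : ℝ≥0∞, C1 < ⊤ ∧ ∀ (u v : E3 → E3) (p : E3 → ℝ), IsSlice s M u v p →
    ∀ o : E3, ‖∫ x, p x * flux ρ o u x‖ₑ ≤ ofReal (C0 / ρ) * M * (∫⁻ x in closedBall o (7 * ρ),
    ‖v x‖ₑ ^ 2) + C1 * wtEnergy u o := by
  obtain ⟨G, hG, hflux⟩ := exists_enorm_flux_le
  obtain ⟨CS, hCS, hS⟩ := exists_local_sobolev_sq h0 h1
  obtain ⟨Cw, hCw, hCwb⟩ := exists_wtEnergy_le_ulocNorm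
  have hv4 : volume (closedBall (0 : E3) 4) < ⊤ := measure_closedBall_lt_top
  choose CR hCR hR using exists_riesz_pairing_bound
  set CRs : ℝ≥0∞ := ∑ j, ∑ k, CR j k with hCRs
  have hCRst : CRs < ⊤ :=
    sum_lt_top.2 fun j _ => sum_lt_top.2 fun k _ => hCR j k
  set A : ℝ≥0∞ := CRs * CS * volume (closedBall (0 : E3) 4) with hA
  have hAt : A < ⊤ := by finiteness
  refine ⟨G * (A.toReal + 1), by positivity, fun ρ hρ M hM => ?_⟩
  have hρ0 : 0 < ρ := by linarith
  obtain ⟨C, hC, hloc⟩ := exists_lintegral_localEnergy_le hρ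
  choose CF hCF hF using fun j k => exists_riesz_far j k (by linarith)
  set CFs := ∑ j, ∑ k, CF j k with hCFs
  have hCFst : CFs < ⊤ :=
    sum_lt_top.2 fun j _ => sum_lt_top.2 fun k _ => hCF j k
  set H : ℝ≥0∞ := ofReal (G / ρ) * (volume (closedBall (0 : E3) (2 * ρ)) +
    ofReal ((1 + 2 * ρ) ^ (15 / 4 : ℝ)) * (Cw * M ^ 2)) with hH
  have hv2 : volume (closedBall (0 : E3) (2 * ρ)) < ⊤ := measure_closedBall_lt_top
  have hHt : H < ⊤ := by finiteness
  set w6 : ℝ≥0∞ := ofReal ((1 + 6 * ρ) ^ (15 / 4 : ℝ)) with hw6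
  refine ⟨CRs * (ofReal (G / ρ) * M * CS * C + w6 * H) + CFs * H, by finiteness,
    fun u v p h o => ?_⟩
  have huE := h.wtEnergy_lt_top hM o
  have huE2 : wtEnergy u o ≤ Cw * M ^ 2 := (hCwb u o h.meas_u).trans (by gcongr; exact h.bound)
  set B := closedBall o (6 * ρ)
  set a := fun j k x => u x j * u x k with ha
  have ham := aestronglyMeasurable_apply_mul h.meas_u
  have haA := fun j k => lintegral_wtE_apply_mul_le u j k o
  -- the near part is square integrable
  set U := fun j k => B.indicator (a j k) with hU
  have hUsq : ∀ j k S, MeasurableSet S →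
    ∫⁻ x in S, ‖U j k x‖ₑ ^ 2 ≤ ∫⁻ x in S, B.indicator (fun x => ‖u x‖ₑ ^ 4) x := fun j k S hS => by
    refine lintegral_mono fun x => ?_
    by_cases hx : x ∈ B
    · simp only [hU, indicator_of_mem hx]
      calc _ ≤ (‖u x‖ₑ ^ 2) ^ 2 := by gcongr; exact enorm_apply_mul_le _ _ _
        _ = _ := by rw [← pow_mul]
    · simp [hU, indicator_of_notMem hx]
  have hUL : ∀ j k, MemLp (U j k) 2 volume := fun j k => by
    refine ⟨(ham j k).indicator measurableSet_closedBall, ?_⟩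
    have h2 : eLpNorm (U j k) 2 volume ^ 2 < ⊤ := by
      rw [eLpNorm_two_sq]
      have := hUsq j k univ MeasurableSet.univ
      rw [Measure.restrict_univ, lintegral_indicator measurableSet_closedBall] at this
      exact this.trans_lt (h.setLIntegral_pow_four_lt_top h0 h1 hM o _)
    exact (pow_lt_top_iff.1 h2).resolve_right two_ne_zero
  have hU1 : ∀ j k, ∫⁻ x, ‖U j k x‖ₑ ≤ w6 * wtEnergy u o := by
    intro j k
    refine le_trans ?_ (setLIntegral_closedBall_le_wtEnergy u o (6 * ρ))
    rw [← lintegral_indicator measurableSet_closedBall]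
    refine lintegral_mono fun x => ?_
    by_cases hx : x ∈ B
    · rw [indicator_of_mem hx]
      simp only [hU, indicator_of_mem hx]
      exact enorm_apply_mul_le _ _ _
    · simp [hU, indicator_of_notMem hx]
  choose W hWL hW using fun j k => exists_riesz_transpose j k (hUL j k)
  choose Q hQL hQ hQb using fun j k => hF j k (a j k) o (ham j k) ((haA j k).trans_lt huE)
  set q := flux ρ o u
  have hqG := hflux ρ hρ0 o u
  have hqm : AEStronglyMeasurable q := aestronglyMeasurable_flux hρ0 o h.meas_u
  have hqL : MemLp q 2 volume := by
    refine ⟨hqm, ?_⟩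
    have h2 : eLpNorm q 2 volume ^ 2 < ⊤ := by
      rw [eLpNorm_two_sq]
      calc _ ≤ ∫⁻ x, ofReal (G / ρ) ^ 2 *
            (closedBall o (2 * ρ)).indicator (fun x => ‖u x‖ₑ ^ 2) x := by
            refine lintegral_mono fun x => ?_
            have := hqG x
            by_cases hx : x ∈ closedBall o (2 * ρ)
            · rw [indicator_of_mem hx] at this ⊢
              rw [← mul_pow]; gcongr
            · rw [indicator_of_notMem hx, mul_zero, nonpos_iff_eq_zero] at this
              rw [this]; simp
        _ = ofReal (G / ρ) ^ 2 * ∫⁻ x in closedBall o (2 * ρ), ‖u x‖ₑ ^ 2 := by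
          rw [lintegral_const_mul' _ _ (by finiteness), lintegral_indicator
            measurableSet_closedBall]
        _ < ⊤ := by
          have := setLIntegral_closedBall_le_wtEnergy u o (2 * ρ)
          exact mul_lt_top (by finiteness) (this.trans_lt (by finiteness))
    exact (pow_lt_top_iff.1 h2).resolve_right two_ne_zero
  have hq1 : ∫⁻ x, ‖q x‖ₑ ≤ H := by
    refine (lintegral_flux_le hqG).trans ?_
    rw [hH]
    gcongr
  have hqi : Integrable q := ⟨hqm, hq1.trans_lt hHt⟩
  have hq0 : ∫ x, q x = 0 := h.div_eq _ (ballBump_isTest hρ0 o)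
  have hqs : ∀ x, q x ≠ 0 → ‖x - o‖ ≤ 2 * ρ := fun x hx => flux_support hρ0 hx
  -- the pressure up to a constant
  set f : E3 → ℝ := fun x => p x + ∑ j, ∑ k, (W j k x + Q j k x) with hf
  have hWQl : LocallyIntegrable (fun x => ∑ j, ∑ k, (W j k x + Q j k x)) := by
    refine locallyIntegrable_finsetSum _ fun j _ => locallyIntegrable_finsetSum _ fun k _ => ?_
    exact ((hWL j k).locallyIntegrable (by norm_num)).add
      ((hQL j k).locallyIntegrable (by norm_num))
  have hfl : LocallyIntegrable f := h.meas_p.add hWQl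
  have hgrad : ∀ g, IsTest univ g → (∀ y, g y ≠ 0 → ‖y - o‖ ≤ (3 * ρ - 1) + 1) →
    ∀ i, ∫ y, f y * pd i g y = 0 := fun g hg hgs i => by
    have hgi := hg.pd i
    have hgi0 := integral_pd hg i
    have hgis : ∀ y, pd i g y ≠ 0 → ‖y - o‖ ≤ 3 * ρ := fun y hy =>
      (pd_support hgs i y hy).trans (by linarith)
    have hloc : ∀ {F : E3 → ℝ}, LocallyIntegrable F → Integrable fun y => F y * pd i g y := by
      intro F hF
      exact (hF.integrable_smul_left_of_hasCompactSupport hgi.1.continuous hgi.2.1).congr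
        (.of_forall fun y => mul_comm _ _)
    have hWi := fun j k => integrable_mul_of_memLp (hWL j k) (hgi.memLp 2)
    have hQi := fun j k =>
      integrable_mul_of_memLp (hQL j k) (hgi.memLp 2)
    have hsplit : ∀ j k x, a j k x * rieszPair j k (pd i g) x =
      U j k x * rieszPair j k (pd i g) x + Bᶜ.indicator (a j k) x * rieszPair j k (pd i g) x :=
  fun j k x => by
      rw [← add_mul]
      congr 1
      exact (congrFun (indicator_self_add_compl B (a j k)) x).symm
    have hUi := fun j k => integrable_mul_of_memLp (hUL j k) (memLp_rieszPair j k hgi)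
    have hai : ∀ j k, Integrable fun x => a j k x * rieszPair j k (pd i g) x := fun j k => by
      simp only [hsplit]
      exact (hUi j k).add (hQ j k _ hgi hgi0 hgis).1
    have hpe := h.pressure_eq g hg i
    have e1 : ∫ x, ∑ j, ∑ k, u x j * u x k * rieszPair j k (pd i g) x =
      ∑ j, ∑ k, ∫ x, (W j k x + Q j k x) * pd i g x := by
      rw [integral_finsetSum _ fun j _ => integrable_finsetSum _ fun k _ => hai j k]
      refine Finset.sum_congr rfl fun j _ => ?_
      rw [integral_finsetSum _ fun k _ => hai j k]
      refine Finset.sum_congr rfl fun k _ => ?_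
      calc _ = ∫ x, (U j k x * rieszPair j k (pd i g) x +
        Bᶜ.indicator (a j k) x * rieszPair j k (pd i g) x) :=
        integral_congr_ae (.of_forall fun x => hsplit j k x)
        _ = _ := by
          rw [integral_add (hUi j k) (hQ j k _ hgi hgi0 hgis).1, hW j k _ hgi,
            (hQ j k _ hgi hgi0 hgis).2, ← integral_add (hWi j k) (hQi j k)]
          congr 1; ext x; ring
    have e2 : ∫ y, f y * pd i g y =
      (∫ y, p y * pd i g y) + ∑ j, ∑ k, ∫ x, (W j k x + Q j k x) * pd i g x := by
      have hWQi : ∀ j k, Integrable fun x => (W j k x + Q j k x) * pd i g x := fun j k =>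
        ((hWi j k).add (hQi j k)).congr (.of_forall fun x => by simp only [Pi.add_apply]; ring)
      have e3 : ∀ y, f y * pd i g y =
        p y * pd i g y + ∑ j, ∑ k, (W j k y + Q j k y) * pd i g y := fun y => by
        simp only [hf, add_mul, Finset.sum_mul]
      simp only [e3]
      rw [integral_add (hloc h.meas_p)
        (integrable_finsetSum _ fun j _ => integrable_finsetSum _ fun k _ => hWQi j k),
        integral_finsetSum _ fun j _ => integrable_finsetSum _ fun k _ => hWQi j k]
      congr 1
      exact Finset.sum_congr rfl fun j _ => by rw [integral_finsetSum _ fun k _ => hWQi j k]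
    rw [e2, hpe, e1, neg_add_cancel]
  obtain ⟨c, hc⟩ := ae_eq_const_of_weak_gradient hfl (by linarith : 0 < 3 * ρ - 1) hgrad
  have hWq : ∀ j k, Integrable fun x => W j k x * q x := fun j k =>
    integrable_mul_of_memLp (hWL j k) hqL
  have hQq : ∀ j k, Integrable fun x => Q j k x * q x := fun j k =>
    integrable_mul_of_memLp (hQL j k) hqL
  have hpq : ∫ x, p x * q x = -∑ j, ∑ k, ((∫ x, W j k x * q x) + ∫ x, Q j k x * q x) := by
    have e4 : ∀ᵐ x, p x * q x = c * q x - ∑ j, ∑ k, (W j k x * q x + Q j k x * q x) := by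
      filter_upwards [hc] with x hx
      by_cases hqx : q x = 0
      · simp [hqx]
      · have h3 := hx (by
          rw [mem_ball_iff_norm]
          linarith [hqs x hqx])
        rw [← h3, hf]
        simp only [add_mul, Finset.sum_mul]
        ring
    have hWQq : ∀ j k, Integrable fun x => W j k x * q x + Q j k x * q x := fun j k =>
      (hWq j k).add (hQq j k)
    rw [integral_congr_ae e4, integral_sub (hqi.const_mul c)
      (integrable_finsetSum _ fun j _ => integrable_finsetSum _ fun k _ => hWQq j k),
      integral_const_mul, hq0, mul_zero, zero_sub,
      integral_finsetSum _ fun j _ => integrable_finsetSum _ fun k _ => hWQq j k]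
    congr 1
    refine Finset.sum_congr rfl fun j _ => ?_
    rw [integral_finsetSum _ fun k _ => hWQq j k]
    exact Finset.sum_congr rfl fun k _ => integral_add (hWq j k) (hQq j k)
  set X := ∫⁻ x in closedBall o (7 * ρ), ‖v x‖ₑ ^ 2
  have hW1 : ∀ j k, ‖∫ x, W j k x * q x‖ₑ ≤ CR j k * (ofReal (G / ρ) * M * CS *
    (volume (closedBall (0 : E3) 4) * X + C * wtEnergy u o) +
    w6 * wtEnergy u o * H) := fun j k => by
    refine (hR j k (U j k) (W j k) (hUL j k) (hWL j k) (hW j k) q hqL).trans ?_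
    gcongr
    · calc _ ≤ ∫⁻ z, (closedBall o (3 * ρ)).indicator (fun z =>
            (ofReal (G / ρ) * M * CS) * localEnergy u v z) z := by
            refine lintegral_mono fun z => ?_
            have hU2 : eLpNorm (U j k) 2 (volume.restrict (closedBall z 2)) ≤
                CS * localEnergy u v z := by
              rw [← pow_le_pow_left_iff two_ne_zero, eLpNorm_two_sq]
              exact ((hUsq j k _ measurableSet_closedBall).trans (lintegral_mono fun x =>
                indicator_le_self _ _ _)).trans (hS M u v p h hM z)
            refine (mul_le_mul' hU2 (eLpNorm_flux_le hρ h.bound hqG z)).trans (le_of_eq ?_)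
            by_cases hz : z ∈ closedBall o (3 * ρ)
            · simp only [indicator_of_mem hz]; ring
            · simp only [indicator_of_notMem hz]; ring
        _ = (ofReal (G / ρ) * M * CS) *
          ∫⁻ z in closedBall o (3 * ρ), localEnergy u v z := by
          rw [lintegral_indicator measurableSet_closedBall, lintegral_const_mul' _ _
            (by finiteness)]
        _ ≤ _ := by gcongr; exact hloc u v o h.meas_v
    · exact hU1 j k
  have hQ1 : ∀ j k, ‖∫ x, Q j k x * q x‖ₑ ≤ CF j k * (wtEnergy u o * H) := fun j k => by
    refine (hQb j k q hqL hq0 hqs).trans ?_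
    rw [mul_assoc]
    gcongr
    exact haA j k
  rw [hpq, enorm_neg]
  calc _ ≤ ∑ j, ∑ k, (CR j k * (ofReal (G / ρ) * M * CS *
      (volume (closedBall (0 : E3) 4) * X + C * wtEnergy u o) +
      w6 * wtEnergy u o * H) + CF j k * (wtEnergy u o * H)) := (enorm_sum_le _ _).trans
        (Finset.sum_le_sum fun j _ => (enorm_sum_le _ _).trans (Finset.sum_le_sum fun k _ =>
        (enorm_add_le _ _).trans (add_le_add (hW1 j k) (hQ1 j k))))
    _ = CRs * (ofReal (G / ρ) * M * CS *
      (volume (closedBall (0 : E3) 4) * X + C * wtEnergy u o) +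
      w6 * wtEnergy u o * H) + CFs * (wtEnergy u o * H) := by
        simp only [Finset.sum_add_distrib, ← Finset.sum_mul, hCRs, hCFs]
    _ = ofReal (G / ρ) * A * M * X + (CRs * (ofReal (G / ρ) * M * CS * C +
      w6 * H) + CFs * H) * wtEnergy u o := by rw [hA]; ring
    _ ≤ _ := by
      gcongr
      rw [show G * (A.toReal + 1) / ρ = G / ρ * (A.toReal + 1) by ring, ofReal_mul (by positivity)]
      gcongr
      rw [ofReal_add toReal_nonneg zero_le_one, ofReal_toReal hAt.ne]
      exact le_self_add

/-! ### A separable norm on test functions -/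

lemma ftR_pd (hg : IsTest univ g) (i : Fin 3) (ξ : E3) :
    ftR (pd i g) ξ = (2 * π * Complex.I * ξ i : ℂ) * ftR g ξ := by
  have hgi : Integrable (fun y => (g y : ℂ)) := (memLp_one_iff_integrable.1 (hg.memLp 1)).ofReal
  have hd : ∀ y, HasFDerivAt (fun y => (g y : ℂ)) (Complex.ofRealCLM.comp (fderiv ℝ g y)) y :=
    fun y => Complex.ofRealCLM.hasFDerivAt.comp y (hg.differentiable y).hasFDerivAt
  have hfd : fderiv ℝ (fun y => (g y : ℂ)) = fun y => Complex.ofRealCLM.comp (fderiv ℝ g y) :=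
    funext fun y => (hd y).fderiv
  have hc : Continuous (fderiv ℝ g) := hg.1.continuous_fderiv (by simp)
  have hfi : Integrable (fderiv ℝ (fun y => (g y : ℂ))) := by
    rw [hfd]
    have h1 : Continuous fun y => Complex.ofRealCLM.comp (fderiv ℝ g y) :=
      continuous_const.clm_comp hc
    exact h1.integrable_of_hasCompactSupport ((hg.2.1.fderiv (𝕜 := ℝ)).comp_left (g := fun L =>
      Complex.ofRealCLM.comp L) (by simp))
  have h2 := congrArg (fun L => L (single i (1 : ℝ)))
    (congrFun (Real.fourier_fderiv hgi (fun y => (hd y).differentiableAt) hfi) ξ)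
  simp only [Real.fourier_continuousLinearMap_apply hfi] at h2
  simp only [hfd] at h2
  have e : ftR (pd i g) = 𝓕 fun x => (Complex.ofRealCLM.comp (fderiv ℝ g x)) (EuclideanSpace.single
    i (1 : ℝ)) := rfl
  rw [e, h2, VectorFourier.fourierSMulRight_apply]
  have e2 : (innerSL ℝ ξ) (single i (1 : ℝ)) = ξ i := by
    rw [innerSL_apply_apply]; simp [EuclideanSpace.inner_single_right]
  simp only [ftR, neg_apply, e2, neg_smul]
  simp
  ring

/-- A norm on test functions, computed on the Fourier side, that controls the function and its
first derivatives, and dominates the symbols of order at most two. -/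
noncomputable def specNorm (g : E3 → ℝ) : ℝ := ∫ ξ, (1 + ‖ξ‖ ^ 2) * ‖ftR g ξ‖

lemma IsTest.integrable_specNorm (hg : IsTest univ g) :
    Integrable fun ξ => (1 + ‖ξ‖ ^ 2) * ‖ftR g ξ‖ := by
  refine (hg.integrable_ftR.norm.add (hg.integrable_pow_mul_ftR 2)).congr (.of_forall fun ξ => ?_)
  simp only [Pi.add_apply]; ring

lemma specNorm_nonneg (g : E3 → ℝ) : 0 ≤ specNorm g := integral_nonneg fun ξ => by positivity

lemma integral_symbol_le_specNorm (hm : IsHomSymbol σ m) (h0 : 0 ≤ σ) (h2 : σ ≤ 2) :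
    ∃ C, 0 ≤ C ∧ ∀ g, IsTest univ g → ∫ ξ, ‖(m ξ : ℂ) * ftR g ξ‖ ≤ C * specNorm g := by
  obtain ⟨C, hC, hb⟩ := hm.exists_bound
  refine ⟨C, hC, fun g hg => ?_⟩
  rw [specNorm, ← integral_const_mul]
  refine integral_mono_of_nonneg (.of_forall fun ξ => norm_nonneg _)
    (hg.integrable_specNorm.const_mul C) (.of_forall fun ξ => ?_)
  simp only [norm_mul, norm_real, norm_eq_abs]
  rw [← mul_assoc]
  gcongr
  refine (hb ξ).trans ?_
  gcongr
  rcases le_total ‖ξ‖ 1 with h | h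
  · exact (Real.rpow_le_one (norm_nonneg _) h h0).trans (by nlinarith)
  · calc _ ≤ ‖ξ‖ ^ (2 : ℝ) := Real.rpow_le_rpow_of_exponent_le h h2
      _ ≤ _ := by rw [rpow_two]; linarith

lemma abs_le_integral_ftR (hg : IsTest univ g) (x : E3) : |g x| ≤ ∫ ξ, ‖ftR g ξ‖ := by
  have h1 := hg.fourierInv_ftR x
  have h2 : ‖(g x : ℂ)‖ ≤ ∫ ξ, ‖ftR g ξ‖ := by
    rw [← h1, fourierInv_eq]
    refine (norm_integral_le_integral_norm _).trans (le_of_eq ?_)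
    congr 1; ext ξ
    rw [Circle.norm_smul]
  simpa using h2

lemma abs_le_specNorm (hg : IsTest univ g) (x : E3) : |g x| ≤ specNorm g := by
  refine (abs_le_integral_ftR hg x).trans ?_
  exact integral_mono hg.integrable_ftR.norm hg.integrable_specNorm fun ξ => le_mul_of_one_le_left
    (norm_nonneg _) (by nlinarith)

lemma norm_ftR_pd_le (hg : IsTest univ g) (i : Fin 3) (ξ : E3) :
    ‖ftR (pd i g) ξ‖ ≤ 2 * π * ((1 + ‖ξ‖ ^ 2) * ‖ftR g ξ‖) := by
  rw [ftR_pd hg, norm_mul]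
  have h1 : ‖(2 * π * Complex.I * ξ i)‖ ≤ 2 * π * (1 + ‖ξ‖ ^ 2) := by
    simp only [norm_mul, Complex.norm_I, norm_real, Complex.norm_ofNat, mul_one,
      norm_of_nonneg Real.pi_pos.le]
    have := PiLp.norm_apply_le ξ i
    gcongr
    nlinarith
  rw [← mul_assoc]
  gcongr

lemma integral_ftR_pd_le (hg : IsTest univ g) (i : Fin 3) :
    ∫ ξ, ‖ftR (pd i g) ξ‖ ≤ 2 * π * specNorm g := by
  rw [specNorm, ← integral_const_mul]
  exact integral_mono (hg.pd i).integrable_ftR.norm (hg.integrable_specNorm.const_mul _)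
    fun ξ => norm_ftR_pd_le hg i ξ

lemma abs_pd_le_specNorm (hg : IsTest univ g) (i : Fin 3) (x : E3) :
    |pd i g x| ≤ 2 * π * specNorm g :=
  (abs_le_integral_ftR (hg.pd i) x).trans (integral_ftR_pd_le hg i)

lemma integral_abs_le_of_support (hg : IsTest univ g) (hs : ∀ y, g y ≠ 0 → ‖y‖ ≤ R)
    (hA : ∀ x, |g x| ≤ A) : ∫ y, |g y| ≤ volume.real (closedBall (0 : E3) R) * A := by
  have h1 : Integrable ((closedBall (0 : E3) R).indicator fun _ => A) :=
    (integrable_indicator_iff measurableSet_closedBall).2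
    (integrableOn_const measure_closedBall_lt_top.ne)
  calc _ ≤ ∫ y, (closedBall (0 : E3) R).indicator (fun _ => A) y := by
        refine integral_mono (memLp_one_iff_integrable.1 (hg.memLp 1)).abs h1 fun y => ?_
        by_cases hy : y ∈ closedBall (0 : E3) R
        · simpa [hy] using hA y
        · simp [(by by_contra hc; exact hy (by simpa using hs y hc) : g y = 0), hy]
    _ = _ := by rw [integral_indicator_const _ measurableSet_closedBall, smul_eq_mul]

lemma testSpace_sub {h : E3 → ℝ} (hg : IsTest univ g) (hh : IsTest univ h) :
    IsTest univ (g - h) := testSpace.sub_mem hg hh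

/-- Any set of test functions is separable for the norm `specNorm`. -/
lemma exists_countable_dense_tests (S : Set (E3 → ℝ)) (hS : ∀ g ∈ S, IsTest univ g) :
    ∃ D ⊆ S, D.Countable ∧ ∀ g ∈ S, ∀ ε > 0, ∃ h ∈ D, specNorm (g - h) ≤ ε := by
  have hint : ∀ g, IsTest univ g → Integrable fun ξ => ((1 + ‖ξ‖ ^ 2 : ℝ) : ℂ) * ftR g ξ :=
    fun g hg => by
    refine hg.integrable_specNorm.mono' ?_ (.of_forall fun ξ => ?_)
    · refine AEStronglyMeasurable.mul ?_ hg.integrable_ftR.1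
      exact (Complex.continuous_ofReal.comp
        (by fun_prop : Continuous fun ξ : E3 => 1 + ‖ξ‖ ^ 2)).aestronglyMeasurable
    · rw [norm_mul, norm_real, norm_of_nonneg (by positivity)]
  let J : S → Lp ℂ 1 volume := fun g => (hint g.1 (hS g.1 g.2)).toL1
  have : Fact ((1 : ℝ≥0∞) ≠ ⊤) := ⟨ENNReal.one_ne_top⟩
  obtain ⟨t, hts, htc, htd⟩ :=
    (TopologicalSpace.IsSeparable.of_separableSpace (range J)).exists_countable_dense_subset
  have hJ : ∀ g h : S, ‖J g - J h‖ = specNorm (g.1 - h.1) := fun g h => by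
    rw [← Integrable.toL1_sub, L1.norm_of_fun_eq_integral_norm, specNorm]
    congr 1; ext ξ
    have e : ftR (g.1 - h.1) ξ = ftR g.1 ξ - ftR h.1 ξ := by
      rw [sub_eq_add_neg, show -h.1 = (-1 : ℝ) • h.1 by simp,
        ftR_add (hS _ g.2) (testSpace.smul_mem (-1) (hS _ h.2)), ftR_smul]
      push_cast; ring
    simp only [Pi.sub_apply, e, ← mul_sub, norm_mul, norm_real]
    rw [norm_of_nonneg (by positivity)]
  choose f hf using fun x : t => hts x.2
  have := htc.to_subtype
  refine ⟨range fun x : t => (f x).1, ?_, countable_range _, fun g hg ε hε => ?_⟩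
  · rintro _ ⟨x, rfl⟩; exact (f x).2
  · obtain ⟨y, hy, hyd⟩ := Metric.mem_closure_iff.1 (htd (mem_range_self _)) ε hε
    refine ⟨_, ⟨⟨y, hy⟩, rfl⟩, ?_⟩
    have h2 := hJ ⟨g, hg⟩ (f ⟨y, hy⟩)
    rw [hf ⟨y, hy⟩] at h2
    rw [dist_eq_norm, h2] at hyd
    exact hyd.le

/-- A linear functional on test functions, bounded by `specNorm` on functions with support in a
fixed ball. -/
structure IsTestFunctional (Φ : (E3 → ℝ) → ℝ) : Prop where
  sub : ∀ g h, IsTest univ g → IsTest univ h → Φ (g - h) = Φ g - Φ h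
  bound : ∀ R > 0, ∃ K, ∀ g, IsTest univ g → (∀ y, g y ≠ 0 → ‖y‖ ≤ R) → |Φ g| ≤ K * specNorm g

/-- A family of functionals that vanishes almost everywhere on each test function vanishes, almost
everywhere, on all test functions at once. -/
lemma ae_forall_test (Ψ : ℝ → (E3 → ℝ) → ℝ) (h1 : ∀ g, IsTest univ g → ∀ᵐ t, t ∈ I → Ψ t g = 0)
    (h2 : ∀ᵐ t, t ∈ I → IsTestFunctional (Ψ t)) : ∀ᵐ t, t ∈ I → ∀ g, IsTest univ g → Ψ t g = 0 := by
  let S : ℕ → Set (E3 → ℝ) := fun n => {g | IsTest univ g ∧ ∀ y, g y ≠ 0 → ‖y‖ ≤ n + 1}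
  choose D hDS hDc hD using fun n => exists_countable_dense_tests (S n) fun g hg => hg.1
  have hall : ∀ᵐ t, ∀ n, ∀ g ∈ D n, t ∈ I → Ψ t g = 0 := by
    rw [ae_all_iff]; intro n
    rw [ae_ball_iff (hDc n)]
    exact fun g hg => h1 g (hDS n hg).1
  filter_upwards [hall, h2] with t ht1 ht2 htI g hg
  obtain ⟨R, hR, hRs⟩ := hg.exists_radius
  obtain ⟨n, hn⟩ := exists_nat_ge R
  have hgS : g ∈ S n := ⟨hg, fun y hy => (hRs y hy).trans (by linarith)⟩
  obtain ⟨K, hK⟩ := (ht2 htI).bound (n + 1) (by positivity)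
  refine abs_eq_zero.1 (le_antisymm (le_of_forall_pos_le_add fun ε hε => ?_) (abs_nonneg _))
  obtain ⟨h, hhD, hhε⟩ := hD n g hgS (ε / (|K| + 1)) (by positivity)
  have hhS := hDS n hhD
  have e : Ψ t g = Ψ t (g - h) := by rw [(ht2 htI).sub g h hg hhS.1, ht1 n h hhD htI, sub_zero]
  rw [e, zero_add]
  refine (hK _ (testSpace_sub hg hhS.1) fun y hy => ?_).trans ?_
  · by_cases h0 : g y = 0
    · exact hhS.2 y fun h' => hy (by simp [h0, h'])
    · exact hgS.2 y h0
  · calc _ ≤ (|K| + 1) * (ε / (|K| + 1)) :=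
      mul_le_mul (by linarith [le_abs_self K]) hhε (specNorm_nonneg _) (by positivity)
      _ = ε := by field_simp

/-! ### Operators on test functions with integrable decay -/

/-- A linear operator on test functions whose values are continuous and decay like the weight `wt`,
with a constant controlled by `specNorm` and the size of the support. -/
structure IsTestOp (L : (E3 → ℝ) → E3 → ℝ) : Prop where
  cont : ∀ g, IsTest univ g → Continuous (L g)
  add : ∀ g h, IsTest univ g → IsTest univ h → ∀ x, L (g + h) x = L g x + L h x
  smul : ∀ (c : ℝ) g x, L (c • g) x = c * L g x
  decay : ∀ R > 0, ∃ C, 0 ≤ C ∧ ∀ g, IsTest univ g → (∀ y, g y ≠ 0 → ‖y‖ ≤ R) →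
    ∀ x, |L g x| ≤ C * specNorm g * wt x

lemma IsTestOp.sub {L : (E3 → ℝ) → E3 → ℝ} (hL : IsTestOp L) {h : E3 → ℝ} (hg : IsTest univ g)
    (hh : IsTest univ h) (x : E3) : L (g - h) x = L g x - L h x := by
  rw [sub_eq_add_neg, show -h = (-1 : ℝ) • h by simp, hL.add _ _ hg (testSpace.smul_mem (-1) hh),
    hL.smul]
  ring

lemma IsTestOp.le_wt {L : (E3 → ℝ) → E3 → ℝ} (hL : IsTestOp L) (hg : IsTest univ g) :
    ∃ C, 0 ≤ C ∧ ∀ x, |L g x| ≤ C * wt x := by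
  obtain ⟨R, hR, hs⟩ := hg.exists_radius
  obtain ⟨C, hC, h⟩ := hL.decay R hR
  exact ⟨C * specNorm g, mul_nonneg hC (specNorm_nonneg g), h g hg hs⟩

lemma abs_le_wt_of_support (hR : 0 ≤ R) (hs : ∀ y, g y ≠ 0 → ‖y‖ ≤ R) (hA : ∀ x, |g x| ≤ A)
    (x : E3) : |g x| ≤ (1 + R) ^ (15 / 4 : ℝ) * A * wt x := by
  have hA0 := (abs_nonneg _).trans (hA x)
  by_cases h0 : g x = 0
  · rw [h0, abs_zero]
    have := wt_pos x
    positivity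
  · have h1 := wt_le_mul (a := 0) (by simpa using hs x h0)
    rw [(by simp [wt] : wt 0 = 1)] at h1
    calc _ ≤ A * 1 := by simpa using hA x
      _ ≤ A * ((1 + R) ^ (15 / 4 : ℝ) * wt x) := by gcongr
      _ = _ := by ring

lemma isTestOp_id : IsTestOp (fun g => g) where
  cont _ hg := hg.1.continuous
  add _ _ _ _ _ := rfl
  smul _ _ _ := rfl
  decay R hR := ⟨(1 + R) ^ (15 / 4 : ℝ), by positivity, fun g hg hs =>
    abs_le_wt_of_support hR.le hs (abs_le_specNorm hg)⟩

lemma isTestOp_pd (i : Fin 3) : IsTestOp (pd i) where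
  cont _ hg := (hg.pd i).1.continuous
  add g h hg hh x := by
    simp only [pd]
    rw [fderiv_add (hg.differentiable x) (hh.differentiable x)]; rfl
  smul c g x := by
    simp only [pd]
    rw [fderiv_const_smul_field]; rfl
  decay R hR := ⟨(1 + R) ^ (15 / 4 : ℝ) * (2 * π), by positivity, fun g hg hs x => by
    have h0 : ∀ y, g y ≠ 0 → ‖y - 0‖ ≤ R := by simpa using hs
    have := abs_le_wt_of_support hR.le (fun y hy => by simpa using pd_support h0 i y hy)
      (abs_pd_le_specNorm hg i) x
    linarith⟩

lemma isTestOp_lam (h0 : 3 / 4 ≤ σ) (h2 : σ ≤ 2) : IsTestOp (lam σ) where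
  cont g hg := Complex.continuous_re.comp
    ((isHomSymbol_lam σ (by linarith)).continuous_mulC (by linarith) h2 hg)
  add g h hg hh x := by
    simp only [lam, fourierMul_eq_re]
    rw [(isHomSymbol_lam σ (by linarith)).mulC_add (by linarith) h2 hg hh, Complex.add_re]
  smul c g x := by
    simp only [lam, fourierMul_eq_re]
    rw [mulC_smul, Complex.re_ofReal_mul]
  decay R hR := by
    have hm := isHomSymbol_lam σ (by linarith)
    obtain ⟨C, hC, h⟩ := hm.exists_decay_le h0 h2 hR
    obtain ⟨A, hA, hA'⟩ := integral_symbol_le_specNorm hm (by linarith) h2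
    refine ⟨C * (A + volume.real (closedBall (0 : E3) R)), by positivity,
      fun g hg hs x => (abs_re_le_norm _).trans ((h univ g hg hs x).trans ?_)⟩
    have h1 := hA' g hg
    have h3 := integral_abs_le_of_support hg hs (abs_le_specNorm hg)
    have := (wt_pos x).le
    calc _ ≤ C * (A * specNorm g + volume.real (closedBall (0 : E3) R) * specNorm g) *
          wt x := by gcongr
      _ = _ := by ring

lemma isTestOp_rieszPair_pd (j k i : Fin 3) : IsTestOp (fun g => rieszPair j k (pd i g)) where
  cont g hg := continuous_rieszPair j k (hg.pd i)
  add g h hg hh x := by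
    have e : pd i (g + h) = pd i g + pd i h := funext fun y => (isTestOp_pd i).add g h hg hh y
    rw [e, rieszPair_add j k (hg.pd i) (hh.pd i)]
  smul c g x := by
    have e : pd i (c • g) = c • pd i g := funext fun y => (isTestOp_pd i).smul c g y
    rw [e, rieszPair_smul]
  decay R hR := by
    obtain ⟨C, hC, h⟩ := (isHomSymbol_riesz j k).exists_decay_of_meanZero_le le_rfl zero_le_two hR
    refine ⟨C * (2 * π + volume.real (closedBall (0 : E3) R) * (2 * π)),
      by positivity, fun g hg hs x => ?_⟩
    have hs' := fun y hy =>
      by simpa using pd_support (by simpa using hs : ∀ y, g y ≠ 0 → ‖y - 0‖ ≤ R) i y hy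
    refine (abs_re_le_norm _).trans ((h univ _ (hg.pd i) (integral_pd hg i) hs' x).trans ?_)
    have h3 := integral_abs_le_of_support (hg.pd i) hs' (abs_pd_le_specNorm hg i)
    have h4 : ∫ ξ, ‖((ξ j * ξ k / ‖ξ‖ ^ 2 : ℝ)) * ftR (pd i g) ξ‖ ≤
      2 * π * specNorm g := by
      refine le_trans (integral_mono_of_nonneg (.of_forall fun ξ => norm_nonneg _)
        (hg.pd i).integrable_ftR.norm (.of_forall fun ξ => ?_)) (integral_ftR_pd_le hg i)
      simp only [norm_mul, norm_real]
      exact mul_le_of_le_one_left (norm_nonneg _) (riesz_symbol_abs_le_one j k ξ)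
    have := (wt_pos x).le
    calc _ ≤ C * (2 * π * specNorm g +
          volume.real (closedBall (0 : E3) R) * (2 * π * specNorm g)) * wt x := by
          gcongr
      _ = _ := by ring

lemma lintegral_mul_le_of_le_wt {a : E3 → ℝ} (hC : 0 ≤ C) (hg : ∀ x, |g x| ≤ C * wt x) :
    ∫⁻ x, ‖a x * g x‖ₑ ≤ ofReal C * ∫⁻ x, wtE x * ‖a x‖ₑ := by
  rw [← lintegral_ofReal_mul]
  refine lintegral_mono fun x => ?_
  have h : ‖g x‖ₑ ≤ ofReal C * wtE x := by
    rw [wtE, ← ofReal_mul hC, ← ofReal_norm]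
    exact ofReal_le_ofReal (hg x)
  calc _ = ‖a x‖ₑ * ‖g x‖ₑ := enorm_mul _ _
    _ ≤ ‖a x‖ₑ * (ofReal C * wtE x) := by gcongr
    _ = _ := by ring

lemma IsTestOp.integrable_mul {L : (E3 → ℝ) → E3 → ℝ} (hL : IsTestOp L) {a : E3 → ℝ}
    (ha : AEStronglyMeasurable a) (hw : ∫⁻ x, wtE x * ‖a x‖ₑ < ⊤) (hg : IsTest univ g) :
    Integrable fun x => a x * L g x := by
  obtain ⟨C, hC, h⟩ := hL.le_wt hg
  exact ⟨ha.mul (hL.cont g hg).aestronglyMeasurable,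
    (lintegral_mul_le_of_le_wt hC h).trans_lt (mul_lt_top ofReal_lt_top hw)⟩

lemma IsTestOp.isTestFunctional {L : (E3 → ℝ) → E3 → ℝ} (hL : IsTestOp L) {a : E3 → ℝ}
    (ha : AEStronglyMeasurable a) (hw : ∫⁻ x, wtE x * ‖a x‖ₑ < ⊤) :
    IsTestFunctional fun g => ∫ x, a x * L g x where
  sub g h hg hh := by
    simp only [hL.sub hg hh, mul_sub]
    exact integral_sub (hL.integrable_mul ha hw hg) (hL.integrable_mul ha hw hh)
  bound R hR := by
    obtain ⟨C, hC, h⟩ := hL.decay R hR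
    refine ⟨C * (∫⁻ x, wtE x * ‖a x‖ₑ).toReal, fun g hg hs => ?_⟩
    have h0 := mul_nonneg hC (specNorm_nonneg g)
    have h1 := (enorm_integral_le_lintegral_enorm (fun x => a x * L g x)).trans
      (lintegral_mul_le_of_le_wt h0 (h g hg hs))
    rw [← ofReal_toReal hw.ne, ← ofReal_mul h0, ← ofReal_norm,
      ofReal_le_ofReal_iff (by positivity)] at h1
    exact h1.trans (le_of_eq (by ring))

lemma IsTestFunctional.add {Φ Φ' : (E3 → ℝ) → ℝ} (h : IsTestFunctional Φ)
    (h' : IsTestFunctional Φ') : IsTestFunctional fun g => Φ g + Φ' g where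
  sub g k hg hk := by rw [h.sub g k hg hk, h'.sub g k hg hk]; ring
  bound R hR := by
    obtain ⟨K, hK⟩ := h.bound R hR
    obtain ⟨K', hK'⟩ := h'.bound R hR
    exact ⟨K + K', fun g hg hs => (abs_add_le _ _).trans
      (by rw [add_mul]; exact add_le_add (hK g hg hs) (hK' g hg hs))⟩

lemma IsTestFunctional.neg {Φ : (E3 → ℝ) → ℝ} (h : IsTestFunctional Φ) :
    IsTestFunctional fun g => - Φ g where
  sub g k hg hk := by rw [h.sub g k hg hk]; ring
  bound R hR := by
    obtain ⟨K, hK⟩ := h.bound R hR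
    exact ⟨K, fun g hg hs => by rw [abs_neg]; exact hK g hg hs⟩

lemma IsTestFunctional.sum {ι : Type*} (A : Finset ι) {Φ : ι → (E3 → ℝ) → ℝ}
    (h : ∀ l, IsTestFunctional (Φ l)) : IsTestFunctional fun g => ∑ l ∈ A, Φ l g := by
  classical
  induction A using Finset.induction_on with
  | empty => exact ⟨fun _ _ _ _ => by simp, fun R _ => ⟨0, fun g _ _ => by simp⟩⟩
  | insert l A hl ih => simpa only [Finset.sum_insert hl] using (h l).add ih

/-- Integration against a locally integrable function composed with a partial derivative. -/
lemma isTestFunctional_pd {p : E3 → ℝ} (hp : LocallyIntegrable p) (i : Fin 3) :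
    IsTestFunctional fun g => ∫ x, p x * pd i g x := by
  have key : ∀ R : ℝ, IsTestFunctional fun g =>
    ∫ x, (closedBall (0 : E3) R).indicator p x * pd i g x := fun R => by
    have h1 : Integrable ((closedBall (0 : E3) R).indicator p) :=
      (integrable_indicator_iff measurableSet_closedBall).2 (hp.integrableOn_isCompact
      (isCompact_closedBall _ _))
    refine (isTestOp_pd i).isTestFunctional h1.1 (lt_of_le_of_lt (lintegral_mono fun x => ?_) h1.2)
    exact mul_le_of_le_one_left zero_le (by
      rw [wtE, ← ofReal_one]; exact ofReal_le_ofReal (wt_le_one x))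
  have e : ∀ R, ∀ g : E3 → ℝ, (∀ y, g y ≠ 0 → ‖y‖ ≤ R) → ∫ x, p x * pd i g x =
    ∫ x, (closedBall (0 : E3) R).indicator p x * pd i g x := fun R g hs => by
    congr 1; ext x
    by_cases hx : x ∈ closedBall (0 : E3) R
    · rw [indicator_of_mem hx]
    · have : pd i g x = 0 := by
        by_contra hc
        exact hx (by simpa using pd_support (by simpa using hs : ∀ y, g y ≠ 0 → ‖y - 0‖ ≤ R) i x hc)
      simp [this]
  constructor
  · intro g h hg hh
    obtain ⟨R, -, hR⟩ := hg.exists_radius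
    obtain ⟨R', -, hR'⟩ := hh.exists_radius
    have h2 : ∀ y, h y ≠ 0 → ‖y‖ ≤ max R R' := fun y hy => (hR' y hy).trans (le_max_right _ _)
    have h3 : ∀ y, (g - h) y ≠ 0 → ‖y‖ ≤ max R R' := fun y hy => by
      by_cases h0 : g y = 0
      · exact h2 y fun h' => hy (by simp [h0, h'])
      · exact (fun y hy => (hR y hy).trans (le_max_left _ _)) y h0
    rw [e _ g (fun y hy => (hR y hy).trans (le_max_left _ _)), e _ h h2, e _ _ h3]
    exact (key _).sub g h hg hh
  · intro R hR
    obtain ⟨K, hK⟩ := (key R).bound R hR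
    exact ⟨K, fun g hg hs => by rw [e R g hs]; exact hK g hg hs⟩

/-! ### Space-time test functions of product form -/

lemma IsTest.mono {X : Type*} [NormedAddCommGroup X] [NormedSpace ℝ X] [NormedSpace ℝ F]
    {Ω Ω' : Set X} {φ : X → F} (h : IsTest Ω φ) (hΩ : Ω ⊆ Ω') : IsTest Ω' φ :=
  ⟨h.1, h.2.1, h.2.2.trans hΩ⟩

lemma Ioo_subset_timeIoo (ha : 0 ≤ a) (hb : (b : EReal) < T) :
    Ioo a b ⊆ timeIoo T := fun _ ht => ⟨ha.trans_lt ht.1, (EReal.coe_lt_coe_iff.2 ht.2).trans hb⟩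

lemma isTest_prod (hθ : IsTest (timeIoo T) θ) (hg : IsTest univ g) :
    IsTest (slab T) fun z : ℝ × E3 => θ z.1 * g z.2 := by
  have hK : Function.support (fun z : ℝ × E3 => θ z.1 * g z.2) ⊆ tsupport θ ×ˢ tsupport g :=
    fun z hz => by
    have hz' := hz
    exact ⟨subset_tsupport _ (left_ne_zero_of_mul hz'), subset_tsupport _
      (right_ne_zero_of_mul hz')⟩
  exact ⟨(hθ.1.comp contDiff_fst).mul (hg.1.comp contDiff_snd),
    HasCompactSupport.of_support_subset_isCompact (hθ.2.1.prod hg.2.1) hK,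
    (closure_minimal hK ((isClosed_tsupport _).prod (isClosed_tsupport _))).trans
    (prod_mono hθ.2.2 (subset_univ _))⟩

lemma isTest_prod_single (hθ : IsTest (timeIoo T) θ) (hg : IsTest univ g) (i : Fin 3) :
    IsTest (slab T) fun z : ℝ × E3 => (θ z.1 * g z.2) • (single i 1 : E3) := by
  have h := isTest_prod hθ hg
  refine ⟨h.1.smul contDiff_const, h.2.1.smul_right (f' := fun _ => single i 1),
    (closure_mono ?_).trans h.2.2⟩
  exact fun z hz hc => hz (by simp [hc])

lemma inner_smul_single (w : E3) (c : ℝ) (i : Fin 3) :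
    inner ℝ w (c • (single i 1 : E3)) = c * w i := by
  rw [inner_smul_right, EuclideanSpace.inner_single_right]; simp

lemma fderiv_apply_eq_sum (g : E3 → ℝ) (x a : E3) : fderiv ℝ g x a = ∑ i, a i * pd i g x := by
  have e : a = ∑ i, a i • (single i 1) := by
    ext j
    simp [Pi.single_apply]
  conv_lhs => rw [e]
  simp [pd]

lemma inner_gradient_eq_sum (x a : E3) : inner ℝ a (gradient g x) = ∑ i, a i * pd i g x := by
  rw [← fderiv_apply_eq_sum, real_inner_comm, gradient, InnerProductSpace.toDual_symm_apply]

lemma lam_zero (σ : ℝ) (x : E3) : lam σ (fun _ => 0) x = 0 := by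
  have := mulC_smul (fun ξ => (2 * π * ‖ξ‖) ^ σ) 0 (fun _ => 0) x
  simp only [zero_smul, Complex.ofReal_zero, zero_mul] at this
  rw [lam, fourierMul_eq_re, show (fun _ : E3 => (0 : ℝ)) = 0 from rfl, this, Complex.zero_re]

lemma inner_lamVec_prod_single (σ : ℝ) (θ : ℝ → ℝ) (g : E3 → ℝ) (i : Fin 3) (w : E3) (z : ℝ × E3) :
    inner ℝ w (lamVec σ (fun z : ℝ × E3 => (θ z.1 * g z.2) • (single i 1 : E3)) z) =
    θ z.1 * (w i * lam σ g z.2) := by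
  have e : lamVec σ (fun z : ℝ × E3 => (θ z.1 * g z.2) • (single i 1)) z =
    (θ z.1 * lam σ g z.2) • (single i 1) := by
    ext j
    simp only [lamVec, PiLp.smul_apply, PiLp.single_apply, smul_eq_mul]
    by_cases hj : j = i
    · subst hj
      simp only [if_true, mul_one]
      change lam σ (θ z.1 • g) z.2 = _
      rw [lam, fourierMul_eq_re, mulC_smul, Complex.re_ofReal_mul]; rfl
    · simp [hj, lam_zero]
  rw [e, inner_smul_single]; ring

lemma spDeriv_prod_single (θ : ℝ → ℝ) (hg : IsTest univ g) (i : Fin 3) (z : ℝ × E3) (a : E3) :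
    spDeriv (fun z : ℝ × E3 => (θ z.1 * g z.2) • (single i 1 : E3)) z a =
    (θ z.1 * fderiv ℝ g z.2 a) • (single i 1 : E3) := by
  rw [spDeriv, (((hg.differentiable z.2).hasFDerivAt.const_mul (θ z.1)).smul_const _).fderiv]; simp

lemma spDiv_prod_single (θ : ℝ → ℝ) (hg : IsTest univ g) (i : Fin 3) (z : ℝ × E3) :
    spDiv (fun z : ℝ × E3 => (θ z.1 * g z.2) • (single i 1 : E3)) z =
    θ z.1 * pd i g z.2 := by
  simp only [spDiv, spDeriv_prod_single θ hg]
  simp [pd]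

lemma dt_prod_single (hθ : IsTest (timeIoo T) θ) (g : E3 → ℝ) (i : Fin 3) (z : ℝ × E3) :
    dt (fun z : ℝ × E3 => (θ z.1 * g z.2) • (single i 1 : E3)) z =
    (deriv θ z.1 * g z.2) • (single i 1 : E3) :=
      ((((hθ.1.differentiable (by simp) z.1).hasDerivAt).mul_const (g z.2)).smul_const _).deriv

lemma inner_spGrad_prod (θ : ℝ → ℝ) (hg : IsTest univ g) (z : ℝ × E3) (a : E3) :
    inner ℝ a (spGrad (fun z : ℝ × E3 => θ z.1 * g z.2) z) =
    θ z.1 * inner ℝ a (gradient g z.2) := by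
  rw [spGrad, real_inner_comm, gradient, InnerProductSpace.toDual_symm_apply,
    ((hg.differentiable z.2).hasFDerivAt.const_mul (θ z.1)).fderiv, real_inner_comm, gradient,
    InnerProductSpace.toDual_symm_apply]
  simp

/-! ### Integrals over time slabs -/

lemma restrict_prod_univ (I : Set ℝ) : (volume.restrict (I ×ˢ univ) : Measure (ℝ × E3)) =
    (volume.restrict I).prod volume := by
  rw [Measure.volume_eq_prod, ← Measure.prod_restrict, Measure.restrict_univ]

lemma measurableSet_timeIoo (T : EReal) : MeasurableSet (timeIoo T) :=
  measurableSet_Ioi.inter (measurable_coe_real_ereal measurableSet_Iio)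

lemma measurableSet_slab (T : EReal) : MeasurableSet (slab T) :=
  (measurableSet_timeIoo T).prod MeasurableSet.univ

lemma setIntegral_slab_mul (ha : 0 ≤ a) (hb : (b : EReal) < T) (hθ : Continuous θ)
    (hθs : Function.support θ ⊆ Ioo a b) (hA : ∀ t, |θ t| ≤ A) {F : ℝ → E3 → ℝ}
    (hF : Integrable (fun z : ℝ × E3 => F z.1 z.2) ((volume.restrict (Ioo a b)).prod volume)) :
    IntegrableOn (fun z : ℝ × E3 => θ z.1 * F z.1 z.2) (slab T) ∧ ∫ z in slab T, θ z.1 * F z.1 z.2 =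
    ∫ t in Ioo a b, θ t * ∫ x, F t x := by
  have h0 : ∀ z ∈ slab T \ Ioo a b ×ˢ univ, θ z.1 * F z.1 z.2 = 0 := by
    rintro z ⟨-, hz⟩
    have : θ z.1 = 0 := by
      by_contra hc
      exact hz ⟨hθs hc, mem_univ _⟩
    rw [this, zero_mul]
  have hi : Integrable (fun z : ℝ × E3 => θ z.1 * F z.1 z.2) ((volume.restrict (Ioo a b)).prod
    volume) := hF.bdd_mul (hθ.comp continuous_fst).aestronglyMeasurable (.of_forall fun z => hA z.1)
  constructor
  · rw [← restrict_prod_univ] at hi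
    exact IntegrableOn.of_forall_sdiff_eq_zero hi (measurableSet_slab T) h0
  · rw [setIntegral_eq_of_subset_of_forall_sdiff_eq_zero (measurableSet_slab T)
      (prod_mono (Ioo_subset_timeIoo ha hb) le_rfl) h0, restrict_prod_univ, integral_prod _ hi]
    simp only [integral_const_mul]

lemma IsTest.exists_abs_le {X : Type*} [NormedAddCommGroup X] [NormedSpace ℝ X] {Ω : Set X}
    {θ : X → ℝ} (hθ : IsTest Ω θ) : ∃ A, ∀ t, |θ t| ≤ A := by
  obtain ⟨C, hC⟩ := hθ.2.1.exists_bound_of_continuous hθ.1.continuous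
  exact ⟨C, hC⟩

lemma ae_integral_eq_zero (ha : 0 ≤ a) (hb : (b : EReal) < T) {F : ℝ → E3 → ℝ}
    (hF : Integrable (fun z : ℝ × E3 => F z.1 z.2) ((volume.restrict (Ioo a b)).prod volume))
    (h : ∀ θ, IsTest (Ioo a b) θ → ∫ z in slab T, θ z.1 * F z.1 z.2 = 0) :
    ∀ᵐ t, t ∈ Ioo a b → ∫ x, F t x = 0 := by
  have hi : IntegrableOn (fun t => ∫ x, F t x) (Ioo a b) := hF.integral_prod_left
  refine isOpen_Ioo.ae_eq_zero_of_integral_contDiff_smul_eq_zero hi.locallyIntegrableOn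
    fun θ h1 h2 h3 => ?_
  have hθ : IsTest (Ioo a b) θ := ⟨h1, h2, h3⟩
  obtain ⟨A, hA⟩ := hθ.exists_abs_le
  have hsub := (subset_tsupport _).trans h3
  have h4 := h θ hθ
  rw [(setIntegral_slab_mul ha hb h1.continuous hsub hA hF).2] at h4
  rw [← h4]
  refine (setIntegral_eq_integral_of_forall_compl_eq_zero fun t ht => ?_).symm
  have : θ t = 0 := by
    by_contra hc
    exact ht (hsub hc)
  rw [this, zero_smul]

/-- A space-time function on `I × ℝ³` that is integrable against the weight. -/
structure IsSlabWeighted (I : Set ℝ) (f : ℝ → E3 → ℝ) : Prop where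
  meas : AEStronglyMeasurable (fun z : ℝ × E3 => f z.1 z.2) ((volume.restrict I).prod volume)
  lt_top : ∫⁻ t in I, ∫⁻ x, wtE x * ‖f t x‖ₑ < ⊤

lemma IsSlabWeighted.mono {J : Set ℝ} {f : ℝ → E3 → ℝ} (h : IsSlabWeighted I f) (hJ : J ⊆ I) :
    IsSlabWeighted J f where
  meas := h.meas.mono_measure (Measure.prod_mono (Measure.restrict_mono hJ le_rfl) le_rfl)
  lt_top := (lintegral_mono_set hJ).trans_lt h.lt_top

lemma IsSlabWeighted.neg {f : ℝ → E3 → ℝ} (h : IsSlabWeighted I f) :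
    IsSlabWeighted I (fun t x => - f t x) where
  meas := h.meas.neg
  lt_top := by simpa only [enorm_neg] using h.lt_top

lemma IsSlabWeighted.ae_slice (hI : MeasurableSet I) {f : ℝ → E3 → ℝ} (h : IsSlabWeighted I f) :
    ∀ᵐ t, t ∈ I → AEStronglyMeasurable (f t) ∧ ∫⁻ x, wtE x * ‖f t x‖ₑ < ⊤ := by
  rw [← ae_restrict_iff' hI]
  filter_upwards [h.meas.prodMk_left,
    ae_lt_top' ((measurable_wtE.comp measurable_snd).aemeasurable.mul
    h.meas.enorm).lintegral_prod_right' h.lt_top.ne] with t ht1 ht2 using ⟨ht1, ht2⟩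

lemma IsSlabWeighted.integrable_prod {L : (E3 → ℝ) → E3 → ℝ} {f : ℝ → E3 → ℝ}
    (hf : IsSlabWeighted I f) (hL : IsTestOp L) {g : E3 → ℝ} (hg : IsTest univ g) :
    Integrable (fun z : ℝ × E3 => f z.1 z.2 * L g z.2) ((volume.restrict I).prod volume) := by
  obtain ⟨C, hC, h⟩ := hL.le_wt hg
  have hm : AEStronglyMeasurable (fun z : ℝ × E3 => f z.1 z.2 * L g z.2) ((volume.restrict I).prod
    volume) := hf.meas.mul ((hL.cont g hg).comp continuous_snd).aestronglyMeasurable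
  refine ⟨hm, ?_⟩
  rw [HasFiniteIntegral, lintegral_prod _ hm.enorm]
  calc _ ≤ ∫⁻ t in I, ofReal C * ∫⁻ x, wtE x * ‖f t x‖ₑ :=
    lintegral_mono fun t => lintegral_mul_le_of_le_wt hC h
    _ = ofReal C * ∫⁻ t in I, ∫⁻ x, wtE x * ‖f t x‖ₑ := lintegral_ofReal_mul _ _
    _ < ⊤ := mul_lt_top ofReal_lt_top hf.lt_top

lemma lintegral_wtE_enorm_le (f : E3 → F) : ∫⁻ x, wtE x * ‖f x‖ₑ ≤ (∫⁻ x, wtE x) +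
    wtEnergy f 0 := by
  rw [wtEnergy, ← lintegral_add_left measurable_wtE]
  refine lintegral_mono fun x => ?_
  rw [sub_zero, ← mul_one_add]
  gcongr
  rcases le_total ‖f x‖ₑ 1 with h | h
  · exact h.trans le_self_add
  · exact (le_self_pow h two_ne_zero).trans le_add_self

lemma MemL22uloc.exists_wtEnergy_le {v : ℝ → E3 → E3} (h : MemL22uloc T' v) :
    ∃ K : ℝ≥0∞, K < ⊤ ∧ ∀ z, ∫⁻ t in Ioo 0 T', wtEnergy (v t) z ≤ K := by
  obtain ⟨C, hC, hb⟩ := lintegral_wtE_mul_le_average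
  have hm := h.1
  rw [restrict_prod_univ] at hm
  set S := ⨆ o, cylNorm T' v o
  refine ⟨C * ((∫⁻ x, wtE x) * S ^ 2), mul_lt_top hC (mul_lt_top
    lintegral_wtE_lt_top (pow_lt_top h.2)), fun z => ?_⟩
  have hm2 := hm.enorm.pow_const 2
  have e1 : ∫⁻ t in Ioo 0 T', wtEnergy (v t) z =
    ∫⁻ x, wtE (x - z) * ∫⁻ t in Ioo 0 T', ‖v t x‖ₑ ^ 2 := by
    simp only [wtEnergy]
    rw [lintegral_lintegral_swap]
    · exact lintegral_congr fun x => lintegral_ofReal_mul _ _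
    · exact ((measurable_wtE.comp (measurable_snd.sub_const z)).aemeasurable).mul hm2
  rw [e1]
  refine (hb _ z hm2.lintegral_prod_left').trans (mul_le_mul_right ?_ _)
  have hmw : Measurable fun x => wtE (x - z) := measurable_wtE.comp (measurable_id.sub_const z)
  rw [← lintegral_wtE_sub z, ← lintegral_mul_const _ hmw]
  refine lintegral_mono fun y => mul_le_mul_right ?_ _
  have e2 : ∫⁻ x in ball y 1, ∫⁻ t in Ioo 0 T', ‖v t x‖ₑ ^ 2 = cylNorm T' v y ^ 2 := by
    rw [cylNorm, eLpNorm_two_sq, Measure.volume_eq_prod, ← Measure.prod_restrict,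
      lintegral_prod_symm]
    exact hm2.mono_measure (Measure.prod_mono le_rfl Measure.restrict_le_self)
  rw [e2]
  gcongr
  exact le_iSup (cylNorm T' v) y

/-! ### Time slices of a local Leray solution -/

/-- Disintegration in time of a weak equation: if a space-time pairing vanishes against all
products `θ(t) g(x)`, then for almost every time the spatial pairing vanishes for all `g`. -/
lemma ae_forall_test_sum {ι : Type*} [Fintype ι] (ha : 0 ≤ a) (hb : (b : EReal) < T)
    {f : ι → ℝ → E3 → ℝ} {L : ι → (E3 → ℝ) → E3 → ℝ} (hf : ∀ l, IsSlabWeighted (Ioo a b) (f l))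
    (hL : ∀ l, IsTestOp (L l)) {p : ℝ → E3 → ℝ} {i : Fin 3}
    (hp : ∀ᵐ t, t ∈ Ioo a b → LocallyIntegrable (p t)) (hpi : ∀ g, IsTest univ g →
    Integrable (fun z : ℝ × E3 => p z.1 z.2 * pd i g z.2) ((volume.restrict (Ioo a b)).prod volume))
    (h : ∀ g, IsTest univ g → ∀ θ, IsTest (Ioo a b) θ → ∫ z in slab T, θ z.1 * (p z.1 z.2 * pd i g
    z.2 + ∑ l, f l z.1 z.2 * L l g z.2) = 0) : ∀ᵐ t, t ∈ Ioo a b → ∀ g, IsTest univ g →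
    (∫ x, p t x * pd i g x) + ∑ l, ∫ x, f l t x * L l g x = 0 := by
  have hsl := ae_all_iff.2 fun l => (hf l).ae_slice measurableSet_Ioo
  refine ae_forall_test (fun t g => (∫ x, p t x * pd i g x) + ∑ l, ∫ x, f l t x * L l g x) ?_ ?_
  · intro g hg
    filter_upwards [ae_integral_eq_zero ha hb (F := fun t x => p t x * pd i g x + ∑ l, f l t x *
      L l g x) ((hpi g hg).add (integrable_finsetSum _ fun l _ => (hf l).integrable_prod (hL l) hg))
      (h g hg), (ae_restrict_iff' measurableSet_Ioo).1 (hpi g hg).prod_right_ae, hsl] with t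
      ht2 ht3 ht4 htI
    rw [← ht2 htI, integral_add (ht3 htI)
      (integrable_finsetSum _ fun l _ => (hL l).integrable_mul (ht4 l htI).1 (ht4 l htI).2 hg),
      integral_finsetSum _ fun l _ => (hL l).integrable_mul (ht4 l htI).1 (ht4 l htI).2 hg]
  · filter_upwards [hp, hsl] with t ht1 ht2 htI using (isTestFunctional_pd (ht1 htI) i).add
      (IsTestFunctional.sum _ fun l => (hL l).isTestFunctional (ht2 l htI).1 (ht2 l htI).2)

lemma locallyIntegrable_zero_fun : LocallyIntegrable (fun _ : E3 => (0 : ℝ)) :=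
  (continuous_const).locallyIntegrable

section

variable {u v : ℝ → E3 → E3}

lemma MemLinftyL2uloc.exists_bound (h : MemLinftyL2uloc T' u) :
    ∃ M : ℝ≥0∞, M < ⊤ ∧ ∀ᵐ t, t ∈ Ioo 0 T' → AEStronglyMeasurable (u t) ∧ ulocNorm (u t) ≤ M := by
  obtain ⟨M, hM⟩ := h.2
  refine ⟨M, ENNReal.coe_lt_top, ?_⟩
  filter_upwards [hM] with t ht htI using ⟨(ht htI).1.1, (ht htI).2⟩

lemma MemLinftyL2uloc.lintegral_wtEnergy_lt_top (h : MemLinftyL2uloc T' u) :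
    ∫⁻ t in Ioo 0 T', wtEnergy (u t) 0 < ⊤ := by
  obtain ⟨M, hM, hb⟩ := h.exists_bound
  obtain ⟨C, hC, hw⟩ := exists_wtEnergy_le_ulocNorm
  calc _ ≤ ∫⁻ t in Ioo 0 T', C * M ^ 2 := by
        refine lintegral_mono_ae ((ae_restrict_iff' measurableSet_Ioo).2 ?_)
        filter_upwards [hb] with t ht htI
        refine (hw (u t) 0 (ht htI).1).trans ?_
        gcongr
        exact (ht htI).2
    _ < ⊤ := by
      rw [setLIntegral_const]
      exact mul_lt_top (mul_lt_top hC (pow_lt_top hM)) (by simp)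

lemma isSlabWeighted_apply (hm : AEStronglyMeasurable (fun z : ℝ × E3 => w z.1 z.2) (volume.restrict
    (Ioo 0 T' ×ˢ univ))) (hw : ∫⁻ t in Ioo 0 T', wtEnergy (w t) 0 < ⊤) (i : Fin 3) : IsSlabWeighted
    (Ioo 0 T') fun t x => w t x i := by
  rw [restrict_prod_univ] at hm
  refine ⟨aestronglyMeasurable_apply hm i, ?_⟩
  calc ∫⁻ t in Ioo 0 T', ∫⁻ x, wtE x * ‖w t x i‖ₑ
    ≤ ∫⁻ t in Ioo 0 T', ((∫⁻ x, wtE x) + wtEnergy (w t) 0) := lintegral_mono fun t =>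
      (lintegral_wtE_enorm_le _).trans (add_le_add le_rfl (wtEnergy_apply_le _ _ _))
    _ < ⊤ := by
      rw [lintegral_add_left measurable_const, setLIntegral_const]
      exact add_lt_top.2 ⟨mul_lt_top lintegral_wtE_lt_top (by simp), hw⟩

lemma isSlabWeighted_apply_mul (hm : AEStronglyMeasurable (fun z : ℝ × E3 => w z.1 z.2)
    (volume.restrict (Ioo 0 T' ×ˢ univ))) (hw : ∫⁻ t in Ioo 0 T', wtEnergy (w t) 0 < ⊤) (j k :
    Fin 3) : IsSlabWeighted (Ioo 0 T') fun t x => w t x j * w t x k := by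
  rw [restrict_prod_univ] at hm
  exact ⟨(aestronglyMeasurable_apply hm j).mul (aestronglyMeasurable_apply hm k),
    (lintegral_mono fun t => by simpa using lintegral_wtE_apply_mul_le (w t) j k 0).trans_lt hw⟩

lemma IsLocalLerayWith.integrable_pressure (h : IsLocalLerayWith s T u₀ u v P)
    (hT' : (T' : EReal) < T) (ha : 0 < a) (R : ℝ) :
    Integrable (fun z : ℝ × E3 => P z.1 z.2)
    ((volume.restrict (Ioo a T')).prod (volume.restrict (closedBall 0 R))) := by
  rw [Measure.prod_restrict, ← Measure.volume_eq_prod]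
  exact (h.locInt_pressure.integrableOn_compact_subset (fun z hz =>
    ⟨⟨ha.trans_le hz.1.1, (EReal.coe_le_coe_iff.2 hz.1.2).trans_lt hT'⟩, mem_univ _⟩)
    (isCompact_Icc.prod (isCompact_closedBall _ _))).mono_set (prod_mono Ioo_subset_Icc_self le_rfl)

lemma IsLocalLerayWith.ae_locallyIntegrable_pressure (h : IsLocalLerayWith s T u₀ u v P)
    (hT' : (T' : EReal) < T) (ha : 0 < a) : ∀ᵐ t, t ∈ Ioo a T' → LocallyIntegrable (P t) := by
  have h1 : ∀ᵐ t, ∀ n : ℕ, t ∈ Ioo a T' → IntegrableOn (P t) (closedBall 0 n) := ae_all_iff.2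
    fun n => (ae_restrict_iff' measurableSet_Ioo).1 (h.integrable_pressure hT' ha n).prod_right_ae
  filter_upwards [h1] with t ht htI
  rw [locallyIntegrable_iff]
  intro K hK
  obtain ⟨R, hR⟩ := hK.isBounded.subset_closedBall 0
  obtain ⟨n, hn⟩ := exists_nat_ge R
  exact (ht n htI).mono_set (hR.trans (closedBall_subset_closedBall hn))

lemma IsLocalLerayWith.integrable_pressure_mul (h : IsLocalLerayWith s T u₀ u v P)
    (hT' : (T' : EReal) < T) (ha : 0 < a) (hg : IsTest univ g) :
    Integrable (fun z : ℝ × E3 => P z.1 z.2 * g z.2)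
    ((volume.restrict (Ioo a T')).prod volume) := by
  obtain ⟨R, hR, hs⟩ := hg.exists_radius
  obtain ⟨A, hA⟩ := hg.exists_abs_le
  have h1 := (h.integrable_pressure hT' ha R).mul_bdd
    (hg.1.continuous.comp continuous_snd).aestronglyMeasurable (.of_forall fun z => hA z.2)
  rw [← Measure.restrict_univ (μ := (volume : Measure E3)), Measure.prod_restrict]
  rw [Measure.prod_restrict] at h1
  refine IntegrableOn.of_forall_sdiff_eq_zero h1 (measurableSet_Ioo.prod MeasurableSet.univ) ?_
  rintro z ⟨hz1, hz2⟩
  have : g z.2 = 0 := by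
    by_contra hc
    exact hz2 ⟨hz1.1, by simpa using hs _ hc⟩
  rw [this, mul_zero]

/-- Almost every time slice of a local Leray solution is a slice in the static sense. -/
lemma IsLocalLerayWith.ae_isSlice (h : IsLocalLerayWith s T u₀ u v P) (hs0 : 3 / 4 ≤ s)
    (hs1 : s < 1) (hT'0 : 0 < T') (hT' : (T' : EReal) < T) :
    ∃ M : ℝ≥0∞, M < ⊤ ∧ ∀ᵐ t, t ∈ Ioo 0 T' → IsSlice s M (u t) (v t) (P t) := by
  have hu := h.bounded T' hT'0 hT'
  have hv := h.lam_bounded T' hT'0 hT'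
  obtain ⟨M, hM, hMb⟩ := hu.exists_bound
  obtain ⟨K, hK, hKb⟩ := hv.exists_wtEnergy_le
  have huw := hu.lintegral_wtEnergy_lt_top
  have hvw := (hKb 0).trans_lt hK
  have hui := isSlabWeighted_apply hu.1 huw
  have hvi := isSlabWeighted_apply hv.1 hvw
  have huu := isSlabWeighted_apply_mul hu.1 huw
  have hl1 := isTestOp_lam hs0 (by linarith)
  have e1 : ∀ᵐ t, ∀ i, t ∈ Ioo 0 T' → ∀ g, IsTest univ g →
      ∫ x, v t x i * g x = ∫ x, u t x i * lam s g x := by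
    refine ae_all_iff.2 fun i => ?_
    have key := ae_forall_test_sum le_rfl hT'
      (f := ![fun t x => v t x i, fun t x => - u t x i]) (L := ![fun g => g, lam s])
      (by rw [Fin.forall_fin_two]; exact ⟨hvi i, (hui i).neg⟩)
      (by rw [Fin.forall_fin_two]; exact ⟨isTestOp_id, hl1⟩) (i := 0) (.of_forall fun _ _ =>
        locallyIntegrable_zero_fun)
      (fun g hg => by simp) (fun g hg θ hθ => ?_)
    · filter_upwards [key] with t ht htI g hg
      have := ht htI g hg
      simp only [zero_mul, integral_zero, Fin.sum_univ_two, Matrix.cons_val_zero,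
        Matrix.cons_val_one, zero_add, neg_mul, integral_neg] at this
      linarith
    · obtain ⟨A, hA⟩ := hθ.exists_abs_le
      have h1 := h.isLam.2 _ (isTest_prod_single (hθ.mono (Ioo_subset_timeIoo le_rfl hT')) hg i)
      simp only [inner_smul_single, inner_lamVec_prod_single] at h1
      have h2 := (setIntegral_slab_mul le_rfl hT' hθ.1.continuous ((subset_tsupport _).trans hθ.2.2)
        hA (F := fun t x => v t x i * g x) ((hvi i).integrable_prod isTestOp_id hg)).1
      have h3 := (setIntegral_slab_mul le_rfl hT' hθ.1.continuous ((subset_tsupport _).trans hθ.2.2)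
        hA (F := fun t x => u t x i * lam s g x) ((hui i).integrable_prod hl1 hg)).1
      simp only [Fin.sum_univ_two, Matrix.cons_val_zero, Matrix.cons_val_one, zero_mul, zero_add,
        neg_mul]
      calc _ = (∫ z in slab T, θ z.1 * (v z.1 z.2 i * g z.2)) -
            ∫ z in slab T, θ z.1 * (u z.1 z.2 i * lam s g z.2) := by
            rw [← integral_sub h2 h3]
            congr 1; ext z; ring
        _ = 0 := by
          rw [← h1, sub_eq_zero]
          congr 1; ext z; ring
  have e2 : ∀ᵐ t, t ∈ Ioo 0 T' → ∀ g : E3 → ℝ, IsTest univ g →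
    ∑ i, ∫ x, u t x i * pd i g x = 0 := by
    have key := ae_forall_test_sum le_rfl hT' hui isTestOp_pd (i := 0) (.of_forall fun _ _ =>
      locallyIntegrable_zero_fun) (fun g hg => by simp) (fun g hg θ hθ => ?_)
    · filter_upwards [key] with t ht htI g hg
      simpa using ht htI g hg
    · have h1 := h.solenoidal _ (isTest_prod (hθ.mono (Ioo_subset_timeIoo le_rfl hT')) hg)
      simp only [inner_spGrad_prod θ hg, inner_gradient_eq_sum] at h1
      simpa using h1
  have e3 : ∀ᵐ t, ∀ i, ∀ n : ℕ, t ∈ Ioo (1 / ((n : ℝ) + 1)) T' → LocallyIntegrable (P t) ∧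
    ∀ g : E3 → ℝ, IsTest univ g → (∫ x, P t x * pd i g x) +
      ∑ l : Fin 3 × Fin 3, ∫ x, u t x l.1 * u t x l.2 * rieszPair l.1 l.2 (pd i g) x = 0 := by
    refine ae_all_iff.2 fun i => ae_all_iff.2 fun n => ?_
    have ha : 0 < 1 / ((n : ℝ) + 1) := by positivity
    have hsub : Ioo (1 / ((n : ℝ) + 1)) T' ⊆ Ioo 0 T' := Ioo_subset_Ioo_left ha.le
    have hloc := h.ae_locallyIntegrable_pressure hT' ha
    have key := ae_forall_test_sum (ι := Fin 3 × Fin 3) ha.le hT'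
      (fun l => (huu l.1 l.2).mono hsub) (fun l => isTestOp_rieszPair_pd l.1 l.2 i) hloc
      (fun g hg => h.integrable_pressure_mul hT' ha (hg.pd i)) (fun g hg θ hθ => ?_)
    · filter_upwards [key, hloc] with t ht ht' htI using ⟨ht' htI, ht htI⟩
    · obtain ⟨A, hA⟩ := hθ.exists_abs_le
      have h1 := h.pressure _ (isTest_prod_single (hθ.mono (Ioo_subset_timeIoo ha.le hT')) hg i)
      have er : ∀ (j k : Fin 3) (z : ℝ × E3), rieszPair j k (fun y => θ z.1 * pd i g y) z.2 =
        θ z.1 * rieszPair j k (pd i g) z.2 := fun j k z => rieszPair_smul j k _ _ _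
      simp only [spDiv_prod_single θ hg, er] at h1
      have hs := (subset_tsupport θ).trans hθ.2.2
      have h2 := (setIntegral_slab_mul ha.le hT' hθ.1.continuous hs hA
        (F := fun t x => P t x * pd i g x) (h.integrable_pressure_mul hT' ha (hg.pd i))).1
      have h3 := (setIntegral_slab_mul ha.le hT' hθ.1.continuous hs hA (F := fun t x => ∑ l : Fin 3
        × Fin 3, u t x l.1 * u t x l.2 * rieszPair l.1 l.2 (pd i g) x) (integrable_finsetSum _ fun l
        _ => ((huu l.1 l.2).mono hsub).integrable_prod (isTestOp_rieszPair_pd l.1 l.2 i) hg)).1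
      simp only [mul_add]
      rw [integral_add h2 h3, add_eq_zero_iff_eq_neg]
      calc _ = ∫ z in slab T, P z.1 z.2 * (θ z.1 * pd i g z.2) := by congr 1; ext z; ring
        _ = _ := h1.trans (by
          congr 2; ext z
          rw [Fintype.sum_prod_type, Finset.mul_sum]
          refine Finset.sum_congr rfl fun j _ => ?_
          rw [Finset.mul_sum]
          exact Finset.sum_congr rfl fun k _ => by ring)
  have hsl := ae_all_iff.2 fun i => (hui i).ae_slice measurableSet_Ioo
  have hsl2 : ∀ᵐ t, ∀ l : Fin 3 × Fin 3, t ∈ Ioo 0 T' → AEStronglyMeasurable (fun x => u t x l.1 *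
    u t x l.2) ∧ ∫⁻ x, wtE x * ‖u t x l.1 * u t x l.2‖ₑ < ⊤ := ae_all_iff.2 fun l =>
    (huu l.1 l.2).ae_slice measurableSet_Ioo
  have hvm := hv.1
  rw [restrict_prod_univ] at hvm
  have hv1 := (ae_restrict_iff' measurableSet_Ioo).1 hvm.prodMk_left
  have hv2 : ∀ᵐ t, t ∈ Ioo 0 T' → wtEnergy (v t) 0 < ⊤ := (ae_restrict_iff' measurableSet_Ioo).1
    (ae_lt_top' ((measurable_wtE.comp (measurable_snd.sub_const 0)).aemeasurable.mul
    (hvm.enorm.pow_const 2)).lintegral_prod_right' hvw.ne)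
  refine ⟨M, hM, ?_⟩
  filter_upwards [hMb, hv1, hv2, e1, e2, e3, hsl, hsl2] with t t1 t2 t3 t4 t5 t6 t7 t8 htI
  have hex : ∃ n : ℕ, t ∈ Ioo (1 / ((n : ℝ) + 1)) T' := by
    obtain ⟨n, hn⟩ := exists_nat_one_div_lt htI.1
    exact ⟨n, hn, htI.2⟩
  obtain ⟨n, hn⟩ := hex
  refine ⟨(t1 htI).1, t2 htI, (t1 htI).2, t3 htI, fun g hg i => t4 i htI g hg, fun g hg => ?_,
    (t6 0 n hn).1, fun g hg i => ?_⟩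
  · simp only [inner_gradient_eq_sum]
    rw [integral_finsetSum _ fun i _ => (isTestOp_pd i).integrable_mul (t7 i htI).1 (t7 i htI).2 hg]
    exact t5 htI g hg
  · rw [eq_neg_of_add_eq_zero_left ((t6 i n hn).2 g hg), Fintype.sum_prod_type]
    have hint :=
      fun j k => (isTestOp_rieszPair_pd j k i).integrable_mul (t8 (j, k) htI).1 (t8 (j, k) htI).2 hg
    rw [integral_finsetSum _ fun j _ => integrable_finsetSum _ fun k _ => hint j k]
    congr 1
    exact Finset.sum_congr rfl fun j _ => (integral_finsetSum _ fun k _ => hint j k).symm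

end

/-! ### The commutator terms of the local energy inequality -/

lemma commKernelOn_comm (σ : ℝ) (z : E3) (R : ℝ) (x y : E3) :
    commKernelOn σ z R x y = commKernelOn σ z R y x := by
  by_cases h : x ∈ closedBall z R ∨ y ∈ closedBall z R
  · rw [commKernelOn_of_mem h, commKernelOn_of_mem h.symm, commKernelE, commKernelE,
      ← commKernel_neg, neg_sub]
  · rw [commKernelOn_of_notMem (fun hx => h (Or.inl hx)) (fun hy => h (Or.inr hy)),
      commKernelOn_of_notMem (fun hy => h (Or.inr hy)) (fun hx => h (Or.inl hx))]

lemma exists_lamComm_bound (h0 : 3 / 4 ≤ s) (h1 : s < 1) (hr : 0 < r) :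
    ∃ C : ℝ≥0∞, C < ⊤ ∧ ∀ (w : E3 → E3) (o : E3), AEStronglyMeasurable w →
    ∫⁻ x, ‖lamComm s (ballBump r o) w x‖ₑ ^ 2 ≤ C * wtEnergy w o := by
  obtain ⟨L, hL, hLip⟩ := exists_ballBump_bddLip hr
  obtain ⟨C, hC, hb⟩ := exists_comm_bound h0 h1 (2 * r)
  set A := ‖lamConst s‖ₑ * ofReal (1 * L) with hA
  have hAt : A < ⊤ := mul_lt_top enorm_lt_top ofReal_lt_top
  refine ⟨A ^ 2 * C, mul_lt_top (pow_lt_top hAt) hC, fun w o hw => ?_⟩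
  have hpt : ∀ x, ‖lamComm s (ballBump r o) w x‖ₑ ≤
    A * ∫⁻ y, commKernelOn s o (2 * r) y x * ‖w y‖ₑ := fun x => by
    rw [lamComm, enorm_smul, hA, mul_assoc]
    refine mul_le_mul_right ((enorm_integral_le_lintegral_enorm _).trans ?_) _
    rw [← lintegral_ofReal_mul]
    refine lintegral_mono fun y => ?_
    rw [enorm_smul, ← mul_assoc]
    gcongr
    have := enorm_kernel_mul_le (κ := fun z => ‖z‖ ^ (-s - 3)) zero_le_one
      (fun z _ => by rw [one_mul, abs_of_nonneg (by positivity)]) hL (hLip o)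
      (fun x hx => norm_le_of_ballBump_ne_zero hr hx) x y
    rw [commKernelOn_comm s o (2 * r) y x]
    refine le_trans (le_of_eq ?_) this
    congr 1
    rw [show -s - 3 = -(3 + s) by ring, rpow_neg (norm_nonneg _)]
    ring
  calc _ ≤ ∫⁻ x, A ^ 2 * (∫⁻ y, commKernelOn s o (2 * r) y x * ‖w y‖ₑ) ^ 2 := by
        refine lintegral_mono fun x => ?_
        rw [← mul_pow]
        gcongr
        exact hpt x
    _ = A ^ 2 * ∫⁻ x, (∫⁻ y, commKernelOn s o (2 * r) y x * ‖w y‖ₑ) ^ 2 :=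
      lintegral_const_mul' _ _ (pow_lt_top hAt).ne
    _ ≤ A ^ 2 * (C * wtEnergy w o) := mul_le_mul_right (hb _ o hw.enorm) _
    _ = _ := by rw [mul_assoc]

lemma ennreal_mul_le_add_sq (h0 : ε ≠ 0) (ht : ε ≠ ⊤) (a b : ℝ≥0∞) :
    a * b ≤ ε * a ^ 2 + ε⁻¹ * b ^ 2 := by
  rcases le_total (ε * a) b with h | h
  · refine le_trans ?_ le_add_self
    calc _ = ε⁻¹ * (ε * a * b) := by
          rw [mul_assoc, ← mul_assoc, ENNReal.inv_mul_cancel h0 ht, one_mul]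
      _ ≤ ε⁻¹ * (b * b) := by gcongr
      _ = _ := by rw [sq]
  · refine le_trans ?_ le_self_add
    calc _ ≤ a * (ε * a) := by gcongr
      _ = _ := by ring

lemma lintegral_inner_smul_le (h0 : ε ≠ 0) (ht : ε ≠ ⊤) (hr : 0 < r) (o : E3) (f w : E3 → E3)
    (hw : AEStronglyMeasurable w) : ∫⁻ x, ‖inner ℝ (f x) (ballBump r o x • w x)‖ₑ ≤
    ε * (∫⁻ x, ‖f x‖ₑ ^ 2) + ε⁻¹ * (ofReal ((1 + 2 * r) ^ (15 / 4 : ℝ)) * wtEnergy w o) := by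
  calc _ ≤ ∫⁻ x, (ε * ‖f x‖ₑ ^ 2 +
        ε⁻¹ * (closedBall o (2 * r)).indicator (fun x => ‖w x‖ₑ ^ 2) x) := by
        refine lintegral_mono fun x => ?_
        have h1 : ‖inner ℝ (f x) (ballBump r o x • w x)‖ₑ ≤ ‖f x‖ₑ * ‖ballBump r o x • w x‖ₑ := by
          simp only [← ofReal_norm]
          rw [← ofReal_mul (norm_nonneg _)]
          exact ofReal_le_ofReal (norm_inner_le_norm _ _)
        refine (h1.trans (ennreal_mul_le_add_sq h0 ht _ _)).trans ?_
        gcongr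
        by_cases hx : x ∈ closedBall o (2 * r)
        · rw [indicator_of_mem hx, enorm_smul]
          gcongr
          refine mul_le_of_le_one_left' ?_
          rw [← ofReal_norm, ← ofReal_one]
          refine ofReal_le_ofReal ?_
          rw [norm_of_nonneg (ballBump_nonneg _ _ _)]
          exact ballBump_le_one _ _ _
        · have : ballBump r o x = 0 := by
            by_contra hc
            exact hx (by simpa [dist_eq_norm] using norm_le_of_ballBump_ne_zero hr hc)
          simp [this]
    _ = ε * (∫⁻ x, ‖f x‖ₑ ^ 2) + ε⁻¹ * ∫⁻ x in closedBall o (2 * r), ‖w x‖ₑ ^ 2 := by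
      rw [lintegral_add_right' _
        (((hw.enorm.pow_const 2).indicator measurableSet_closedBall).const_mul _),
        lintegral_const_mul' _ _ ht, lintegral_const_mul' _ _ (ENNReal.inv_ne_top.2 h0),
        lintegral_indicator measurableSet_closedBall]
    _ ≤ _ := by
      gcongr
      exact setLIntegral_closedBall_le_wtEnergy w o (2 * r)

lemma exists_mul_le {A η : ℝ≥0∞} (hA : A < ⊤) (h0 : 0 < η) (ht : η < ⊤) :
    ∃ ε : ℝ≥0∞, ε ≠ 0 ∧ ε ≠ ⊤ ∧ ε * A ≤ η := by
  refine ⟨η / (A + 1), (ENNReal.div_pos h0.ne' (by finiteness)).ne',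
    (div_lt_top ht.ne (by simp)).ne, ?_⟩
  calc _ ≤ η / (A + 1) * (A + 1) := mul_le_mul_right le_self_add _
    _ = η := ENNReal.div_mul_cancel (by simp) (by finiteness)

/-- Both commutator terms are small multiples of the dissipation, up to lower order terms. -/
lemma exists_commutator_terms_bound (h0 : 3 / 4 ≤ s) (h1 : s < 1) (hρ : 0 < ρ) {η : ℝ≥0∞}
    (hη : 0 < η) (hηt : η < ⊤) :
    ∃ C : ℝ≥0∞, C < ⊤ ∧ ∀ (u v : E3 → E3) (o : E3), AEStronglyMeasurable u →
    AEStronglyMeasurable v → (∫⁻ x, ‖inner ℝ (lamComm s (ballBump (2 * ρ) o) v x) (ballBump ρ o x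
    • u x)‖ₑ) + (∫⁻ x, ‖inner ℝ (lamComm s (ballBump ρ o) u x) (ballBump (2 * ρ) o x • v x)‖ₑ) ≤
    η * wtEnergy v o + C * wtEnergy u o := by
  obtain ⟨A, hA, hAb⟩ := exists_lamComm_bound h0 h1 (r := 2 * ρ) (by positivity)
  obtain ⟨B, hB, hBb⟩ := exists_lamComm_bound h0 h1 hρ
  set D := ofReal ((1 + 2 * ρ) ^ (15 / 4 : ℝ))
  set E := ofReal ((1 + 2 * (2 * ρ)) ^ (15 / 4 : ℝ))
  obtain ⟨ε, hε0, hεt, hε⟩ := exists_mul_le hA (half_pos hη.ne')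
    (ENNReal.half_le_self.trans_lt hηt)
  obtain ⟨δ, hδ0, hδt, hδ⟩ := exists_mul_le ofReal_lt_top
    (half_pos hη.ne') (ENNReal.half_le_self.trans_lt hηt)
  refine ⟨ε⁻¹ * D + δ⁻¹ * B, add_lt_top.2 ⟨mul_lt_top (inv_lt_top.2 (pos_iff_ne_zero.2 hε0))
    ofReal_lt_top, mul_lt_top (inv_lt_top.2 (pos_iff_ne_zero.2 hδ0)) hB⟩, fun u v o hu hv => ?_⟩
  have t1 := lintegral_inner_smul_le hε0 hεt hρ o (lamComm s (ballBump (2 * ρ) o) v) u hu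
  have t2 := lintegral_inner_smul_le (ENNReal.inv_ne_zero.2 hδt) (ENNReal.inv_ne_top.2 hδ0)
    (r := 2 * ρ) (by positivity) o (lamComm s (ballBump ρ o) u) v hv
  rw [inv_inv] at t2
  calc _ ≤ (ε * (A * wtEnergy v o) + ε⁻¹ * (D * wtEnergy u o)) +
        (δ⁻¹ * (B * wtEnergy u o) + δ * (E * wtEnergy v o)) :=
        add_le_add (t1.trans (add_le_add (mul_le_mul_right (hAb v o hv) _) le_rfl))
          (t2.trans (add_le_add (mul_le_mul_right (hBb u o hu) _) le_rfl))
    _ = (ε * A + δ * E) * wtEnergy v o + (ε⁻¹ * D + δ⁻¹ * B) * wtEnergy u o := by ring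
    _ ≤ _ := by
      gcongr
      exact (add_le_add hε hδ).trans (add_halves η).le

/-- The right-hand side of the local energy inequality on a time slice: the critical terms carry
the small factor `1 / ρ`, and the commutator terms the small factor `η`. -/
lemma exists_energy_rhs_bound (h0 : 3 / 4 ≤ s) (h1 : s < 1) : ∃ C0 : ℝ, 0 < C0 ∧ ∀ ρ, 2 ≤ ρ →
    ∀ M : ℝ≥0∞, M < ⊤ → ∀ η : ℝ≥0∞, 0 < η → η < ⊤ → ∃ C1 : ℝ≥0∞, C1 < ⊤ ∧
    ∀ (u v : E3 → E3) (p : E3 → ℝ), IsSlice s M u v p → ∀ o : E3, 2 * ‖∫ x, inner ℝ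
    (-(lamComm s (ballBump (2 * ρ) o) v x)) (ballBump ρ o x • u x)‖ₑ +
    2 * ‖∫ x, inner ℝ (lamComm s (ballBump ρ o) u x) (ballBump (2 * ρ) o x • v x)‖ₑ +
    ‖∫ x, ‖u x‖ ^ 2 * flux ρ o u x‖ₑ + 2 * ‖∫ x, p x * flux ρ o u x‖ₑ ≤
    ofReal (C0 / ρ) * M * (∫⁻ x in closedBall o (7 * ρ), ‖v x‖ₑ ^ 2) + η * wtEnergy v o +
    C1 * wtEnergy u o := by
  obtain ⟨A, hA, hAb⟩ := exists_cubic_bound h0 h1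
  obtain ⟨B, hB, hBb⟩ := exists_pressure_bound h0 h1
  refine ⟨A + 2 * B, by positivity, fun ρ hρ M hM η hη hηt => ?_⟩
  obtain ⟨a, ha, hab⟩ := hAb ρ hρ M hM
  obtain ⟨b, hb, hbb⟩ := hBb ρ hρ M hM
  obtain ⟨c, hc, hcb⟩ := exists_commutator_terms_bound h0 h1 (by linarith)
    (half_pos hη.ne') (ENNReal.half_le_self.trans_lt hηt)
  refine ⟨2 * c + a + 2 * b, by finiteness, fun u v p h o => ?_⟩
  have t2 : ‖∫ x, ‖u x‖ ^ 2 * flux ρ o u x‖ₑ ≤ ∫⁻ x, ‖u x‖ₑ ^ 2 * ‖flux ρ o u x‖ₑ :=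
    (enorm_integral_le_lintegral_enorm _).trans (le_of_eq (lintegral_congr fun x =>
    by rw [enorm_mul, enorm_pow, enorm_norm]))
  have t3 : ‖∫ x, inner ℝ (-(lamComm s (ballBump (2 * ρ) o) v x)) (ballBump ρ o x • u x)‖ₑ ≤
    ∫⁻ x, ‖inner ℝ (lamComm s (ballBump (2 * ρ) o) v x) (ballBump ρ o x • u x)‖ₑ := by
    exact (enorm_integral_le_lintegral_enorm _).trans (le_of_eq (lintegral_congr fun x =>
      by rw [inner_neg_left, enorm_neg]))
  set V := ∫⁻ x in closedBall o (7 * ρ), ‖v x‖ₑ ^ 2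
  have e : ofReal ((A + 2 * B) / ρ) =
    ofReal (A / ρ) + 2 * ofReal (B / ρ) := by
    rw [add_div, mul_div_assoc, ofReal_add (by positivity) (by positivity),
      ofReal_mul zero_le_two, ofReal_ofNat]
  calc _ ≤ 2 * (η / 2 * wtEnergy v o + c * wtEnergy u o) +
        (ofReal (A / ρ) * M * V + a * wtEnergy u o) +
        2 * (ofReal (B / ρ) * M * V + b * wtEnergy u o) := by
        rw [← mul_add]
        exact add_le_add (add_le_add
          (mul_le_mul_right ((add_le_add t3 (enorm_integral_le_lintegral_enorm
          fun x => inner ℝ (lamComm s (ballBump ρ o) u x) (ballBump (2 * ρ) o x • v x))).trans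
          (hcb u v o h.meas_u h.meas_v)) _)
          (t2.trans (hab u v p h o))) (mul_le_mul_right (hbb u v p h o) _)
    _ = ofReal ((A + 2 * B) / ρ) * M * V + (2 * (η / 2)) * wtEnergy v o +
      (2 * c + a + 2 * b) * wtEnergy u o := by rw [e]; ring
    _ = _ := by rw [ENNReal.mul_div_cancel two_ne_zero ofNat_ne_top]

/-! ### The local energy inequality on time slices -/

/-- The energy of a field, localized to the ball `B_ρ(o)` with a smooth cutoff. -/
noncomputable def cutEnergy (ρ : ℝ) (o : E3) (f : E3 → E3) : ℝ :=
  ∫ x, ballBump ρ o x * ‖f x‖ ^ 2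

/-- The bound for the right-hand side of the local energy inequality on a time slice. -/
noncomputable def rhsBound (C0 ρ : ℝ) (M η C1 : ℝ≥0∞) (o : E3) (u v : E3 → E3) : ℝ≥0∞ :=
  ofReal (C0 / ρ) * M * (∫⁻ x in closedBall o (7 * ρ), ‖v x‖ₑ ^ 2) +
    η * wtEnergy v o + C1 * wtEnergy u o

lemma enorm_setIntegral_slab_le (ha : 0 ≤ a) (hb : (b : EReal) < T)
    (hθs : Function.support θ ⊆ Ioo a b) (F : ℝ → E3 → ℝ) : ‖∫ z in slab T, θ z.1 * F z.1 z.2‖ₑ ≤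
    ∫⁻ t in Ioo a b, ‖θ t‖ₑ * ‖∫ x, F t x‖ₑ := by
  have h0 : ∀ z ∈ slab T \ Ioo a b ×ˢ univ, θ z.1 * F z.1 z.2 = 0 := by
    rintro z ⟨-, hz⟩
    have : θ z.1 = 0 := by
      by_contra hc
      exact hz ⟨hθs hc, mem_univ _⟩
    rw [this, zero_mul]
  rw [setIntegral_eq_of_subset_of_forall_sdiff_eq_zero (measurableSet_slab T)
    (prod_mono (Ioo_subset_timeIoo ha hb) le_rfl) h0, restrict_prod_univ]
  by_cases hi : Integrable (fun z : ℝ × E3 => θ z.1 * F z.1 z.2)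
    ((volume.restrict (Ioo a b)).prod volume)
  · rw [integral_prod _ hi]
    simp only [integral_const_mul]
    exact (enorm_integral_le_lintegral_enorm _).trans (le_of_eq (lintegral_congr fun t =>
      by rw [enorm_mul]))
  · rw [integral_undef hi, enorm_zero]
    exact zero_le

lemma enorm_ballBump_le (hρ : 0 < ρ) (o x : E3) :
    ‖ballBump ρ o x‖ₑ ≤ ofReal ((1 + 2 * ρ) ^ (15 / 4 : ℝ)) * wtE (x - o) := by
  by_cases hx : ballBump ρ o x = 0
  · simp [hx]
  · refine le_trans ?_ (one_le_mul_wtE (norm_le_of_ballBump_ne_zero hρ hx))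
    rw [← ofReal_norm, ← ofReal_one, norm_of_nonneg (ballBump_nonneg _ _ _)]
    exact ofReal_le_ofReal (ballBump_le_one _ _ _)

lemma continuous_ballBump (hρ : 0 < ρ) (o : E3) : Continuous (ballBump ρ o) :=
  (ballBump_isTest hρ o).1.continuous

lemma integrable_cut (hρ : 0 < ρ) (hf : AEStronglyMeasurable f) (hw : wtEnergy f o < ⊤) :
    Integrable fun x => ballBump ρ o x * ‖f x‖ ^ 2 := by
  refine ⟨(continuous_ballBump hρ o).aestronglyMeasurable.mul (hf.norm.pow 2), ?_⟩
  calc _ ≤ ∫⁻ x, ofReal ((1 + 2 * ρ) ^ (15 / 4 : ℝ)) * (wtE (x - o) * ‖f x‖ₑ ^ 2) := by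
        refine lintegral_mono fun x => ?_
        rw [enorm_mul, enorm_pow, enorm_norm, ← mul_assoc]
        gcongr
        exact enorm_ballBump_le hρ o x
    _ = ofReal ((1 + 2 * ρ) ^ (15 / 4 : ℝ)) * wtEnergy f o := lintegral_ofReal_mul _ _
    _ < ⊤ := mul_lt_top ofReal_lt_top hw

section

variable {u v : ℝ → E3 → E3}

lemma aemeasurable_wtEnergy (hm : AEStronglyMeasurable (fun z : ℝ × E3 => w z.1 z.2)
    ((volume.restrict I).prod volume)) (z : E3) : AEMeasurable (fun t => wtEnergy (w t) z)
    (volume.restrict I) := ((measurable_wtE.comp (measurable_snd.sub_const z)).aemeasurable.mul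
      (hm.enorm.pow_const 2)).lintegral_prod_right'

lemma aemeasurable_setLIntegral_sq (hm : AEStronglyMeasurable (fun z : ℝ × E3 => w z.1 z.2)
    ((volume.restrict I).prod volume)) (A : Set E3) : AEMeasurable (fun t => ∫⁻ x in A, ‖w t x‖ₑ ^
    2) (volume.restrict I) :=
      ((hm.mono_measure (Measure.prod_mono (le_refl (volume.restrict I))
      (Measure.restrict_le_self))).enorm.pow_const 2).lintegral_prod_right'

lemma aemeasurable_rhsBound {C0 : ℝ} {η C1 : ℝ≥0∞} (o : E3)
    (hu : AEStronglyMeasurable (fun z : ℝ × E3 => u z.1 z.2) ((volume.restrict I).prod volume))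
    (hv : AEStronglyMeasurable (fun z : ℝ × E3 => v z.1 z.2) ((volume.restrict I).prod volume)) :
    AEMeasurable (fun t => rhsBound C0 ρ M η C1 o (u t) (v t)) (volume.restrict I) :=
  (((aemeasurable_setLIntegral_sq hv _).const_mul _).add
    ((aemeasurable_wtEnergy hv o).const_mul _)).add ((aemeasurable_wtEnergy hu o).const_mul _)

lemma rhsBound_le {C0 : ℝ} {η C1 : ℝ≥0∞} (o : E3) (f g : E3 → E3) : rhsBound C0 ρ M η C1 o f g ≤
    (ofReal (C0 / ρ) * M * ofReal ((1 + 7 * ρ) ^ (15 / 4 : ℝ)) + η) * wtEnergy g o +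
    C1 * wtEnergy f o := by
  rw [rhsBound, add_mul, mul_assoc _ (ofReal _) (wtEnergy _ _)]
  gcongr
  exact setLIntegral_closedBall_le_wtEnergy g o (7 * ρ)

lemma lintegral_rhsBound_lt_top {C0 : ℝ} {η C1 : ℝ≥0∞} (hM : M < ⊤) (hη : η < ⊤) (hC1 : C1 < ⊤)
    (o : E3) (hu : AEStronglyMeasurable (fun z : ℝ × E3 => u z.1 z.2) ((volume.restrict I).prod
    volume)) (huw : ∫⁻ t in I, wtEnergy (u t) o < ⊤) (hvw : ∫⁻ t in I, wtEnergy (v t) o < ⊤) :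
    ∫⁻ t in I, rhsBound C0 ρ M η C1 o (u t) (v t) < ⊤ := by
  refine (lintegral_mono fun t => rhsBound_le o (u t) (v t)).trans_lt ?_
  have hA : ofReal (C0 / ρ) * M * ofReal ((1 + 7 * ρ) ^ (15 / 4 : ℝ)) + η < ⊤ := by finiteness
  rw [lintegral_add_right' _ ((aemeasurable_wtEnergy hu o).const_mul _),
    lintegral_const_mul' _ _ hA.ne, lintegral_const_mul' _ _ hC1.ne]
  exact add_lt_top.2 ⟨mul_lt_top hA hvw, mul_lt_top hC1 huw⟩

lemma integrable_cut_prod (hρ : 0 < ρ) (hm : AEStronglyMeasurable (fun z : ℝ × E3 => w z.1 z.2)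
    ((volume.restrict I).prod volume)) (hw : ∫⁻ t in I, wtEnergy (w t) o < ⊤) : Integrable
    (fun z : ℝ × E3 => ballBump ρ o z.2 * ‖w z.1 z.2‖ ^ 2) ((volume.restrict I).prod volume) := by
  have hm2 : AEStronglyMeasurable (fun z : ℝ × E3 => ballBump ρ o z.2 * ‖w z.1 z.2‖ ^ 2)
    ((volume.restrict I).prod volume) :=
    ((continuous_ballBump hρ o).comp continuous_snd).aestronglyMeasurable.mul (hm.norm.pow 2)
  refine ⟨hm2, ?_⟩
  rw [HasFiniteIntegral, lintegral_prod _ hm2.enorm]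
  calc _ ≤ ∫⁻ t in I, ofReal ((1 + 2 * ρ) ^ (15 / 4 : ℝ)) * wtEnergy (w t) o := by
        refine lintegral_mono fun t => ?_
        rw [wtEnergy, ← lintegral_ofReal_mul]
        refine lintegral_mono fun x => ?_
        rw [enorm_mul, enorm_pow, enorm_norm, ← mul_assoc]
        gcongr
        exact enorm_ballBump_le hρ o x
    _ < ⊤ := by
      rw [lintegral_ofReal_mul]
      exact mul_lt_top ofReal_lt_top hw

lemma ballBump_mul_ballBump (hρ : 0 < ρ) (o x : E3) : ballBump (2 * ρ) o x * ballBump ρ o x =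
    ballBump ρ o x := by
  by_cases hx : ballBump ρ o x = 0
  · simp [hx]
  · rw [ballBump_eq_one (by positivity) (norm_le_of_ballBump_ne_zero hρ hx), one_mul]

lemma lamComm_const_mul (s c : ℝ) (χ : E3 → ℝ) (w : E3 → E3) (x : E3) :
    lamComm s (fun y => c * χ y) w x = c • lamComm s χ w x := by
  have : ∫ y, ((c * χ x - c * χ y) / ‖x - y‖ ^ (3 + s)) • w y =
    c • ∫ y, ((χ x - χ y) / ‖x - y‖ ^ (3 + s)) • w y := by
    rw [← integral_smul]
    congr 1
    funext y
    rw [smul_smul, ← mul_sub, mul_div_assoc]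
  rw [lamComm, lamComm, smul_comm c, this]

/-- The local energy inequality, tested with a product of a time cutoff and a ball cutoff, with the
spatial terms estimated slice by slice. -/
lemma IsLocalLerayWith.energy_test (h : IsLocalLerayWith s T u₀ u v P) (hT'0 : 0 < T')
    (hT' : (T' : EReal) < T) {C0 : ℝ} (hρ : 0 < ρ) {η C1 : ℝ≥0∞} (hM : M < ⊤) (hη : η < ⊤)
    (hC1 : C1 < ⊤) (hb : ∀ᵐ t, t ∈ Ioo 0 T' → 2 * ‖∫ x, inner ℝ (-(lamComm s (ballBump (2 * ρ) o)
    (v t) x)) (ballBump ρ o x • u t x)‖ₑ + 2 * ‖∫ x, inner ℝ (lamComm s (ballBump ρ o) (u t) x)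
    (ballBump (2 * ρ) o x • v t x)‖ₑ + ‖∫ x, ‖u t x‖ ^ 2 * flux ρ o (u t) x‖ₑ +
    2 * ‖∫ x, P t x * flux ρ o (u t) x‖ₑ ≤ rhsBound C0 ρ M η C1 o (u t) (v t)) (huw :
    ∫⁻ t in Ioo 0 T', wtEnergy (u t) o < ⊤) (hvw : ∫⁻ t in Ioo 0 T', wtEnergy (v t) o < ⊤) (hθ :
    IsTest (Ioo 0 T') θ) (hθ0 : ∀ t, 0 ≤ θ t) : 0 ≤ (∫ t in Ioo 0 T', deriv θ t * cutEnergy ρ o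
    (u t)) + ∫ t in Ioo 0 T', θ t * ((rhsBound C0 ρ M η C1 o (u t) (v t)).toReal - 2 * cutEnergy ρ
    o (v t)) := by
  have hum := (h.bounded T' hT'0 hT').1
  have hvm := (h.lam_bounded T' hT'0 hT').1
  rw [restrict_prod_univ] at hum hvm
  have hθ' : IsTest (timeIoo T) θ := hθ.mono (Ioo_subset_timeIoo le_rfl hT')
  have hφ := ballBump_isTest hρ o
  obtain ⟨A, hA⟩ := hθ.exists_abs_le
  have hsupp : Function.support θ ⊆ Ioo 0 T' := (subset_tsupport θ).trans hθ.2.2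
  have hd : IsTest (Ioo 0 T') (deriv θ) :=
    ⟨hθ.1.iterate_deriv 1, hθ.2.1.deriv, tsupport_deriv_subset.trans hθ.2.2⟩
  obtain ⟨A', hA'⟩ := hd.exists_abs_le
  have key := h.suitable _ _ (isTest_prod hθ' hφ)
    (fun z => mul_nonneg (hθ0 _) (ballBump_nonneg _ _ _)) (ballBump_isTest (r := 2 * ρ)
    (by positivity) o) (ballBump_nonneg _ _) (fun t x => by
      rw [mul_left_comm, ballBump_mul_ballBump hρ])
  have hcu := integrable_cut_prod hρ hum huw
  have hcv := integrable_cut_prod hρ hvm hvw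
  have eL : ∫ z in slab T, θ z.1 * ballBump ρ o z.2 * ‖v z.1 z.2‖ ^ 2 =
      ∫ t in Ioo 0 T', θ t * cutEnergy ρ o (v t) := by
    simp only [mul_assoc]
    exact (setIntegral_slab_mul le_rfl hT' hθ.1.continuous hsupp hA
      (F := fun t x => ballBump ρ o x * ‖v t x‖ ^ 2) hcv).2
  have eD : ∫ z in slab T, ‖u z.1 z.2‖ ^ 2 * dt (fun z : ℝ × E3 => θ z.1 * ballBump ρ o z.2) z =
    ∫ t in Ioo 0 T', deriv θ t * cutEnergy ρ o (u t) := by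
    refine Eq.trans ?_ (setIntegral_slab_mul le_rfl hT' hd.1.continuous ((subset_tsupport _).trans
      hd.2.2) hA' (F := fun t x => ballBump ρ o x * ‖u t x‖ ^ 2) hcu).2
    congr 1; ext z
    have : dt (fun z : ℝ × E3 => θ z.1 * ballBump ρ o z.2) z =
      deriv θ z.1 * ballBump ρ o z.2 := by
      exact (((hθ.1.differentiable (by simp) z.1).hasDerivAt).mul_const (ballBump ρ o z.2)).deriv
    rw [this]; ring
  set F₁ := fun t x =>
    inner ℝ (-(lamComm s (ballBump (2 * ρ) o) (v t) x)) (ballBump ρ o x • u t x) with hF₁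
  set F₂ : ℝ → E3 → ℝ := fun t x =>
    inner ℝ (lamComm s (ballBump ρ o) (u t) x) (ballBump (2 * ρ) o x • v t x) with hF₂
  set F₃ : ℝ → E3 → ℝ := fun t x => ‖u t x‖ ^ 2 * flux ρ o (u t) x with hF₃
  set F₄ : ℝ → E3 → ℝ := fun t x => P t x * flux ρ o (u t) x with hF₄
  have e₁ : ∫ z in slab T, inner ℝ (-(lamComm s (ballBump (2 * ρ) o) (v z.1) z.2))
    ((θ z.1 * ballBump ρ o z.2) • u z.1 z.2) = ∫ z in slab T, θ z.1 * F₁ z.1 z.2 := by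
    congr 1; ext z
    rw [hF₁, mul_smul, inner_smul_right]
  have e₂ : ∫ z in slab T, inner ℝ (lamComm s (fun y => θ z.1 * ballBump ρ o y) (u z.1) z.2)
    (ballBump (2 * ρ) o z.2 • v z.1 z.2) = ∫ z in slab T, θ z.1 * F₂ z.1 z.2 := by
    congr 1; ext z
    rw [hF₂, lamComm_const_mul, real_inner_smul_left]
  have e₃ : ∫ z in slab T, ‖u z.1 z.2‖ ^ 2 * inner ℝ (u z.1 z.2)
    (spGrad (fun z : ℝ × E3 => θ z.1 * ballBump ρ o z.2) z) =
    ∫ z in slab T, θ z.1 * F₃ z.1 z.2 := by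
    congr 1; ext z
    simp only [hF₃, inner_spGrad_prod θ hφ, flux]; ring
  have e₄ : ∫ z in slab T, P z.1 z.2 * inner ℝ (u z.1 z.2)
    (spGrad (fun z : ℝ × E3 => θ z.1 * ballBump ρ o z.2) z) =
    ∫ z in slab T, θ z.1 * F₄ z.1 z.2 := by
    congr 1; ext z
    simp only [hF₄, inner_spGrad_prod θ hφ, flux]; ring
  rw [eL, eD, e₁, e₂, e₃, e₄] at key
  have hRm := aemeasurable_rhsBound (C0 := C0) (ρ := ρ) (M := M) (η := η) (C1 := C1) o hum hvm
  have hRt := lintegral_rhsBound_lt_top (C0 := C0) (ρ := ρ) (v := v) hM hη hC1 o hum huw hvw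
  have hθR := (integrable_toReal_of_lintegral_ne_top hRm hRt.ne).bdd_mul
    hθ.1.continuous.aestronglyMeasurable (.of_forall hA)
  have hθv : Integrable (fun t => θ t * cutEnergy ρ o (v t)) (volume.restrict (Ioo 0 T')) :=
    Integrable.bdd_mul hcv.integral_prod_left hθ.1.continuous.aestronglyMeasurable (.of_forall hA)
  set J := fun F : ℝ → E3 → ℝ => ∫ z in slab T, θ z.1 * F z.1 z.2
  have bd : 2 * ‖J F₁‖ₑ + 2 * ‖J F₂‖ₑ + ‖J F₃‖ₑ + 2 * ‖J F₄‖ₑ ≤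
    ofReal (∫ t in Ioo 0 T', θ t * (rhsBound C0 ρ M η C1 o (u t) (v t)).toReal) := by
    have b := fun F => enorm_setIntegral_slab_le le_rfl hT' hsupp F
    have c2 : ∀ f : ℝ → ℝ≥0∞, 2 * ∫⁻ t in Ioo 0 T', f t = ∫⁻ t in Ioo 0 T', 2 * f t :=
      fun f => (lintegral_const_mul' _ _ ofNat_ne_top).symm
    calc _ ≤ 2 * (∫⁻ t in Ioo 0 T', ‖θ t‖ₑ * ‖∫ x, F₁ t x‖ₑ) +
          2 * (∫⁻ t in Ioo 0 T', ‖θ t‖ₑ * ‖∫ x, F₂ t x‖ₑ) +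
          (∫⁻ t in Ioo 0 T', ‖θ t‖ₑ * ‖∫ x, F₃ t x‖ₑ) +
          2 * (∫⁻ t in Ioo 0 T', ‖θ t‖ₑ * ‖∫ x, F₄ t x‖ₑ) := by
          gcongr <;> exact b _
      _ ≤ ∫⁻ t in Ioo 0 T', (2 * (‖θ t‖ₑ * ‖∫ x, F₁ t x‖ₑ) + 2 * (‖θ t‖ₑ * ‖∫ x, F₂ t x‖ₑ) +
        ‖θ t‖ₑ * ‖∫ x, F₃ t x‖ₑ + 2 * (‖θ t‖ₑ * ‖∫ x, F₄ t x‖ₑ)) := by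
        rw [c2, c2, c2]
        refine le_trans (add_le_add (le_trans (add_le_add (le_lintegral_add _ _) le_rfl)
          (le_lintegral_add _ _)) le_rfl) (le_lintegral_add _ _)
      _ ≤ ∫⁻ t in Ioo 0 T', ‖θ t * (rhsBound C0 ρ M η C1 o (u t) (v t)).toReal‖ₑ := by
        refine lintegral_mono_ae ?_
        filter_upwards [(ae_restrict_iff' measurableSet_Ioo).2 hb,
          ae_lt_top' hRm hRt.ne] with t ht ht'
        calc _ = ‖θ t‖ₑ * (2 * ‖∫ x, F₁ t x‖ₑ + 2 * ‖∫ x, F₂ t x‖ₑ + ‖∫ x, F₃ t x‖ₑ +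
          2 * ‖∫ x, F₄ t x‖ₑ) := by ring
          _ ≤ ‖θ t‖ₑ * rhsBound C0 ρ M η C1 o (u t) (v t) := mul_le_mul_right ht _
          _ = _ := by rw [enorm_mul, enorm_of_nonneg toReal_nonneg, ofReal_toReal ht'.ne]
      _ = _ := by
        rw [ofReal_integral_eq_lintegral_ofReal hθR (.of_forall fun t =>
          mul_nonneg (hθ0 t) toReal_nonneg)]
        exact lintegral_congr fun t => enorm_of_nonneg (mul_nonneg (hθ0 t) toReal_nonneg)
  have bd' : 2 * |J F₁| + 2 * |J F₂| + |J F₃| + 2 * |J F₄| ≤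
    ∫ t in Ioo 0 T', θ t * (rhsBound C0 ρ M η C1 o (u t) (v t)).toReal := by
    rw [← ofReal_le_ofReal_iff (integral_nonneg fun t => mul_nonneg (hθ0 t) toReal_nonneg)]
    refine le_trans (le_of_eq ?_) bd
    rw [ofReal_add (by positivity) (by positivity), ofReal_add (by positivity) (by positivity),
      ofReal_add (by positivity) (by positivity)]
    simp only [ofReal_mul zero_le_two, ofReal_ofNat, ← norm_eq_abs, ofReal_norm]
  have e5 : ∫ t in Ioo 0 T',
    θ t * ((rhsBound C0 ρ M η C1 o (u t) (v t)).toReal - 2 * cutEnergy ρ o (v t)) =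
    (∫ t in Ioo 0 T', θ t * (rhsBound C0 ρ M η C1 o (u t) (v t)).toReal) -
      2 * ∫ t in Ioo 0 T', θ t * cutEnergy ρ o (v t) := by
    rw [← integral_const_mul, ← integral_sub hθR (hθv.const_mul 2)]
    congr 1; ext t; ring
  rw [e5]
  have a1 := neg_abs_le (J F₁)
  have a2 := neg_abs_le (J F₂)
  have a3 := le_abs_self (J F₃)
  have a4 := le_abs_self (J F₄)
  linarith

end

/-! ### Differential inequalities in the sense of distributions -/

/-- A sequence of even mollifiers on the line. -/
lemma exists_time_mollifier : ∃ η : ℕ → ℝ → ℝ, (∀ n, ContDiff ℝ ∞ (η n)) ∧ (∀ n t, 0 ≤ η n t) ∧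
    (∀ n t, η n (-t) = η n t) ∧ (∀ n, ∫ t, η n t = 1) ∧
    (∀ n, Function.support (η n) ⊆ Ioo (-(1 / ((n : ℝ) + 1))) (1 / ((n : ℝ) + 1))) ∧
    ∀ f : ℝ → ℝ, LocallyIntegrable f → ∀ᵐ t, Tendsto (fun n => ∫ τ, η n (τ - t) * f τ) atTop
    (𝓝 (f t)) := by
  have hp : ∀ n : ℕ, (0 : ℝ) < 1 / (n + 1) := fun n => Nat.one_div_pos_of_nat
  let φ : ℕ → ContDiffBump (0 : ℝ) := fun n =>
    ⟨1 / (n + 1) / 2, 1 / (n + 1), half_pos (hp n), half_lt_self (hp n)⟩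
  refine ⟨fun n => (φ n).normed volume, fun n => (φ n).contDiff_normed, fun n =>
    (φ n).nonneg_normed,
    fun n t => (φ n).normed_neg t, fun n => (φ n).integral_normed, fun n t ht => ?_, fun f hf => ?_⟩
  · rwa [ContDiffBump.support_normed_eq, Real.ball_eq_Ioo, zero_sub, zero_add] at ht
  · have h := ContDiffBump.ae_convolution_tendsto_right_of_locallyIntegrable (φ := φ)
      tendsto_one_div_add_atTop_nhds_zero_nat
      (.of_forall fun n => by
        change 1 / ((n : ℝ) + 1) ≤ 2 * (1 / (n + 1) / 2)
        linarith) hf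
    filter_upwards [h] with t ht
    refine ht.congr fun n => ?_
    rw [convolution_eq_swap]
    congr 1; ext τ
    rw [← (φ n).normed_neg (τ - t), neg_sub]
    rfl

lemma integral_window_eq_zero {η : ℝ → ℝ} {δ : ℝ} (hs : Function.support η ⊆ Ioo (-δ) δ)
    (hab : a ≤ b) (h : b ≤ -δ ∨ δ ≤ a) : ∫ y in a..b, η y = 0 := by
  rw [intervalIntegral.integral_congr (g := fun _ => 0)]
  · simp
  intro y hy
  rw [uIcc_of_le hab] at hy
  by_contra hc
  have h2 := hs hc
  rcases h with h | h
  · linarith [h2.1, hy.2]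
  · linarith [h2.2, hy.1]

/-- If `e' ≤ h` weakly on `(0, T')`, then `e t2 ≤ e t1 + ∫ h` over `(t1, t2)` for almost all times
`t1 < t2`. -/
lemma exists_times_of_weak_ineq {e h : ℝ → ℝ} (he : IntegrableOn e (Ioo 0 T'))
    (hh : IntegrableOn h (Ioo 0 T')) (hw : ∀ θ, IsTest (Ioo 0 T') θ → (∀ t, 0 ≤ θ t) → 0 ≤
    (∫ t in Ioo 0 T', deriv θ t * e t) + ∫ t in Ioo 0 T', θ t * h t) : ∃ S ⊆ Ioo 0 T',
    (∀ᵐ t, t ∈ Ioo 0 T' → t ∈ S) ∧ ∀ t1 ∈ S, ∀ t2 ∈ S, t1 < t2 → e t2 ≤ e t1 +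
    ∫ t in Ioo t1 t2, h t := by
  obtain ⟨η, hηc, hη0, hηe, hη1, hηs, hηt⟩ := exists_time_mollifier
  set E := (Ioo 0 T').indicator e with hE
  have hEi : Integrable E := (integrable_indicator_iff measurableSet_Ioo).2 he
  refine ⟨{t | t ∈ Ioo 0 T' ∧ Tendsto (fun n => ∫ τ, η n (τ - t) * E τ) atTop (𝓝 (E t))},
    fun t ht => ht.1, ?_, ?_⟩
  · filter_upwards [hηt E hEi.locallyIntegrable] with t ht htI using ⟨htI, ht⟩
  rintro t1 ⟨h1, h1t⟩ t2 ⟨h2, h2t⟩ h12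
  have hηi : ∀ n, ∀ a b, IntervalIntegrable (η n) volume a b := fun n a b =>
    (hηc n).continuous.intervalIntegrable a b
  have hηI : ∀ n, Integrable (η n) := fun n => by
    by_contra hc
    have := hη1 n
    rw [integral_undef hc] at this
    exact zero_ne_one this
  set θ : ℕ → ℝ → ℝ := fun n s => ∫ y in (s - t2)..(s - t1), η n y with hθ
  have hle : ∀ s, s - t2 ≤ s - t1 := fun s => by linarith
  have hθ0 : ∀ n s, 0 ≤ θ n s := fun n s =>
    intervalIntegral.integral_nonneg (hle s) fun y _ => hη0 n y
  have hθ1 : ∀ n s, θ n s ≤ 1 := fun n s => by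
    rw [hθ]; simp only
    rw [intervalIntegral.integral_of_le (hle s), ← hη1 n]
    exact setIntegral_le_integral (hηI n) (.of_forall (hη0 n))
  have hθd : ∀ n s, HasDerivAt (θ n) (η n (s - t1) - η n (s - t2)) s := fun n s => by
    have hF := fun x => intervalIntegral.integral_hasDerivAt_right (hηi n 0 x)
      (hηc n).continuous.stronglyMeasurable.stronglyMeasurableAtFilter
      (hηc n).continuous.continuousAt
    have e1 : θ n = fun s => (∫ y in (0 : ℝ)..(s - t1), η n y) - ∫ y in (0 : ℝ)..(s - t2), η n y :=
      by
      ext s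
      rw [intervalIntegral.integral_interval_sub_left (hηi n _ _) (hηi n _ _)]
    rw [e1]
    exact ((hF (s - t1)).comp_sub_const s t1).sub ((hF (s - t2)).comp_sub_const s t2)
  have hθs : ∀ n, Function.support (θ n) ⊆
    Icc (t1 - 1 / (n + 1)) (t2 + 1 / (n + 1)) := fun n s hs => by
    by_contra hc
    refine hs (integral_window_eq_zero (hηs n) (hle s) ?_)
    rw [mem_Icc, not_and_or, not_le, not_le] at hc
    rcases hc with hc | hc
    · left; linarith
    · right; linarith
  have hlim0 := tendsto_one_div_add_atTop_nhds_zero_nat (𝕜 := ℝ)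
  have hev : ∀ᶠ n : ℕ in atTop, IsTest (Ioo 0 T') (θ n) := by
    have hpos : 0 < min t1 (T' - t2) := lt_min h1.1 (by linarith [h2.2])
    filter_upwards [hlim0.eventually_lt_const hpos] with n hn
    refine ⟨?_, HasCompactSupport.of_support_subset_isCompact isCompact_Icc (hθs n),
      (closure_minimal (hθs n) isClosed_Icc).trans fun s hs => ?_⟩
    · rw [contDiff_infty_iff_deriv]
      refine ⟨fun s => (hθd n s).differentiableAt, ?_⟩
      rw [show deriv (θ n) = fun s => η n (s - t1) - η n (s - t2) from
        funext fun s => (hθd n s).deriv]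
      exact ((hηc n).comp (contDiff_id.sub contDiff_const)).sub
        ((hηc n).comp (contDiff_id.sub contDiff_const))
    · have hn1 := hn.trans_le (min_le_left _ _)
      have hn2 := hn.trans_le (min_le_right _ _)
      exact ⟨by linarith [hs.1], by linarith [hs.2]⟩
  have hI : ∀ n t, Integrable fun τ => η n (τ - t) * E τ := fun n t => by
    obtain ⟨C, hC⟩ := (HasCompactSupport.of_support_subset_isCompact isCompact_Icc
      ((hηs n).trans Ioo_subset_Icc_self)).exists_bound_of_continuous (hηc n).continuous
    exact hEi.bdd_mul ((hηc n).continuous.comp (by fun_prop)).aestronglyMeasurable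
      (.of_forall fun τ => hC _)
  have hA : ∀ n, ∫ t in Ioo 0 T', deriv (θ n) t * e t =
    (∫ τ, η n (τ - t1) * E τ) - ∫ τ, η n (τ - t2) * E τ := fun n => by
    rw [← integral_sub (hI n t1) (hI n t2), ← integral_indicator measurableSet_Ioo]
    congr 1; ext τ
    rw [hE]
    by_cases hτ : τ ∈ Ioo 0 T'
    · rw [indicator_of_mem hτ, indicator_of_mem hτ, (hθd n τ).deriv]; ring
    · rw [indicator_of_notMem hτ, indicator_of_notMem hτ]; ring
  have hB : Tendsto (fun n => ∫ t in Ioo 0 T', θ n t * h t) atTop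
    (𝓝 (∫ t in Ioo 0 T', (Ioo t1 t2).indicator h t)) := by
    refine tendsto_integral_of_dominated_convergence (fun t => |h t|) (fun n => ?_) hh.abs
      (fun n => .of_forall fun t => ?_) ?_
    · exact (continuous_iff_continuousAt.2 fun s => (hθd n s).continuousAt).aestronglyMeasurable.mul
        hh.1
    · rw [norm_eq_abs, abs_mul, abs_of_nonneg (hθ0 n t)]
      exact mul_le_of_le_one_left (abs_nonneg _) (hθ1 n t)
    · refine ae_restrict_of_ae ?_
      filter_upwards [(Set.countable_singleton t1).ae_notMem volume,
        (Set.countable_singleton t2).ae_notMem volume] with t hn1 hn2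
      refine tendsto_const_nhds.congr' ?_
      by_cases ht : t ∈ Ioo t1 t2
      · have hpos : 0 < min (t - t1) (t2 - t) := lt_min (by linarith [ht.1]) (by linarith [ht.2])
        filter_upwards [hlim0.eventually_lt_const hpos] with n hn
        have hn1 := hn.trans_le (min_le_left _ _)
        have hn2 := hn.trans_le (min_le_right _ _)
        have : θ n t = 1 := by
          rw [hθ]; simp only
          rw [intervalIntegral.integral_eq_integral_of_support_subset, hη1 n]
          intro y hy
          have := hηs n hy
          exact ⟨by linarith [this.1], by linarith [this.2]⟩
        rw [indicator_of_mem ht, this, one_mul]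
      · rw [indicator_of_notMem ht]
        have hpos : t < t1 ∨ t2 < t := by
          by_contra hc
          push Not at hc
          exact ht ⟨lt_of_le_of_ne hc.1 fun hh => hn1 (by simp [hh]),
            lt_of_le_of_ne hc.2 fun hh => hn2 (by simp [hh])⟩
        have hpos' : 0 < max (t1 - t) (t - t2) := by
          rcases hpos with hp | hp
          · exact lt_max_of_lt_left (by linarith)
          · exact lt_max_of_lt_right (by linarith)
        filter_upwards [hlim0.eventually_lt_const hpos'] with n hn
        have : θ n t = 0 := by
          refine integral_window_eq_zero (hηs n) (hle t) ?_
          rcases lt_max_iff.1 hn with hn | hn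
          · left; linarith
          · right; linarith
        rw [this, zero_mul]
  have hD : 0 ≤ E t1 - E t2 + ∫ t in Ioo 0 T', (Ioo t1 t2).indicator h t := by
    refine ge_of_tendsto ((h1t.sub h2t).add hB) ?_
    filter_upwards [hev] with n hn
    rw [← hA n]
    exact hw _ hn (hθ0 n)
  rw [hE, indicator_of_mem h1, indicator_of_mem h2, setIntegral_indicator measurableSet_Ioo,
    inter_eq_right.2 (Ioo_subset_Ioo h1.1.le h2.2.le)] at hD
  linarith

/-- The weighted form of `exists_times_of_weak_ineq`, with the integrating factor `e^{-lt}`. -/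
lemma exists_times_of_weak_ineq_exp {e h : ℝ → ℝ} (he : IntegrableOn e (Ioo 0 T'))
    (hh : IntegrableOn h (Ioo 0 T')) (hw : ∀ θ, IsTest (Ioo 0 T') θ → (∀ t, 0 ≤ θ t) → 0 ≤
    (∫ t in Ioo 0 T', deriv θ t * e t) + ∫ t in Ioo 0 T', θ t * h t) (l :
    ℝ) : ∃ S ⊆ Ioo 0 T', (∀ᵐ t, t ∈ Ioo 0 T' → t ∈ S) ∧ ∀ t1 ∈ S, ∀ t2 ∈ S, t1 < t2 →
    exp (-l * t2) * e t2 ≤ exp (-l * t1) * e t1 + ∫ t in Ioo t1 t2, exp (-l * t) *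
    (h t - l * e t) := by
  have hc : ContDiff ℝ ∞ fun t : ℝ => exp (-l * t) :=
    Real.contDiff_exp.comp (contDiff_const.mul contDiff_id)
  have hbd : ∀ f : ℝ → ℝ, IntegrableOn f (Ioo 0 T') →
    IntegrableOn (fun t => exp (-l * t) * f t) (Ioo 0 T') := fun f hf => by
    obtain ⟨C, hC⟩ := (isCompact_Icc (a := (0 : ℝ))).exists_bound_of_continuousOn
      hc.continuous.continuousOn
    exact Integrable.bdd_mul hf hc.continuous.aestronglyMeasurable
      ((ae_restrict_iff' measurableSet_Ioo).2 (.of_forall fun t ht =>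
      hC t (Ioo_subset_Icc_self ht)))
  refine exists_times_of_weak_ineq (hbd e he) (hbd _ (hh.sub (he.const_mul l))) fun θ hθ hθ0 => ?_
  have hθ' : IsTest (Ioo 0 T') fun t => exp (-l * t) * θ t :=
    ⟨hc.mul hθ.1, hθ.2.1.mul_left, (tsupport_mul_subset_right).trans hθ.2.2⟩
  refine (hw _ hθ' fun t => mul_nonneg (exp_pos _).le (hθ0 t)).trans (le_of_eq ?_)
  obtain ⟨A, hA⟩ := hθ.exists_abs_le
  have hd : IsTest (Ioo 0 T') (deriv θ) :=
    ⟨hθ.1.iterate_deriv 1, hθ.2.1.deriv, tsupport_deriv_subset.trans hθ.2.2⟩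
  obtain ⟨A', hA'⟩ := hd.exists_abs_le
  have i1 := fun f hf =>
    Integrable.bdd_mul (hbd f hf) hθ.1.continuous.aestronglyMeasurable (.of_forall hA)
  have ed : ∀ t, deriv (fun t => exp (-l * t) * θ t) t =
    exp (-l * t) * deriv θ t - l * (exp (-l * t) * θ t) := fun t => by
    have d1 : HasDerivAt (fun t : ℝ => exp (-l * t)) (exp (-l * t) * (-l)) t := by
      simpa using ((hasDerivAt_id t).const_mul (-l)).exp
    exact (d1.mul ((hθ.1.differentiable (by simp) t).hasDerivAt)).deriv.trans (by ring)
  have e1 : ∫ t in Ioo 0 T', deriv (fun t => exp (-l * t) * θ t) t * e t =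
    (∫ t in Ioo 0 T', deriv θ t * (exp (-l * t) * e t)) -
      ∫ t in Ioo 0 T', θ t * (exp (-l * t) * (l * e t)) := by
    rw [← integral_sub (Integrable.bdd_mul (hbd e he) hd.1.continuous.aestronglyMeasurable
      (.of_forall hA')) (i1 _ (he.const_mul l))]
    congr 1; ext t; rw [ed]; ring
  have e2 : ∫ t in Ioo 0 T', θ t * (exp (-l * t) * (h t - l * e t)) =
    (∫ t in Ioo 0 T', θ t * (exp (-l * t) * h t)) -
      ∫ t in Ioo 0 T', θ t * (exp (-l * t) * (l * e t)) := by
    rw [← integral_sub (i1 _ hh) (i1 _ (he.const_mul l))]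
    congr 1; ext t; ring
  have e3 : ∫ t in Ioo 0 T', exp (-l * t) * θ t * h t =
    ∫ t in Ioo 0 T', θ t * (exp (-l * t) * h t) := by
    congr 1; ext t; ring
  rw [e1, e2, e3]; ring

/-! ### Decay at infinity from a convolution inequality -/

lemma eventually_lintegral_sub_mul_le {W D : E3 → ℝ≥0∞} (hW : Measurable W) (hWt : ∫⁻ y, W y < ⊤)
    (hD : Measurable D) {K : ℝ≥0∞} (hK : K < ⊤) (hDK : ∀ x, D x ≤ K) {m : ℝ≥0∞}
    (hm : ∀ᶠ x in cocompact E3, D x ≤ m) (hε : 0 < ε) :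
    ∀ᶠ x in cocompact E3, ∫⁻ z, W (z - x) * D z ≤ m * (∫⁻ y, W y) + ε := by
  have : (cocompact E3).IsCountablyGenerated := by
    rw [← Metric.cobounded_eq_cocompact, ← comap_norm_atTop]
    infer_instance
  have h1 : Tendsto (fun x => ∫⁻ y, W y * (D (y + x) - m)) (cocompact E3) (𝓝 (∫⁻ _y : E3, 0)) := by
    refine tendsto_lintegral_filter_of_dominated_convergence (fun y => W y * K) ?_ ?_ ?_ ?_
    · exact .of_forall fun x => hW.mul ((hD.comp (measurable_id.add_const x)).sub measurable_const)
    · exact .of_forall fun x => .of_forall fun y => mul_le_mul_right (tsub_le_self.trans (hDK _)) _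
    · rw [lintegral_mul_const _ hW]
      exact (mul_lt_top hWt hK).ne
    · refine .of_forall fun y => tendsto_const_nhds.congr' ?_
      have hy : Tendsto (fun x => y + x) (cocompact E3) (cocompact E3) :=
        (Homeomorph.addLeft y).isClosedEmbedding.tendsto_cocompact
      filter_upwards [hy.eventually hm] with x hx
      rw [tsub_eq_zero_of_le hx, mul_zero]
  rw [lintegral_zero] at h1
  filter_upwards [h1.eventually_le_const hε] with x hx
  calc _ = ∫⁻ y, W y * D (y + x) := by
        rw [← lintegral_add_right_eq_self _ x]
        simp
    _ ≤ ∫⁻ y, (m * W y + W y * (D (y + x) - m)) := by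
      refine lintegral_mono fun y => ?_
      rw [mul_comm m, ← mul_add]
      exact mul_le_mul_right le_add_tsub _
    _ = m * (∫⁻ y, W y) + ∫⁻ y, W y * (D (y + x) - m) := by
      rw [lintegral_add_left (hW.const_mul m), lintegral_const_mul _ hW]
    _ ≤ _ := by gcongr

lemma tendsto_lintegral_sub_mul {W D : E3 → ℝ≥0∞} (hW : Measurable W) (hWt : ∫⁻ y, W y < ⊤)
    (hD : Measurable D) {K : ℝ≥0∞} (hK : K < ⊤) (hDK : ∀ x, D x ≤ K)
    (hD0 : Tendsto D (cocompact E3) (𝓝 0)) : Tendsto (fun x => ∫⁻ z, W (z - x) * D z) (cocompact E3)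
    (𝓝 0) := by
  refine tendsto_nhds_zero.2 fun ε hε => ?_
  rcases eq_or_ne ε ⊤ with rfl | hεt
  · exact .of_forall fun _ => le_top
  obtain ⟨δ, hδ0, hδt, hδ⟩ := exists_mul_le hWt (half_pos hε.ne')
    (ENNReal.half_le_self.trans_lt hεt.lt_top)
  filter_upwards [eventually_lintegral_sub_mul_le hW hWt hD hK hDK
    (hD0.eventually_le_const (pos_iff_ne_zero.2 hδ0)) (half_pos hε.ne')] with x hx
  exact hx.trans ((add_le_add hδ le_rfl).trans (add_halves ε).le)

/-- Integrals over a measurable family of sets depend measurably on the parameter. -/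
lemma measurable_setLIntegral {f : E3 → ℝ≥0∞} (hf : AEMeasurable f) {S : E3 → Set E3}
    (hS : MeasurableSet {p : E3 × E3 | p.2 ∈ S p.1}) : Measurable fun y => ∫⁻ x in S y, f x := by
  obtain ⟨g, hg, hfg⟩ := hf
  have e : (fun y => ∫⁻ x in S y, f x) = fun y => ∫⁻ x, (S y).indicator g x := by
    ext y
    rw [lintegral_indicator (show MeasurableSet (S y) from measurable_prodMk_left hS)]
    exact lintegral_congr_ae (ae_restrict_of_ae hfg)
  rw [e]
  exact Measurable.lintegral_prod_right' (Measurable.indicator (hg.comp measurable_snd) hS)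

/-- A bounded function that is dominated by a vanishing function plus its own convolution with a
kernel of mass at most one half vanishes at infinity. -/
lemma tendsto_zero_of_le_lintegral {W D b : E3 → ℝ≥0∞} (hW : Measurable W) (hWt : ∫⁻ y, W y ≤ 1 / 2)
    (hD : Measurable D) {K : ℝ≥0∞} (hK : K < ⊤) (hDK : ∀ x, D x ≤ K)
    (hb : Tendsto b (cocompact E3) (𝓝 0)) (h : ∀ x, D x ≤ b x + ∫⁻ z, W (z - x) * D z) :
    Tendsto D (cocompact E3) (𝓝 0) := by
  set L := limsup D (cocompact E3) with hL
  have hLK : L ≤ K := limsup_le_of_le (h := .of_forall hDK)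
  have hLt : L < ⊤ := hLK.trans_lt hK
  have hstep : ∀ ε : ℝ≥0, 0 < ε → L ≤ L * (1 / 2) + 3 * ε := by
    intro ε hε
    have hε' : (0 : ℝ≥0∞) < ε := by exact_mod_cast hε
    have h1 : ∀ᶠ x in cocompact E3, D x ≤ L + ε :=
      (eventually_lt_of_limsup_lt (ENNReal.lt_add_right hLt.ne hε'.ne')).mono fun x hx => hx.le
    have h2 := eventually_lintegral_sub_mul_le hW (hWt.trans_lt (by simp)) hD hK hDK h1 hε'
    refine limsup_le_of_le (h := ?_)
    filter_upwards [h2, hb.eventually_le_const hε'] with x hx hx'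
    calc D x ≤ b x + ∫⁻ z, W (z - x) * D z := h x
      _ ≤ ε + ((L + ε) * (1 / 2) + ε) := by
        gcongr
        refine hx.trans ?_
        gcongr
      _ ≤ ε + ((L * (1 / 2) + ε) + ε) := by
        rw [add_mul]
        gcongr
        exact mul_le_of_le_one_right' (by simp)
      _ = _ := by ring
  have hL0 : L = 0 := by
    have h2 : L ≤ L * (1 / 2) := by
      refine ENNReal.le_of_forall_pos_le_add fun ε hε _ => ?_
      have := hstep (ε / 3) (by positivity)
      rwa [show (3 : ℝ≥0∞) * ((ε / 3 : ℝ≥0) : ℝ≥0∞) = ε by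
        rw [ENNReal.coe_div (by norm_num)]; exact ENNReal.mul_div_cancel (by simp) (by simp)] at this
    by_contra hc
    rw [mul_one_div] at h2
    exact absurd h2 (not_le.2 (ENNReal.half_lt_self hc hLt.ne))
  exact tendsto_of_le_liminf_of_limsup_le zero_le (by rw [← hL, hL0])

/-! ### Cut-off energies -/

lemma ofReal_cutEnergy (hρ : 0 < ρ) (hf : AEStronglyMeasurable f) (hw : wtEnergy f o < ⊤) :
    ofReal (cutEnergy ρ o f) = ∫⁻ x, ofReal (ballBump ρ o x) * ‖f x‖ₑ ^ 2 := by
  rw [cutEnergy, ofReal_integral_eq_lintegral_ofReal (integrable_cut hρ hf hw)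
    (.of_forall fun x => mul_nonneg (ballBump_nonneg _ _ _) (by positivity))]
  refine lintegral_congr fun x => ?_
  rw [ofReal_mul (ballBump_nonneg _ _ _), ofReal_pow (norm_nonneg _), ofReal_norm]

lemma cutEnergy_nonneg (ρ : ℝ) (o : E3) (f : E3 → E3) : 0 ≤ cutEnergy ρ o f :=
  integral_nonneg fun x => mul_nonneg (ballBump_nonneg _ _ _) (by positivity)

lemma setLIntegral_le_cutEnergy (hρ : 0 < ρ) (hf : AEStronglyMeasurable f)
    (hw : wtEnergy f o < ⊤) : ∫⁻ x in closedBall o ρ, ‖f x‖ₑ ^ 2 ≤ ofReal (cutEnergy ρ o f) := by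
  rw [ofReal_cutEnergy hρ hf hw, ← lintegral_indicator measurableSet_closedBall]
  refine lintegral_mono fun x => ?_
  by_cases hx : x ∈ closedBall o ρ
  · rw [indicator_of_mem hx, ballBump_eq_one hρ (by simpa [dist_eq_norm] using hx)]
    simp
  · rw [indicator_of_notMem hx]; exact zero_le

lemma ofReal_cutEnergy_le (hρ : 0 < ρ) (hf : AEStronglyMeasurable f) (hw : wtEnergy f o < ⊤) :
    ofReal (cutEnergy ρ o f) ≤ ofReal ((1 + 2 * ρ) ^ (15 / 4 : ℝ)) * wtEnergy f o := by
  rw [ofReal_cutEnergy hρ hf hw, wtEnergy, ← lintegral_ofReal_mul]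
  refine lintegral_mono fun x => ?_
  rw [← mul_assoc]
  gcongr
  have := enorm_ballBump_le hρ o x
  rwa [enorm_of_nonneg (ballBump_nonneg _ _ _)] at this

/-- The weighted energy of a field in `E²` vanishes at infinity. -/
lemma MemE2.tendsto_wtEnergy (hf : MemE2 f) : Tendsto (wtEnergy f) (cocompact E3) (𝓝 0) := by
  obtain ⟨C, hC, hb⟩ := lintegral_wtE_mul_le_average
  set D := fun y => ∫⁻ x in ball y 1, ‖f x‖ₑ ^ 2 with hD
  have hDe : ∀ y, D y = eLpNorm f 2 (volume.restrict (ball y 1)) ^ 2 := fun y =>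
    (eLpNorm_two_sq _ _).symm
  have hDm : Measurable D :=
    measurable_setLIntegral (hf.1.1.enorm.pow_const 2) (measurableSet_dist_lt 1)
  have hD0 : Tendsto D (cocompact E3) (𝓝 0) := by
    rw [show D = fun y => eLpNorm f 2 (volume.restrict (ball y 1)) ^ 2 from funext hDe]
    simpa [Function.comp_def] using ((ENNReal.continuous_pow 2).tendsto 0).comp hf.2
  have hDK : ∀ y, D y ≤ ulocNorm f ^ 2 := fun y => by
    rw [hDe]
    gcongr
    exact le_iSup (fun o => eLpNorm f 2 (volume.restrict (ball o 1))) y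
  have hlim := tendsto_lintegral_sub_mul measurable_wtE lintegral_wtE_lt_top hDm (pow_lt_top hf.1.2)
    hDK hD0
  refine tendsto_of_tendsto_of_tendsto_of_le_of_le tendsto_const_nhds
    (by simpa using ENNReal.Tendsto.const_mul hlim (Or.inr hC.ne)) (fun _ => zero_le)
    (fun x => hb _ x (hf.1.1.enorm.pow_const 2))

/-! ### The energy inequality between almost all times -/

lemma ofReal_cutEnergy_eq_eLpNorm (hρ : 0 < ρ) (hf : AEStronglyMeasurable f)
    (hw : wtEnergy f o < ⊤) : ofReal (cutEnergy ρ o f) = eLpNorm (fun x => √(ballBump ρ o x) • f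
    x) 2 volume ^ 2 := by
  rw [ofReal_cutEnergy hρ hf hw, eLpNorm_two_sq]
  refine lintegral_congr fun x => ?_
  rw [enorm_smul, mul_pow, enorm_of_nonneg (Real.sqrt_nonneg _),
    ← ofReal_pow (Real.sqrt_nonneg _), Real.sq_sqrt (ballBump_nonneg _ _ _)]

lemma aestronglyMeasurable_sqrt_ballBump_smul (hρ : 0 < ρ) (o : E3) (hf : AEStronglyMeasurable f) :
    AEStronglyMeasurable fun x => √(ballBump ρ o x) • f x :=
  (continuous_ballBump hρ o).sqrt.aestronglyMeasurable.smul hf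

lemma eLpNorm_sqrt_ballBump_smul_le (hρ : 0 < ρ) (o : E3) (f : E3 → E3) :
    eLpNorm (fun x => √(ballBump ρ o x) • f x) 2 volume ≤
    eLpNorm f 2 (volume.restrict (closedBall o (2 * ρ))) := by
  rw [← eLpNorm_indicator_eq_eLpNorm_restrict measurableSet_closedBall]
  refine eLpNorm_mono fun x => ?_
  by_cases hx : x ∈ closedBall o (2 * ρ)
  · rw [indicator_of_mem hx, norm_smul, norm_of_nonneg (Real.sqrt_nonneg _)]
    exact mul_le_of_le_one_left (norm_nonneg _) (Real.sqrt_le_one.2 (ballBump_le_one _ _ _))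
  · have : ballBump ρ o x = 0 := by
      by_contra hc
      exact hx (by simpa [dist_eq_norm] using norm_le_of_ballBump_ne_zero hρ hc)
    simp [this]

lemma eventually_cutEnergy_le {ι : Type*} {l : Filter ι} (hρ : 0 < ρ) {f : ι → E3 → E3}
    {g : E3 → E3} (hf : ∀ᶠ t in l, AEStronglyMeasurable (f t) ∧ wtEnergy (f t) o < ⊤)
    (hg : AEStronglyMeasurable g) (hgw : wtEnergy g o < ⊤)
    (h : Tendsto (fun t => eLpNorm (f t - g) 2 (volume.restrict (closedBall o (2 * ρ)))) l (𝓝 0))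
    (hε : 0 < ε) : ∀ᶠ t in l, ofReal (cutEnergy ρ o (f t)) ≤ ofReal (cutEnergy ρ o g) + ε := by
  set N := eLpNorm (fun x => √(ballBump ρ o x) • g x) 2 volume
  have hlim : Tendsto (fun t => (N + eLpNorm (f t - g) 2
    (volume.restrict (closedBall o (2 * ρ)))) ^ 2) l (𝓝 (N ^ 2)) := by
    have := ((ENNReal.continuous_pow 2).tendsto (N + 0)).comp (h.const_add N)
    rwa [add_zero] at this
  have hN2 := (ofReal_cutEnergy_eq_eLpNorm hρ hg hgw).symm
  filter_upwards [hlim.eventually_lt_const (ENNReal.lt_add_right (hN2 ▸ ofReal_ne_top) hε.ne'),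
    hf] with t ht hft
  rw [← hN2, ofReal_cutEnergy_eq_eLpNorm hρ hft.1 hft.2]
  refine le_trans ?_ ht.le
  gcongr
  calc _ = eLpNorm ((fun x => √(ballBump ρ o x) • g x) +
        fun x => √(ballBump ρ o x) • (f t - g) x) 2 volume := by
        congr 1; ext1 x
        simp only [Pi.add_apply, Pi.sub_apply, ← smul_add, add_sub_cancel]
    _ ≤ N + eLpNorm (fun x => √(ballBump ρ o x) • (f t - g) x) 2 volume :=
      eLpNorm_add_le (aestronglyMeasurable_sqrt_ballBump_smul hρ o hg)
        (aestronglyMeasurable_sqrt_ballBump_smul hρ o (hft.1.sub hg)) one_le_two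
    _ ≤ _ := by
      gcongr
      exact eLpNorm_sqrt_ballBump_smul_le hρ o _

lemma MemL2uloc.wtEnergy_lt_top (hf : MemL2uloc f) (z : E3) : wtEnergy f z < ⊤ := by
  obtain ⟨C, hC, hw⟩ := exists_wtEnergy_le_ulocNorm
  exact (hw f z hf.1).trans_lt (mul_lt_top hC (pow_lt_top hf.2))

lemma exists_mem_of_ae_nhdsGT (hab : a < b) {p : ℝ → Prop} (h : ∀ᶠ t in 𝓝[>] a ⊓ ae volume, p t) :
    ∃ t ∈ Ioo a b, p t := by
  have hne : (𝓝[>] a ⊓ ae volume).NeBot := by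
    refine inf_neBot_iff.2 fun {A} hA {B} hB => ?_
    obtain ⟨c, hc, hcA⟩ := (mem_nhdsGT_iff_exists_Ioo_subset).1 hA
    by_contra hemp
    have := measure_mono_null (fun t ht htB => hemp ⟨t, hcA ht, htB⟩) hB
    rw [Real.volume_Ioo, ENNReal.ofReal_eq_zero] at this
    linarith [mem_Ioi.1 hc]
  have h2 : ∀ᶠ t in 𝓝[>] a ⊓ ae volume, t ∈ Ioo a b := mem_inf_of_left (Ioo_mem_nhdsGT hab)
  exact (h2.and h).exists

section

variable {u v : ℝ → E3 → E3}

lemma lintegral_wtEnergy_lt_top_of_bound (h : ∫⁻ t in Ioo 0 T', wtEnergy (w t) 0 < ⊤) (o : E3) :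
    ∫⁻ t in Ioo 0 T', wtEnergy (w t) o < ⊤ := by
  refine (lintegral_mono fun t => wtEnergy_le_mul (w t) (z := o) (z' := 0) (R := ‖o‖)
    (by simp)).trans_lt ?_
  rw [lintegral_ofReal_mul]
  exact mul_lt_top ofReal_lt_top h

/-- The localized energy inequality with integrating factor, between almost all pairs of times. -/
lemma IsLocalLerayWith.exists_energy_times (h : IsLocalLerayWith s T u₀ u v P) (hs0 : 3 / 4 ≤ s)
    (hs1 : s < 1) (hT'0 : 0 < T') (hT' : (T' : EReal) < T) :
    ∃ M : ℝ≥0∞, M < ⊤ ∧ (∀ᵐ t, t ∈ Ioo 0 T' → IsSlice s M (u t) (v t) (P t)) ∧ ∃ C0 : ℝ, 0 < C0 ∧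
    ∀ ρ, 2 ≤ ρ → ∀ η : ℝ≥0∞, 0 < η → η < ⊤ → ∃ C1 : ℝ≥0∞, C1 < ⊤ ∧ ∀ (o : E3) (l : ℝ), 0 ≤ l →
    ∃ S ⊆ Ioo 0 T', (∀ᵐ t, t ∈ Ioo 0 T' → t ∈ S) ∧ ∀ t1 ∈ S, ∀ t2 ∈ S, t1 < t2 →
    ofReal (exp (-l * t2) * cutEnergy ρ o (u t2)) +
    (∫⁻ t in Ioo t1 t2, ofReal (exp (-l * t) * (2 * cutEnergy ρ o (v t) +
    l * cutEnergy ρ o (u t)))) ≤ ofReal (exp (-l * t1) * cutEnergy ρ o (u t1)) +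
    ∫⁻ t in Ioo t1 t2, ofReal (exp (-l * t)) * rhsBound C0 ρ M η C1 o (u t) (v t) := by
  obtain ⟨M, hM, hsl⟩ := h.ae_isSlice hs0 hs1 hT'0 hT'
  obtain ⟨C0, hC0, hb⟩ := exists_energy_rhs_bound hs0 hs1
  refine ⟨M, hM, hsl, C0, hC0, fun ρ hρ η hη hηt => ?_⟩
  obtain ⟨C1, hC1, hb⟩ := hb ρ hρ M hM η hη hηt
  refine ⟨C1, hC1, fun o l hl => ?_⟩
  have hρ0 : 0 < ρ := by linarith
  have hu := h.bounded T' hT'0 hT'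
  have hv := h.lam_bounded T' hT'0 hT'
  obtain ⟨K, hK, hKb⟩ := hv.exists_wtEnergy_le
  have huw := lintegral_wtEnergy_lt_top_of_bound hu.lintegral_wtEnergy_lt_top o
  have hvw : ∫⁻ t in Ioo 0 T', wtEnergy (v t) o < ⊤ := (hKb o).trans_lt hK
  have hum := hu.1
  have hvm := hv.1
  rw [restrict_prod_univ] at hum hvm
  have hei : IntegrableOn (fun t => cutEnergy ρ o (u t)) (Ioo 0 T') :=
    (integrable_cut_prod hρ0 hum huw).integral_prod_left
  have hdi : IntegrableOn (fun t => cutEnergy ρ o (v t)) (Ioo 0 T') :=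
    (integrable_cut_prod hρ0 hvm hvw).integral_prod_left
  have hRm := aemeasurable_rhsBound (C0 := C0) (ρ := ρ) (M := M) (η := η) (C1 := C1) o hum hvm
  have hRt := lintegral_rhsBound_lt_top (C0 := C0) (ρ := ρ) (v := v) hM hηt hC1 o hum huw hvw
  have hRi : IntegrableOn (fun t => (rhsBound C0 ρ M η C1 o (u t) (v t)).toReal) (Ioo 0 T') :=
    integrable_toReal_of_lintegral_ne_top hRm hRt.ne
  obtain ⟨S, hSI, hSae, hS⟩ := exists_times_of_weak_ineq_exp hei (hRi.sub (hdi.const_mul 2))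
    (fun θ hθ hθ0 => h.energy_test hT'0 hT' hρ0 hM hηt hC1
    (by filter_upwards [hsl] with t ht htI using hb _ _ _ (ht htI) o) huw hvw hθ hθ0) l
  refine ⟨S, hSI, hSae, fun t1 h1 t2 h2 h12 => ?_⟩
  have key := hS t1 h1 t2 h2 h12
  have hsub := Ioo_subset_Ioo (hSI h1).1.le (hSI h2).2.le
  have hexp : ∀ f : ℝ → ℝ, IntegrableOn f (Ioo 0 T') →
    IntegrableOn (fun t => exp (-l * t) * f t) (Ioo t1 t2) := fun f hf => by
    refine Integrable.bdd_mul (c := 1) (hf.mono_set hsub) (by fun_prop)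
      ((ae_restrict_iff' measurableSet_Ioo).2 (.of_forall fun t ht => ?_))
    rw [norm_of_nonneg (exp_pos _).le, Real.exp_le_one_iff]
    have := (hsub ht).1
    nlinarith
  have i2 : IntegrableOn (fun t => exp (-l * t) * (2 * cutEnergy ρ o (v t) + l * cutEnergy ρ o
    (u t))) (Ioo t1 t2) := hexp _ ((hdi.const_mul 2).add (hei.const_mul l))
  have n2 : ∀ t, 0 ≤ exp (-l * t) * (2 * cutEnergy ρ o (v t) + l * cutEnergy ρ o (u t)) :=
    fun t => mul_nonneg (exp_pos _).le
    (add_nonneg (mul_nonneg zero_le_two (cutEnergy_nonneg _ _ _))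
    (mul_nonneg hl (cutEnergy_nonneg _ _ _)))
  have e1 : ∫⁻ t in Ioo t1 t2, ofReal (exp (-l * t)) *
    rhsBound C0 ρ M η C1 o (u t) (v t) = ofReal (∫ t in Ioo t1 t2,
      exp (-l * t) * (rhsBound C0 ρ M η C1 o (u t) (v t)).toReal) := by
    rw [ofReal_integral_eq_lintegral_ofReal (hexp _ hRi) (.of_forall fun t =>
      mul_nonneg (exp_pos _).le toReal_nonneg)]
    refine lintegral_congr_ae ?_
    filter_upwards [ae_mono (Measure.restrict_mono hsub le_rfl) (ae_lt_top' hRm hRt.ne)] with t ht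
    rw [ofReal_mul (exp_pos _).le, ofReal_toReal ht.ne]
  rw [e1, ← ofReal_integral_eq_lintegral_ofReal i2 (.of_forall n2), ← ofReal_add
    (mul_nonneg (exp_pos _).le (cutEnergy_nonneg _ _ _)) (integral_nonneg n2), ← ofReal_add
    (mul_nonneg (exp_pos _).le (cutEnergy_nonneg _ _ _)) (integral_nonneg fun t =>
    mul_nonneg (exp_pos _).le toReal_nonneg)]
  refine ofReal_le_ofReal ?_
  have e2 : ∫ t in Ioo t1 t2, exp (-l * t) * ((rhsBound C0 ρ M η C1 o (u t) (v t)).toReal -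
    2 * cutEnergy ρ o (v t) - l * cutEnergy ρ o (u t)) =
    (∫ t in Ioo t1 t2, exp (-l * t) * (rhsBound C0 ρ M η C1 o (u t) (v t)).toReal) -
    ∫ t in Ioo t1 t2, exp (-l * t) * (2 * cutEnergy ρ o (v t) + l * cutEnergy ρ o (u t)) := by
    rw [← integral_sub (hexp _ hRi) i2]
    congr 1; ext t; ring
  simp only [Pi.sub_apply] at key
  rw [e2] at key
  linarith

/-- The energy inequality starting from the initial time. -/
lemma IsLocalLerayWith.energy_from_zero (h : IsLocalLerayWith s T u₀ u v P) (hu₀ : MemL2uloc u₀)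
    (hT'0 : 0 < T') (hT' : (T' : EReal) < T) (hρ : 0 < ρ) {l : ℝ} (hl : 0 ≤ l) {S : Set ℝ}
    (hSI : S ⊆ Ioo 0 T') (hSae : ∀ᵐ t, t ∈ Ioo 0 T' → t ∈ S) {f R : ℝ → ℝ≥0∞}
    (hS : ∀ t1 ∈ S, ∀ t2 ∈ S, t1 < t2 → ofReal (exp (-l * t2) * cutEnergy ρ o (u t2)) +
    (∫⁻ t in Ioo t1 t2, f t) ≤ ofReal (exp (-l * t1) * cutEnergy ρ o (u t1)) +
    ∫⁻ t in Ioo t1 t2, R t) : ∀ t ∈ S, ofReal (exp (-l * t) * cutEnergy ρ o (u t)) +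
    (∫⁻ τ in Ioo 0 t, f τ) ≤ ofReal (cutEnergy ρ o u₀) + ∫⁻ τ in Ioo 0 t, R τ := fun t ht => by
  have hU : Ioo 0 t = ⋃ n : ℕ, Ioo (1 / ((n : ℝ) + 1)) t := by
    ext τ
    simp only [mem_iUnion, mem_Ioo]
    constructor
    · rintro ⟨h1, h2⟩
      obtain ⟨n, hn⟩ := exists_nat_one_div_lt h1
      exact ⟨n, hn, h2⟩
    · rintro ⟨n, h1, h2⟩
      exact ⟨lt_trans (by positivity) h1, h2⟩
  have hdir : Directed (· ⊆ ·) fun n : ℕ => Ioo (1 / ((n : ℝ) + 1)) t := by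
    refine Monotone.directed_le fun m n hmn => Ioo_subset_Ioo_left ?_
    gcongr
  have hfsup : ∫⁻ τ in Ioo 0 t, f τ = ⨆ n : ℕ, ∫⁻ τ in Ioo (1 / ((n : ℝ) + 1)) t, f τ := by
    conv_lhs => rw [hU]
    exact setLIntegral_iUnion_of_directed _ hdir
  rw [hfsup, ENNReal.add_iSup]
  refine iSup_le fun n => ENNReal.le_of_forall_pos_le_add fun ε hε _ => ?_
  have hb := (h.bounded T' hT'0 hT').exists_bound
  obtain ⟨M, hM, hMb⟩ := hb
  have hev1 : ∀ᶠ τ in 𝓝[>] (0 : ℝ) ⊓ ae volume, τ ∈ Ioo 0 T' :=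
    mem_inf_of_left (Ioo_mem_nhdsGT hT'0)
  have hev2 : ∀ᶠ τ in 𝓝[>] (0 : ℝ) ⊓ ae volume,
    AEStronglyMeasurable (u τ) ∧ wtEnergy (u τ) o < ⊤ := by
    filter_upwards [hev1, hMb.filter_mono inf_le_right] with τ hτ hτ' using ⟨(hτ' hτ).1,
      MemL2uloc.wtEnergy_lt_top ⟨(hτ' hτ).1, (hτ' hτ).2.trans_lt hM⟩ o⟩
  have hε' : (0 : ℝ≥0∞) < ε := by exact_mod_cast hε
  have hev3 := eventually_cutEnergy_le hρ hev2 hu₀.1 (hu₀.wtEnergy_lt_top o)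
    (h.initial _ (isCompact_closedBall o (2 * ρ))) hε'
  obtain ⟨a, haI, ha1, ha2, ha3⟩ := exists_mem_of_ae_nhdsGT
    (lt_min ((hSI ht).1) (by positivity : (0 : ℝ) < 1 / (n + 1)))
    (hev1.and ((hSae.filter_mono inf_le_right).and hev3))
  have hat := haI.2.trans_le (min_le_left _ _)
  calc _ ≤ ofReal (exp (-l * t) * cutEnergy ρ o (u t)) + ∫⁻ τ in Ioo a t, f τ :=
    add_le_add le_rfl (lintegral_mono_set
      (Ioo_subset_Ioo_left (haI.2.trans_le (min_le_right _ _)).le))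
    _ ≤ ofReal (exp (-l * a) * cutEnergy ρ o (u a)) + ∫⁻ τ in Ioo a t, R τ :=
      hS a (ha2 ha1) t ht hat
    _ ≤ (ofReal (cutEnergy ρ o u₀) + ε) + ∫⁻ τ in Ioo 0 t, R τ :=
        add_le_add (le_trans (ofReal_le_ofReal (mul_le_of_le_one_left (cutEnergy_nonneg _ _ _)
          (Real.exp_le_one_iff.2 (by nlinarith [haI.1])))) ha3)
          (lintegral_mono_set (Ioo_subset_Ioo_left haI.1.le))
    _ = _ := by ring

end

/-! ### Uniform decay at infinity -/

lemma lintegral_indicator_one_mul {A : Set E3} (hA : MeasurableSet A) (f : E3 → ℝ≥0∞) :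
    ∫⁻ x, A.indicator 1 x * f x = ∫⁻ x in A, f x := by
  rw [← lintegral_indicator hA]
  refine lintegral_congr fun x => ?_
  by_cases hx : x ∈ A <;> simp [hx]

/-- Fubini for a weight in time and a weight in space. -/
lemma lintegral_time_space {k : ℝ → ℝ≥0∞} (hk : Measurable k) (hkt : ∀ t, k t ≠ ⊤)
    {z : ℝ → E3 → ℝ≥0∞} (hz : AEMeasurable (fun q : ℝ × E3 => z q.1 q.2) ((volume.restrict I).prod
    volume)) {G : E3 → ℝ≥0∞} (hG : Measurable G) (hGt : ∀ x, G x ≠ ⊤) : ∫⁻ t in I, k t * ∫⁻ x, G x *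
    z t x = ∫⁻ x, G x * ∫⁻ t in I, k t * z t x := by
  have e1 : ∀ t, k t * ∫⁻ x, G x * z t x = ∫⁻ x, G x * (k t * z t x) := fun t => by
    rw [← lintegral_const_mul' _ _ (hkt t)]
    exact lintegral_congr fun x => by ring
  simp only [e1]
  rw [lintegral_lintegral_swap]
  · exact lintegral_congr fun x => lintegral_const_mul' _ _ (hGt x)
  · exact (hG.comp measurable_snd).aemeasurable.mul ((hk.comp measurable_fst).aemeasurable.mul hz)

lemma exists_mem_Ioo_of_ae (hab : a < b) {p : ℝ → Prop} (h : ∀ᵐ t, p t) :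
    ∃ t ∈ Ioo a b, p t := exists_mem_of_ae_nhdsGT hab (h.filter_mono inf_le_right)

section

variable {u v : ℝ → E3 → E3}

lemma MemLinftyL2uloc.exists_wtEnergy_le (h : MemLinftyL2uloc T' u) :
    ∃ K : ℝ≥0∞, K < ⊤ ∧ ∀ z, ∫⁻ t in Ioo 0 T', wtEnergy (u t) z ≤ K := by
  obtain ⟨M, hM, hb⟩ := h.exists_bound
  obtain ⟨C, hC, hw⟩ := exists_wtEnergy_le_ulocNorm
  refine ⟨C * M ^ 2 * volume (Ioo 0 T'), mul_lt_top (mul_lt_top hC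
    (pow_lt_top hM)) (by simp), fun z => ?_⟩
  calc _ ≤ ∫⁻ t in Ioo 0 T', C * M ^ 2 := by
        refine lintegral_mono_ae ((ae_restrict_iff' measurableSet_Ioo).2 ?_)
        filter_upwards [hb] with t ht htI
        refine (hw (u t) z (ht htI).1).trans ?_
        gcongr
        exact (ht htI).2
    _ = _ := setLIntegral_const _ _

lemma exists_div_ofReal_le {K : ℝ≥0∞} (hK : K < ⊤) (hε : ε ≠ 0) (hεt : ε ≠ ⊤) :
    ∃ r : ℝ, 2 ≤ r ∧ K / ofReal r ≤ ε := by
  refine ⟨2 + (K / ε).toReal, le_add_of_nonneg_right toReal_nonneg, ENNReal.div_le_of_le_mul ?_⟩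
  rw [ofReal_add zero_le_two toReal_nonneg, ofReal_toReal (div_lt_top hK.ne hε).ne, mul_add]
  exact ((ENNReal.mul_div_cancel hε hεt).ge).trans le_add_self

/-- The local energies of a local Leray solution starting from `E²` are dominated, uniformly in
time, by a function that vanishes at infinity. The radius `ρ`, the small parameter `η` and the
rate `l` are chosen in this order, so that the three parts of the right-hand side of the energy
inequality are each absorbed by the left-hand side. -/
lemma IsLocalLerayWith.exists_decay (h : IsLocalLerayWith s T u₀ u v P) (hs0 : 3 / 4 ≤ s)
    (hs1 : s < 1) (hu₀ : MemE2 u₀) (hT'0 : 0 < T') (hT' : (T' : EReal) < T) :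
    ∃ B : E3 → ℝ≥0∞, Tendsto B (cocompact E3) (𝓝 0) ∧ (∀ o, ∀ᵐ t, t ∈ Ioo 0 T' →
    ∫⁻ x in closedBall o 2, ‖u t x‖ₑ ^ 2 ≤ B o) ∧ ∀ o, ∫⁻ t in Ioo 0 T', ∫⁻ x in closedBall o 2,
    ‖v t x‖ₑ ^ 2 ≤ B o := by
  obtain ⟨M, hM, hsl, C0, hC0, hE⟩ := h.exists_energy_times hs0 hs1 hT'0 hT'
  obtain ⟨Cw, hCw, hav⟩ := lintegral_wtE_mul_le_average
  set A : ℝ≥0∞ := Cw * ∫⁻ y, wtE y with hA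
  have hAt : A < ⊤ := mul_lt_top hCw lintegral_wtE_lt_top
  -- The flux term of `W` below has mass at most `1 / 4`; the factor `512 = 8 ^ 3` is the ratio of
  -- the volumes of the balls of radii `8 * ρ` and `ρ`.
  obtain ⟨ρ, hρ2, hρM⟩ := exists_div_ofReal_le (ε := 1 / 2 / 2)
    (mul_lt_top (mul_lt_top (ofReal_lt_top (r := C0)) hM) (by simp : (512 : ℝ≥0∞) < ⊤)) (by simp)
    (by finiteness)
  have hρ0 : 0 < ρ := by linarith
  -- `η` and then `l` make the mass of the tail term of `W` at most `1 / 4`.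
  obtain ⟨η, hη0, hηt, hηA⟩ := exists_mul_le hAt (η := 1 / 2 / 2 / 2) (by simp) (by finiteness)
  obtain ⟨C1, hC1, hE⟩ := hE ρ hρ2 η (pos_iff_ne_zero.2 hη0) hηt.lt_top
  obtain ⟨l, hl2, hlA⟩ := exists_div_ofReal_le (ε := 1 / 2 / 2 / 2) (mul_lt_top hC1 hAt) (by simp)
    (by finiteness)
  have hl0 : 0 < l := by linarith
  set κ : ℝ≥0∞ := η + C1 / ofReal l with hκ
  have hlE : ofReal l ≠ 0 := (ENNReal.ofReal_pos.2 hl0).ne'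
  have hκA : κ * A ≤ 1 / 2 / 2 := by
    rw [hκ, add_mul, ← ENNReal.mul_div_right_comm]
    exact (add_le_add hηA hlA).trans (add_halves _).le
  have hκt : κ < ⊤ := add_lt_top.2 ⟨hηt.lt_top, div_lt_top hC1.ne hlE⟩
  set a : ℝ≥0∞ := ofReal (C0 / ρ) * M with ha
  have hat : a < ⊤ := mul_lt_top ofReal_lt_top hM
  have hu := h.bounded T' hT'0 hT'
  have hv := h.lam_bounded T' hT'0 hT'
  obtain ⟨Kv, hKv, hKvb⟩ := hv.exists_wtEnergy_le
  obtain ⟨Ku, hKu, hKub⟩ := hu.exists_wtEnergy_le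
  have hum := hu.1
  have hvm := hv.1
  rw [restrict_prod_univ] at hum hvm
  set z : ℝ → E3 → ℝ≥0∞ := fun t x => 2 * ‖v t x‖ₑ ^ 2 + ofReal l * ‖u t x‖ₑ ^ 2 with hz
  set k : ℝ → ℝ≥0∞ := fun t => ofReal (exp (-l * t)) with hk
  have hkm : Measurable k := by rw [hk]; fun_prop
  have hkt : ∀ t, k t ≠ ⊤ := fun t => ofReal_ne_top
  have hzm : AEMeasurable (fun q : ℝ × E3 => z q.1 q.2) ((volume.restrict (Ioo 0 T')).prod
    volume) :=
    ((hvm.enorm.pow_const 2).const_mul 2).add ((hum.enorm.pow_const 2).const_mul _)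
  set Z : E3 → ℝ≥0∞ := fun x => ∫⁻ t in Ioo 0 T', k t * z t x with hZ
  have hZm : AEMeasurable Z volume :=
    ((hkm.comp measurable_fst).aemeasurable.mul hzm).lintegral_prod_left'
  set D : E3 → ℝ≥0∞ := fun o => ∫⁻ x in closedBall o ρ, Z x with hD
  have hDm : Measurable D := measurable_setLIntegral hZm (measurableSet_dist_le ρ)
  set e₀ : E3 → ℝ≥0∞ := fun o => ofReal (cutEnergy ρ o u₀) with he₀
  set Q : E3 → ℝ≥0∞ := fun o => ∫⁻ t in Ioo 0 T', k t * rhsBound C0 ρ M η C1 o (u t) (v t) with hQ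
  have hwt : ∀ o : E3, Measurable fun x : E3 => wtE (x - o) := fun o =>
    measurable_wtE.comp (measurable_id.sub_const o)
  have hball : ∀ (o : E3) (r : ℝ), ∫⁻ t in Ioo 0 T', k t * ∫⁻ x in closedBall o r, z t x =
      ∫⁻ x in closedBall o r, Z x := fun o r => by
    simp only [← lintegral_indicator_one_mul measurableSet_closedBall]
    refine lintegral_time_space hkm hkt hzm (measurable_one.indicator measurableSet_closedBall)
      fun x => ?_
    by_cases hx : x ∈ closedBall o r <;> simp [hx]
  have hwZ : ∀ o : E3, ∫⁻ t in Ioo 0 T', k t * ∫⁻ x, wtE (x - o) * z t x = ∫⁻ x, wtE (x - o) *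
    Z x := fun o => lintegral_time_space hkm hkt hzm (hwt o) fun x => ofReal_ne_top
  have hslice : ∀ᵐ t ∂(volume.restrict (Ioo 0 T')), AEStronglyMeasurable (u t) ∧
    AEStronglyMeasurable (v t) ∧ wtEnergy (u t) 0 < ⊤ ∧ wtEnergy (v t) 0 < ⊤ := by
    refine (ae_restrict_iff' measurableSet_Ioo).2 ?_
    filter_upwards [hsl] with t ht htI using ⟨(ht htI).meas_u, (ht htI).meas_v,
      (ht htI).wtEnergy_lt_top hM 0, (ht htI).energy_v⟩
  have hQle : ∀ o, Q o ≤ a * (∫⁻ x in closedBall o (7 * ρ), Z x) +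
    κ * ∫⁻ x, wtE (x - o) * Z x := by
    intro o
    rw [← hball, ← hwZ, ← lintegral_const_mul' _ _ hat.ne, ← lintegral_const_mul' _ _ hκt.ne]
    have hm : AEMeasurable (fun t => κ * (k t * ∫⁻ x, wtE (x - o) * z t x))
        (volume.restrict (Ioo 0 T')) :=
      (hkm.aemeasurable.mul (((hwt o).comp measurable_snd).aemeasurable.mul
        hzm).lintegral_prod_right').const_mul _
    rw [← lintegral_add_right' _ hm]
    refine lintegral_mono_ae ?_
    filter_upwards [hslice] with t ht
    have h1 : ∫⁻ x in closedBall o (7 * ρ), ‖v t x‖ₑ ^ 2 ≤ ∫⁻ x in closedBall o (7 * ρ), z t x :=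
      lintegral_mono fun x => (le_mul_of_one_le_left' one_le_two).trans le_self_add
    have h2 : wtEnergy (v t) o ≤ ∫⁻ x, wtE (x - o) * z t x := lintegral_mono fun x =>
      mul_le_mul_right ((le_mul_of_one_le_left' one_le_two).trans le_self_add) _
    have h3 : C1 * wtEnergy (u t) o ≤
      C1 / ofReal l * ∫⁻ x, wtE (x - o) * z t x := by
      rw [wtEnergy, ← lintegral_const_mul' _ _ hC1.ne,
        ← lintegral_const_mul' _ _ (div_lt_top hC1.ne hlE).ne]
      refine lintegral_mono fun x => ?_
      calc _ = C1 / ofReal l * (wtE (x - o) *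
            (ofReal l * ‖u t x‖ₑ ^ 2)) := by
            rw [show C1 / ofReal l * (wtE (x - o) * (ofReal l * ‖u t x‖ₑ ^ 2)) =
              (C1 / ofReal l * ofReal l) * (wtE (x - o) * ‖u t x‖ₑ ^ 2) by ring,
              ENNReal.div_mul_cancel hlE ofReal_ne_top]
        _ ≤ _ := by gcongr; exact le_add_self
    calc k t * rhsBound C0 ρ M η C1 o (u t) (v t)
        ≤ k t * (a * (∫⁻ x in closedBall o (7 * ρ), z t x) +
          η * (∫⁻ x, wtE (x - o) * z t x) +
          C1 / ofReal l * ∫⁻ x, wtE (x - o) * z t x) := by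
          rw [rhsBound]
          gcongr
      _ = _ := by rw [hκ]; ring
  set β : ℝ≥0∞ := volume (closedBall (0 : E3) ρ) with hβ
  have hβ0 : β ≠ 0 := (Metric.measure_closedBall_pos volume 0 hρ0).ne'
  have hβt : β ≠ ⊤ := measure_closedBall_lt_top.ne
  set W : E3 → ℝ≥0∞ := fun y =>
    a * β⁻¹ * (closedBall (0 : E3) (8 * ρ)).indicator 1 y + κ * Cw * wtE y with hW
  have hWm : Measurable W := ((measurable_one.indicator measurableSet_closedBall).const_mul _).add
    (measurable_wtE.const_mul _)
  have hWI : ∫⁻ y, W y ≤ 1 / 2 := by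
    have e1 : ∫⁻ y, W y = a * 512 + κ * A := by
      rw [hW, lintegral_add_right _ (measurable_wtE.const_mul _),
        lintegral_const_mul _ (measurable_one.indicator measurableSet_closedBall),
        lintegral_const_mul _ measurable_wtE, lintegral_indicator_one measurableSet_closedBall,
        Measure.addHaar_closedBall_mul volume (0 : E3) (by norm_num : (0 : ℝ) ≤ 8) hρ0.le, hA]
      have : ofReal (8 ^ Module.finrank ℝ E3) = 512 := by rw [finrank_euclideanSpace_fin]; norm_num
      rw [this, ← hβ, mul_assoc κ, mul_assoc a, mul_left_comm β⁻¹, ENNReal.inv_mul_cancel hβ0 hβt,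
        mul_one]
    rw [e1, ha, ofReal_div_of_pos hρ0, ← ENNReal.mul_div_right_comm, ← ENNReal.mul_div_right_comm]
    exact (add_le_add hρM hκA).trans (ENNReal.add_halves _).le
  have hQW : ∀ o, Q o ≤ ∫⁻ y, W (y - o) * D y := fun o => by
    refine (hQle o).trans ?_
    have h1 : ∫⁻ x in closedBall o (7 * ρ), Z x ≤
      β⁻¹ * ∫⁻ y, (closedBall (0 : E3) (8 * ρ)).indicator 1 (y - o) * D y := by
      have := mul_lintegral_closedBall_le hZm o (7 * ρ) ρ
      rw [show 7 * ρ + ρ = 8 * ρ by ring, ← hβ, mul_comm] at this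
      rw [mul_comm β⁻¹, ← div_eq_mul_inv, ENNReal.le_div_iff_mul_le (Or.inl hβ0) (Or.inl hβt)]
      refine this.trans (le_of_eq ?_)
      rw [← lintegral_indicator_one_mul measurableSet_closedBall]
      refine lintegral_congr fun y => ?_
      congr 1
      simp only [indicator, mem_closedBall, dist_eq_norm, sub_zero, Pi.one_apply]
    have h2 : ∫⁻ x, wtE (x - o) * Z x ≤ Cw * ∫⁻ y, wtE (y - o) * D y := by
      refine (hav Z o hZm).trans (mul_le_mul_right (lintegral_mono fun y => ?_) _)
      exact mul_le_mul_right (lintegral_mono_set (Metric.ball_subset_closedBall.trans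
        (closedBall_subset_closedBall (by linarith)))) _
    have hm1 : Measurable fun y => κ * Cw * (wtE (y - o) * D y) := ((hwt o).mul hDm).const_mul _
    calc _ ≤ a * (β⁻¹ * ∫⁻ y, (closedBall (0 : E3) (8 * ρ)).indicator 1 (y - o) * D y) +
      κ * (Cw * ∫⁻ y, wtE (y - o) * D y) := by gcongr
      _ = ∫⁻ y, (a * β⁻¹ * ((closedBall (0 : E3) (8 * ρ)).indicator 1 (y - o) * D y) +
          κ * Cw * (wtE (y - o) * D y)) := by
          rw [lintegral_add_right _ hm1, lintegral_const_mul' _ _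
            (mul_lt_top hat (inv_lt_top.2 (pos_iff_ne_zero.2 hβ0))).ne, lintegral_const_mul' _ _
            (mul_lt_top hκt hCw).ne, mul_assoc a, mul_assoc κ]
      _ = _ := lintegral_congr fun y => by rw [hW]; ring
  -- the energy inequality on the whole time interval
  have hmain : ∀ o, D o ≤ e₀ o + Q o ∧ ∀ᵐ t, t ∈ Ioo 0 T' →
    k t * ∫⁻ x in closedBall o ρ, ‖u t x‖ₑ ^ 2 ≤ e₀ o + Q o := fun o => by
    obtain ⟨S, hSI, hSae, hS⟩ := hE o l hl0.le
    have hz0 := h.energy_from_zero hu₀.1 hT'0 hT' hρ0 hl0.le hSI hSae hS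
    have hRle : ∀ t ∈ S, (∫⁻ τ in Ioo 0 t, ofReal (exp (-l * τ)) * rhsBound C0 ρ M η C1 o (u τ)
      (v τ)) ≤ Q o := fun t ht => lintegral_mono_set (Ioo_subset_Ioo_right (hSI ht).2.le)
    constructor
    · have hU : Ioo 0 T' = ⋃ q : {q : ℚ // (q : ℝ) < T'}, Ioo 0 (q : ℝ) := by
        ext τ
        simp only [mem_iUnion, mem_Ioo]
        exact ⟨fun h => let ⟨q, h1, h2⟩ := exists_rat_btwn h.2; ⟨⟨q, h2⟩, h.1, h1⟩,
          fun ⟨q, h⟩ => ⟨h.1, h.2.trans q.2⟩⟩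
      set f := fun t => ofReal (exp (-l * t) *
        (2 * cutEnergy ρ o (v t) + l * cutEnergy ρ o (u t))) with hf
      have h1 : ∫⁻ t in Ioo 0 T', f t ≤ e₀ o + Q o := by
        rw [hU]
        refine (setLIntegral_iUnion_of_directed _ (Monotone.directed_le fun p q hpq => ?_)).trans_le
          (iSup_le fun q => ?_)
        · exact Ioo_subset_Ioo_right (Rat.cast_le.2 hpq)
        obtain ⟨t, htI, ht⟩ := exists_mem_Ioo_of_ae (max_lt hT'0 q.2) hSae
        have htS := ht ⟨(le_max_left _ _).trans_lt htI.1, htI.2⟩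
        calc _ ≤ ∫⁻ τ in Ioo 0 t, f τ :=
          lintegral_mono_set (Ioo_subset_Ioo_right ((le_max_right _ _).trans htI.1.le))
          _ ≤ _ := le_add_self
          _ ≤ _ := hz0 t htS
          _ ≤ _ := add_le_add le_rfl (hRle t htS)
      refine le_trans ?_ h1
      rw [hD]; simp only
      rw [← hball]
      refine lintegral_mono_ae ?_
      filter_upwards [hslice] with t ht
      rw [hf, hk]; simp only
      rw [ofReal_mul (exp_pos _).le]
      refine mul_le_mul_right ?_ _
      rw [ofReal_add (mul_nonneg zero_le_two (cutEnergy_nonneg _ _ _))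
        (mul_nonneg hl0.le (cutEnergy_nonneg _ _ _)), ofReal_mul zero_le_two,
        ofReal_mul hl0.le, ofReal_ofNat]
      have m2 : AEMeasurable (fun x => ofReal l * ‖u t x‖ₑ ^ 2)
          (volume.restrict (closedBall o ρ)) :=
        ((ht.1.enorm.pow_const 2).const_mul _).restrict
      rw [hz, lintegral_add_right' _ m2, lintegral_const_mul' _ _ ofNat_ne_top,
        lintegral_ofReal_mul]
      gcongr
      · exact setLIntegral_le_cutEnergy hρ0 ht.2.1 (wtEnergy_lt_top ht.2.2.2 o)
      · exact setLIntegral_le_cutEnergy hρ0 ht.1 (wtEnergy_lt_top ht.2.2.1 o)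
    · filter_upwards [hSae, (ae_restrict_iff' measurableSet_Ioo).1 hslice] with t ht hts htI
      calc _ ≤ k t * ofReal (cutEnergy ρ o (u t)) := mul_le_mul_right
            (setLIntegral_le_cutEnergy hρ0 (hts htI).1 (wtEnergy_lt_top (hts htI).2.2.1 o)) _
        _ = ofReal (exp (-l * t) * cutEnergy ρ o (u t)) :=
          (ofReal_mul (exp_pos _).le).symm
        _ ≤ _ := le_self_add
        _ ≤ _ := hz0 t (ht htI)
        _ ≤ _ := add_le_add le_rfl (hRle t (ht htI))
  have he0 : Tendsto e₀ (cocompact E3) (𝓝 0) := by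
    refine tendsto_of_tendsto_of_tendsto_of_le_of_le tendsto_const_nhds ?_ (fun _ => zero_le)
      (fun x => ofReal_cutEnergy_le hρ0 hu₀.1.1 (hu₀.1.wtEnergy_lt_top x))
    simpa using ENNReal.Tendsto.const_mul hu₀.tendsto_wtEnergy (Or.inr ofReal_ne_top)
  have hk1 : ∀ t ∈ Ioo 0 T', k t ≤ 1 := fun t ht => by
    rw [hk]; simp only
    rw [ENNReal.ofReal_le_one, Real.exp_le_one_iff]
    nlinarith [ht.1]
  have hZK : ∀ o, ∫⁻ x, wtE (x - o) * Z x ≤ 2 * Kv + ofReal l * Ku := fun o => by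
    rw [← hwZ]
    calc _ ≤ ∫⁻ t in Ioo 0 T', (2 * wtEnergy (v t) o + ofReal l * wtEnergy (u t) o) := by
          refine lintegral_mono_ae ?_
          filter_upwards [hslice, ae_restrict_mem measurableSet_Ioo] with t ht htI
          refine (mul_le_of_le_one_left' (hk1 t htI)).trans (le_of_eq ?_)
          have m2 : AEMeasurable fun x => wtE (x - o) * ‖u t x‖ₑ ^ 2 :=
            (hwt o).aemeasurable.mul (ht.1.enorm.pow_const 2)
          rw [wtEnergy, wtEnergy, ← lintegral_const_mul' _ _ ofNat_ne_top,
            ← lintegral_ofReal_mul,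
            ← lintegral_add_right' _ (m2.const_mul _)]
          exact lintegral_congr fun x => by rw [hz]; ring
      _ = 2 * (∫⁻ t in Ioo 0 T', wtEnergy (v t) o) +
        ofReal l * ∫⁻ t in Ioo 0 T', wtEnergy (u t) o := by
        rw [lintegral_add_right' _ ((aemeasurable_wtEnergy hum o).const_mul _), lintegral_const_mul'
          _ _ ofNat_ne_top, lintegral_ofReal_mul]
      _ ≤ _ := by
        gcongr
        exacts [hKvb o, hKub o]
  set K : ℝ≥0∞ := ofReal ((1 + ρ) ^ (15 / 4 : ℝ)) * (2 * Kv + ofReal l * Ku) with hK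
  have hKt : K < ⊤ := by finiteness
  have hDK : ∀ o, D o ≤ K := fun o => by
    refine le_trans ?_ (mul_le_mul_right (hZK o) _)
    rw [hD, ← lintegral_ofReal_mul]; simp only
    refine (setLIntegral_mono' measurableSet_closedBall fun x hx => ?_).trans
      (setLIntegral_le_lintegral _ _)
    rw [← mul_assoc]
    exact le_mul_of_one_le_left' (one_le_mul_wtE (by simpa [dist_eq_norm] using hx))
  have hWD := tendsto_lintegral_sub_mul hWm (hWI.trans_lt (by simp)) hDm hKt hDK
    (tendsto_zero_of_le_lintegral hWm hWI hDm hKt hDK he0 fun o => (hmain o).1.trans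
    (add_le_add le_rfl (hQW o)))
  -- removal of the integrating factor
  have hkinv : ∀ t ∈ Ioo 0 T', ∀ y : ℝ≥0∞, y ≤ ofReal (exp (l * T')) * (k t * y) :=
    fun t ht y => by
    rw [← mul_assoc, hk, ← ofReal_mul (exp_pos _).le, ← Real.exp_add]
    refine le_mul_of_one_le_left' ?_
    rw [ENNReal.one_le_ofReal, Real.one_le_exp_iff]
    nlinarith [ht.2]
  refine ⟨fun o => ofReal (exp (l * T')) * (e₀ o + ∫⁻ y, W (y - o) * D y),
    by simpa using ENNReal.Tendsto.const_mul (he0.add hWD) (Or.inr ofReal_ne_top),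
    fun o => ?_, fun o => ?_⟩
  · filter_upwards [(hmain o).2] with t ht htI
    exact (lintegral_mono_set (closedBall_subset_closedBall hρ2)).trans
      ((hkinv t htI _).trans (mul_le_mul_right ((ht htI).trans (add_le_add le_rfl (hQW o))) _))
  · calc _ ≤ ∫⁻ t in Ioo 0 T', ofReal (exp (l * T')) *
          (k t * ∫⁻ x in closedBall o ρ, z t x) := by
          exact setLIntegral_mono' measurableSet_Ioo fun t ht =>
            le_trans ((lintegral_mono_set (closedBall_subset_closedBall hρ2)).trans
            (lintegral_mono fun x => (le_mul_of_one_le_left' one_le_two).trans le_self_add))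
            (hkinv t ht _)
      _ = ofReal (exp (l * T')) * D o := by rw [lintegral_ofReal_mul, hball]
      _ ≤ _ := mul_le_mul_right ((hmain o).1.trans (add_le_add le_rfl (hQW o))) _

end

/-! ### Weakly continuous representatives -/

/-- A family of vectors, locally bounded on `G`, whose inner products with a dense set `D` extend
to continuous functions on `I ⊆ closure G` has a weakly continuous extension to `I`. -/
lemma exists_weak_extension {H : Type*} [NormedAddCommGroup H] [InnerProductSpace ℝ H]
    [CompleteSpace H] {G : Set ℝ} (hI : I ⊆ closure G) {F : ℝ → H}
    (hb : ∀ t ∈ I, ∃ C, ∀ᶠ τ in 𝓝[G] t, ‖F τ‖ ≤ C) {D : Set H} (hD : Dense D) {ℓ : H → ℝ → ℝ}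
    (hc : ∀ d ∈ D, ContinuousOn (ℓ d) I) (hGI : G ⊆ I) (hℓ : ∀ t ∈ G, ∀ d ∈ D, inner ℝ (F t) d =
    ℓ d t) : ∃ W : ℝ → H, (∀ t ∈ G, W t = F t) ∧ ∀ h, ContinuousOn (fun t => inner ℝ (W t) h)
    I := by
  -- at each time, a weak limit along an ultrafilter
  have h1 : ∀ t ∈ I, ∃ w : H, (∀ d ∈ D, inner ℝ w d = ℓ d t) ∧
    ∀ C, (∀ᶠ τ in 𝓝[G] t, ‖F τ‖ ≤ C) → ‖w‖ ≤ C := fun t ht => by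
    have := mem_closure_iff_nhdsWithin_neBot.1 (hI ht)
    obtain ⟨C, hC⟩ := hb t ht
    set U := Ultrafilter.of (𝓝[G] t)
    have hU : U ≤ 𝓝[G] t := Ultrafilter.of_le _
    have hin : ∀ {C h τ}, ‖F τ‖ ≤ C → |inner ℝ (F τ) h| ≤ C * ‖h‖ := fun hτ =>
      (abs_real_inner_le_norm _ _).trans (by gcongr)
    have hlim : ∀ h, ∃ a, Tendsto (fun τ => inner ℝ (F τ) h) U (𝓝 a) := fun h => by
      obtain ⟨a, -, ha⟩ := (isCompact_Icc).ultrafilter_le_nhds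
        (U.map fun τ => inner ℝ (F τ) h)
        (le_principal_iff.2 ((hC.filter_mono hU).mono fun τ hτ => abs_le.1 (hin hτ)))
      exact ⟨a, ha⟩
    choose L hL using hlim
    have hLb : ∀ C, (∀ᶠ τ in 𝓝[G] t, ‖F τ‖ ≤ C) → ∀ h, |L h| ≤ C * ‖h‖ := fun C hC h =>
      le_of_tendsto (hL h).abs ((hC.filter_mono hU).mono fun τ hτ => hin hτ)
    let L' : H →ₗ[ℝ] ℝ :=
      { toFun := L
        map_add' := fun a b => tendsto_nhds_unique (hL (a + b))
          (by simpa only [inner_add_right] using (hL a).add (hL b))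
        map_smul' := fun c a => tendsto_nhds_unique (hL (c • a))
          (by simpa only [inner_smul_right, smul_eq_mul, RingHom.id_apply] using (hL a).const_mul c)
            }
    set w := (InnerProductSpace.toDual ℝ H).symm (L'.mkContinuous C (hLb C hC)) with hw
    have hwL : ∀ h, inner ℝ w h = L h := fun h => by
      rw [hw, InnerProductSpace.toDual_symm_apply]; rfl
    refine ⟨w, fun d hd => ?_, fun C' hC' => ?_⟩
    · rw [hwL]
      refine tendsto_nhds_unique (hL d) ((((hc d hd t ht).mono hGI).mono_left hU).congr' ?_)
      filter_upwards [hU self_mem_nhdsWithin] with τ hτ using (hℓ τ hτ d hd).symm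
    · have h0 : 0 ≤ C' := by
        obtain ⟨τ, hτ⟩ := hC'.exists
        exact (norm_nonneg _).trans hτ
      have h2 := (le_abs_self _).trans (hLb C' hC' w)
      rw [← hwL, real_inner_self_eq_norm_sq] at h2
      by_contra! hcon
      nlinarith
  choose! W hW hWb using h1
  refine ⟨W, fun t ht => hD.eq_of_inner_left ℝ fun d hd => ?_, fun h t ht => ?_⟩
  · rw [hW t (hGI ht) d hd, hℓ t ht d hd]
  · obtain ⟨C, hC⟩ := hb t ht
    have hev : ∀ᶠ τ in 𝓝[I] t, ‖W τ‖ ≤ C := by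
      filter_upwards [mem_nhdsWithin_of_mem_nhds (eventually_nhds_nhdsWithin.2 hC),
        self_mem_nhdsWithin] with τ hτ hτI using hWb τ hτI C hτ
    have hC0 := (norm_nonneg _).trans (hWb t ht C hC)
    refine Metric.tendsto_nhds.2 fun ε hε => ?_
    obtain ⟨d, hd, hdh⟩ := hD.exists_dist_lt h (by positivity : 0 < ε / 3 / (C + 1))
    have hd' : C * ‖h - d‖ ≤ ε / 3 := by
      rw [dist_eq_norm, lt_div_iff₀ (by positivity)] at hdh
      nlinarith [norm_nonneg (h - d)]
    have hdiff : ∀ τ, ‖W τ‖ ≤ C → |inner ℝ (W τ) h - inner ℝ (W τ) d| ≤ ε / 3 := fun τ hτ => by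
      rw [← inner_sub_right]
      exact (abs_real_inner_le_norm _ _).trans ((by gcongr : _ ≤ C * ‖h - d‖).trans hd')
    filter_upwards [hev, Metric.tendsto_nhds.1 (((hc d hd).congr fun τ hτ => hW τ hτ d hd) t ht)
      (ε / 3) (by positivity)] with τ h1 h2
    have h3 := abs_le.1 (hdiff τ h1)
    have h4 := abs_le.1 (hdiff t (hWb t ht C hC))
    rw [dist_eq, abs_lt] at h2 ⊢
    constructor <;> linarith [h2.2, h3.2]


lemma eLpNorm_sqrt_wt_smul (f : E3 → E3) : eLpNorm (fun x => √(wt x) • f x) 2 volume ^ 2 =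
    wtEnergy f 0 := by
  rw [eLpNorm_two_sq]
  refine lintegral_congr fun x => ?_
  rw [enorm_smul, mul_pow, enorm_of_nonneg (Real.sqrt_nonneg _),
    ← ofReal_pow (Real.sqrt_nonneg _), Real.sq_sqrt (wt_pos x).le, sub_zero, wtE]

lemma memLp_sqrt_wt_smul (hf : AEStronglyMeasurable f) (hw : wtEnergy f 0 < ⊤) :
    MemLp (fun x => √(wt x) • f x) 2 volume :=
  ⟨continuous_wt.sqrt.aestronglyMeasurable.smul hf, (pow_lt_top_iff.1
    ((eLpNorm_sqrt_wt_smul f).trans_lt hw)).resolve_right two_ne_zero⟩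

/-- The vector field with the components `g i`. -/
def ofComponents (g : Fin 3 → testSpace) (x : E3) : E3 := WithLp.toLp 2 fun i => (g i : E3 → ℝ) x

lemma continuous_ofComponents (g : Fin 3 → testSpace) : Continuous (ofComponents g) :=
  (PiLp.continuous_toLp 2 _).comp (continuous_pi fun i => (g i).2.1.continuous)

lemma hasCompactSupport_ofComponents (g : Fin 3 → testSpace) :
    HasCompactSupport (ofComponents g) := by
  refine HasCompactSupport.intro (isCompact_iUnion fun i => (g i).2.2.1.isCompact) fun x hx => ?_
  ext i
  exact image_eq_zero_of_notMem_tsupport (f := (g i : E3 → ℝ)) fun h => hx (mem_iUnion.2 ⟨i, h⟩)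

lemma memLp_ofComponents (g : Fin 3 → testSpace) :
    MemLp (fun x => (√(wt x))⁻¹ • ofComponents g x) 2 volume :=
  ((continuous_wt.sqrt.inv₀ fun x => (Real.sqrt_pos.2 (wt_pos x)).ne').smul (continuous_ofComponents
    g)).memLp_of_hasCompactSupport (hasCompactSupport_ofComponents g).smul_left

lemma dense_ofComponents : Dense (range fun g : Fin 3 → testSpace => (memLp_ofComponents
    g).toLp) := by
  let K : (Fin 3 → testSpace) →ₗ[ℝ] Lp E3 2 volume :=
    { toFun := fun g => (memLp_ofComponents g).toLp
      map_add' := fun g h => by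
        rw [← MemLp.toLp_add]
        refine MemLp.toLp_congr _ _ (.of_forall fun x => ?_)
        ext i; simp [ofComponents, mul_add]
      map_smul' := fun c g => by
        rw [← MemLp.toLp_const_smul]
        refine MemLp.toLp_congr _ _ (.of_forall fun x => ?_)
        ext i; simp [ofComponents, mul_left_comm] }
  change Dense (LinearMap.range K : Set (Lp E3 2 (volume : Measure E3)))
  rw [Submodule.dense_iff_topologicalClosure_eq_top, Submodule.topologicalClosure_eq_top_iff,
    Submodule.eq_bot_iff]
  intro f hf
  have hfi := fun i => by
    refine ae_eq_zero_of_integral_contDiff_smul_eq_zero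
      ((((Lp.memLp f).mono (aestronglyMeasurable_apply (Lp.memLp f).1 i) (.of_forall fun x =>
      PiLp.norm_apply_le (f x) i)).locallyIntegrable one_le_two).smul_continuous
      (continuous_wt.sqrt.inv₀ fun x => (Real.sqrt_pos.2 (wt_pos x)).ne')) fun g hg hgs => ?_
    have h0 := hf _ ⟨Pi.single i (⟨g, hg, hgs, subset_univ _⟩), rfl⟩
    rw [L2.inner_def] at h0
    rw [← h0]
    refine integral_congr_ae ?_
    filter_upwards [(memLp_ofComponents
      (Pi.single i (⟨g, hg, hgs, subset_univ _⟩))).coeFn_toLp] with x hx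
    change _ = inner ℝ ((memLp_ofComponents _).toLp _ x) (f x)
    rw [hx, real_inner_smul_left, PiLp.inner_apply, Finset.sum_eq_single i]
    · simp [ofComponents]; ring
    · intro j _ hj; simp [ofComponents, hj]
    · simp
  refine (Lp.eq_zero_iff_ae_eq_zero).2 ?_
  filter_upwards [hfi 0, hfi 1, hfi 2] with x h0 h1 h2
  have hr := inv_ne_zero (Real.sqrt_pos.2 (wt_pos x)).ne'
  ext i
  fin_cases i
  exacts [(mul_eq_zero.1 h0).resolve_right hr, (mul_eq_zero.1 h1).resolve_right hr,
    (mul_eq_zero.1 h2).resolve_right hr]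

/-! ### The evolution of the pairings with test functions -/

/-- A locally integrable function with integrable weak derivative `h` on `(0, T')` is, almost
everywhere, the primitive of `h` that starts from its essential limit at `0`. -/
lemma ae_eq_primitive_of_weak_deriv {e₀ : ℝ} {e h : ℝ → ℝ} (he : IntegrableOn e (Ioo 0 T'))
    (hh : IntegrableOn h (Ioo 0 T')) (hw : ∀ θ, IsTest (Ioo 0 T') θ →
    (∫ t in Ioo 0 T', deriv θ t * e t) + ∫ t in Ioo 0 T', θ t * h t = 0) (h0 :
    Tendsto e (𝓝[>] 0 ⊓ ae volume) (𝓝 e₀)) : ∀ᵐ t, t ∈ Ioo 0 T' → e t = e₀ +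
    ∫ τ in (0)..t, h τ := by
  obtain ⟨S₁, -, hS₁, h1⟩ := exists_times_of_weak_ineq he hh fun θ hθ _ => (hw θ hθ).ge
  obtain ⟨S₂, -, hS₂, h2⟩ := exists_times_of_weak_ineq he.neg hh.neg fun θ hθ _ => by
    simp only [Pi.neg_apply, mul_neg, integral_neg]
    linarith [hw θ hθ]
  filter_upwards [hS₁, hS₂] with t ht1 ht2 htI
  have hne : (𝓝[>] (0 : ℝ) ⊓ ae volume).NeBot := ⟨fun hbot => by
    obtain ⟨_, _, h⟩ := exists_mem_of_ae_nhdsGT zero_lt_one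
      (by rw [hbot]; exact mem_bot)
    exact h⟩
  have hi : IntervalIntegrable h volume 0 t := (intervalIntegrable_iff_integrableOn_Ioo_of_le
    htI.1.le).2 (hh.mono_set (Ioo_subset_Ioo_right htI.2.le))
  have hprim : Tendsto (fun a => ∫ τ in (0)..a, h τ) (𝓝[>] 0 ⊓ ae volume) (𝓝 0) := by
    have := intervalIntegral.continuousOn_primitive_interval' hi left_mem_uIcc 0 left_mem_uIcc
    rw [ContinuousWithinAt, intervalIntegral.integral_same] at this
    refine this.mono_left (inf_le_left.trans (nhdsWithin_le_of_mem ?_))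
    rw [uIcc_of_le htI.1.le]
    exact Icc_mem_nhdsGT htI.1
  have hlim : Tendsto (fun a => e a + ((∫ τ in (0)..t, h τ) - ∫ τ in (0)..a, h τ))
    (𝓝[>] 0 ⊓ ae volume) (𝓝 (e₀ + ((∫ τ in (0)..t, h τ) - 0))) := h0.add (hprim.const_sub _)
  rw [sub_zero] at hlim
  refine tendsto_nhds_unique (tendsto_const_nhds.congr' ?_) hlim
  filter_upwards [mem_inf_of_left (Ioo_mem_nhdsGT htI.1), mem_inf_of_right hS₁,
    mem_inf_of_right hS₂] with a ha ha1 ha2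
  have haI : a ∈ Ioo 0 T' := ⟨ha.1, ha.2.trans htI.2⟩
  have b1 := h1 a (ha1 haI) t (ht1 htI) ha.2
  have b2 := h2 a (ha2 haI) t (ht2 htI) ha.2
  simp only [Pi.neg_apply, integral_neg] at b2
  have hi' : IntervalIntegrable h volume 0 a := hi.mono_set (by
    rw [uIcc_of_le ha.1.le, uIcc_of_le htI.1.le]; exact Icc_subset_Icc_right ha.2.le)
  rw [intervalIntegral.integral_interval_sub_left hi hi',
    intervalIntegral.integral_of_le ha.2.le, integral_Ioc_eq_integral_Ioo]
  linarith

lemma integrable_apply_mul_test (hf : AEStronglyMeasurable f) (hw : wtEnergy f 0 < ⊤) (i : Fin 3)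
    (hg : IsTest univ g) : Integrable fun x => f x i * g x :=
  isTestOp_id.integrable_mul (aestronglyMeasurable_apply hf i) ((lintegral_wtE_enorm_le _).trans_lt
    (add_lt_top.2 ⟨lintegral_wtE_lt_top, (wtEnergy_apply_le _ i 0).trans_lt hw⟩)) hg

/-- The density in space of the time derivative of `∫ uᵢ g`, with the pressure expressed by the
velocity. -/
noncomputable def momentumDensity (s : ℝ) (u : ℝ → E3 → E3) (i : Fin 3) (g : E3 → ℝ) (t : ℝ)
    (x : E3) : ℝ :=
  -(u t x i * lam (2 * s) g x) + ∑ j, u t x j * u t x i * pd j g x -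
    ∑ j, ∑ k, u t x j * u t x k * rieszPair j k (pd i g) x

section

variable {u v : ℝ → E3 → E3}

lemma integrable_momentumDensity (hs0 : 3 / 4 ≤ s) (hs1 : s < 1) (hu : MemLinftyL2uloc T' u)
    (i : Fin 3) (hg : IsTest univ g) :
    Integrable (fun z : ℝ × E3 => momentumDensity s u i g z.1 z.2)
    ((volume.restrict (Ioo 0 T')).prod volume) := by
  have huw := hu.lintegral_wtEnergy_lt_top
  have huu := isSlabWeighted_apply_mul hu.1 huw
  refine (((isSlabWeighted_apply hu.1 huw i).integrable_prod (isTestOp_lam (by linarith)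
    (by linarith)) hg).neg.add (integrable_finsetSum _ fun j _ => (huu j i).integrable_prod
    (isTestOp_pd j) hg)).sub (integrable_finsetSum _ fun j _ => integrable_finsetSum _ fun k _ =>
    (huu j k).integrable_prod (isTestOp_rieszPair_pd j k i) hg)

lemma IsLocalLerayWith.weak_deriv (h : IsLocalLerayWith s T u₀ u v P) (hs0 : 3 / 4 ≤ s)
    (hs1 : s < 1) (hT'0 : 0 < T') (hT' : (T' : EReal) < T) (i : Fin 3) (hg : IsTest univ g)
    (hθ : IsTest (Ioo 0 T') θ) : (∫ t in Ioo 0 T', deriv θ t * ∫ x, u t x i * g x) +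
    ∫ t in Ioo 0 T', θ t * ∫ x, momentumDensity s u i g t x = 0 := by
  have hu := h.bounded T' hT'0 hT'
  have hui := isSlabWeighted_apply hu.1 hu.lintegral_wtEnergy_lt_top i
  have huu := isSlabWeighted_apply_mul hu.1 hu.lintegral_wtEnergy_lt_top
  have hθ' := hθ.mono (Ioo_subset_timeIoo le_rfl hT')
  have hd : IsTest (Ioo 0 T') (deriv θ) :=
    ⟨hθ.1.iterate_deriv 1, hθ.2.1.deriv, tsupport_deriv_subset.trans hθ.2.2⟩
  obtain ⟨A, hA⟩ := hθ.exists_abs_le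
  obtain ⟨A', hA'⟩ := hd.exists_abs_le
  have I1 := setIntegral_slab_mul le_rfl hT' hd.1.continuous ((subset_tsupport _).trans hd.2.2) hA'
    (F := fun t x => u t x i * g x) (hui.integrable_prod isTestOp_id hg)
  have I2 := fun F hF => setIntegral_slab_mul le_rfl hT' hθ.1.continuous
    ((subset_tsupport _).trans hθ.2.2) hA (F := F) hF
  have I3 := I2 _ (integrable_momentumDensity hs0 hs1 hu i hg)
  set R := fun t x => ∑ j, ∑ k, u t x j * u t x k * rieszPair j k (pd i g) x
  have I4 := (I2 R (integrable_finsetSum _ fun j _ => integrable_finsetSum _ fun k _ =>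
    (huu j k).integrable_prod (isTestOp_rieszPair_pd j k i) hg)).1
  have hp := h.pressure _ (isTest_prod_single hθ' hg i)
  have er : ∀ (j k : Fin 3) (z : ℝ × E3), rieszPair j k (fun y => θ z.1 * pd i g y) z.2 = θ z.1 *
    rieszPair j k (pd i g) z.2 := fun j k z => rieszPair_smul j k _ _ _
  have I5 : IntegrableOn (fun z : ℝ × E3 => P z.1 z.2 * (θ z.1 * pd i g z.2)) (slab T) := by
    have hψ := isTest_prod hθ' (hg.pd i)
    obtain ⟨B, hB⟩ := hψ.exists_abs_le
    refine IntegrableOn.of_forall_sdiff_eq_zero ((h.locInt_pressure.integrableOn_compact_subset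
      hψ.2.2 hψ.2.1).mul_bdd hψ.1.continuous.aestronglyMeasurable (.of_forall hB))
      (measurableSet_slab T) fun z hz => ?_
    exact (congrArg (P z.1 z.2 * ·) (image_eq_zero_of_notMem_tsupport hz.2)).trans (mul_zero _)
  have hm := h.momentum _ (isTest_prod_single hθ' hg i)
  simp only [spDiv_prod_single θ hg, er] at hp hm
  have hp' : ∫ z in slab T, P z.1 z.2 * (θ z.1 * pd i g z.2) = -∫ z in slab T, θ z.1 * R z.1 z.2 :=
    by
    rw [hp]
    congr 2; ext z
    simp only [R, Finset.mul_sum]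
    exact Finset.sum_congr rfl fun j _ => Finset.sum_congr rfl fun k _ => by ring
  rw [← I1.2, ← I3.2, ← integral_add I1.1 I3.1, ← hm]
  have e0 : ∫ z in slab T, (θ z.1 * R z.1 z.2 + P z.1 z.2 * (θ z.1 * pd i g z.2)) = 0 := by
    rw [integral_add I4 I5, hp']; ring
  rw [← add_zero (∫ z in slab T, _), ← e0]
  refine (integral_add (I1.1.add I3.1) (I4.add I5)).symm.trans ?_
  congr 1; ext z
  simp only [dt_prod_single hθ', inner_smul_single, inner_lamVec_prod_single,
    spDeriv_prod_single θ hg, fderiv_apply_eq_sum, Pi.add_apply, momentumDensity, R]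
  have : (θ z.1 * ∑ j, u z.1 z.2 j * pd j g z.2) * u z.1 z.2 i =
    θ z.1 * ∑ j, u z.1 z.2 j * u z.1 z.2 i * pd j g z.2 := by
    rw [mul_assoc, Finset.sum_mul]
    congr 1; exact Finset.sum_congr rfl fun j _ => by ring
  rw [this]; ring

lemma IsLocalLerayWith.tendsto_pairing (h : IsLocalLerayWith s T u₀ u v P) (hu₀ : MemL2uloc u₀)
    (hT'0 : 0 < T') (hT' : (T' : EReal) < T) (i : Fin 3) (hg : IsTest univ g) :
    Tendsto (fun t => ∫ x, u t x i * g x) (𝓝[>] 0 ⊓ ae volume) (𝓝 (∫ x, u₀ x i * g x)) := by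
  obtain ⟨A, hA⟩ := hg.exists_abs_le
  set K := tsupport g
  have hK : IsCompact K := hg.2.1
  obtain ⟨M, hM⟩ := (h.bounded T' hT'0 hT').2
  have hlim := ENNReal.Tendsto.const_mul (a := ofReal A * volume K ^ (1 / 2 : ℝ)) (h.initial K hK)
    (Or.inr (mul_ne_top ofReal_ne_top (ENNReal.rpow_ne_top_of_nonneg (by norm_num)
    hK.measure_lt_top.ne)))
  rw [mul_zero] at hlim
  refine tendsto_iff_edist_tendsto_0.2 (tendsto_of_tendsto_of_tendsto_of_le_of_le'
    tendsto_const_nhds hlim (.of_forall fun _ => zero_le) ?_)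
  filter_upwards [mem_inf_of_left (Ioo_mem_nhdsGT hT'0), mem_inf_of_right hM] with t htI ht
  have hut := (ht htI).1
  have hd : AEStronglyMeasurable (u t - u₀) (volume.restrict K) := (hut.1.sub hu₀.1).restrict
  rw [edist_eq_enorm_sub, ← integral_sub
    ((fun hf => integrable_apply_mul_test hf.1 (hf.wtEnergy_lt_top 0) i hg) hut)
    ((fun hf => integrable_apply_mul_test hf.1 (hf.wtEnergy_lt_top 0) i hg) hu₀)]
  calc _ ≤ ∫⁻ x, ‖u t x i * g x - u₀ x i * g x‖ₑ := enorm_integral_le_lintegral_enorm _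
    _ = ∫⁻ x in K, ‖u t x i * g x - u₀ x i * g x‖ₑ := by
      refine (setLIntegral_eq_of_support_subset fun x hx => ?_).symm
      by_contra hc
      simp [image_eq_zero_of_notMem_tsupport hc] at hx
    _ ≤ ∫⁻ x in K, ofReal A * ‖(u t - u₀) x‖ₑ := lintegral_mono fun x => by
      rw [← sub_mul, mul_comm, enorm_mul]
      gcongr
      · rw [← ofReal_norm]; exact ofReal_le_ofReal (hA x)
      · exact enorm_le_iff_norm_le.2 (PiLp.norm_apply_le (u t x - u₀ x) i)
    _ = ofReal A * eLpNorm (u t - u₀) 1 (volume.restrict K) := by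
      rw [lintegral_ofReal_mul, eLpNorm_one_eq_lintegral_enorm]
    _ ≤ ofReal A * (eLpNorm (u t - u₀) 2 (volume.restrict K) * volume K ^ (1 / 2 : ℝ)) := by
      gcongr
      refine (eLpNorm_le_eLpNorm_mul_rpow_measure_univ one_le_two hd).trans (le_of_eq ?_)
      rw [Measure.restrict_apply_univ]; norm_num
    _ = _ := by ring

/-- The pairing of the velocity with a test function is absolutely continuous in time. -/
lemma IsLocalLerayWith.ae_pairing_eq (h : IsLocalLerayWith s T u₀ u v P) (hs0 : 3 / 4 ≤ s)
    (hs1 : s < 1) (hu₀ : MemL2uloc u₀) (hT'0 : 0 < T') (hT' : (T' : EReal) < T) (i : Fin 3)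
    (hg : IsTest univ g) : ∀ᵐ t, t ∈ Ioo 0 T' → ∫ x, u t x i * g x = (∫ x, u₀ x i * g x) +
    ∫ τ in (0)..t, ∫ x, momentumDensity s u i g τ x := by
  have hu := h.bounded T' hT'0 hT'
  exact ae_eq_primitive_of_weak_deriv ((isSlabWeighted_apply hu.1 hu.lintegral_wtEnergy_lt_top
    i).integrable_prod isTestOp_id hg).integral_prod_left (integrable_momentumDensity hs0 hs1 hu i
    hg).integral_prod_left (fun θ hθ => h.weak_deriv hs0 hs1 hT'0 hT' i hg hθ)
    (h.tendsto_pairing hu₀ hT'0 hT' i hg)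

end

/-! ### The weakly continuous representative of a local Leray solution -/

/-- The time interval `[0, T)`, where `T = ∞` is allowed. -/
def timeIco (T : EReal) : Set ℝ := {t | 0 ≤ t ∧ (t : EReal) < T}

/-- `w` takes values in `L²(wt dx)` and is weakly continuous there on the set `I` of times. The
pairing is written in `L²(dx)`, after multiplication by `√wt`. -/
structure IsWeaklyContinuous (I : Set ℝ) (w : ℝ → E3 → E3) : Prop where
  meas : ∀ t ∈ I, AEStronglyMeasurable (w t)
  energy : ∀ t ∈ I, wtEnergy (w t) 0 < ⊤
  cont : ∀ h : E3 → E3, MemLp h 2 volume →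
    ContinuousOn (fun t => ∫ x, inner ℝ (√(wt x) • w t x) (h x)) I

lemma ae_timeIoo {p : ℝ → Prop} (h : ∀ T' : ℝ, 0 < T' → (T' : EReal) < T → ∀ᵐ t, t ∈ Ioo 0 T' →
    p t) : ∀ᵐ t, t ∈ timeIoo T → p t := by
  have h1 : ∀ᵐ t : ℝ, ∀ q : ℚ, 0 < (q : ℝ) → ((q : ℝ)) < T → t ∈ Ioo 0 (q : ℝ) → p t := by
    simp only [ae_all_iff]
    exact fun q hq hqT => h q hq hqT
  filter_upwards [h1] with t ht htI
  obtain ⟨q, hq, hqT⟩ := EReal.lt_iff_exists_rat_btwn.1 htI.2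
  have hq' := EReal.coe_lt_coe_iff.1 hq
  exact ht q (htI.1.trans hq') hqT ⟨htI.1, hq'⟩

lemma exists_mem_timeIoo {ε : ℝ} (ht : t ∈ timeIco T) (hε : 0 < ε) {p : ℝ → Prop}
    (h : ∀ᵐ τ, τ ∈ timeIoo T → p τ) : ∃ τ ∈ Ioo t (t + ε), τ ∈ timeIoo T ∧ p τ := by
  obtain ⟨q, hq, hqT⟩ := EReal.lt_iff_exists_rat_btwn.1 ht.2
  have hq' := EReal.coe_lt_coe_iff.1 hq
  obtain ⟨τ, hτ, hp⟩ := exists_mem_Ioo_of_ae (lt_min hq' (by linarith : t < t + ε)) h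
  have hτI : τ ∈ timeIoo T := ⟨ht.1.trans_lt hτ.1,
    (EReal.coe_lt_coe_iff.2 (hτ.2.trans_le (min_le_left _ _))).trans hqT⟩
  exact ⟨τ, ⟨hτ.1, hτ.2.trans_le (min_le_right _ _)⟩, hτI, hp hτI⟩

lemma integral_inner_ofComponents (hf : AEStronglyMeasurable f) (hw : wtEnergy f 0 < ⊤)
    (g : Fin 3 → testSpace) : ∫ x, inner ℝ (√(wt x) • f x) ((√(wt x))⁻¹ • ofComponents g x) =
    ∑ i, ∫ x, f x i * (g i : E3 → ℝ) x := by
  rw [← integral_finsetSum _ fun i _ => integrable_apply_mul_test hf hw i (g i).2]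
  refine integral_congr_ae (.of_forall fun x => ?_)
  simp only [real_inner_smul_left, real_inner_smul_right, inv_mul_cancel_left₀
    ((Real.sqrt_pos.2 (wt_pos x)).ne')]
  simp [PiLp.inner_apply, ofComponents, mul_comm]

section

variable {u v : ℝ → E3 → E3}

/-- A local Leray solution agrees at almost every time with a weakly continuous field that starts
from the initial datum. -/
lemma IsLocalLerayWith.exists_isWeaklyContinuous (h : IsLocalLerayWith s T u₀ u v P)
    (hs0 : 3 / 4 ≤ s) (hs1 : s < 1) (hT : 0 < T) (hu₀ : MemL2uloc u₀) :
    ∃ w : ℝ → E3 → E3, w 0 = u₀ ∧ (∀ᵐ t, t ∈ timeIoo T → w t = u t) ∧ IsWeaklyContinuous (timeIco T)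
    w := by
  classical
  set U := Function.update u 0 u₀ with hU
  have hU0 : U 0 = u₀ := Function.update_self _ _ _
  have hUt : ∀ t ∈ timeIoo T, U t = u t := fun t ht => Function.update_of_ne ht.1.ne' _ _
  have : Fact ((2 : ℝ≥0∞) ≠ ⊤) := ⟨ofNat_ne_top⟩
  obtain ⟨D, hDs, hDc, hD⟩ := dense_ofComponents.exists_countable_dense_subset
  have hDs' : ∀ d ∈ D, ∃ g : Fin 3 → testSpace, (memLp_ofComponents g).toLp = d := fun d hd =>
    hDs hd
  choose! γ hγ using hDs'
  set ℓ : Lp E3 2 (volume : Measure E3) → ℝ → ℝ := fun d t => ∑ i,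
    ((∫ x, u₀ x i * (γ d i : E3 → ℝ) x) +
    ∫ τ in (0)..t, ∫ x, momentumDensity s u i (γ d i) τ x) with hℓ
  have hN : ∀ q : ℚ, 0 < (q : ℝ) → ((q : ℝ) : EReal) < T → ∃ N : ℝ≥0∞, N < ⊤ ∧
    ∀ᵐ t : ℝ, t ∈ Ioo 0 (q : ℝ) → AEStronglyMeasurable (u t) ∧ wtEnergy (u t) 0 ≤ N :=
  fun q hq hqT => by
    obtain ⟨M, hM, hb⟩ := (h.bounded q hq hqT).exists_bound
    obtain ⟨C, hC, hw⟩ := exists_wtEnergy_le_ulocNorm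
    refine ⟨C * M ^ 2, mul_lt_top hC (pow_lt_top hM), hb.mono fun t ht htI =>
      ⟨(ht htI).1, (hw _ 0 (ht htI).1).trans ?_⟩⟩
    gcongr
    exact (ht htI).2
  choose! N hNt hNb using hN
  set G : Set ℝ := {t | t ∈ timeIco T ∧ AEStronglyMeasurable (U t) ∧
    (∀ q : ℚ, ((q : ℝ) : EReal) < T → t < q → wtEnergy (U t) 0 ≤ N q + wtEnergy u₀ 0) ∧
    ∀ d ∈ D, ∑ i, ∫ x, U t x i * (γ d i : E3 → ℝ) x = ℓ d t} with hG
  have hq : ∀ t ∈ timeIco T, ∃ q : ℚ, t < q ∧ 0 < (q : ℝ) ∧ ((q : ℝ) : EReal) < T := fun t ht => by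
    obtain ⟨q, hq, hqT⟩ := EReal.lt_iff_exists_rat_btwn.1 ht.2
    have hq' := EReal.coe_lt_coe_iff.1 hq
    exact ⟨q, hq', ht.1.trans_lt hq', hqT⟩
  have hGw : ∀ t ∈ G, wtEnergy (U t) 0 < ⊤ := fun t ht => by
    obtain ⟨q, hq1, hq2, hq3⟩ := hq t ht.1
    exact (ht.2.2.1 q hq3 hq1).trans_lt (add_lt_top.2 ⟨hNt q hq2 hq3, hu₀.wtEnergy_lt_top 0⟩)
  have hGae : ∀ᵐ t, t ∈ timeIoo T → t ∈ G := by
    have a1 : ∀ᵐ t : ℝ, ∀ q : ℚ, 0 < (q : ℝ) → ((q : ℝ) : EReal) < T → t ∈ Ioo 0 (q : ℝ) →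
      AEStronglyMeasurable (u t) ∧ wtEnergy (u t) 0 ≤ N q := by
      simp only [ae_all_iff]
      exact hNb
    have a2 : ∀ᵐ t, ∀ d ∈ D, t ∈ timeIoo T → ∀ i, ∫ x, u t x i * (γ d i : E3 → ℝ) x =
      (∫ x, u₀ x i * (γ d i : E3 → ℝ) x) +
        ∫ τ in (0)..t, ∫ x, momentumDensity s u i (γ d i) τ x := by
      refine (ae_ball_iff hDc).2 fun d hd => ae_timeIoo fun T' hT'0 hT' => ?_
      have := ae_all_iff.2 fun i => h.ae_pairing_eq hs0 hs1 hu₀ hT'0 hT' i (γ d i).2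
      filter_upwards [this] with t ht htI i using ht i htI
    filter_upwards [a1, a2] with t h1 h2 htI
    have htI' : t ∈ timeIco T := ⟨htI.1.le, htI.2⟩
    obtain ⟨q, hq1, hq2, hq3⟩ := hq t htI'
    refine ⟨htI', ?_, fun q hqT htq => ?_, fun d hd => ?_⟩ <;> rw [hUt t htI]
    · exact (h1 q hq2 hq3 ⟨htI.1, hq1⟩).1
    · exact (h1 q (htI.1.trans htq) hqT ⟨htI.1, htq⟩).2.trans le_self_add
    · exact Finset.sum_congr rfl fun i _ => h2 d hd htI i
  have hG0 : (0 : ℝ) ∈ G := by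
    refine ⟨⟨le_rfl, by exact_mod_cast hT⟩, ?_, fun q _ _ => ?_, fun d hd => ?_⟩ <;> rw [hU0]
    · exact hu₀.1
    · exact le_add_self
    · simp [hℓ]
  have hcl : timeIco T ⊆ closure G := fun t ht => Metric.mem_closure_iff.2 fun ε hε => by
    obtain ⟨τ, hτ, hτI, hp⟩ := exists_mem_timeIoo ht hε hGae
    refine ⟨τ, hp, ?_⟩
    rw [dist_eq, abs_lt]
    constructor <;> linarith [hτ.1, hτ.2]
  let F : ℝ → Lp E3 2 (volume : Measure E3) := fun t =>
    if ht : t ∈ G then (memLp_sqrt_wt_smul ht.2.1 (hGw t ht)).toLp else 0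
  have hF : ∀ t ht, F t = (memLp_sqrt_wt_smul ht.2.1 (hGw t ht)).toLp := fun t ht => dif_pos ht
  have hinner : ∀ {f h : E3 → E3} (hf : MemLp f 2 volume) (hh : MemLp h 2 volume),
    inner ℝ hf.toLp hh.toLp = ∫ x, inner ℝ (f x) (h x) := fun hf hh => by
    rw [L2.inner_def]
    refine integral_congr_ae ?_
    filter_upwards [hf.coeFn_toLp, hh.coeFn_toLp] with x h1 h2
    rw [h1, h2]
  obtain ⟨W, hWG, hW⟩ := exists_weak_extension hcl (F := F) (ℓ := ℓ) (fun t ht => by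
    obtain ⟨q, hq1, hq2, hq3⟩ := hq t ht
    refine ⟨(N q + wtEnergy u₀ 0 + 1).toReal, ?_⟩
    filter_upwards [mem_nhdsWithin_of_mem_nhds (Iio_mem_nhds hq1), self_mem_nhdsWithin]
      with τ hτ hτG
    have hfin := (add_lt_top.2 ⟨add_lt_top.2 ⟨hNt q hq2 hq3, hu₀.wtEnergy_lt_top 0⟩, one_lt_top⟩).ne
    rw [hF τ hτG, Lp.norm_toLp]
    refine toReal_mono hfin ?_
    have h2 := (eLpNorm_sqrt_wt_smul (U τ)).trans_le (hτG.2.2.1 q hq3 hτ)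
    rcases le_total (eLpNorm (fun x => √(wt x) • U τ x) 2 volume) 1 with h1 | h1
    · exact h1.trans le_add_self
    · exact (le_self_pow h1 two_ne_zero).trans (h2.trans le_self_add))
    hD (fun d hd t ht => by
      obtain ⟨q, hq1, hq2, hq3⟩ := hq t ht
      have hmem : Icc 0 (q : ℝ) ∈ 𝓝[timeIco T] t := by
        filter_upwards [mem_nhdsWithin_of_mem_nhds (Iio_mem_nhds hq1), self_mem_nhdsWithin]
          with τ hτ hτI using ⟨hτI.1, hτ.le⟩
      refine ContinuousWithinAt.mono_of_mem_nhdsWithin (t := Icc 0 (q : ℝ))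
        (tendsto_finsetSum _ fun i _ => tendsto_const_nhds.add ?_) hmem
      have hi := (intervalIntegrable_iff_integrableOn_Ioo_of_le hq2.le).2
        (integrable_momentumDensity hs0 hs1 (h.bounded q hq2 hq3) i (γ d i).2).integral_prod_left
      have := intervalIntegral.continuousOn_primitive_interval' hi left_mem_uIcc
      rw [uIcc_of_le hq2.le] at this
      exact this t ⟨ht.1, hq1.le⟩)
    (fun t ht => ht.1) (fun t ht d hd => by
      rw [← ht.2.2.2 d hd, ← integral_inner_ofComponents ht.2.1 (hGw t ht),
        ← hinner (memLp_sqrt_wt_smul ht.2.1 (hGw t ht)) (memLp_ofComponents _), ← hF t ht, hγ d hd])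
  have hr := fun x => (Real.sqrt_pos.2 (wt_pos x)).ne'
  set w := fun t => if t ∈ G then U t else fun x => (√(wt x))⁻¹ • W t x with hw
  have hwG : ∀ t ∈ G, w t = U t := fun t ht => if_pos ht
  have hwW : ∀ t, (fun x => √(wt x) • w t x) =ᵐ[volume] W t := fun t => by
    by_cases ht : t ∈ G
    · rw [hwG t ht, hWG t ht, hF t ht]
      exact (MemLp.coeFn_toLp _).symm
    · exact .of_forall fun x => by simpa only [hw, if_neg ht] using smul_inv_smul₀ (hr x) _
  refine ⟨w, (hwG 0 hG0).trans hU0, ?_, fun t ht => ?_, fun t ht => ?_, fun h hh => ?_⟩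
  · filter_upwards [hGae] with t ht htI
    rw [hwG t (ht htI), hUt t htI]
  · refine (((continuous_wt.sqrt.inv₀ hr).aestronglyMeasurable).smul ((Lp.memLp (W t)).1.congr
      (hwW t).symm)).congr (.of_forall fun x => inv_smul_smul₀ (hr x) _)
  · rw [← eLpNorm_sqrt_wt_smul, eLpNorm_congr_ae (hwW t)]
    exact pow_lt_top (Lp.memLp (W t)).2
  · refine (hW hh.toLp).congr fun t _ => ?_
    simp only [L2.inner_def]
    refine integral_congr_ae ?_
    filter_upwards [hwW t, hh.coeFn_toLp] with x h1 h2
    rw [h1, h2]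

end

/-! ### Strong continuity from the right -/

lemma integrable_cut_inner (hρ : 0 < ρ) {g : E3 → E3} (hf : AEStronglyMeasurable f)
    (hfw : wtEnergy f o < ⊤) (hg : AEStronglyMeasurable g) (hgw : wtEnergy g o < ⊤) :
    Integrable fun x => ballBump ρ o x * inner ℝ (f x) (g x) := by
  refine ((integrable_cut hρ hf hfw).add (integrable_cut hρ hg hgw)).mono'
    ((continuous_ballBump hρ o).aestronglyMeasurable.mul (hf.inner hg)) (.of_forall fun x => ?_)
  have h0 := ballBump_nonneg ρ o x
  rw [norm_mul, norm_of_nonneg h0, Pi.add_apply, ← mul_add]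
  gcongr
  have := norm_inner_le_norm (𝕜 := ℝ) (f x) (g x)
  nlinarith [sq_nonneg ‖g x‖]

lemma cutEnergy_sub (hρ : 0 < ρ) {g : E3 → E3} (hf : AEStronglyMeasurable f)
    (hfw : wtEnergy f o < ⊤) (hg : AEStronglyMeasurable g) (hgw : wtEnergy g o < ⊤) :
    cutEnergy ρ o (f - g) = cutEnergy ρ o f + cutEnergy ρ o g - 2 * ∫ x, ballBump ρ o x * inner
    ℝ (f x) (g x) := by
  have h1 := integrable_cut hρ hf hfw
  have h2 := integrable_cut hρ hg hgw
  rw [cutEnergy, cutEnergy, cutEnergy, ← integral_add h1 h2, ← integral_const_mul]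
  refine Eq.trans ?_ (integral_sub (h1.add h2) ((integrable_cut_inner hρ hf hfw hg hgw).const_mul 2))
  congr 1; ext x
  rw [Pi.sub_apply, norm_sub_sq_real]; ring

lemma wtEnergy_sub_lt_top {g : E3 → E3} (hm : AEStronglyMeasurable f) (hf : wtEnergy f z < ⊤)
    (hg : wtEnergy g z < ⊤) : wtEnergy (f - g) z < ⊤ := by
  have hmz : AEMeasurable fun x => 2 * (wtE (x - z) * ‖f x‖ₑ ^ 2) :=
    ((measurable_wtE.comp (measurable_id.sub_const z)).aemeasurable.mul
    (hm.enorm.pow_const 2)).const_mul 2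
  calc _ ≤ ∫⁻ x, (2 * (wtE (x - z) * ‖f x‖ₑ ^ 2) +
        2 * (wtE (x - z) * ‖g x‖ₑ ^ 2)) := lintegral_mono fun x => by
        rw [mul_left_comm, mul_left_comm 2, ← mul_add]
        gcongr
        have h2 := ENNReal.rpow_add_le_mul_rpow_add_rpow ‖f x‖ₑ ‖g x‖ₑ one_le_two
        norm_num at h2
        rw [← mul_add]
        exact (pow_le_pow_left₀ zero_le enorm_sub_le 2).trans h2
    _ = 2 * wtEnergy f z + 2 * wtEnergy g z := by
      rw [lintegral_add_left' hmz, lintegral_const_mul' _ _ ofNat_ne_top,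
        lintegral_const_mul' _ _ ofNat_ne_top, wtEnergy, wtEnergy]
    _ < ⊤ := by finiteness

section

lemma IsWeaklyContinuous.continuousOn_cut_inner (h : IsWeaklyContinuous I w) (hρ : 0 < ρ) (o : E3)
    (hf : AEStronglyMeasurable f) (hfw : wtEnergy f 0 < ⊤) :
    ContinuousOn (fun t => ∫ x, ballBump ρ o x * inner ℝ (w t x) (f x)) I := by
  have hc := (continuous_ballBump hρ o).mul (continuous_wt.inv₀ fun x => (wt_pos x).ne')
  obtain ⟨C, hC⟩ := hc.bounded_above_of_compact_support (ballBump_isTest hρ o).2.1.mul_right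
  have hm : MemLp (fun x => (ballBump ρ o x * (wt x)⁻¹) • √(wt x) • f x) 2 volume :=
    (memLp_sqrt_wt_smul hf hfw).of_le_mul (c := C)
      (hc.aestronglyMeasurable.smul (memLp_sqrt_wt_smul hf hfw).1)
      (.of_forall fun x => by rw [norm_smul]; gcongr; exact hC x)
  refine (h.cont _ hm).congr fun t _ => integral_congr_ae (.of_forall fun x => ?_)
  simp only [real_inner_smul_left, real_inner_smul_right]
  field_simp [(wt_pos x).ne']
  rw [Real.sq_sqrt (wt_pos x).le]

/-- Weak lower semicontinuity of the local energy. -/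
lemma IsWeaklyContinuous.cutEnergy_sub_le (h : IsWeaklyContinuous I w) (hρ : 0 < ρ)
    (hf : AEStronglyMeasurable f) (hfw : wtEnergy f 0 < ⊤) {E : ℝ} (ht : t ∈ I)
    (hE : ∃ᶠ τ in 𝓝[I] t, cutEnergy ρ o (w τ - f) ≤ E) : cutEnergy ρ o (w t - f) ≤ E := by
  have hfx := wtEnergy_lt_top hfw o
  have hwx := fun τ hτ => wtEnergy_lt_top (h.energy τ hτ) o
  have hdm := fun τ hτ => (h.meas τ hτ).sub hf
  have hdx := fun τ hτ => wtEnergy_sub_lt_top (h.meas τ hτ) (hwx τ hτ) hfx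
  -- the energy of `w τ - w t` is nonnegative
  have key : ∃ᶠ τ in 𝓝[I] t, 2 * (∫ x, ballBump ρ o x * inner ℝ (w τ x) ((w t - f) x)) ≤
    E + cutEnergy ρ o (w t - f) + 2 * ∫ x, ballBump ρ o x * inner ℝ (f x) ((w t - f) x) := by
    refine (hE.and_eventually self_mem_nhdsWithin).mono fun τ hτ => ?_
    have e := cutEnergy_sub hρ (hdm τ hτ.2) (hdx τ hτ.2) (hdm t ht) (hdx t ht)
    have e2 : ∫ x, ballBump ρ o x * inner ℝ ((w τ - f) x) ((w t - f) x) =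
      (∫ x, ballBump ρ o x * inner ℝ (w τ x) ((w t - f) x)) -
        ∫ x, ballBump ρ o x * inner ℝ (f x) ((w t - f) x) := by
      rw [← integral_sub (integrable_cut_inner hρ (h.meas τ hτ.2) (hwx τ hτ.2) (hdm t ht)
        (hdx t ht)) (integrable_cut_inner hρ hf hfx (hdm t ht) (hdx t ht))]
      congr 1; ext x
      rw [Pi.sub_apply, inner_sub_left, mul_sub]
    have := cutEnergy_nonneg ρ o (w τ - f - (w t - f))
    linarith [hτ.1]
  have h1 := le_of_tendsto_of_frequently
    ((h.continuousOn_cut_inner hρ o (hdm t ht) (wtEnergy_lt_top (hdx t ht) 0) t ht).const_mul 2) key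
  have e3 : cutEnergy ρ o (w t - f) = (∫ x, ballBump ρ o x * inner ℝ (w t x) ((w t - f) x)) -
    ∫ x, ballBump ρ o x * inner ℝ (f x) ((w t - f) x) := by
    rw [← integral_sub (integrable_cut_inner hρ (h.meas t ht) (hwx t ht) (hdm t ht) (hdx t ht))
      (integrable_cut_inner hρ hf hfx (hdm t ht) (hdx t ht)), cutEnergy]
    congr 1; ext x
    rw [← mul_sub, ← inner_sub_left, ← Pi.sub_apply, real_inner_self_eq_norm_sq]
  linarith

/-- A weakly continuous field is strongly continuous from the right at a time at which the local
energy is upper semicontinuous from the right. -/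
lemma IsWeaklyContinuous.exists_cutEnergy_sub_le (h : IsWeaklyContinuous (timeIco T) w) (hρ : 0 < ρ)
    (ht : t ∈ timeIco T) (hE : ∀ ε > 0, ∃ δ > 0, ∀ᵐ τ, τ ∈ timeIoo T → τ ∈ Ioo t (t + δ) →
    cutEnergy ρ o (w τ) ≤ cutEnergy ρ o (w t) + ε) {ε : ℝ} (hε :
    0 < ε) : ∃ δ > 0, ∀ t' ∈ timeIco T, t' ∈ Ioo t (t + δ) → cutEnergy ρ o (w t' - w t) ≤ ε := by
  obtain ⟨δ₁, hδ₁, h1⟩ := hE (ε / 2) (half_pos hε)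
  have hx : ∀ τ ∈ timeIco T, wtEnergy (w τ) o < ⊤ := fun τ hτ => wtEnergy_lt_top (h.energy τ hτ) o
  obtain ⟨δ₂, hδ₂, h2⟩ := Metric.mem_nhdsWithin_iff.1 (Metric.tendsto_nhds.1
    (h.continuousOn_cut_inner hρ o (h.meas t ht) (h.energy t ht) t ht) (ε / 4) (by positivity))
  have e0 : ∫ x, ballBump ρ o x * inner ℝ (w t x) (w t x) = cutEnergy ρ o (w t) := by
    simp only [real_inner_self_eq_norm_sq, cutEnergy]
  refine ⟨min δ₁ δ₂, lt_min hδ₁ hδ₂, fun t' ht'I ht' => h.cutEnergy_sub_le hρ (h.meas t ht)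
    (h.energy t ht) ht'I (frequently_nhdsWithin_iff.2 (Metric.nhds_basis_ball.frequently_iff.2 fun r
    hr => ?_))⟩
  obtain ⟨τ, hτ, hτI, hp⟩ := exists_mem_timeIoo ht'I (lt_min hr (sub_pos.2 ht'.2)) h1
  have hτ1 := hτ.2.trans_le (add_le_add le_rfl (min_le_left _ _))
  have hτ2 := hτ.2.trans_le (add_le_add le_rfl (min_le_right _ _))
  have m1 := min_le_left δ₁ δ₂
  have m2 := min_le_right δ₁ δ₂
  have hτI' : τ ∈ timeIco T := ⟨hτI.1.le, hτI.2⟩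
  refine ⟨τ, by rw [mem_ball, dist_eq, abs_lt]; constructor <;> linarith [hτ.1], ?_, hτI'⟩
  have h3 := hp ⟨ht'.1.trans hτ.1, by linarith⟩
  have h4 : dist _ (∫ x, ballBump ρ o x * inner ℝ (w t x) (w t x)) < ε / 4 := h2 ⟨by
    rw [mem_ball, dist_eq, abs_lt]; constructor <;> linarith [hτ.1, ht'.1], hτI'⟩
  rw [e0, dist_eq, abs_lt] at h4
  rw [cutEnergy_sub hρ (h.meas τ hτI') (hx τ hτI') (h.meas t ht) (hx t ht)]
  linarith [h4.1]

end

/-! ### Continuity in the uniformly local norm -/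

section

variable {u v : ℝ → E3 → E3}

/-- The local energy is upper semicontinuous from the right at `t`, up to null sets of times. -/
def IsRightUpper (T : EReal) (w : ℝ → E3 → E3) (ρ t : ℝ) : Prop :=
  ∀ ε > 0, ∃ δ > 0, ∀ᵐ τ, τ ∈ timeIoo T → τ ∈ Ioo t (t + δ) →
    cutEnergy ρ 0 (w τ) ≤ cutEnergy ρ 0 (w t) + ε

lemma IsLocalLerayWith.isRightUpper (h : IsLocalLerayWith s T u₀ u v P) (hs0 : 3 / 4 ≤ s)
    (hs1 : s < 1) (hu₀ : MemL2uloc u₀) (hw0 : w 0 = u₀) (hwu : ∀ᵐ t, t ∈ timeIoo T → w t = u t)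
    (hρ : 2 ≤ ρ) (hT'0 : 0 < T') (hT' : (T' : EReal) < T) :
    IsRightUpper T w ρ 0 ∧ ∀ᵐ t, t ∈ Ioo 0 T' → IsRightUpper T w ρ t := by
  obtain ⟨M, hM, -, C0, -, hE⟩ := h.exists_energy_times hs0 hs1 hT'0 hT'
  obtain ⟨C1, hC1, hE⟩ := hE ρ hρ 1 one_pos one_lt_top
  obtain ⟨S, hSI, hSae, hS⟩ := hE 0 0 le_rfl
  have hz := h.energy_from_zero hu₀ hT'0 hT' (by linarith) le_rfl hSI hSae hS
  simp only [neg_zero, zero_mul, Real.exp_zero, one_mul, ofReal_one] at hS hz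
  set R := fun t => rhsBound C0 ρ M 1 C1 0 (u t) (v t)
  have hu := h.bounded T' hT'0 hT'
  obtain ⟨K, hK, hvK⟩ := (h.lam_bounded T' hT'0 hT').exists_wtEnergy_le
  have hum := hu.1
  rw [restrict_prod_univ] at hum
  have key : ∀ t ∈ Ico 0 T', (∀ τ ∈ S, t < τ → ofReal (cutEnergy ρ 0 (u τ)) ≤
    ofReal (cutEnergy ρ 0 (w t)) + ∫⁻ a in Ioo t τ, R a) → IsRightUpper T w ρ t := fun t ht hle ε
      hε => by
    obtain ⟨δ, hδ, hδR⟩ := exists_pos_setLIntegral_lt_of_measure_lt (lintegral_rhsBound_lt_top hM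
      one_lt_top hC1 0 hum hu.lintegral_wtEnergy_lt_top ((hvK 0).trans_lt hK)).ne
      (ENNReal.ofReal_pos.2 hε).ne'
    obtain ⟨d, hd, hdδ⟩ : ∃ d : ℝ, 0 < d ∧ ofReal d < δ := by
      obtain ⟨r, hr0, hr⟩ := ENNReal.lt_iff_exists_nnreal_btwn.1 hδ
      exact ⟨r, by exact_mod_cast hr0, by simpa using hr⟩
    refine ⟨min d (T' - t), lt_min hd (sub_pos.2 ht.2), ?_⟩
    filter_upwards [hSae, hwu] with τ hτS hτw hτI hτ
    have h1 := hτ.2.trans_le (add_le_add le_rfl (min_le_left _ _))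
    have h2 := hτ.2.trans_le (add_le_add le_rfl (min_le_right _ _))
    have hsub : Ioo t τ ⊆ Ioo 0 T' := Ioo_subset_Ioo ht.1 (by linarith)
    have h3 := hδR (Ioo t τ) (by
      rw [Measure.restrict_apply measurableSet_Ioo, inter_eq_left.2 hsub, Real.volume_Ioo]
      exact (ofReal_le_ofReal (by linarith)).trans_lt hdδ)
    rw [Measure.restrict_restrict measurableSet_Ioo, inter_eq_left.2 hsub] at h3
    have h4 := (hle τ (hτS ⟨hτI.1, by linarith⟩) hτ.1).trans (add_le_add le_rfl h3.le)
    rw [← ofReal_add (cutEnergy_nonneg _ _ _) hε.le, ofReal_le_ofReal_iff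
      (add_nonneg (cutEnergy_nonneg _ _ _) hε.le)] at h4
    rwa [hτw hτI]
  refine ⟨key 0 ⟨le_rfl, hT'0⟩ fun τ hτ _ => ?_, ?_⟩
  · rw [hw0]
    exact le_self_add.trans (hz τ hτ)
  · filter_upwards [hSae, hwu] with t htS htw htI
    refine key t ⟨htI.1.le, htI.2⟩ fun τ hτ htτ => ?_
    rw [htw (Ioo_subset_timeIoo le_rfl hT' htI)]
    exact le_self_add.trans (hS t (htS htI) τ hτ htτ)

/-- The decay at infinity holds at every time for the weakly continuous representative. -/
lemma IsLocalLerayWith.exists_decay_rep (h : IsLocalLerayWith s T u₀ u v P) (hs0 : 3 / 4 ≤ s)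
    (hs1 : s < 1) (hu₀ : MemE2 u₀) (hw : IsWeaklyContinuous (timeIco T) w)
    (hwu : ∀ᵐ t, t ∈ timeIoo T → w t = u t) (hT'0 : 0 < T') (hT' : (T' : EReal) < T) :
    ∃ B : E3 → ℝ≥0∞, Tendsto B (cocompact E3) (𝓝 0) ∧ (∃ K < ⊤, ∀ o, B o ≤ K) ∧
    (∀ t ∈ Ico 0 T', ∀ o, eLpNorm (w t) 2 (volume.restrict (ball o 1)) ≤ B o) ∧
    ∀ o, cylNorm T' v o ≤ B o := by
  obtain ⟨B, hB, hBu, hBv⟩ := h.exists_decay hs0 hs1 hu₀ hT'0 hT'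
  have hu := h.bounded T' hT'0 hT'
  have hv := h.lam_bounded T' hT'0 hT'
  obtain ⟨M, hM, hMb⟩ := hu.exists_bound
  obtain ⟨C, hC, hCw⟩ := exists_wtEnergy_le_ulocNorm
  set V := ⨆ o, cylNorm T' v o
  set K := ofReal ((1 + 2 * 1) ^ (15 / 4 : ℝ)) * (C * M ^ 2) + V ^ 2 with hK
  have hV : V < ⊤ := hv.2
  have hKt : K < ⊤ := by finiteness
  have hsq : ∀ {a b : ℝ≥0∞}, a ^ 2 ≤ b → a ≤ b ^ (1 / 2 : ℝ) := fun {a b} hab => by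
    have h2 := ENNReal.rpow_le_rpow hab (by norm_num : (0 : ℝ) ≤ 1 / 2)
    rwa [← rpow_natCast, ← rpow_mul, Nat.cast_ofNat, mul_one_div_cancel two_ne_zero,
      ENNReal.rpow_one] at h2
  refine ⟨fun o => min (B o) K ^ (1 / 2 : ℝ), ?_, ⟨K ^ (1 / 2 : ℝ), ENNReal.rpow_lt_top_of_nonneg
    (by norm_num) hKt.ne, fun o => ENNReal.rpow_le_rpow (min_le_right _ _) (by norm_num)⟩,
    fun t ht o => hsq ?_, fun o => hsq (le_min ?_ ?_)⟩
  · have h1 : Tendsto (fun o => min (B o) K) (cocompact E3) (𝓝 0) :=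
      tendsto_of_tendsto_of_tendsto_of_le_of_le tendsto_const_nhds hB (fun _ => zero_le) fun _ =>
      min_le_left _ _
    have h2 := ((ENNReal.continuous_rpow_const (y := 1 / 2)).tendsto 0).comp h1
    rwa [ENNReal.zero_rpow_of_pos (by norm_num)] at h2
  · set b := min (B o) K
    have hb : b ≠ ⊤ := ((min_le_right _ _).trans_lt hKt).ne
    have hI : ∀ τ ∈ Ico 0 T', τ ∈ timeIco T := fun τ hτ =>
      ⟨hτ.1, (EReal.coe_lt_coe_iff.2 hτ.2).trans hT'⟩
    have hae : ∀ᵐ τ, τ ∈ timeIoo T → τ ∈ Ioo 0 T' → cutEnergy 1 o (w τ) ≤ b.toReal := by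
      filter_upwards [hwu, hBu o, hMb] with τ h1 h2 h3 hτI hτ
      have hm := (h3 hτ).1
      have hwe := hCw (u τ) o hm
      have hfin := hwe.trans_lt (mul_lt_top hC (pow_lt_top ((h3 hτ).2.trans_lt hM)))
      rw [h1 hτI, ← ENNReal.ofReal_le_iff_le_toReal hb]
      refine le_min ?_ ?_
      · refine le_trans ?_ (h2 hτ)
        rw [ofReal_cutEnergy_eq_eLpNorm one_pos hm hfin, ← eLpNorm_two_sq]
        have := eLpNorm_sqrt_ballBump_smul_le one_pos o (u τ)
        rw [mul_one] at this
        gcongr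
      · refine (ofReal_cutEnergy_le one_pos hm hfin).trans (le_trans ?_ le_self_add)
        gcongr
        refine hwe.trans ?_
        gcongr
        exact (h3 hτ).2
    have hle := hw.cutEnergy_sub_le one_pos aestronglyMeasurable_zero
      (by simp [wtEnergy]) (hI t ht) (frequently_nhdsWithin_iff.2
        (Metric.nhds_basis_ball.frequently_iff.2 fun r hr => by
          obtain ⟨τ, hτ, hτI, hp⟩ := exists_mem_timeIoo (hI t ht) (lt_min hr (sub_pos.2 ht.2)) hae
          have h1 := hτ.2.trans_le (add_le_add le_rfl (min_le_left _ _))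
          have h2 := hτ.2.trans_le (add_le_add le_rfl (min_le_right _ _))
          refine ⟨τ, by rw [mem_ball, dist_eq, abs_lt]; constructor <;> linarith [hτ.1],
            ?_, hτI.1.le, hτI.2⟩
          rw [sub_zero]
          exact hp ⟨hτI.1, by linarith⟩))
    rw [sub_zero, ← ENNReal.ofReal_le_iff_le_toReal hb] at hle
    rw [eLpNorm_two_sq]
    exact (lintegral_mono_set Metric.ball_subset_closedBall).trans
      ((setLIntegral_le_cutEnergy one_pos
      (hw.meas t (hI t ht)) (wtEnergy_lt_top (hw.energy t (hI t ht)) o)).trans hle)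
  · refine le_trans ?_ (hBv o)
    have hvm := hv.1
    rw [restrict_prod_univ] at hvm
    rw [cylNorm, eLpNorm_two_sq, Measure.volume_eq_prod, ← Measure.prod_restrict, lintegral_prod]
    · exact lintegral_mono fun t => lintegral_mono_set
        (Metric.ball_subset_closedBall.trans (closedBall_subset_closedBall one_le_two))
    · exact (hvm.enorm.pow_const 2).mono_measure (Measure.prod_mono le_rfl Measure.restrict_le_self)
  · exact le_trans (pow_le_pow_left₀ zero_le (le_iSup (cylNorm T' v) o) 2) le_add_self

lemma tendsto_ulocNorm_sub (hw : IsWeaklyContinuous (timeIco T) w) {B : E3 → ℝ≥0∞}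
    (hB : Tendsto B (cocompact E3) (𝓝 0)) (hT' : (T' : EReal) < T)
    (hwB : ∀ t ∈ Ico 0 T', ∀ o, eLpNorm (w t) 2 (volume.restrict (ball o 1)) ≤ B o)
    (ht : t ∈ Ico 0 T') (hr : ∀ n : ℕ, IsRightUpper T w (n + 2) t) :
    Tendsto (fun t' => ulocNorm (w t' - w t)) (𝓝[>] t) (𝓝 0) := by
  have hI : ∀ τ ∈ Ico 0 T', τ ∈ timeIco T := fun τ hτ =>
    ⟨hτ.1, (EReal.coe_lt_coe_iff.2 hτ.2).trans hT'⟩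
  refine tendsto_nhds_zero.2 fun ε hε => ?_
  obtain ⟨e, he0, he⟩ := ENNReal.lt_iff_exists_nnreal_btwn.1 (half_pos hε.ne')
  obtain ⟨A, hA, hAB⟩ := mem_cocompact.1 (hB.eventually_le_const he0)
  obtain ⟨R, hR⟩ := hA.isBounded.subset_closedBall 0
  obtain ⟨n, hn⟩ := exists_nat_ge R
  have hρ : (0 : ℝ) < n + 2 := by positivity
  have he0' : (0 : ℝ) < e := by exact_mod_cast he0
  obtain ⟨δ, hδ, hδw⟩ := hw.exists_cutEnergy_sub_le hρ (hI t ht) (hr n) (pow_pos he0' 2)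
  filter_upwards [Ioo_mem_nhdsGT (lt_min ht.2 (by linarith : t < t + δ))] with t' ht'
  have h1 : t' ∈ Ico 0 T' := ⟨ht.1.trans ht'.1.le, ht'.2.trans_le (min_le_left _ _)⟩
  refine iSup_le fun o => ?_
  have hm1 := hw.meas t' (hI t' h1)
  have hm2 := hw.meas t (hI t ht)
  by_cases hx : o ∈ A
  · have hsub : ball o 1 ⊆ closedBall 0 (n + 2) := fun x hx' => by
      have a := mem_closedBall_zero_iff.1 (hR hx)
      rw [mem_ball, dist_eq_norm] at hx'
      have := norm_le_norm_sub_add x o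
      rw [mem_closedBall_zero_iff]; linarith
    have h3 : eLpNorm (w t' - w t) 2 (volume.restrict (ball o 1)) ^ 2 ≤ (e : ℝ≥0∞) ^ 2 := by
      rw [eLpNorm_two_sq]
      refine (lintegral_mono_set hsub).trans ((setLIntegral_le_cutEnergy hρ (hm1.sub hm2)
        (wtEnergy_sub_lt_top hm1 (hw.energy t' (hI t' h1)) (hw.energy t (hI t ht)))).trans ?_)
      exact (ofReal_le_ofReal (hδw t' (hI t' h1) ⟨ht'.1, ht'.2.trans_le (min_le_right _ _)⟩)).trans
        (le_of_eq (by rw [ofReal_pow he0'.le, ENNReal.ofReal_coe_nnreal]))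
    exact ((pow_le_pow_left_iff two_ne_zero).1 h3).trans (he.le.trans ENNReal.half_le_self)
  · have hBx := hAB hx
    refine (eLpNorm_sub_le hm1.restrict hm2.restrict one_le_two).trans ?_
    calc _ ≤ (e : ℝ≥0∞) + e := add_le_add ((hwB t' h1 o).trans hBx) ((hwB t ht o).trans hBx)
      _ ≤ ε / 2 + ε / 2 := add_le_add he.le he.le
      _ = ε := add_halves ε

end

lemma IsWeaklyContinuous.continuousOn_pairing (h : IsWeaklyContinuous I w) {φ : E3 → E3}
    (hφ : IsTest univ φ) : ContinuousOn (fun t => ∫ x, inner ℝ (w t x) (φ x)) I := by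
  have hr := fun x => (Real.sqrt_pos.2 (wt_pos x)).ne'
  refine (h.cont (fun x => (√(wt x))⁻¹ • φ x)
    (((continuous_wt.sqrt.inv₀ hr).smul hφ.1.continuous).memLp_of_hasCompactSupport
    hφ.2.1.smul_left)).congr fun t _ => integral_congr_ae (.of_forall fun x => ?_)
  simp only [real_inner_smul_left, real_inner_smul_right]
  rw [inv_mul_cancel_left₀ (hr x)]

/-- Decay at infinity, weak continuity and strong continuity from the right, in terms of the
representative of the velocity. -/
lemma IsLocalLerayWith.exists_isContRep {u₀ : E3 → E3} {u v : ℝ → E3 → E3} {P : ℝ → E3 → ℝ}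
    (h : IsLocalLerayWith s T u₀ u v P) (hs0 : 3 / 4 ≤ s) (hs1 : s < 1) (hT : 0 < T)
    (hu₀ : MemE2 u₀) : (∀ T' : ℝ, 0 < T' → (T' : EReal) < T → MemLinftyE2 T' u ∧ MemG22 T' v) ∧
    ∃ w : ℝ → E3 → E3, IsContRep T u₀ u w ∧ Tendsto (fun t' => ulocNorm (w t' - w 0)) (𝓝[>] 0)
    (𝓝 0) ∧ ∀ᵐ t : ℝ, t ∈ timeIoo T → Tendsto (fun t' => ulocNorm (w t' - w t)) (𝓝[>] t) (𝓝 0) := by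
  obtain ⟨w, hw0, hwu, hw⟩ := h.exists_isWeaklyContinuous hs0 hs1 hT hu₀.1
  have hdec := fun (T' : ℝ) h0 h1 => h.exists_decay_rep (T' := T') hs0 hs1 hu₀ hw hwu h0 h1
  have hup := fun (T' : ℝ) h0 h1 (n : ℕ) => h.isRightUpper (T' := T') hs0 hs1 hu₀.1 hw0 hwu
    (ρ := n + 2) (by linarith [n.cast_nonneg (α := ℝ)]) h0 h1
  have hq : ∀ t ∈ timeIco T, ∃ T' : ℝ, t ∈ Ico 0 T' ∧ 0 < T' ∧ T' < T := fun t ht => by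
    obtain ⟨q, hq, hqT⟩ := EReal.lt_iff_exists_rat_btwn.1 ht.2
    have hq' := EReal.coe_lt_coe_iff.1 hq
    exact ⟨q, ⟨ht.1, hq'⟩, ht.1.trans_lt hq', hqT⟩
  have hE2 : ∀ t ∈ timeIco T, MemE2 (w t) := fun t ht => by
    obtain ⟨T', htT', hT'0, hT'⟩ := hq t ht
    obtain ⟨B, hB, ⟨K, hK, hBK⟩, hwB, -⟩ := hdec T' hT'0 hT'
    exact ⟨⟨hw.meas t ht, (iSup_le fun o => (hwB t htT' o).trans (hBK o)).trans_lt hK⟩,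
      tendsto_of_tendsto_of_tendsto_of_le_of_le tendsto_const_nhds hB (fun _ => zero_le) fun o =>
      hwB t htT' o⟩
  have hright : ∀ t ∈ timeIco T, (∀ n : ℕ, IsRightUpper T w (n + 2) t) →
    Tendsto (fun t' => ulocNorm (w t' - w t)) (𝓝[>] t) (𝓝 0) :=
    fun t ht hr => by
      obtain ⟨T', htT', hT'0, hT'⟩ := hq t ht
      obtain ⟨B, hB, -, hwB, -⟩ := hdec T' hT'0 hT'
      exact tendsto_ulocNorm_sub hw hB hT' hwB htT' hr
  refine ⟨fun T' hT'0 hT' => ⟨⟨h.bounded T' hT'0 hT', ?_⟩, h.lam_bounded T' hT'0 hT', ?_⟩, w,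
    ⟨?_, fun t h1 h2 => (hE2 t ⟨h1, h2⟩).1, hw0, fun φ hφ => hw.continuousOn_pairing hφ⟩,
    hright 0 (⟨le_rfl, by exact_mod_cast hT⟩) ?_, ?_⟩
  · filter_upwards [hwu] with t ht htI
    have htT := Ioo_subset_timeIoo le_rfl hT' htI
    rw [← ht htT]
    exact hE2 t ⟨htT.1.le, htT.2⟩
  · obtain ⟨B, hB, -, -, hvB⟩ := hdec T' hT'0 hT'
    exact tendsto_of_tendsto_of_tendsto_of_le_of_le tendsto_const_nhds hB (fun _ => zero_le) hvB
  · filter_upwards [hwu] with t ht htI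
    rw [ht htI]
  · obtain ⟨T', -, hT'0, hT'⟩ := hq 0 (⟨le_rfl, by exact_mod_cast hT⟩)
    exact fun n => (hup T' hT'0 hT' n).1
  · have := ae_timeIoo (p := fun t => ∀ n : ℕ, IsRightUpper T w (n + 2) t)
      fun T' hT'0 hT' => by
        filter_upwards [ae_all_iff.2 fun n => (hup T' hT'0 hT' n).2] with t ht htI n using ht n htI
    filter_upwards [this] with t ht htI using hright t ⟨htI.1.le, htI.2⟩ (ht htI)

end FracNS

theorem theorem1p2 (s : ℝ) (hs : s ∈ Set.Ico (3 / 4 : ℝ) 1) (T : EReal) (hT : 0 < T)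
    (u₀ : FracNS.E3 → FracNS.E3) (hu₀ : FracNS.MemE2 u₀) (hdiv : FracNS.IsSolenoidal u₀)
    (u : ℝ → FracNS.E3 → FracNS.E3) (hu : FracNS.IsLocalLeray s T u₀ u) :
    (∀ T' : ℝ, 0 < T' → (T' : EReal) < T → FracNS.MemLinftyE2 T' u) ∧
    (∃ v : ℝ → FracNS.E3 → FracNS.E3, FracNS.IsLam s T u v ∧
      ∀ T' : ℝ, 0 < T' → (T' : EReal) < T → FracNS.MemG22 T' v) ∧
    (∃ w : ℝ → FracNS.E3 → FracNS.E3, FracNS.IsContRep T u₀ u w ∧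
      Filter.Tendsto (fun t' => FracNS.ulocNorm (w t' - w 0))
        (nhdsWithin 0 (Set.Ioi 0)) (nhds 0) ∧
      ∀ᵐ t : ℝ, t ∈ FracNS.timeIoo T →
        Filter.Tendsto (fun t' => FracNS.ulocNorm (w t' - w t))
          (nhdsWithin t (Set.Ioi t)) (nhds 0)) := by
  obtain ⟨v, P, h⟩ := hu
  obtain ⟨h1, h2⟩ := h.exists_isContRep hs.1 hs.2 hT hu₀
  exact ⟨fun T' h0 hT' => (h1 T' h0 hT').1, ⟨v, h.isLam, fun T' h0 hT' => (h1 T' h0 hT').2⟩, h2⟩
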